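/- All vector spaces and algebras are over $\mathbb C$. A graded commutative dga is an $\mathbb N$-graded algebra $\Omega\mathcal A=\bigoplus_{k\ge 0}\Omega^k\mathcal A$ with $\alpha\beta=(-1)^{|\alpha||\beta|}\beta\alpha$ and a linear map $d$ of degree $1$ with $d^2=0$ and $d(\alpha\beta)=d(\alpha)\beta+(-1)^{|\alpha|}\alpha\, d(\beta)$; write $\mathcal A=\Omega^0\mathcal A$. **The category $\mathcal C_\flat(\Omega\mathcal A)$ and $\pi^1$.** An object of $\mathcal C_\flat(\Omega\mathcal A)$ is a graded $\Omega\mathcal A$-bimodule $\Omega\mathcal E$ that is finitely generated projective (a direct summand, as a graded bimodule, of some $(\Omega\mathcal A)^m$), with a linear map $\nabla:\Omega\mathcal E\to\Omega\mathcal E$ of degree $1$ such that $\nabla(\varepsilon\alpha)=\nabla(\varepsilon)\alpha+(-1)^{|\varepsilon|}\varepsilon\, d\alpha$, $\nabla(\alpha\varepsilon)=d(\alpha)\varepsilon+(-1)^{|\alpha|}\alpha\nabla(\varepsilon)$ and $\nabla^2=0$. Morphisms are the bimodule maps of degree $0$ that commute with the connections. The tensor product is $\Omega\mathcal E\otimes_{\Omega\mathcal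 A}\Omega\mathcal F$ with $\nabla(\varepsilon\otimes\zeta)=\nabla\varepsilon\otimes\zeta+(-1)^{|\varepsilon|}\varepsilon\otimes\nabla\zeta$, and the unit object is $(\Omega\mathcal A,d)$. For a unital algebra homomorphism $p:\mathcal A\to\mathbb C$ the fibre functor at $p$ sends $\Omega\mathcal E$ to $\Omega^0\mathcal E\otimes_{\mathcal A}\mathbb C$, where $\mathcal A$ acts on $\mathbb C$ through $p$, and $\pi^1(\Omega\mathcal A,p)$ is the group scheme of tensor automorphisms of this functor: its group of $R$-points, for a commutative $\mathbb C$-algebra $R$, consists of the natural tensor automorphisms of the functor after extension of scalars to $R$. **Property Q.** Let $\Omega\mathcal A$ be a graded commutative dga with a conjugate linear involution $*$ that preserves degrees and satisfies $(a\omega)^*=\omega^*a^*$ and $d(a^*)=(da)^*$ for $a\in\mathcal A$, $\omega\in\Omega\mathcal A$. Let $\mathcal A$ be embedded as a dense unital $*$-subalgebra in a commutative unital $C^*$-algebra $A$ such that $\mathcal A\cap A^\times=\mathcal A^\times$. Then $\Omega\mathcal A$ satisfies property Q if, for all $a,a_1,\dots,a_s\in\mathcal A$ with $a\ge 0$ and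 $|a_i|\le a$ in $A$ and all $\omega_1,\dots,\omega_s\in\Omega^1\mathcal A$, the equality $da=\sum_{i=1}^s a_i\omega_i$ implies that $a=0$ or $a$ is invertible. A point $p$ of the Gelfand spectrum $\widehat A$ gives a homomorphism $p:\mathcal A\to\mathbb C$ by restriction. **Algebraic hulls.** The algebraic hull of a topological group $H$ is the group scheme of tensor automorphisms of the forgetful functor on the finite-dimensional complex continuous representations of $H$. For a group scheme $G$ the algebraic hull of $G\times H$ is the group scheme of tensor automorphisms of the forgetful functor on the finite-dimensional vector spaces with an algebraic representation of $G$ and a continuous representation of $H$ that commute. **Proposition.** Let $V$ be an $n$-dimensional complex vector space and consider the exterior algebra $\bigwedge V$ as a graded commutative dga with $d=0$. 1. $\bigwedge V$ satisfies property Q (with $A=\mathbb C$), and at its base point $(\bigwedge V)^0=\mathbb C$ its fundamental group $\pi^1(\bigwedge V)$ is isomorphic to the algebraic hull of $\mathbb R^n$. 2. More generally, let $\Omega\mathcal A$ be a graded commutative dga with $*$ and $\mathcal A\subseteq A$ as above that satisfies property Q, and let $p\in\widehat A$. Then the graded tensor product $\Omega\mathcal A\otimes\bigwedge V$, whose degree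 $0$ part is $\mathcal A\subseteq A$, satisfies property Q as well, and $\pi^1(\Omega\mathcal A\otimes\bigwedge V,p)$ is isomorphic to the algebraic hull of $\pi^1(\Omega\mathcal A,p)\times\mathbb R^n$. -/

import Mathlib

open CategoryTheory TensorProduct
open scoped ComplexOrder

universe u v

namespace NCG

section GradedLinearAlgebra

variable {M N : Type*} [AddCommGroup M] [Module ℂ M] [AddCommGroup N] [Module ℂ N]

theorem bijective_of_isInternal {gr : ℕ → Submodule ℂ M} (h : DirectSum.IsInternal gr) :
    Function.Bijective (DirectSum.coeLinearMap gr) := h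

/-- The linear map on an internally graded space that is given by `f k` in degree `k`. -/
noncomputable def gradedLift {gr : ℕ → Submodule ℂ M} (h : DirectSum.IsInternal gr)
    (f : ∀ k, gr k →ₗ[ℂ] N) : M →ₗ[ℂ] N :=
  DirectSum.toModule ℂ ℕ N f ∘ₗ
    (LinearEquiv.ofBijective (DirectSum.coeLinearMap gr) (bijective_of_isInternal h)).symm.toLinearMap

theorem gradedLift_apply {gr : ℕ → Submodule ℂ M} (h : DirectSum.IsInternal gr)
    (f : ∀ k, gr k →ₗ[ℂ] N) {k : ℕ} {x : M} (hx : x ∈ gr k) :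
    gradedLift h f x = f k ⟨x, hx⟩ := by
  have : (LinearEquiv.ofBijective (DirectSum.coeLinearMap gr) (bijective_of_isInternal h)).symm x =
      DirectSum.lof ℂ ℕ (fun k => gr k) k ⟨x, hx⟩ := by
    rw [LinearEquiv.symm_apply_eq, LinearEquiv.ofBijective_apply]
    exact (DirectSum.coeLinearMap_lof gr k ⟨x, hx⟩).symm
  simp only [gradedLift, LinearMap.comp_apply, LinearEquiv.coe_coe, this]
  simp

/-- The sign operator, `(-1) ^ k` in degree `k`. -/
noncomputable def gradedSign {gr : ℕ → Submodule ℂ M} (h : DirectSum.IsInternal gr) :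
    M →ₗ[ℂ] M :=
  gradedLift h fun k => (-1 : ℂ) ^ k • (gr k).subtype

theorem gradedSign_apply {gr : ℕ → Submodule ℂ M} (h : DirectSum.IsInternal gr)
    {k : ℕ} {x : M} (hx : x ∈ gr k) : gradedSign h x = (-1 : ℂ) ^ k • x := by
  simp [gradedSign, gradedLift_apply h _ hx]

/-- The projection onto the component of degree `l`. -/
noncomputable def gradedProj {gr : ℕ → Submodule ℂ M} (h : DirectSum.IsInternal gr) (l : ℕ) :
    M →ₗ[ℂ] M :=
  gradedLift h fun k => if k = l then (gr k).subtype else 0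

theorem gradedProj_same {gr : ℕ → Submodule ℂ M} (h : DirectSum.IsInternal gr)
    {k : ℕ} {x : M} (hx : x ∈ gr k) : gradedProj h k x = x := by
  simp [gradedProj, gradedLift_apply h _ hx]

theorem gradedProj_ne {gr : ℕ → Submodule ℂ M} (h : DirectSum.IsInternal gr)
    {k l : ℕ} (hkl : k ≠ l) {x : M} (hx : x ∈ gr k) : gradedProj h l x = 0 := by
  simp [gradedProj, gradedLift_apply h _ hx, hkl]

theorem isInternal_of_proj (gr : ℕ → Submodule ℂ M) (π : ℕ → M →ₗ[ℂ] M)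
    (h₁ : ∀ k, ∀ x ∈ gr k, π k x = x) (h₂ : ∀ k l, k ≠ l → ∀ x ∈ gr k, π l x = 0)
    (h₃ : ⨆ k, gr k = ⊤) : DirectSum.IsInternal gr := by
  rw [DirectSum.isInternal_submodule_iff_iSupIndep_and_iSup_eq_top]
  refine ⟨fun k => ?_, h₃⟩
  rw [Submodule.disjoint_def]
  intro x hx hx'
  have hle : (⨆ j, ⨆ (_ : j ≠ k), gr j) ≤ LinearMap.ker (π k) :=
    iSup₂_le fun j hj y hy => h₂ j k hj y hy
  rw [← h₁ k x hx]
  exact hle hx'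

/-- Induction on homogeneous components. -/
theorem graded_induction {gr : ℕ → Submodule ℂ M} (h : ⨆ k, gr k = ⊤) {P : M → Prop}
    (hom : ∀ k, ∀ x ∈ gr k, P x) (add : ∀ x y, P x → P y → P (x + y)) (x : M) : P x := by
  have hx : x ∈ ⨆ k, gr k := h ▸ Submodule.mem_top
  exact Submodule.iSup_induction gr (motive := P) hx hom (hom 0 0 (zero_mem _)) add

/-- The total grading on a tensor product over `ℂ`: degree `r` is spanned by the `x ⊗ y` with
`|x| + |y| = r`. -/
def tensorGr (gM : ℕ → Submodule ℂ M) (gN : ℕ → Submodule ℂ N) (r : ℕ) :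
    Submodule ℂ (M ⊗[ℂ] N) :=
  Submodule.span ℂ {z | ∃ k l, k + l = r ∧ ∃ x ∈ gM k, ∃ y ∈ gN l, z = x ⊗ₜ[ℂ] y}

theorem tmul_mem_tensorGr {gM : ℕ → Submodule ℂ M} {gN : ℕ → Submodule ℂ N} {k l : ℕ} {x : M}
    {y : N} (hx : x ∈ gM k) (hy : y ∈ gN l) : x ⊗ₜ[ℂ] y ∈ tensorGr gM gN (k + l) :=
  Submodule.subset_span ⟨k, l, rfl, x, hx, y, hy, rfl⟩

theorem iSup_tensorGr {gM : ℕ → Submodule ℂ M} {gN : ℕ → Submodule ℂ N}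
    (hM : ⨆ k, gM k = ⊤) (hN : ⨆ k, gN k = ⊤) : ⨆ r, tensorGr gM gN r = ⊤ := by
  rw [eq_top_iff]
  rintro z -
  induction z using TensorProduct.induction_on with
  | zero => exact zero_mem _
  | add x y hx hy => exact add_mem hx hy
  | tmul x y =>
    refine graded_induction hM (P := fun x => x ⊗ₜ[ℂ] y ∈ _) (fun k x hx => ?_)
      (fun a b ha hb => by rw [TensorProduct.add_tmul]; exact add_mem ha hb) x
    refine graded_induction hN (P := fun y => x ⊗ₜ[ℂ] y ∈ _) (fun l y hy => ?_)
      (fun a b ha hb => by rw [TensorProduct.tmul_add]; exact add_mem ha hb) y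
    exact Submodule.mem_iSup_of_mem (k + l) (tmul_mem_tensorGr hx hy)

/-- The projection of a tensor product onto the component of total degree `r`. -/
noncomputable def tensorProj {gM : ℕ → Submodule ℂ M} {gN : ℕ → Submodule ℂ N}
    (hM : DirectSum.IsInternal gM) (hN : DirectSum.IsInternal gN) (r : ℕ) :
    M ⊗[ℂ] N →ₗ[ℂ] M ⊗[ℂ] N :=
  ∑ q ∈ Finset.HasAntidiagonal.antidiagonal r, TensorProduct.map (gradedProj hM q.1) (gradedProj hN q.2)

theorem tensorProj_tmul {gM : ℕ → Submodule ℂ M} {gN : ℕ → Submodule ℂ N}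
    (hM : DirectSum.IsInternal gM) (hN : DirectSum.IsInternal gN) (r : ℕ) {k l : ℕ} {x : M}
    {y : N} (hx : x ∈ gM k) (hy : y ∈ gN l) :
    tensorProj hM hN r (x ⊗ₜ[ℂ] y) = if k + l = r then x ⊗ₜ[ℂ] y else 0 := by
  simp only [tensorProj, LinearMap.sum_apply, TensorProduct.map_tmul]
  split_ifs with h
  · rw [Finset.sum_eq_single (k, l)]
    · rw [gradedProj_same hM hx, gradedProj_same hN hy]
    · rintro ⟨a, b⟩ - hab
      by_cases hka : k = a
      · subst hka
        have : l ≠ b := fun h' => hab (by rw [h'])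
        simp [gradedProj_ne hN this hy]
      · simp [gradedProj_ne hM hka hx]
    · intro h'
      exact absurd (Finset.HasAntidiagonal.mem_antidiagonal.2 h) h'
  · refine Finset.sum_eq_zero ?_
    rintro ⟨a, b⟩ hab
    rw [Finset.HasAntidiagonal.mem_antidiagonal] at hab
    by_cases hka : k = a
    · have : l ≠ b := fun h' => h (by simp only at hab; omega)
      simp [gradedProj_ne hN this hy]
    · simp [gradedProj_ne hM hka hx]

/-- The image of the total grading under a linear surjection whose kernel is homogeneous. -/
theorem isInternal_map_tensorGr {gM : ℕ → Submodule ℂ M} {gN : ℕ → Submodule ℂ N}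
    (hM : DirectSum.IsInternal gM) (hN : DirectSum.IsInternal gN)
    {P : Type*} [AddCommGroup P] [Module ℂ P] (q : M ⊗[ℂ] N →ₗ[ℂ] P)
    (hq : Function.Surjective q)
    (hker : ∀ r, LinearMap.ker q ≤ (LinearMap.ker q).comap (tensorProj hM hN r)) :
    DirectSum.IsInternal fun r => (tensorGr gM gN r).map q := by
  have key : ∀ r, ∃ π : P →ₗ[ℂ] P, ∀ z, π (q z) = q (tensorProj hM hN r z) := by
    intro r
    let e := q.quotKerEquivOfSurjective hq
    refine ⟨(LinearMap.ker q).liftQ (q ∘ₗ tensorProj hM hN r) (fun z hz => hker r hz) ∘ₗ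
      e.symm.toLinearMap, fun z => ?_⟩
    have : e.symm (q z) = (LinearMap.ker q).mkQ z := by
      rw [LinearEquiv.symm_apply_eq]; rfl
    rw [LinearMap.comp_apply, LinearEquiv.coe_coe, this]
    rfl
  choose π hπ using key
  have hhom : ∀ k r, ∀ z ∈ tensorGr gM gN k, tensorProj hM hN r z = if k = r then z else 0 := by
    intro k r z hz
    induction hz using Submodule.span_induction with
    | mem z hz =>
      obtain ⟨a, b, hab, x, hx, y, hy, rfl⟩ := hz
      rw [tensorProj_tmul hM hN r hx hy, hab]
    | zero => simp
    | add x y _ _ hx hy => rw [map_add, hx, hy]; split_ifs <;> simp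
    | smul c x _ hx => rw [map_smul, hx]; split_ifs <;> simp
  refine isInternal_of_proj _ π ?_ ?_ ?_
  · rintro k _ ⟨z, hz, rfl⟩
    rw [hπ, hhom k k z hz, if_pos rfl]
  · rintro k l hkl _ ⟨z, hz, rfl⟩
    rw [hπ, hhom k l z hz, if_neg hkl, map_zero]
  · rw [← Submodule.map_iSup, iSup_tensorGr hM.submodule_iSup_eq_top hN.submodule_iSup_eq_top,
      Submodule.map_top, LinearMap.range_eq_top.2 hq]

end GradedLinearAlgebra

/-! ### Graded commutative differential graded algebras -/

/-- A graded commutative differential graded algebra `(Ω, d)` over `ℂ`, graded by `ℕ`. -/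
structure CDGA where
  carrier : Type u
  [ring : Ring carrier]
  [algebra : Algebra ℂ carrier]
  gr : ℕ → Submodule ℂ carrier
  [graded : GradedAlgebra gr]
  d : carrier →ₗ[ℂ] carrier
  d_mem : ∀ {k : ℕ} {ω : carrier}, ω ∈ gr k → d ω ∈ gr (k + 1)
  leibniz : ∀ {k : ℕ} {ω : carrier}, ω ∈ gr k → ∀ ν : carrier,
    d (ω * ν) = d ω * ν + (-1 : ℂ) ^ k • (ω * d ν)
  d_d : ∀ ω, d (d ω) = 0
  comm : ∀ {k l : ℕ} {α β : carrier}, α ∈ gr k → β ∈ gr l →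
    α * β = (-1 : ℂ) ^ (k * l) • (β * α)

namespace CDGA

attribute [instance] CDGA.ring CDGA.algebra CDGA.graded

instance : CoeSort CDGA.{u} (Type u) := ⟨CDGA.carrier⟩

theorem internal (Ω : CDGA.{u}) : DirectSum.IsInternal Ω.gr :=
  DirectSum.Decomposition.isInternal Ω.gr

theorem iSup_gr (Ω : CDGA.{u}) : ⨆ k, Ω.gr k = ⊤ := Ω.internal.submodule_iSup_eq_top

theorem one_mem (Ω : CDGA.{u}) : (1 : Ω) ∈ Ω.gr 0 := SetLike.GradedOne.one_mem

theorem mul_mem (Ω : CDGA.{u}) {k l : ℕ} {α β : Ω} (hα : α ∈ Ω.gr k) (hβ : β ∈ Ω.gr l) :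
    α * β ∈ Ω.gr (k + l) := SetLike.GradedMul.mul_mem hα hβ

theorem d_one (Ω : CDGA.{u}) : Ω.d 1 = 0 := by
  have := Ω.leibniz Ω.one_mem 1
  simpa using this

end CDGA

/-! ### The exterior algebra -/

section Exterior

variable (V : Type u) [AddCommGroup V] [Module ℂ V]

theorem exterior_comm_one {k l : ℕ} {α β : ExteriorAlgebra ℂ V} (hk : k = 1) (hα : α ∈ ⋀[ℂ]^k V)
    (hβ : β ∈ ⋀[ℂ]^l V) : α * β = (-1 : ℂ) ^ l • (β * α) := by
  subst hk
  obtain ⟨v, rfl⟩ : ∃ v, ExteriorAlgebra.ι ℂ v = α := by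
    have h := Submodule.pow_one (LinearMap.range (ExteriorAlgebra.ι ℂ : V →ₗ[ℂ] _))
    exact h.le hα
  induction hβ using Submodule.pow_induction_on_left' with
  | algebraMap r => simp [Algebra.commutes]
  | add x y i hx hy ihx ihy => rw [mul_add, add_mul, smul_add, ihx, ihy]
  | mem_mul m hm i x hx ih =>
    obtain ⟨w, rfl⟩ := hm
    have h := ExteriorAlgebra.ι_add_mul_swap (R := ℂ) v w
    have h' : ExteriorAlgebra.ι ℂ v * ExteriorAlgebra.ι ℂ w =
      -(ExteriorAlgebra.ι ℂ w * ExteriorAlgebra.ι ℂ v) := eq_neg_of_add_eq_zero_left h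
    rw [← mul_assoc, h', neg_mul, mul_assoc, ih, mul_smul_comm, pow_succ]
    simp [mul_assoc]

theorem exterior_comm {k l : ℕ} {α β : ExteriorAlgebra ℂ V} (hα : α ∈ ⋀[ℂ]^k V)
    (hβ : β ∈ ⋀[ℂ]^l V) : α * β = (-1 : ℂ) ^ (k * l) • (β * α) := by
  induction hα using Submodule.pow_induction_on_left' with
  | algebraMap r => simp [Algebra.commutes]
  | add x y i hx hy ihx ihy => rw [mul_add, add_mul, smul_add, ihx, ihy]
  | mem_mul m hm i x hx ih =>
    have h := exterior_comm_one V (k := 1) rfl ((Submodule.pow_one (LinearMap.range (ExteriorAlgebra.ι ℂ : V →ₗ[ℂ] _))).ge hm) hβ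
    rw [mul_assoc, ih, mul_smul_comm, ← mul_assoc, h, smul_mul_assoc, smul_smul, mul_assoc,
      Nat.succ_mul, pow_add]

/-- The exterior algebra `⋀ V` with differential `d = 0`. -/
noncomputable def CDGA.exterior : CDGA.{u} where
  carrier := ExteriorAlgebra ℂ V
  gr := fun k => ⋀[ℂ]^k V
  d := 0
  d_mem := fun _ => zero_mem _
  leibniz := fun _ _ => by simp
  d_d := fun _ => rfl
  comm := fun hα hβ => exterior_comm V hα hβ

end Exterior

/-! ### The graded tensor product of two graded commutative dgas -/

namespace CDGA

section Tensor

variable (Ω Ω' : CDGA.{u})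

/-- The underlying algebra of `Ω ⊗ Ω'`, where
`(α ⊗ β) (α' ⊗ β') = (-1) ^ (|β| |α'|) (α α') ⊗ (β β')`. -/
abbrev TensorCarrier : Type u := GradedTensorProduct ℂ Ω.gr Ω'.gr

/-- The total grading on `Ω ⊗ Ω'`. -/
noncomputable def tGr (r : ℕ) : Submodule ℂ (TensorCarrier Ω Ω') :=
  (tensorGr Ω.gr Ω'.gr r).map (GradedTensorProduct.of ℂ Ω.gr Ω'.gr).toLinearMap

theorem tGr_internal : DirectSum.IsInternal (tGr Ω Ω') := by
  refine isInternal_map_tensorGr Ω.internal Ω'.internal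
    (GradedTensorProduct.of ℂ Ω.gr Ω'.gr).toLinearMap
    (GradedTensorProduct.of ℂ Ω.gr Ω'.gr).surjective ?_
  intro r
  simp

variable {Ω Ω'}

/-- The element `α ⊗ β` of `Ω ⊗ Ω'`. -/
noncomputable def tm : Ω →ₗ[ℂ] Ω' →ₗ[ℂ] TensorCarrier Ω Ω' :=
  (TensorProduct.mk ℂ Ω Ω').compr₂ (GradedTensorProduct.of ℂ Ω.gr Ω'.gr).toLinearMap

theorem tm_eq (α : Ω) (β : Ω') : tm α β = GradedTensorProduct.of ℂ Ω.gr Ω'.gr (α ⊗ₜ[ℂ] β) := rfl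

theorem one_eq_tm : (1 : TensorCarrier Ω Ω') = tm 1 1 := rfl

theorem tm_mem {k l : ℕ} {α : Ω} {β : Ω'} (hα : α ∈ Ω.gr k) (hβ : β ∈ Ω'.gr l) :
    tm α β ∈ tGr Ω Ω' (k + l) :=
  ⟨_, tmul_mem_tensorGr hα hβ, rfl⟩

theorem tGr_induction {r : ℕ} {P : TensorCarrier Ω Ω' → Prop}
    (tmul : ∀ k l, k + l = r → ∀ α ∈ Ω.gr k, ∀ β ∈ Ω'.gr l, P (tm α β))
    (zero : P 0) (add : ∀ x y, P x → P y → P (x + y))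
    (smul : ∀ (c : ℂ) x, P x → P (c • x)) {x : TensorCarrier Ω Ω'} (hx : x ∈ tGr Ω Ω' r) :
    P x := by
  obtain ⟨z, hz, rfl⟩ := hx
  induction hz using Submodule.span_induction with
  | mem z hz =>
    obtain ⟨a, b, hab, x, hx, y, hy, rfl⟩ := hz
    exact tmul a b hab x hx y hy
  | zero => rw [map_zero]; exact zero
  | add x y _ _ hx hy => rw [map_add]; exact add _ _ hx hy
  | smul c x _ hx => rw [map_smul]; exact smul c _ hx

theorem t_induction {P : TensorCarrier Ω Ω' → Prop}
    (tmul : ∀ k l, ∀ α ∈ Ω.gr k, ∀ β ∈ Ω'.gr l, P (tm α β))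
    (zero : P 0) (add : ∀ x y, P x → P y → P (x + y))
    (smul : ∀ (c : ℂ) x, P x → P (c • x)) (x : TensorCarrier Ω Ω') : P x :=
  graded_induction (tGr_internal Ω Ω').submodule_iSup_eq_top
    (fun _ _ hx => tGr_induction (fun k l _ => tmul k l) zero add smul hx) add x

theorem tm_mul_tm {k l : ℕ} (α : Ω) {β : Ω'} {α' : Ω} (β' : Ω') (hβ : β ∈ Ω'.gr l)
    (hα' : α' ∈ Ω.gr k) :
    tm α β * tm α' β' = (-1 : ℂ) ^ (l * k) • tm (α * α') (β * β') := by
  have h := GradedTensorProduct.tmul_coe_mul_coe_tmul (R := ℂ) Ω.gr Ω'.gr α ⟨β, hβ⟩ ⟨α', hα'⟩ β'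
  refine h.trans ?_
  have hz : ∀ (m : ℕ) (x : TensorCarrier Ω Ω'), ((-1 : ℤˣ) ^ m) • x = ((-1 : ℂ) ^ m) • x := by
    intro m x
    rw [Units.smul_def, ← Int.cast_smul_eq_zsmul ℂ]
    congr 1
    push_cast
    rfl
  exact hz _ _

theorem tGr_mul_mem {r s : ℕ} {x y : TensorCarrier Ω Ω'} (hx : x ∈ tGr Ω Ω' r)
    (hy : y ∈ tGr Ω Ω' s) : x * y ∈ tGr Ω Ω' (r + s) := by
  refine tGr_induction (P := fun x => x * y ∈ tGr Ω Ω' (r + s)) ?_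
    (by rw [zero_mul]; exact zero_mem _)
    (fun a b ha hb => by rw [add_mul]; exact add_mem ha hb)
    (fun c a ha => by rw [smul_mul_assoc]; exact Submodule.smul_mem _ _ ha) hx
  intro k l hkl α hα β hβ
  refine tGr_induction (P := fun y => tm α β * y ∈ tGr Ω Ω' (r + s)) ?_
    (by rw [mul_zero]; exact zero_mem _)
    (fun a b ha hb => by rw [mul_add]; exact add_mem ha hb)
    (fun c a ha => by rw [mul_smul_comm]; exact Submodule.smul_mem _ _ ha) hy
  intro k' l' hkl' α' hα' β' hβ'
  rw [tm_mul_tm α β' hβ hα']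
  refine Submodule.smul_mem _ _ ?_
  have h := tm_mem (Ω.mul_mem hα hα') (Ω'.mul_mem hβ hβ')
  have e : k + k' + (l + l') = r + s := by omega
  rwa [e] at h

theorem tGr_one_mem : (1 : TensorCarrier Ω Ω') ∈ tGr Ω Ω' 0 := by
  have h : tm (1 : Ω) (1 : Ω') ∈ tGr Ω Ω' (0 + 0) := tm_mem Ω.one_mem Ω'.one_mem
  rw [one_eq_tm]
  exact h

theorem tGr_gradedMonoid : SetLike.GradedMonoid (tGr Ω Ω') :=
  { one_mem := tGr_one_mem
    mul_mem := by
      intro _ _ _ _ hx hy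
      exact tGr_mul_mem hx hy }

noncomputable instance tGradedAlgebra : GradedAlgebra (tGr Ω Ω') :=
  { tGr_gradedMonoid, (tGr_internal Ω Ω').chooseDecomposition with }

variable (Ω Ω') in
/-- The differential `d (α ⊗ β) = dα ⊗ β + (-1) ^ |α| α ⊗ dβ`. -/
noncomputable def tD : TensorCarrier Ω Ω' →ₗ[ℂ] TensorCarrier Ω Ω' :=
  (GradedTensorProduct.of ℂ Ω.gr Ω'.gr).toLinearMap ∘ₗ
    (TensorProduct.map Ω.d LinearMap.id + TensorProduct.map (gradedSign Ω.internal) Ω'.d) ∘ₗ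
    (GradedTensorProduct.of ℂ Ω.gr Ω'.gr).symm.toLinearMap

theorem tD_tm {k : ℕ} {α : Ω} (hα : α ∈ Ω.gr k) (β : Ω') :
    tD Ω Ω' (tm α β) = tm (Ω.d α) β + (-1 : ℂ) ^ k • tm α (Ω'.d β) := by
  rw [← LinearMap.map_smul₂, ← gradedSign_apply Ω.internal hα]
  rfl

theorem tD_mem {r : ℕ} {x : TensorCarrier Ω Ω'} (hx : x ∈ tGr Ω Ω' r) :
    tD Ω Ω' x ∈ tGr Ω Ω' (r + 1) := by
  refine tGr_induction (P := fun x => tD Ω Ω' x ∈ tGr Ω Ω' (r + 1)) ?_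
    (by rw [map_zero]; exact zero_mem _)
    (fun a b ha hb => by rw [map_add]; exact add_mem ha hb)
    (fun c a ha => by rw [map_smul]; exact Submodule.smul_mem _ _ ha) hx
  intro k l hkl α hα β hβ
  rw [tD_tm hα]
  refine add_mem ?_ (Submodule.smul_mem _ _ ?_)
  · have h := tm_mem (Ω.d_mem hα) hβ
    rwa [show k + 1 + l = r + 1 by omega] at h
  · have h := tm_mem hα (Ω'.d_mem hβ)
    rwa [show k + (l + 1) = r + 1 by omega] at h

theorem tD_leibniz {r : ℕ} {x : TensorCarrier Ω Ω'} (hx : x ∈ tGr Ω Ω' r)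
    (y : TensorCarrier Ω Ω') :
    tD Ω Ω' (x * y) = tD Ω Ω' x * y + (-1 : ℂ) ^ r • (x * tD Ω Ω' y) := by
  refine tGr_induction (P := fun x => tD Ω Ω' (x * y) = tD Ω Ω' x * y +
    (-1 : ℂ) ^ r • (x * tD Ω Ω' y)) ?_ (by simp only [zero_mul, map_zero, smul_zero, add_zero])
    (fun a b ha hb => by rw [add_mul, map_add, map_add, ha, hb, add_mul, add_mul, smul_add]; abel)
    (fun c a ha => by
      rw [smul_mul_assoc, map_smul, map_smul, ha, smul_mul_assoc, smul_mul_assoc, smul_add,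
        smul_comm c]) hx
  intro k l hkl α hα β hβ
  refine t_induction (P := fun y => tD Ω Ω' (tm α β * y) = tD Ω Ω' (tm α β) * y +
    (-1 : ℂ) ^ r • (tm α β * tD Ω Ω' y)) ?_
    (by simp only [mul_zero, map_zero, smul_zero, add_zero])
    (fun a b ha hb => by rw [mul_add, map_add, map_add, ha, hb, mul_add, mul_add, smul_add]; abel)
    (fun c a ha => by
      rw [mul_smul_comm, map_smul, map_smul, ha, mul_smul_comm, mul_smul_comm, smul_add,
        smul_comm c]) y
  intro k' l' α' hα' β' hβ'
  rw [tm_mul_tm α β' hβ hα', map_smul, tD_tm (Ω.mul_mem hα hα'), tD_tm hα,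
    tD_tm hα', add_mul, mul_add, tm_mul_tm _ _ hβ hα', smul_mul_assoc, mul_smul_comm,
    tm_mul_tm _ _ (Ω'.d_mem hβ) hα', tm_mul_tm _ _ hβ (Ω.d_mem hα'),
    tm_mul_tm _ _ hβ hα', Ω.leibniz hα, Ω'.leibniz hβ]
  rw [map_add, LinearMap.add_apply, map_add, map_smul, map_smul, LinearMap.smul_apply]
  subst hkl
  have h2 : (-1 : ℂ) ^ l * (-1 : ℂ) ^ l = 1 := by rw [← mul_pow]; simp
  generalize tm (Ω.d α * α') (β * β') = v₁
  generalize tm (α * Ω.d α') (β * β') = v₂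
  generalize tm (α * α') (Ω'.d β * β') = v₃
  generalize tm (α * α') (β * Ω'.d β') = v₄
  simp only [pow_add, add_mul, mul_add, one_mul, mul_one]
  generalize (-1 : ℂ) ^ l = b at *
  match_scalars
  · ring
  · linear_combination (-(-1 : ℂ) ^ k * (-1 : ℂ) ^ (l * k')) * h2
  · ring
  · ring

theorem tD_tD (x : TensorCarrier Ω Ω') : tD Ω Ω' (tD Ω Ω' x) = 0 := by
  refine t_induction (P := fun x => tD Ω Ω' (tD Ω Ω' x) = 0) ?_ (by rw [map_zero, map_zero])
    (fun a b ha hb => by rw [map_add, map_add, ha, hb, add_zero])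
    (fun c a ha => by rw [map_smul, map_smul, ha, smul_zero]) x
  intro k l α hα β hβ
  rw [tD_tm hα, map_add, map_smul, tD_tm (Ω.d_mem hα), tD_tm hα, Ω.d_d, Ω'.d_d, map_zero,
    map_zero, LinearMap.zero_apply, pow_succ]
  module

theorem t_comm {r s : ℕ} {x y : TensorCarrier Ω Ω'} (hx : x ∈ tGr Ω Ω' r)
    (hy : y ∈ tGr Ω Ω' s) : x * y = (-1 : ℂ) ^ (r * s) • (y * x) := by
  refine tGr_induction (P := fun x => x * y = (-1 : ℂ) ^ (r * s) • (y * x)) ?_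
    (by rw [mul_zero, zero_mul, smul_zero])
    (fun a b ha hb => by rw [add_mul, mul_add, ha, hb, smul_add])
    (fun c a ha => by rw [smul_mul_assoc, mul_smul_comm, ha, smul_comm c]) hx
  intro k l hkl α hα β hβ
  refine tGr_induction (P := fun y => tm α β * y = (-1 : ℂ) ^ (r * s) • (y * tm α β)) ?_
    (by rw [mul_zero, zero_mul, smul_zero])
    (fun a b ha hb => by rw [add_mul, mul_add, ha, hb, smul_add])
    (fun c a ha => by rw [smul_mul_assoc, mul_smul_comm, ha, smul_comm c]) hy
  intro k' l' hkl' α' hα' β' hβ'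
  rw [tm_mul_tm _ _ hβ hα', tm_mul_tm _ _ hβ' hα, Ω.comm hα hα', Ω'.comm hβ hβ', map_smul,
    LinearMap.map_smul₂, smul_smul, smul_smul, smul_smul]
  congr 1
  subst hkl hkl'
  have h1 : (-1 : ℂ) ^ (l' * k) * (-1 : ℂ) ^ (l' * k) = 1 := by rw [← mul_pow]; simp
  simp only [add_mul, mul_add, pow_add]
  rw [mul_comm k l']
  linear_combination (-(-1 : ℂ) ^ (l * k') * (-1 : ℂ) ^ (l * l') * (-1 : ℂ) ^ (k * k')) * h1

variable (Ω Ω') in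
/-- The tensor product `Ω ⊗ Ω'` of graded commutative dgas. -/
noncomputable def tensor : CDGA.{u} where
  carrier := TensorCarrier Ω Ω'
  gr := tGr Ω Ω'
  d := tD Ω Ω'
  d_mem := tD_mem
  leibniz := tD_leibniz
  d_d := tD_tD
  comm := t_comm

end Tensor

end CDGA


/-! ### Graded bimodules -/

/-- A graded bimodule over `Ω`; `lact α e` is `α e` and `ract e α` is `e α`. -/
structure GradedBimodule (Ω : CDGA.{u}) where
  carrier : Type u
  [addCommGroup : AddCommGroup carrier]
  [module : Module ℂ carrier]
  gr : ℕ → Submodule ℂ carrier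
  internal : DirectSum.IsInternal gr
  lact : Ω →ₗ[ℂ] carrier →ₗ[ℂ] carrier
  ract : carrier →ₗ[ℂ] Ω →ₗ[ℂ] carrier
  one_lact : ∀ e, lact 1 e = e
  mul_lact : ∀ α β e, lact (α * β) e = lact α (lact β e)
  ract_one : ∀ e, ract e 1 = e
  ract_mul : ∀ e α β, ract e (α * β) = ract (ract e α) β
  ract_lact : ∀ α e β, ract (lact α e) β = lact α (ract e β)
  lact_mem : ∀ {k l : ℕ} {α : Ω} {e : carrier}, α ∈ Ω.gr k → e ∈ gr l → lact α e ∈ gr (k + l)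
  ract_mem : ∀ {k l : ℕ} {e : carrier} {α : Ω}, e ∈ gr k → α ∈ Ω.gr l → ract e α ∈ gr (k + l)

namespace GradedBimodule

attribute [instance] GradedBimodule.addCommGroup GradedBimodule.module

variable {Ω : CDGA.{u}}

instance : CoeSort (GradedBimodule Ω) (Type u) := ⟨GradedBimodule.carrier⟩

/-- Bimodule morphisms of degree `0`. -/
@[ext]
structure Hom (E F : GradedBimodule Ω) where
  toLin : E →ₗ[ℂ] F
  map_mem : ∀ {k : ℕ} {e : E}, e ∈ E.gr k → toLin e ∈ F.gr k
  map_lact : ∀ α e, toLin (E.lact α e) = F.lact α (toLin e)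
  map_ract : ∀ e α, toLin (E.ract e α) = F.ract (toLin e) α

theorem iSup_gr (E : GradedBimodule Ω) : ⨆ k, E.gr k = ⊤ := E.internal.submodule_iSup_eq_top

/-- The grading on `Ω ^ n`. -/
def freeGr (Ω : CDGA.{u}) (n k : ℕ) : Submodule ℂ (Fin n → Ω) :=
  Submodule.pi Set.univ fun _ => Ω.gr k

theorem mem_freeGr {n k : ℕ} {x : Fin n → Ω} : x ∈ freeGr Ω n k ↔ ∀ a, x a ∈ Ω.gr k := by
  simp [freeGr, Submodule.mem_pi]

theorem single_mem_freeGr {n k : ℕ} (a : Fin n) {α : Ω} (hα : α ∈ Ω.gr k) :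
    (Pi.single a α : Fin n → Ω) ∈ freeGr Ω n k := by
  rw [mem_freeGr]
  intro b
  by_cases h : b = a
  · subst h; simpa using hα
  · simp [h]

theorem freeGr_internal (Ω : CDGA.{u}) (n : ℕ) : DirectSum.IsInternal (freeGr Ω n) := by
  refine isInternal_of_proj _ (fun l => LinearMap.pi fun a =>
    gradedProj Ω.internal l ∘ₗ LinearMap.proj a) ?_ ?_ ?_
  · intro k x hx
    ext a
    exact gradedProj_same Ω.internal (mem_freeGr.1 hx a)
  · intro k l hkl x hx
    ext a
    exact gradedProj_ne Ω.internal hkl (mem_freeGr.1 hx a)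
  · rw [eq_top_iff]
    rintro x -
    rw [← Finset.univ_sum_single x]
    refine sum_mem fun a _ => ?_
    exact graded_induction Ω.iSup_gr
      (P := fun α => (Pi.single a α : Fin n → Ω) ∈ ⨆ k, freeGr Ω n k)
      (fun k α hα => Submodule.mem_iSup_of_mem k (single_mem_freeGr a hα))
      (fun α β hα hβ => by rw [Pi.single_add]; exact add_mem hα hβ) (x a)

/-- The free graded bimodule `Ω ^ n`. -/
noncomputable def free (Ω : CDGA.{u}) (n : ℕ) : GradedBimodule Ω where
  carrier := Fin n → Ω
  gr := freeGr Ω n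
  internal := freeGr_internal Ω n
  lact := LinearMap.mk₂ ℂ (fun α x a => α * x a)
    (fun _ _ _ => by ext; simp [add_mul]) (fun _ _ _ => by ext; simp)
    (fun _ _ _ => by ext; simp [mul_add]) (fun _ _ _ => by ext; simp)
  ract := LinearMap.mk₂ ℂ (fun x α a => x a * α)
    (fun _ _ _ => by ext; simp [add_mul]) (fun _ _ _ => by ext; simp)
    (fun _ _ _ => by ext; simp [mul_add]) (fun _ _ _ => by ext; simp)
  one_lact := fun e => by ext; simp
  mul_lact := fun α β e => by ext; simp [mul_assoc]
  ract_one := fun e => by ext; simp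
  ract_mul := fun e α β => by ext; simp [mul_assoc]
  ract_lact := fun α e β => by ext; simp [mul_assoc]
  lact_mem := fun hα he => mem_freeGr.2 fun a => Ω.mul_mem hα (mem_freeGr.1 he a)
  ract_mem := fun he hα => mem_freeGr.2 fun a => Ω.mul_mem (mem_freeGr.1 he a) hα

/-- `E` is finitely generated projective: a direct summand, as a graded bimodule, of some `Ω ^ n`,
that is, there are morphisms `i : E → Ω ^ n` and `r : Ω ^ n → E` with `r ∘ i = id` (the complement
is then the graded bimodule `ker r`). -/
def IsFGP (E : GradedBimodule Ω) : Prop :=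
  ∃ (n : ℕ) (i : Hom E (free Ω n)) (r : Hom (free Ω n) E), ∀ e : E, r.toLin (i.toLin e) = e

theorem isFGP_iff {E : GradedBimodule Ω} : E.IsFGP ↔
    ∃ (n : ℕ) (i : E →ₗ[ℂ] (Fin n → Ω)) (r : (Fin n → Ω) →ₗ[ℂ] E),
      (∀ {k : ℕ} {e : E}, e ∈ E.gr k → ∀ a, i e a ∈ Ω.gr k) ∧
      (∀ α e a, i (E.lact α e) a = α * i e a) ∧ (∀ e α a, i (E.ract e α) a = i e a * α) ∧
      (∀ {k : ℕ} {w : Fin n → Ω}, (∀ a, w a ∈ Ω.gr k) → r w ∈ E.gr k) ∧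
      (∀ α (w : Fin n → Ω), r (fun a => α * w a) = E.lact α (r w)) ∧
      (∀ (w : Fin n → Ω) α, r (fun a => w a * α) = E.ract (r w) α) ∧ ∀ e, r (i e) = e := by
  constructor
  · rintro ⟨n, i, r, h⟩
    exact ⟨n, i.toLin, r.toLin, fun he => mem_freeGr.1 (i.map_mem he),
      fun α e a => congrFun (i.map_lact α e) a, fun e α a => congrFun (i.map_ract e α) a,
      fun hw => r.map_mem (mem_freeGr.2 hw), fun α w => r.map_lact α w,
      fun w α => r.map_ract w α, h⟩
  · rintro ⟨n, i, r, h1, h2, h3, h4, h5, h6, h7⟩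
    exact ⟨n, ⟨i, fun he => mem_freeGr.2 (h1 he), fun α e => funext (h2 α e),
      fun e α => funext (h3 e α)⟩, ⟨r, fun hw => h4 (mem_freeGr.1 hw), h5, h6⟩, h7⟩

/-- Over a graded commutative dga, the two actions on an fgp bimodule agree up to the sign. -/
theorem IsFGP.lact_eq {E : GradedBimodule Ω} (h : E.IsFGP) {k l : ℕ} {α : Ω} {e : E}
    (hα : α ∈ Ω.gr k) (he : e ∈ E.gr l) : E.lact α e = (-1 : ℂ) ^ (k * l) • E.ract e α := by
  obtain ⟨n, i, r, hri⟩ := h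
  rw [← hri (E.lact α e), ← hri (E.ract e α), ← map_smul, i.map_lact, i.map_ract]
  congr 1
  refine funext fun a => ?_
  exact Ω.comm hα (mem_freeGr.1 (i.map_mem he) a)

/-- `Ω` as a graded bimodule over itself. -/
noncomputable def regular (Ω : CDGA.{u}) : GradedBimodule Ω where
  carrier := Ω
  gr := Ω.gr
  internal := Ω.internal
  lact := LinearMap.mul ℂ Ω
  ract := LinearMap.mul ℂ Ω
  one_lact := fun e => by simp
  mul_lact := fun α β e => by simp [mul_assoc]
  ract_one := fun e => by simp
  ract_mul := fun e α β => by simp [mul_assoc]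
  ract_lact := fun α e β => by simp [mul_assoc]
  lact_mem := fun hα he => Ω.mul_mem hα he
  ract_mem := fun he hα => Ω.mul_mem he hα

theorem regular_isFGP (Ω : CDGA.{u}) : (regular Ω).IsFGP := by
  refine ⟨1, ⟨LinearMap.pi fun _ => LinearMap.id, ?_, ?_, ?_⟩,
    ⟨LinearMap.proj 0, ?_, ?_, ?_⟩, fun e => rfl⟩
  · intro k e he
    exact mem_freeGr.2 fun _ => he
  · intro α e; rfl
  · intro e α; rfl
  · intro k e he
    exact mem_freeGr.1 he 0
  · intro α e; rfl
  · intro e α; rfl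

/-! ### The tensor product over `Ω` -/

section Tensor

variable (E F : GradedBimodule Ω)

/-- The relations `e α ⊗ f = e ⊗ α f`. -/
def balancedRel : Submodule ℂ (E ⊗[ℂ] F) :=
  Submodule.span ℂ {z | ∃ (e : E) (α : Ω) (f : F),
    z = E.ract e α ⊗ₜ[ℂ] f - e ⊗ₜ[ℂ] F.lact α f}

/-- The vector space `E ⊗_Ω F`. -/
abbrev TensorCarrier : Type u := (E ⊗[ℂ] F) ⧸ balancedRel E F

/-- The canonical bilinear map `(e, f) ↦ e ⊗ f` into `E ⊗_Ω F`. -/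
noncomputable def tm : E →ₗ[ℂ] F →ₗ[ℂ] TensorCarrier E F :=
  (TensorProduct.mk ℂ E F).compr₂ (balancedRel E F).mkQ

variable {E F}

theorem tm_balanced (e : E) (α : Ω) (f : F) : tm E F (E.ract e α) f = tm E F e (F.lact α f) := by
  rw [← sub_eq_zero]
  change (balancedRel E F).mkQ (E.ract e α ⊗ₜ[ℂ] f) - (balancedRel E F).mkQ (e ⊗ₜ[ℂ] F.lact α f) = 0
  rw [← map_sub, Submodule.mkQ_apply, Submodule.Quotient.mk_eq_zero]
  exact Submodule.subset_span ⟨e, α, f, rfl⟩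

theorem tm_induction {P : TensorCarrier E F → Prop} (tmul : ∀ e f, P (tm E F e f))
    (add : ∀ x y, P x → P y → P (x + y)) (x : TensorCarrier E F) : P x := by
  obtain ⟨z, rfl⟩ := (balancedRel E F).mkQ_surjective x
  induction z using TensorProduct.induction_on with
  | zero => have h := tmul 0 0; rw [map_zero] at h ⊢; exact h
  | tmul e f => exact tmul e f
  | add x y hx hy => rw [map_add]; exact add _ _ hx hy

/-- The universal property of `E ⊗_Ω F` among `ℂ`-vector spaces. -/
noncomputable def tLift {P : Type*} [AddCommGroup P] [Module ℂ P] (B : E →ₗ[ℂ] F →ₗ[ℂ] P)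
    (h : ∀ e α f, B (E.ract e α) f = B e (F.lact α f)) : TensorCarrier E F →ₗ[ℂ] P :=
  (balancedRel E F).liftQ (TensorProduct.lift B) <| by
    rw [balancedRel, Submodule.span_le]
    rintro _ ⟨e, α, f, rfl⟩
    simp [h]

theorem tLift_tm {P : Type*} [AddCommGroup P] [Module ℂ P] (B : E →ₗ[ℂ] F →ₗ[ℂ] P)
    (h : ∀ e α f, B (E.ract e α) f = B e (F.lact α f)) (e : E) (f : F) :
    tLift B h (tm E F e f) = B e f := rfl

variable (E F) in
/-- The grading of `E ⊗_Ω F`. -/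
def tGr (r : ℕ) : Submodule ℂ (TensorCarrier E F) :=
  (tensorGr E.gr F.gr r).map (balancedRel E F).mkQ

theorem tm_mem {k l : ℕ} {e : E} {f : F} (he : e ∈ E.gr k) (hf : f ∈ F.gr l) :
    tm E F e f ∈ tGr E F (k + l) :=
  ⟨_, tmul_mem_tensorGr he hf, rfl⟩

theorem tGr_induction {r : ℕ} {P : TensorCarrier E F → Prop}
    (tmul : ∀ k l, k + l = r → ∀ e ∈ E.gr k, ∀ f ∈ F.gr l, P (tm E F e f))
    (zero : P 0) (add : ∀ x y, P x → P y → P (x + y))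
    (smul : ∀ (c : ℂ) x, P x → P (c • x)) {x : TensorCarrier E F} (hx : x ∈ tGr E F r) :
    P x := by
  obtain ⟨z, hz, rfl⟩ := hx
  induction hz using Submodule.span_induction with
  | mem z hz =>
    obtain ⟨a, b, hab, x, hx, y, hy, rfl⟩ := hz
    exact tmul a b hab x hx y hy
  | zero => rw [map_zero]; exact zero
  | add x y _ _ hx hy => rw [map_add]; exact add _ _ hx hy
  | smul c x _ hx => rw [map_smul]; exact smul c _ hx

theorem tGr_internal : DirectSum.IsInternal (tGr E F) := by
  refine isInternal_map_tensorGr E.internal F.internal _ (balancedRel E F).mkQ_surjective ?_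
  intro r
  rw [Submodule.ker_mkQ]
  conv_lhs => rw [balancedRel]
  rw [Submodule.span_le]
  rintro _ ⟨e, α, f, rfl⟩
  change tensorProj E.internal F.internal r _ ∈ balancedRel E F
  refine graded_induction E.iSup_gr (P := fun e => tensorProj E.internal F.internal r
    (E.ract e α ⊗ₜ[ℂ] f - e ⊗ₜ[ℂ] F.lact α f) ∈ balancedRel E F) ?_ ?_ e
  swap
  · intro x y hx hy
    have h := add_mem hx hy
    rw [← map_add] at h
    convert h using 2
    simp only [map_add, LinearMap.add_apply, TensorProduct.add_tmul]
    abel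
  intro k e he
  refine graded_induction Ω.iSup_gr (P := fun α => tensorProj E.internal F.internal r
    (E.ract e α ⊗ₜ[ℂ] f - e ⊗ₜ[ℂ] F.lact α f) ∈ balancedRel E F) ?_ ?_ α
  swap
  · intro x y hx hy
    have h := add_mem hx hy
    rw [← map_add] at h
    convert h using 2
    simp only [map_add, LinearMap.add_apply, TensorProduct.add_tmul, TensorProduct.tmul_add]
    abel
  intro j α hα
  refine graded_induction F.iSup_gr (P := fun f => tensorProj E.internal F.internal r
    (E.ract e α ⊗ₜ[ℂ] f - e ⊗ₜ[ℂ] F.lact α f) ∈ balancedRel E F) ?_ ?_ f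
  swap
  · intro x y hx hy
    have h := add_mem hx hy
    rw [← map_add] at h
    convert h using 2
    simp only [map_add, TensorProduct.tmul_add]
    abel
  intro l f hf
  rw [map_sub, tensorProj_tmul _ _ _ (E.ract_mem he hα) hf,
    tensorProj_tmul _ _ _ he (F.lact_mem hα hf), add_assoc]
  split_ifs
  · exact Submodule.subset_span ⟨e, α, f, rfl⟩
  · simp

variable (E F) in
/-- The left action `α (e ⊗ f) = α e ⊗ f`. -/
noncomputable def tL : Ω →ₗ[ℂ] TensorCarrier E F →ₗ[ℂ] TensorCarrier E F :=
  (tLift (LinearMap.mk₂ ℂ (fun e f => (tm E F).flip f ∘ₗ E.lact.flip e)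
    (fun _ _ _ => by ext; simp) (fun _ _ _ => by ext; simp)
    (fun _ _ _ => by ext; simp) (fun _ _ _ => by ext; simp))
    (fun e β f => by
      ext α
      change tm E F (E.lact α (E.ract e β)) f = tm E F (E.lact α e) (F.lact β f)
      rw [← E.ract_lact, tm_balanced])).flip

variable (E F) in
/-- The right action `(e ⊗ f) α = e ⊗ f α`. -/
noncomputable def tR : TensorCarrier E F →ₗ[ℂ] Ω →ₗ[ℂ] TensorCarrier E F :=
  tLift (LinearMap.mk₂ ℂ (fun e f => tm E F e ∘ₗ F.ract f)
    (fun _ _ _ => by ext; simp) (fun _ _ _ => by ext; simp)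
    (fun _ _ _ => by ext; simp) (fun _ _ _ => by ext; simp))
    (fun e β f => by
      ext α
      change tm E F (E.ract e β) (F.ract f α) = tm E F e (F.ract (F.lact β f) α)
      rw [F.ract_lact, tm_balanced])

theorem tL_tm (α : Ω) (e : E) (f : F) : tL E F α (tm E F e f) = tm E F (E.lact α e) f := rfl

theorem tR_tm (e : E) (f : F) (α : Ω) : tR E F (tm E F e f) α = tm E F e (F.ract f α) := rfl

theorem tL_mem {k l : ℕ} {α : Ω} {x : TensorCarrier E F} (hα : α ∈ Ω.gr k) (hx : x ∈ tGr E F l) :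
    tL E F α x ∈ tGr E F (k + l) := by
  refine tGr_induction (P := fun x => tL E F α x ∈ tGr E F (k + l)) ?_
    (by rw [map_zero]; exact zero_mem _)
    (fun a b ha hb => by rw [map_add]; exact add_mem ha hb)
    (fun c a ha => by rw [map_smul]; exact Submodule.smul_mem _ _ ha) hx
  intro i j hij e he f hf
  have h := tm_mem (E.lact_mem hα he) hf
  rw [show k + i + j = k + l by omega] at h
  exact h

theorem tR_mem {k l : ℕ} {α : Ω} {x : TensorCarrier E F} (hx : x ∈ tGr E F k) (hα : α ∈ Ω.gr l) :
    tR E F x α ∈ tGr E F (k + l) := by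
  refine tGr_induction (P := fun x => tR E F x α ∈ tGr E F (k + l)) ?_
    (by rw [map_zero]; exact zero_mem _)
    (fun a b ha hb => by rw [map_add]; exact add_mem ha hb)
    (fun c a ha => by rw [map_smul]; exact Submodule.smul_mem _ _ ha) hx
  intro i j hij e he f hf
  have h := tm_mem he (F.ract_mem hf hα)
  rw [show i + (j + l) = k + l by omega] at h
  exact h

variable (E F) in
/-- The graded bimodule `E ⊗_Ω F`. -/
noncomputable def tensor : GradedBimodule Ω where
  carrier := TensorCarrier E F
  gr := tGr E F
  internal := tGr_internal
  lact := tL E F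
  ract := tR E F
  one_lact := tm_induction (fun e f => by rw [tL_tm, E.one_lact])
    fun x y hx hy => by rw [map_add, hx, hy]
  mul_lact := fun α β => tm_induction (fun e f => by rw [tL_tm, tL_tm, tL_tm, E.mul_lact])
    fun x y hx hy => by rw [map_add, hx, hy, map_add, map_add]
  ract_one := tm_induction (fun e f => by rw [tR_tm, F.ract_one])
    fun x y hx hy => by rw [map_add, LinearMap.add_apply, hx, hy]
  ract_mul := fun x α β => tm_induction
    (P := fun x => tR E F x (α * β) = tR E F (tR E F x α) β)
    (fun e f => by rw [tR_tm, tR_tm, tR_tm, F.ract_mul])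
    (fun x y hx hy => by
      rw [map_add, LinearMap.add_apply, hx, hy, LinearMap.add_apply, map_add,
        LinearMap.add_apply]) x
  ract_lact := fun α x β => tm_induction
    (P := fun x => tR E F (tL E F α x) β = tL E F α (tR E F x β))
    (fun e f => by rw [tR_tm, tL_tm, tR_tm, tL_tm])
    (fun x y hx hy => by
      rw [map_add, map_add, LinearMap.add_apply, hx, hy, map_add, LinearMap.add_apply, map_add]) x
  lact_mem := tL_mem
  ract_mem := tR_mem

/-- A tensor product of fgp bimodules is fgp. -/
theorem IsFGP.tensor (hE : E.IsFGP) (hF : F.IsFGP) : (GradedBimodule.tensor E F).IsFGP := by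
  obtain ⟨m, i, r, i_mem, i_l, i_r, r_mem, r_l, r_r, hri⟩ := isFGP_iff.1 hE
  obtain ⟨n, j, s, j_mem, j_l, j_r, s_mem, s_l, s_r, hsj⟩ := isFGP_iff.1 hF
  have single_mem {N k : ℕ} (a : Fin N) {α : Ω} (hα : α ∈ Ω.gr k) (b : Fin N) :
      (Pi.single a α : Fin N → Ω) b ∈ Ω.gr k := mem_freeGr.1 (single_mem_freeGr a hα) b
  have single_l {N : ℕ} (a : Fin N) (α β : Ω) : (Pi.single a (α * β) : Fin N → Ω) =
      fun b => α * (Pi.single a β : Fin N → Ω) b := by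
    funext b
    by_cases h : b = a
    · subst h; simp
    · simp [h]
  have single_r {N : ℕ} (a : Fin N) (α β : Ω) : (Pi.single a (α * β) : Fin N → Ω) =
      fun b => (Pi.single a α : Fin N → Ω) b * β := by
    funext b
    by_cases h : b = a
    · subst h; simp
    · simp [h]
  obtain ⟨one, one_def⟩ : ∃ one : Fin m → E, ∀ a, one a = r (Pi.single a (1 : Ω)) :=
    ⟨_, fun _ => rfl⟩
  have one_mem (a : Fin m) : one a ∈ E.gr 0 := by
    rw [one_def]
    exact r_mem (single_mem a Ω.one_mem)
  have one_r (a : Fin m) (α : Ω) : E.ract (one a) α = r (Pi.single a α) := by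
    rw [one_def, ← r_r, ← single_r, one_mul]
  have one_comm (a : Fin m) (α : Ω) : E.ract (one a) α = E.lact α (one a) := by
    rw [one_r, one_def, ← r_l, ← single_l, mul_one]
  obtain ⟨I, I_tm⟩ : ∃ I : TensorCarrier E F →ₗ[ℂ] (Fin (m * n) → Ω), ∀ e f c,
      I (tm E F e f) c = i e (finProdFinEquiv.symm c).1 * j f (finProdFinEquiv.symm c).2 :=
    ⟨tLift (LinearMap.mk₂ ℂ (fun e f c => i e (finProdFinEquiv.symm c).1 *
        j f (finProdFinEquiv.symm c).2)
      (fun _ _ _ => by ext; simp [add_mul]) (fun _ _ _ => by ext; simp)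
      (fun _ _ _ => by ext; simp [mul_add]) (fun _ _ _ => by ext; simp))
      (fun e α f => by
        ext c
        simp only [LinearMap.mk₂_apply]
        rw [i_r, j_l, mul_assoc]), fun _ _ _ => rfl⟩
  obtain ⟨R, R_apply⟩ : ∃ R : (Fin (m * n) → Ω) →ₗ[ℂ] TensorCarrier E F, ∀ w,
      R w = ∑ c, tm E F (one (finProdFinEquiv.symm c).1)
        (s (Pi.single (finProdFinEquiv.symm c).2 (w c) : Fin n → Ω)) :=
    ⟨∑ c, tm E F (one (finProdFinEquiv.symm c).1) ∘ₗ s ∘ₗ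
      LinearMap.single ℂ (fun _ : Fin n => (Ω : Type u)) (finProdFinEquiv.symm c).2 ∘ₗ
      LinearMap.proj c, fun w => by simp only [LinearMap.sum_apply]; rfl⟩
  refine isFGP_iff.2 ⟨m * n, I, R, ?_, ?_, ?_, ?_, ?_, ?_, ?_⟩
  · intro k x hx c
    refine tGr_induction (P := fun x => I x c ∈ Ω.gr k) ?_
      (by rw [map_zero]; exact zero_mem _)
      (fun a b ha hb => by rw [map_add]; exact add_mem ha hb)
      (fun c a ha => by rw [map_smul]; exact Submodule.smul_mem _ _ ha) hx
    rintro k l rfl e he f hf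
    rw [I_tm]
    exact Ω.mul_mem (i_mem he _) (j_mem hf _)
  · intro α x c
    refine tm_induction (P := fun x => I (tL E F α x) c = α * I x c) ?_
      (fun x y hx hy => by
        rw [map_add, map_add, Pi.add_apply, hx, hy, map_add, Pi.add_apply, mul_add]) x
    intro e f
    rw [tL_tm, I_tm, I_tm, i_l, mul_assoc]
  · intro x α c
    refine tm_induction (P := fun x => I (tR E F x α) c = I x c * α) ?_
      (fun x y hx hy => by
        rw [map_add, LinearMap.add_apply, map_add, Pi.add_apply, hx, hy, map_add, Pi.add_apply,
          add_mul]) x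
    intro e f
    rw [tR_tm, I_tm, I_tm, j_r, mul_assoc]
  · intro k w hw
    change R w ∈ tGr E F k
    rw [R_apply]
    refine sum_mem fun c _ => ?_
    have h := tm_mem (one_mem (finProdFinEquiv.symm c).1)
      (s_mem (single_mem (finProdFinEquiv.symm c).2 (hw c)))
    rwa [zero_add] at h
  · intro α w
    change R _ = tL E F α (R w)
    rw [R_apply, R_apply, map_sum]
    refine Finset.sum_congr rfl fun c _ => ?_
    rw [tL_tm, ← one_comm, tm_balanced, ← s_l, ← single_l]
  · intro w α
    change R _ = tR E F (R w) α
    rw [R_apply, R_apply, map_sum, LinearMap.sum_apply]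
    refine Finset.sum_congr rfl fun c _ => ?_
    rw [tR_tm, ← s_r, ← single_r]
  · intro x
    refine tm_induction (P := fun x => R (I x) = x) ?_
      (fun x y hx hy => by rw [map_add, map_add, hx, hy]) x
    intro e f
    rw [R_apply, ← finProdFinEquiv.sum_comp, Fintype.sum_prod_type]
    simp only [I_tm, Equiv.symm_apply_apply]
    have h1 (a : Fin m) : ∑ b : Fin n, tm E F (one a) (s (Pi.single b (i e a * j f b))) =
        tm E F (E.ract (one a) (i e a)) f := by
      rw [tm_balanced, ← map_sum, ← map_sum, Finset.univ_sum_single (fun b => i e a * j f b),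
        s_l, hsj]
    simp only [h1]
    rw [← LinearMap.sum_apply, ← map_sum]
    simp only [one_r]
    rw [← map_sum, Finset.univ_sum_single, hri]

end Tensor

end GradedBimodule

/-! ### Flat connections -/

/-- A graded fgp bimodule over `Ω` with a flat connection `∇`. -/
structure FlatBundle (Ω : CDGA.{u}) extends GradedBimodule Ω where
  fgp : toGradedBimodule.IsFGP
  conn : carrier →ₗ[ℂ] carrier
  conn_mem : ∀ {k : ℕ} {e : carrier}, e ∈ gr k → conn e ∈ gr (k + 1)
  conn_ract : ∀ {k : ℕ} {e : carrier}, e ∈ gr k → ∀ α : Ω,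
    conn (ract e α) = ract (conn e) α + (-1 : ℂ) ^ k • ract e (Ω.d α)
  conn_lact : ∀ {k : ℕ} {α : Ω}, α ∈ Ω.gr k → ∀ e : carrier,
    conn (lact α e) = lact (Ω.d α) e + (-1 : ℂ) ^ k • lact α (conn e)
  flat : ∀ e, conn (conn e) = 0

namespace FlatBundle

variable {Ω : CDGA.{u}}

/-- Bimodule morphisms of degree `0` that commute with the connections. -/
@[ext]
structure Hom (E F : FlatBundle Ω) extends
    GradedBimodule.Hom E.toGradedBimodule F.toGradedBimodule where
  map_conn : ∀ e, toLin (E.conn e) = F.conn (toLin e)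

/-- The category of flat connections over `Ω`. -/
instance : Category (FlatBundle Ω) where
  Hom := Hom
  id E :=
    { toLin := LinearMap.id
      map_mem := fun he => he
      map_lact := fun _ _ => rfl
      map_ract := fun _ _ => rfl
      map_conn := fun _ => rfl }
  comp φ ψ :=
    { toLin := ψ.toLin ∘ₗ φ.toLin
      map_mem := fun he => ψ.map_mem (φ.map_mem he)
      map_lact := fun α e => by simp [φ.map_lact, ψ.map_lact]
      map_ract := fun e α => by simp [φ.map_ract, ψ.map_ract]
      map_conn := fun e => by simp [φ.map_conn, ψ.map_conn] }

/-- The unit object `(Ω, d)`. -/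
noncomputable def unit (Ω : CDGA.{u}) : FlatBundle Ω where
  toGradedBimodule := GradedBimodule.regular Ω
  fgp := GradedBimodule.regular_isFGP Ω
  conn := Ω.d
  conn_mem := Ω.d_mem
  conn_ract := Ω.leibniz
  conn_lact := Ω.leibniz
  flat := Ω.d_d

section Tensor

open GradedBimodule

variable (E F : FlatBundle Ω)

/-- The bilinear map `(e, f) ↦ ∇e ⊗ f + (-1) ^ |e| e ⊗ ∇f`. -/
noncomputable def tConnAux : E.carrier →ₗ[ℂ] F.carrier →ₗ[ℂ]
    TensorCarrier E.toGradedBimodule F.toGradedBimodule :=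
  tm E.toGradedBimodule F.toGradedBimodule ∘ₗ E.conn +
    (tm E.toGradedBimodule F.toGradedBimodule ∘ₗ gradedSign E.internal).compl₂ F.conn

variable {E F}

theorem tConnAux_apply {k : ℕ} {e : E.carrier} (he : e ∈ E.gr k) (f : F.carrier) :
    tConnAux E F e f = tm E.toGradedBimodule F.toGradedBimodule (E.conn e) f +
      (-1 : ℂ) ^ k • tm E.toGradedBimodule F.toGradedBimodule e (F.conn f) := by
  simp [tConnAux, gradedSign_apply E.internal he]

theorem tConnAux_balanced (e : E.carrier) (α : Ω) (f : F.carrier) :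
    tConnAux E F (E.ract e α) f = tConnAux E F e (F.lact α f) := by
  refine graded_induction E.iSup_gr
    (P := fun e => tConnAux E F (E.ract e α) f = tConnAux E F e (F.lact α f)) ?_
    (fun x y hx hy => by
      rw [map_add, LinearMap.add_apply, map_add, LinearMap.add_apply, map_add,
        LinearMap.add_apply, hx, hy]) e
  intro k e he
  refine graded_induction Ω.iSup_gr
    (P := fun α => tConnAux E F (E.ract e α) f = tConnAux E F e (F.lact α f)) ?_
    (fun x y hx hy => by
      rw [map_add, map_add, LinearMap.add_apply, map_add, LinearMap.add_apply, map_add, hx, hy]) α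
  intro j α hα
  rw [tConnAux_apply (E.ract_mem he hα), tConnAux_apply he, E.conn_ract he, F.conn_lact hα,
    map_add, map_add, LinearMap.add_apply, map_smul, map_smul, LinearMap.smul_apply,
    tm_balanced, tm_balanced, tm_balanced, smul_add, smul_smul, ← pow_add, add_assoc]

variable (E F) in
/-- The connection on `E ⊗_Ω F`. -/
noncomputable def tConn : TensorCarrier E.toGradedBimodule F.toGradedBimodule →ₗ[ℂ]
    TensorCarrier E.toGradedBimodule F.toGradedBimodule :=
  tLift (tConnAux E F) tConnAux_balanced

theorem tConn_tm {k : ℕ} {e : E.carrier} (he : e ∈ E.gr k) (f : F.carrier) :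
    tConn E F (tm _ _ e f) = tm _ _ (E.conn e) f + (-1 : ℂ) ^ k • tm _ _ e (F.conn f) :=
  (tLift_tm _ _ e f).trans (tConnAux_apply he f)

theorem tm_hom_induction
    {P : TensorCarrier E.toGradedBimodule F.toGradedBimodule → Prop}
    (tmul : ∀ k, ∀ e ∈ E.gr k, ∀ f, P (tm _ _ e f))
    (add : ∀ x y, P x → P y → P (x + y))
    (x : TensorCarrier E.toGradedBimodule F.toGradedBimodule) : P x :=
  tm_induction (fun e f => graded_induction E.iSup_gr (P := fun e => P (tm _ _ e f))
    (fun k e he => tmul k e he f)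
    (fun a b ha hb => by rw [map_add, LinearMap.add_apply]; exact add _ _ ha hb) e) add x

theorem tConn_mem {k : ℕ} {x : TensorCarrier E.toGradedBimodule F.toGradedBimodule}
    (hx : x ∈ tGr E.toGradedBimodule F.toGradedBimodule k) :
    tConn E F x ∈ tGr E.toGradedBimodule F.toGradedBimodule (k + 1) := by
  refine tGr_induction (P := fun x => tConn E F x ∈ tGr _ _ (k + 1)) ?_
    (by rw [map_zero]; exact zero_mem _)
    (fun a b ha hb => by rw [map_add]; exact add_mem ha hb)
    (fun c a ha => by rw [map_smul]; exact Submodule.smul_mem _ _ ha) hx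
  intro i j hij e he f hf
  rw [tConn_tm he]
  refine add_mem ?_ (Submodule.smul_mem _ _ ?_)
  · have h := GradedBimodule.tm_mem (E.conn_mem he) hf
    rwa [show i + 1 + j = k + 1 by omega] at h
  · have h := GradedBimodule.tm_mem he (F.conn_mem hf)
    rwa [show i + (j + 1) = k + 1 by omega] at h

theorem tConn_ract {k : ℕ} {x : TensorCarrier E.toGradedBimodule F.toGradedBimodule}
    (hx : x ∈ tGr E.toGradedBimodule F.toGradedBimodule k) (α : Ω) :
    tConn E F (tR _ _ x α) = tR _ _ (tConn E F x) α + (-1 : ℂ) ^ k • tR _ _ x (Ω.d α) := by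
  refine tGr_induction (P := fun x => tConn E F (tR _ _ x α) =
    tR _ _ (tConn E F x) α + (-1 : ℂ) ^ k • tR _ _ x (Ω.d α)) ?_ (by simp)
    (fun a b ha hb => by
      simp only [map_add, LinearMap.add_apply, ha, hb, smul_add]; abel)
    (fun c a ha => by
      simp only [map_smul, LinearMap.smul_apply, ha, smul_add, smul_comm c]) hx
  rintro i j rfl e he f hf
  rw [tR_tm, tR_tm, tConn_tm he, tConn_tm he, F.conn_ract hf, map_add, map_add,
    LinearMap.add_apply, map_smul, map_smul, LinearMap.smul_apply, tR_tm, tR_tm]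
  simp only [smul_add, smul_smul, pow_add, add_assoc]

theorem tConn_lact {k : ℕ} {α : Ω} (hα : α ∈ Ω.gr k)
    (x : TensorCarrier E.toGradedBimodule F.toGradedBimodule) :
    tConn E F (tL _ _ α x) = tL _ _ (Ω.d α) x + (-1 : ℂ) ^ k • tL _ _ α (tConn E F x) := by
  refine tm_hom_induction (P := fun x => tConn E F (tL _ _ α x) =
    tL _ _ (Ω.d α) x + (-1 : ℂ) ^ k • tL _ _ α (tConn E F x)) ?_
    (fun a b ha hb => by simp only [map_add, ha, hb, smul_add]; abel) x
  intro i e he f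
  rw [tL_tm, tL_tm, tConn_tm (E.lact_mem hα he), tConn_tm he, E.conn_lact hα, map_add,
    LinearMap.add_apply, map_add, map_smul, map_smul, LinearMap.smul_apply, tL_tm, tL_tm]
  simp only [smul_add, smul_smul, pow_add, add_assoc]

theorem tConn_tConn (x : TensorCarrier E.toGradedBimodule F.toGradedBimodule) :
    tConn E F (tConn E F x) = 0 := by
  refine tm_hom_induction (P := fun x => tConn E F (tConn E F x) = 0) ?_
    (fun a b ha hb => by rw [map_add, map_add, ha, hb, add_zero]) x
  intro k e he f
  rw [tConn_tm he, map_add, map_smul, tConn_tm (E.conn_mem he), tConn_tm he, E.flat, F.flat,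
    map_zero, map_zero, LinearMap.zero_apply, pow_succ]
  module

variable (E F) in
/-- The tensor product `(E ⊗_Ω F, ∇)`. -/
noncomputable def tensor : FlatBundle Ω where
  toGradedBimodule := GradedBimodule.tensor E.toGradedBimodule F.toGradedBimodule
  fgp := IsFGP.tensor E.fgp F.fgp
  conn := tConn E F
  conn_mem := tConn_mem
  conn_ract := tConn_ract
  conn_lact := tConn_lact
  flat := tConn_tConn

end Tensor

/-! ### The fibre at a base point -/

section Fibre

variable (p : Ω.gr 0 →ₐ[ℂ] ℂ)

/-- The action of `Ω⁰` on `E⁰`. -/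
def act₀ (E : FlatBundle Ω) (a : Ω.gr 0) (e : E.gr 0) : E.gr 0 :=
  ⟨E.lact a e, E.lact_mem (k := 0) (l := 0) a.2 e.2⟩

/-- The relations `a e = p(a) e` in `E⁰`. -/
def fibreRel (E : FlatBundle Ω) : Submodule ℂ (E.gr 0) :=
  Submodule.span ℂ {x | ∃ (a : Ω.gr 0) (e : E.gr 0), x = act₀ E a e - p a • e}

/-- The fibre `E_p = E⁰ ⊗_{Ω⁰} ℂ`, where `Ω⁰` acts on `ℂ` through `p`. -/
abbrev Fibre (E : FlatBundle Ω) : Type u := E.gr 0 ⧸ fibreRel p E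

/-- The map in degree `0` induced by a morphism. -/
def Hom.map₀ {E F : FlatBundle Ω} (φ : Hom E F) : E.gr 0 →ₗ[ℂ] F.gr 0 :=
  φ.toLin.restrict fun _ he => φ.map_mem he

theorem fibreRel_le_map {E F : FlatBundle Ω} (φ : Hom E F) :
    fibreRel p E ≤ (fibreRel p F).comap φ.map₀ := by
  rw [fibreRel, Submodule.span_le]
  rintro _ ⟨a, e, rfl⟩
  refine Submodule.subset_span ⟨a, φ.map₀ e, ?_⟩
  rw [map_sub, map_smul]
  congr 1
  exact Subtype.ext (φ.map_lact a e)

/-- The map on fibres induced by a morphism. -/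
def Hom.fibreMap {E F : FlatBundle Ω} (φ : Hom E F) : Fibre p E →ₗ[ℂ] Fibre p F :=
  (fibreRel p E).mapQ (fibreRel p F) φ.map₀ (fibreRel_le_map p φ)

/-- The fibre functor `E ↦ E_p`. -/
def fibreFunctor : FlatBundle Ω ⥤ ModuleCat.{u} ℂ where
  obj E := ModuleCat.of ℂ (Fibre p E)
  map φ := ModuleCat.ofHom (Hom.fibreMap p φ)
  map_id E := by
    ext x
    rfl
  map_comp φ ψ := by
    ext x
    rfl

theorem ract_eq_lact (E : FlatBundle Ω) (a : Ω.gr 0) (e : E.gr 0) :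
    E.ract (e : E.carrier) (a : Ω) = E.lact (a : Ω) (e : E.carrier) := by
  have h := E.fgp.lact_eq a.2 e.2
  simpa using h.symm

/-- The map `E⁰ × F⁰ → (E ⊗_Ω F)_p`, `(e, f) ↦ [e ⊗ f]`. -/
noncomputable def fibreTensorAux (E F : FlatBundle Ω) :
    E.gr 0 →ₗ[ℂ] F.gr 0 →ₗ[ℂ] Fibre p (tensor E F) :=
  LinearMap.mk₂ ℂ (fun e f => (fibreRel p (tensor E F)).mkQ
      ⟨GradedBimodule.tm _ _ (e : E.carrier) (f : F.carrier),
        GradedBimodule.tm_mem (k := 0) (l := 0) e.2 f.2⟩)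
    (fun e e' f => by
      rw [← map_add]; congr 1; refine Subtype.ext ?_
      change GradedBimodule.tm _ _ ((e : E.carrier) + (e' : E.carrier)) _ = _
      rw [map_add]; rfl)
    (fun c e f => by rw [← map_smul]; congr 1)
    (fun e f f' => by
      rw [← map_add]; congr 1; refine Subtype.ext ?_
      change GradedBimodule.tm _ _ _ ((f : F.carrier) + (f' : F.carrier)) = _
      rw [map_add]; rfl)
    (fun c e f => by
      rw [← map_smul]; congr 1; refine Subtype.ext ?_
      change GradedBimodule.tm _ _ _ (c • (f : F.carrier)) = _
      rw [map_smul]; rfl)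

theorem fibreTensorAux_act_left (E F : FlatBundle Ω) (a : Ω.gr 0) (e : E.gr 0) (f : F.gr 0) :
    fibreTensorAux p E F (act₀ E a e) f = p a • fibreTensorAux p E F e f := by
  rw [← sub_eq_zero]
  change (fibreRel p (tensor E F)).mkQ _ - p a • (fibreRel p (tensor E F)).mkQ _ = 0
  rw [← map_smul, ← map_sub, Submodule.mkQ_apply, Submodule.Quotient.mk_eq_zero]
  exact Submodule.subset_span ⟨a, ⟨GradedBimodule.tm _ _ (e : E.carrier) (f : F.carrier),
    GradedBimodule.tm_mem (k := 0) (l := 0) e.2 f.2⟩, rfl⟩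

theorem fibreTensorAux_act_right (E F : FlatBundle Ω) (a : Ω.gr 0) (e : E.gr 0) (f : F.gr 0) :
    fibreTensorAux p E F e (act₀ F a f) = p a • fibreTensorAux p E F e f := by
  rw [← fibreTensorAux_act_left]
  change (fibreRel p (tensor E F)).mkQ _ = (fibreRel p (tensor E F)).mkQ _
  congr 1
  refine Subtype.ext ?_
  change GradedBimodule.tm _ _ (e : E.carrier) (F.lact a f) =
    GradedBimodule.tm _ _ (E.lact a e) (f : F.carrier)
  rw [← GradedBimodule.tm_balanced, ract_eq_lact]

/-- The canonical map `E_p ⊗ F_p → (E ⊗_Ω F)_p`, `[e] ⊗ [f] ↦ [e ⊗ f]`. -/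
noncomputable def fibreTensor (E F : FlatBundle Ω) :
    Fibre p E ⊗[ℂ] Fibre p F →ₗ[ℂ] Fibre p (tensor E F) :=
  TensorProduct.lift <| LinearMap.flip <| (fibreRel p F).liftQ
    (LinearMap.flip <| (fibreRel p E).liftQ (fibreTensorAux p E F) <| by
      rw [fibreRel, Submodule.span_le]
      rintro _ ⟨a, e, rfl⟩
      rw [SetLike.mem_coe, LinearMap.mem_ker]
      ext f : 1
      rw [map_sub, map_smul, LinearMap.sub_apply, LinearMap.smul_apply, fibreTensorAux_act_left,
        sub_self, LinearMap.zero_apply]) <| by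
    conv_lhs => rw [fibreRel]
    rw [Submodule.span_le]
    rintro _ ⟨a, f, rfl⟩
    rw [SetLike.mem_coe, LinearMap.mem_ker]
    refine LinearMap.ext fun x => ?_
    obtain ⟨e, rfl⟩ := (fibreRel p E).mkQ_surjective x
    change fibreTensorAux p E F e (act₀ F a f - p a • f) = 0
    rw [map_sub, map_smul, fibreTensorAux_act_right, sub_self]

end Fibre

end FlatBundle

/-! ### Base change of endomorphisms -/

section BaseChange

variable {R S T : Type u} [CommRing R] [Algebra ℂ R] [CommRing S] [Algebra ℂ S]
  [CommRing T] [Algebra ℂ T]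
  {W W' : Type u} [AddCommGroup W] [Module ℂ W] [AddCommGroup W'] [Module ℂ W']

variable (W) in
/-- The map `R ⊗ W → S ⊗ W` induced by `f : R → S`. -/
noncomputable def scalarMap (f : R →ₐ[ℂ] S) : R ⊗[ℂ] W →ₗ[ℂ] S ⊗[ℂ] W :=
  TensorProduct.map f.toLinearMap LinearMap.id

theorem scalarMap_tmul (f : R →ₐ[ℂ] S) (r : R) (w : W) :
    scalarMap W f (r ⊗ₜ[ℂ] w) = f r ⊗ₜ[ℂ] w := rfl

theorem scalarMap_smul (f : R →ₐ[ℂ] S) (r : R) (x : R ⊗[ℂ] W) :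
    scalarMap W f (r • x) = f r • scalarMap W f x := by
  induction x using TensorProduct.induction_on with
  | zero => simp
  | tmul s w => simp [TensorProduct.smul_tmul', scalarMap_tmul]
  | add x y hx hy => rw [smul_add, map_add, hx, hy, map_add, smul_add]

/-- The base change along `f : R → S` of an `R`-linear endomorphism `φ` of `R ⊗ W`: the `S`-linear
endomorphism of `S ⊗ W` that sends `1 ⊗ w` to the image of `φ (1 ⊗ w)`. -/
noncomputable def extendScalars (f : R →ₐ[ℂ] S) (φ : Module.End R (R ⊗[ℂ] W)) :
    Module.End S (S ⊗[ℂ] W) :=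
  LinearMap.liftBaseChange S
    (scalarMap W f ∘ₗ φ.restrictScalars ℂ ∘ₗ TensorProduct.mk ℂ R W 1)

theorem extendScalars_one_tmul (f : R →ₐ[ℂ] S) (φ : Module.End R (R ⊗[ℂ] W)) (w : W) :
    extendScalars f φ ((1 : S) ⊗ₜ[ℂ] w) = scalarMap W f (φ ((1 : R) ⊗ₜ[ℂ] w)) := by
  simp [extendScalars]

theorem extendScalars_scalarMap (f : R →ₐ[ℂ] S) (φ : Module.End R (R ⊗[ℂ] W)) (x : R ⊗[ℂ] W) :
    extendScalars f φ (scalarMap W f x) = scalarMap W f (φ x) := by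
  induction x using TensorProduct.induction_on with
  | zero => simp
  | tmul r w =>
    have h1 : r ⊗ₜ[ℂ] w = r • ((1 : R) ⊗ₜ[ℂ] w) := by simp [TensorProduct.smul_tmul']
    rw [h1, scalarMap_smul, map_smul, map_smul, scalarMap_smul, scalarMap_tmul, map_one,
      extendScalars_one_tmul]
  | add x y hx hy => rw [map_add, map_add, hx, hy, map_add, map_add]

theorem end_ext {φ ψ : S ⊗[ℂ] W →ₗ[S] S ⊗[ℂ] W'}
    (h : ∀ w, φ ((1 : S) ⊗ₜ[ℂ] w) = ψ ((1 : S) ⊗ₜ[ℂ] w)) : φ = ψ := by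
  refine LinearMap.ext fun x => ?_
  induction x using TensorProduct.induction_on with
  | zero => simp
  | tmul r w =>
    have h1 : r ⊗ₜ[ℂ] w = r • ((1 : S) ⊗ₜ[ℂ] w) := by simp [TensorProduct.smul_tmul']
    rw [h1, map_smul, map_smul, h]
  | add x y hx hy => rw [map_add, map_add, hx, hy]

variable (W) in
/-- Base change of endomorphisms as a monoid homomorphism. -/
noncomputable def extendScalarsHom (f : R →ₐ[ℂ] S) :
    Module.End R (R ⊗[ℂ] W) →* Module.End S (S ⊗[ℂ] W) where
  toFun := extendScalars f
  map_one' := end_ext fun w => by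
    rw [extendScalars_one_tmul, Module.End.one_apply, Module.End.one_apply, scalarMap_tmul, map_one]
  map_mul' φ ψ := end_ext fun w => by
    rw [extendScalars_one_tmul, Module.End.mul_apply, Module.End.mul_apply,
      extendScalars_one_tmul, extendScalars_scalarMap]

theorem extendScalars_id (φ : Module.End R (R ⊗[ℂ] W)) :
    extendScalars (AlgHom.id ℂ R) φ = φ := end_ext fun w => by
  rw [extendScalars_one_tmul]
  exact LinearMap.congr_fun (TensorProduct.map_id (R := ℂ) (M := R) (N := W)) _

theorem extendScalars_comp (f : R →ₐ[ℂ] S) (g : S →ₐ[ℂ] T) (φ : Module.End R (R ⊗[ℂ] W)) :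
    extendScalars (g.comp f) φ = extendScalars g (extendScalars f φ) := end_ext fun w => by
  rw [extendScalars_one_tmul, extendScalars_one_tmul, extendScalars_one_tmul]
  generalize φ ((1 : R) ⊗ₜ[ℂ] w) = x
  induction x using TensorProduct.induction_on with
  | zero => simp
  | tmul r w => rfl
  | add x y hx hy => rw [map_add, hx, hy, map_add, map_add]

/-- `φ ⊗_R ψ` as an endomorphism of `R ⊗ (W ⊗ W') = (R ⊗ W) ⊗_R (R ⊗ W')`. -/
noncomputable def boxTensor (φ : Module.End R (R ⊗[ℂ] W)) (ψ : Module.End R (R ⊗[ℂ] W')) :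
    Module.End R (R ⊗[ℂ] (W ⊗[ℂ] W')) :=
  (TensorProduct.AlgebraTensorModule.distribBaseChange ℂ R W W').symm.toLinearMap ∘ₗ
    TensorProduct.map φ ψ ∘ₗ
    (TensorProduct.AlgebraTensorModule.distribBaseChange ℂ R W W').toLinearMap

theorem boxTensor_one : boxTensor (1 : Module.End R (R ⊗[ℂ] W))
    (1 : Module.End R (R ⊗[ℂ] W')) = 1 := by
  refine LinearMap.ext fun x => ?_
  simp [boxTensor, Module.End.one_eq_id]

theorem boxTensor_mul (φ φ' : Module.End R (R ⊗[ℂ] W)) (ψ ψ' : Module.End R (R ⊗[ℂ] W')) :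
    boxTensor (φ * φ') (ψ * ψ') = boxTensor φ ψ * boxTensor φ' ψ' := by
  refine LinearMap.ext fun x => ?_
  simp [boxTensor, Module.End.mul_eq_comp, TensorProduct.map_comp]

theorem boxTensor_one_tmul (φ : Module.End R (R ⊗[ℂ] W)) (ψ : Module.End R (R ⊗[ℂ] W'))
    (w : W) (w' : W') : boxTensor φ ψ ((1 : R) ⊗ₜ[ℂ] (w ⊗ₜ[ℂ] w')) =
      (TensorProduct.AlgebraTensorModule.distribBaseChange ℂ R W W').symm
        (φ ((1 : R) ⊗ₜ[ℂ] w) ⊗ₜ[R] ψ ((1 : R) ⊗ₜ[ℂ] w')) := by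
  simp [boxTensor, TensorProduct.AlgebraTensorModule.distribBaseChange_tmul]

theorem end_ext₂ {W'' : Type u} [AddCommGroup W''] [Module ℂ W'']
    {φ ψ : S ⊗[ℂ] (W ⊗[ℂ] W') →ₗ[S] S ⊗[ℂ] W''}
    (h : ∀ w w', φ ((1 : S) ⊗ₜ[ℂ] (w ⊗ₜ[ℂ] w')) = ψ ((1 : S) ⊗ₜ[ℂ] (w ⊗ₜ[ℂ] w'))) : φ = ψ := by
  refine end_ext fun z => ?_
  induction z using TensorProduct.induction_on with
  | zero => simp
  | tmul w w' => exact h w w'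
  | add x y hx hy => rw [TensorProduct.tmul_add, map_add, map_add, hx, hy]

theorem scalarMap_distrib (f : R →ₐ[ℂ] S) (x : R ⊗[ℂ] W) (y : R ⊗[ℂ] W') :
    scalarMap (W ⊗[ℂ] W') f
      ((TensorProduct.AlgebraTensorModule.distribBaseChange ℂ R W W').symm (x ⊗ₜ[R] y)) =
    (TensorProduct.AlgebraTensorModule.distribBaseChange ℂ S W W').symm
      (scalarMap W f x ⊗ₜ[S] scalarMap W' f y) := by
  induction x using TensorProduct.induction_on with
  | zero => simp
  | add x x' hx hx' => simp only [TensorProduct.add_tmul, map_add, hx, hx']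
  | tmul r w =>
    induction y using TensorProduct.induction_on with
    | zero => simp
    | add y y' hy hy' => simp only [TensorProduct.tmul_add, map_add, hy, hy']
    | tmul r' w' =>
      simp [scalarMap_tmul, TensorProduct.AlgebraTensorModule.distribBaseChange_symm_tmul]

theorem extendScalars_boxTensor (f : R →ₐ[ℂ] S) (φ : Module.End R (R ⊗[ℂ] W))
    (ψ : Module.End R (R ⊗[ℂ] W')) :
    extendScalars f (boxTensor φ ψ) = boxTensor (extendScalars f φ) (extendScalars f ψ) := by
  refine end_ext₂ fun w w' => ?_
  rw [extendScalars_one_tmul, boxTensor_one_tmul, boxTensor_one_tmul, scalarMap_distrib,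
    extendScalars_one_tmul, extendScalars_one_tmul]

theorem scalarMap_baseChange (f : R →ₐ[ℂ] S) (g : W →ₗ[ℂ] W') (x : R ⊗[ℂ] W) :
    scalarMap W' f (g.baseChange R x) = g.baseChange S (scalarMap W f x) := by
  induction x using TensorProduct.induction_on with
  | zero => simp
  | add x x' hx hx' => rw [map_add, map_add, hx, hx', map_add, map_add]
  | tmul r w => simp [scalarMap_tmul]

theorem extendScalars_baseChange (f : R →ₐ[ℂ] S) (g : Module.End ℂ W) :
    extendScalars f (LinearMap.baseChange R g) = LinearMap.baseChange S g := end_ext fun w => by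
  rw [extendScalars_one_tmul, scalarMap_baseChange, scalarMap_tmul, map_one]

/-- Intertwining is preserved by extension of scalars. -/
theorem extendScalars_intertwine (f : R →ₐ[ℂ] S) (g : W →ₗ[ℂ] W')
    {φ : Module.End R (R ⊗[ℂ] W)} {ψ : Module.End R (R ⊗[ℂ] W')}
    (h : ψ ∘ₗ g.baseChange R = g.baseChange R ∘ₗ φ) :
    extendScalars f ψ ∘ₗ g.baseChange S = g.baseChange S ∘ₗ extendScalars f φ :=
  end_ext fun w => by
    have h' := LinearMap.congr_fun h ((1 : R) ⊗ₜ[ℂ] w)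
    simp only [LinearMap.comp_apply, LinearMap.baseChange_tmul] at h' ⊢
    rw [extendScalars_one_tmul, extendScalars_one_tmul, h', scalarMap_baseChange]

variable (R W) in
/-- The group `GL_W(R)` of `R`-linear automorphisms of `R ⊗ W`. -/
abbrev GLPoints : Type u := (Module.End R (R ⊗[ℂ] W))ˣ

variable (W) in
/-- The map `GL_W(R) → GL_W(S)` induced by `f : R → S`. -/
noncomputable def GLPoints.map (f : R →ₐ[ℂ] S) : GLPoints R W →* GLPoints S W :=
  Units.map (extendScalarsHom W f)

/-- The tensor product `GL_W(R) × GL_{W'}(R) → GL_{W ⊗ W'}(R)`. -/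
noncomputable def GLPoints.box (g : GLPoints R W) (h : GLPoints R W') :
    GLPoints R (W ⊗[ℂ] W') where
  val := boxTensor g.val h.val
  inv := boxTensor g.inv h.inv
  val_inv := by rw [← boxTensor_mul, g.val_inv, h.val_inv, boxTensor_one]
  inv_val := by rw [← boxTensor_mul, g.inv_val, h.inv_val, boxTensor_one]

end BaseChange

/-! ### Tensor automorphisms of a fibre functor -/

/-- The data that enter into the definition of the tensor automorphisms of a fibre functor on a
tensor category `C`: the functor `ω` to complex vector spaces, the unit object, the tensor product
of objects, and the canonical maps `ω X ⊗ ω Y → ω (X ⊗ Y)`. -/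
structure FibreFunctorData (C : Type (u + 1)) [Category.{u} C] where
  ω : C ⥤ ModuleCat.{u} ℂ
  unit : C
  tensor : C → C → C
  μ : ∀ X Y : C, (ω.obj X : Type u) ⊗[ℂ] (ω.obj Y : Type u) →ₗ[ℂ] ω.obj (tensor X Y)

namespace FibreFunctorData

variable {C : Type (u + 1)} [Category.{u} C] (D : FibreFunctorData C)

/-- The group `Aut^⊗(ω)(R)`: families of `R`-linear automorphisms `η X` of `R ⊗ ω X`, natural in
`X`, with `η 1 = id` and `η (X ⊗ Y) = η X ⊗ η Y`. -/
def autPoints (R : Type u) [CommRing R] [Algebra ℂ R] :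
    Subgroup (∀ X : C, GLPoints R (D.ω.obj X)) where
  carrier := {η |
    (∀ (X Y : C) (f : X ⟶ Y), (η Y).val ∘ₗ (D.ω.map f).hom.baseChange R =
      (D.ω.map f).hom.baseChange R ∘ₗ (η X).val) ∧
    η D.unit = 1 ∧
    ∀ X Y : C, (η (D.tensor X Y)).val ∘ₗ (D.μ X Y).baseChange R =
      (D.μ X Y).baseChange R ∘ₗ ((η X).box (η Y)).val}
  mul_mem' := by
    rintro η θ ⟨h1, h2, h3⟩ ⟨k1, k2, k3⟩
    refine ⟨fun X Y f => ?_, ?_, fun X Y => ?_⟩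
    · change (η Y).val ∘ₗ (θ Y).val ∘ₗ _ = _ ∘ₗ (η X).val ∘ₗ (θ X).val
      rw [k1, ← LinearMap.comp_assoc, h1, LinearMap.comp_assoc]
    · rw [Pi.mul_apply, h2, k2, one_mul]
    · change (η _).val ∘ₗ (θ _).val ∘ₗ _ =
        _ ∘ₗ boxTensor ((η X).val * (θ X).val) ((η Y).val * (θ Y).val)
      rw [k3, ← LinearMap.comp_assoc, h3, LinearMap.comp_assoc, boxTensor_mul]
      rfl
  one_mem' := by
    refine ⟨fun X Y f => rfl, rfl, fun X Y => ?_⟩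
    change _ = _ ∘ₗ boxTensor 1 1
    rw [boxTensor_one]
    rfl
  inv_mem' := by
    have key : ∀ {M N : Type u} [AddCommGroup M] [Module R M] [AddCommGroup N] [Module R N]
        (g : (Module.End R M)ˣ) (h : (Module.End R N)ˣ) (a : M →ₗ[R] N),
        h.val ∘ₗ a = a ∘ₗ g.val → (h⁻¹).val ∘ₗ a = a ∘ₗ (g⁻¹).val := by
      intro M N _ _ _ _ g h a H
      have e1 : (h⁻¹).val ∘ₗ h.val = LinearMap.id := h.inv_mul
      have e2 : g.val ∘ₗ (g⁻¹).val = LinearMap.id := g.mul_inv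
      calc (h⁻¹).val ∘ₗ a = (h⁻¹).val ∘ₗ a ∘ₗ (g.val ∘ₗ (g⁻¹).val) := by
            rw [e2, LinearMap.comp_id]
        _ = (h⁻¹).val ∘ₗ (a ∘ₗ g.val) ∘ₗ (g⁻¹).val := rfl
        _ = ((h⁻¹).val ∘ₗ h.val) ∘ₗ a ∘ₗ (g⁻¹).val := by rw [← H]; rfl
        _ = a ∘ₗ (g⁻¹).val := by rw [e1, LinearMap.id_comp]
    rintro η ⟨h1, h2, h3⟩
    refine ⟨fun X Y f => key _ _ _ (h1 X Y f), ?_, fun X Y => ?_⟩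
    · rw [Pi.inv_apply, h2, inv_one]
    · exact key _ _ _ (h3 X Y)

/-- Extension of scalars `Aut^⊗(ω)(R) → Aut^⊗(ω)(S)`. -/
noncomputable def autMap {R S : Type u} [CommRing R] [Algebra ℂ R] [CommRing S] [Algebra ℂ S]
    (f : R →ₐ[ℂ] S) : D.autPoints R →* D.autPoints S where
  toFun η := ⟨fun X => GLPoints.map (D.ω.obj X) f (η.1 X), by
    obtain ⟨η, h1, h2, h3⟩ := η
    refine ⟨fun X Y g => extendScalars_intertwine f _ (h1 X Y g), ?_, fun X Y => ?_⟩
    · change GLPoints.map _ f (η D.unit) = 1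
      rw [h2, map_one]
    · have h := extendScalars_intertwine f _ (h3 X Y)
      change extendScalars f _ ∘ₗ _ = _ ∘ₗ boxTensor (extendScalars f _) (extendScalars f _)
      rw [← extendScalars_boxTensor]
      exact h⟩
  map_one' := Subtype.ext (funext fun X => map_one _)
  map_mul' η θ := Subtype.ext (funext fun X => map_mul _ _ _)

/-- The group scheme `Aut^⊗(ω)`, through its functor of points on commutative `ℂ`-algebras. -/
noncomputable def aut : CommAlgCat.{u} ℂ ⥤ GrpCat.{u + 1} where
  obj R := GrpCat.of (D.autPoints R)
  map f := GrpCat.ofHom (D.autMap f.hom)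
  map_id R := by
    refine GrpCat.hom_ext (MonoidHom.ext fun η => Subtype.ext (funext fun X => Units.ext ?_))
    exact extendScalars_id (η.1 X).val
  map_comp f g := by
    refine GrpCat.hom_ext (MonoidHom.ext fun η => Subtype.ext (funext fun X => Units.ext ?_))
    exact extendScalars_comp f.hom g.hom (η.1 X).val

end FibreFunctorData

/-! ### The fundamental group -/

/-- The fibre functor of the category of flat connections over `Ω` at a base point `p`. -/
noncomputable def FlatBundle.fibreData {Ω : CDGA.{u}} (p : Ω.gr 0 →ₐ[ℂ] ℂ) :
    FibreFunctorData (FlatBundle Ω) where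
  ω := FlatBundle.fibreFunctor p
  unit := FlatBundle.unit Ω
  tensor := FlatBundle.tensor
  μ := FlatBundle.fibreTensor p

/-- The fundamental group `π¹(Ω, p)`: the group scheme of tensor automorphisms of the fibre functor
at `p`. -/
noncomputable def fundamentalGroup (Ω : CDGA.{u}) (p : Ω.gr 0 →ₐ[ℂ] ℂ) :
    CommAlgCat.{u} ℂ ⥤ GrpCat.{u + 1} :=
  (FlatBundle.fibreData p).aut

/-! ### Algebraic hulls -/

/-- The matrix coefficients of `σ : H → GL(W)` are continuous. -/
def ContinuousRep {H : Type} [Group H] [TopologicalSpace H] {W : Type u} [AddCommGroup W]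
    [Module ℂ W] (σ : H →* Module.End ℂ W) : Prop :=
  ∀ (w : W) (ℓ : W →ₗ[ℂ] ℂ), Continuous fun h => ℓ (σ h w)

/-- The tensor product of two representations. -/
noncomputable def tensorRep {H : Type} [Group H] {W W' : Type u} [AddCommGroup W] [Module ℂ W]
    [AddCommGroup W'] [Module ℂ W'] (σ : H →* Module.End ℂ W) (σ' : H →* Module.End ℂ W') :
    H →* Module.End ℂ (W ⊗[ℂ] W') where
  toFun h := TensorProduct.map (σ h) (σ' h)
  map_one' := by rw [map_one, map_one]; exact TensorProduct.map_one
  map_mul' g h := by rw [map_mul, map_mul]; exact TensorProduct.map_mul _ _ _ _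

theorem ContinuousRep.tensor {H : Type} [Group H] [TopologicalSpace H] {W W' : Type u}
    [AddCommGroup W] [Module ℂ W] [AddCommGroup W'] [Module ℂ W'] [FiniteDimensional ℂ W]
    [FiniteDimensional ℂ W']
    {σ : H →* Module.End ℂ W} {σ' : H →* Module.End ℂ W'} (hσ : ContinuousRep σ)
    (hσ' : ContinuousRep σ') : ContinuousRep (tensorRep σ σ') := by
  intro z ℓ
  induction z using TensorProduct.induction_on with
  | zero => simpa using continuous_const
  | add x y hx hy =>
    simp only [map_add]
    exact hx.add hy
  | tmul w w' =>
    let b := Module.finBasis ℂ W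
    let b' := Module.finBasis ℂ W'
    have h : ∀ h, ℓ (tensorRep σ σ' h (w ⊗ₜ[ℂ] w')) =
        ∑ i, ∑ j, b.coord i (σ h w) * b'.coord j (σ' h w') * ℓ (b i ⊗ₜ[ℂ] b' j) := by
      intro h
      change ℓ (σ h w ⊗ₜ[ℂ] σ' h w') = _
      conv_lhs => rw [← b.sum_repr (σ h w), ← b'.sum_repr (σ' h w')]
      simp only [TensorProduct.sum_tmul, TensorProduct.tmul_sum, map_sum, TensorProduct.smul_tmul_smul,
        map_smul, smul_eq_mul, Module.Basis.coord_apply]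
      exact Finset.sum_comm
    simp only [h]
    exact continuous_finsetSum _ fun i _ => continuous_finsetSum _ fun j _ =>
      ((hσ _ _).mul (hσ' _ _)).mul continuous_const

/-- A finite-dimensional complex continuous representation of a topological group `H`. -/
structure ContRep (H : Type) [Group H] [TopologicalSpace H] where
  carrier : Type u
  [addCommGroup : AddCommGroup carrier]
  [module : Module ℂ carrier]
  [finite : FiniteDimensional ℂ carrier]
  σ : H →* Module.End ℂ carrier
  σ_cont : ContinuousRep σ

namespace ContRep

attribute [instance] ContRep.addCommGroup ContRep.module ContRep.finite

variable {H : Type} [Group H] [TopologicalSpace H]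

/-- Equivariant linear maps. -/
@[ext]
structure Hom (X Y : ContRep.{u} H) where
  toLin : X.carrier →ₗ[ℂ] Y.carrier
  map_σ : ∀ h x, toLin (X.σ h x) = Y.σ h (toLin x)

instance : Category (ContRep.{u} H) where
  Hom := Hom
  id X := ⟨LinearMap.id, fun _ _ => rfl⟩
  comp φ ψ := ⟨ψ.toLin ∘ₗ φ.toLin, fun h x => by simp [φ.map_σ, ψ.map_σ]⟩

variable (H) in
/-- The forgetful functor on the tensor category of finite-dimensional continuous
representations of `H`. -/
noncomputable def fibreData : FibreFunctorData (ContRep.{u} H) where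
  ω :=
    { obj := fun X => ModuleCat.of ℂ X.carrier
      map := fun φ => ModuleCat.ofHom (Hom.toLin φ) }
  unit :=
    { carrier := ULift.{u} ℂ
      σ := 1
      σ_cont := fun w ℓ => (continuous_const : Continuous fun _ : H => ℓ w) }
  tensor X Y :=
    { carrier := X.carrier ⊗[ℂ] Y.carrier
      σ := tensorRep X.σ Y.σ
      σ_cont := X.σ_cont.tensor Y.σ_cont }
  μ _ _ := LinearMap.id

end ContRep

/-- The algebraic hull of a topological group `H`: the group scheme of tensor automorphisms of the
forgetful functor on the finite-dimensional complex continuous representations of `H`. -/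
noncomputable def algebraicHull (H : Type) [Group H] [TopologicalSpace H] :
    CommAlgCat.{u} ℂ ⥤ GrpCat.{u + 1} :=
  (ContRep.fibreData.{u} H).aut

/-- A finite-dimensional complex representation of `G × H`, where `G` is a group scheme and `H` is
a topological group: an algebraic representation `ρ : G → GL_W` (a natural transformation of group
functors) and a continuous representation `σ` of `H` on the same space that commute. -/
structure ProdRep (G : CommAlgCat.{u} ℂ ⥤ GrpCat.{u + 1}) (H : Type) [Group H]
    [TopologicalSpace H] where
  carrier : Type u
  [addCommGroup : AddCommGroup carrier]
  [module : Module ℂ carrier]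
  [finite : FiniteDimensional ℂ carrier]
  ρ : ∀ R : CommAlgCat.{u} ℂ, G.obj R →* GLPoints R carrier
  ρ_nat : ∀ {R S : CommAlgCat.{u} ℂ} (f : R ⟶ S) (g : G.obj R),
    ρ S ((G.map f).hom g) = GLPoints.map carrier f.hom (ρ R g)
  σ : H →* Module.End ℂ carrier
  σ_cont : ContinuousRep σ
  comm : ∀ (R : CommAlgCat.{u} ℂ) (g : G.obj R) (h : H),
    (ρ R g).val ∘ₗ (σ h).baseChange R = (σ h).baseChange R ∘ₗ (ρ R g).val

namespace ProdRep

attribute [instance] ProdRep.addCommGroup ProdRep.module ProdRep.finite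

variable {G : CommAlgCat.{u} ℂ ⥤ GrpCat.{u + 1}} {H : Type} [Group H] [TopologicalSpace H]

/-- Equivariant linear maps. -/
@[ext]
structure Hom (X Y : ProdRep G H) where
  toLin : X.carrier →ₗ[ℂ] Y.carrier
  map_ρ : ∀ (R : CommAlgCat.{u} ℂ) (g : G.obj R),
    toLin.baseChange R ∘ₗ (X.ρ R g).val = (Y.ρ R g).val ∘ₗ toLin.baseChange R
  map_σ : ∀ h x, toLin (X.σ h x) = Y.σ h (toLin x)

instance : Category (ProdRep G H) where
  Hom := Hom
  id X := ⟨LinearMap.id, fun _ _ => by simp, fun _ _ => rfl⟩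
  comp φ ψ := ⟨ψ.toLin ∘ₗ φ.toLin, fun R g => by
      rw [LinearMap.baseChange_comp, LinearMap.comp_assoc, φ.map_ρ, ← LinearMap.comp_assoc,
        ψ.map_ρ, LinearMap.comp_assoc],
    fun h x => by simp [φ.map_σ, ψ.map_σ]⟩

/-- The trivial one-dimensional representation. -/
noncomputable def unit (G : CommAlgCat.{u} ℂ ⥤ GrpCat.{u + 1}) (H : Type) [Group H]
    [TopologicalSpace H] : ProdRep G H where
  carrier := ULift.{u} ℂ
  ρ := fun _ => 1
  ρ_nat := fun f _ => (map_one (GLPoints.map _ f.hom)).symm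
  σ := 1
  σ_cont := fun w ℓ => (continuous_const : Continuous fun _ : H => ℓ w)
  comm := fun R _ h => by
    simp only [MonoidHom.one_apply, Units.val_one, Module.End.one_eq_id, LinearMap.baseChange_id]

theorem boxTensor_baseChange {R : Type u} [CommRing R] [Algebra ℂ R] {W W' : Type u}
    [AddCommGroup W] [Module ℂ W] [AddCommGroup W'] [Module ℂ W'] (a : Module.End ℂ W)
    (b : Module.End ℂ W') :
    boxTensor (LinearMap.baseChange R a) (LinearMap.baseChange R b) =
      LinearMap.baseChange R (TensorProduct.map a b) := by
  refine end_ext₂ fun w w' => ?_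
  rw [boxTensor_one_tmul]
  simp [TensorProduct.AlgebraTensorModule.distribBaseChange_symm_tmul]

/-- The tensor product of representations. -/
noncomputable def tensor (X Y : ProdRep G H) : ProdRep G H where
  carrier := X.carrier ⊗[ℂ] Y.carrier
  ρ := fun R =>
    { toFun := fun g => (X.ρ R g).box (Y.ρ R g)
      map_one' := Units.ext (by
        change boxTensor (X.ρ R 1).val (Y.ρ R 1).val = 1
        rw [map_one, map_one]
        exact boxTensor_one)
      map_mul' := fun g h => Units.ext (by
        change boxTensor (X.ρ R (g * h)).val (Y.ρ R (g * h)).val = _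
        rw [map_mul, map_mul]
        exact boxTensor_mul _ _ _ _) }
  ρ_nat := fun f g => Units.ext (by
    change boxTensor (X.ρ _ _).val (Y.ρ _ _).val =
      extendScalars f.hom (boxTensor (X.ρ _ g).val (Y.ρ _ g).val)
    rw [extendScalars_boxTensor, X.ρ_nat, Y.ρ_nat]
    rfl)
  σ := tensorRep X.σ Y.σ
  σ_cont := X.σ_cont.tensor Y.σ_cont
  comm := fun R g h => by
    change boxTensor (X.ρ R g).val (Y.ρ R g).val * LinearMap.baseChange R (TensorProduct.map _ _) =
      LinearMap.baseChange R (TensorProduct.map _ _) * boxTensor (X.ρ R g).val (Y.ρ R g).val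
    rw [← boxTensor_baseChange, ← boxTensor_mul, ← boxTensor_mul]
    congr 1
    · exact X.comm R g h
    · exact Y.comm R g h

variable (G H) in
/-- The forgetful functor on the tensor category of representations of `G × H`. -/
noncomputable def fibreData : FibreFunctorData (ProdRep G H) where
  ω :=
    { obj := fun X => ModuleCat.of ℂ X.carrier
      map := fun φ => ModuleCat.ofHom (Hom.toLin φ) }
  unit := unit G H
  tensor := tensor
  μ _ _ := LinearMap.id

end ProdRep

/-- The algebraic hull of `G × H`, where `G` is a group scheme and `H` is a topological group: the
group scheme of tensor automorphisms of the forgetful functor on the finite-dimensional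
representations of `G × H`. -/
noncomputable def algebraicHullProd (G : CommAlgCat.{u} ℂ ⥤ GrpCat.{u + 1}) (H : Type) [Group H]
    [TopologicalSpace H] : CommAlgCat.{u} ℂ ⥤ GrpCat.{u + 1} :=
  (ProdRep.fibreData G H).aut

/-! ### Star structures and property Q -/

/-- The analytic data on `Ω`: a conjugate linear, degree preserving involution `*` on `Ω` that
satisfies `(a ω)* = ω* a*` and `d (a*) = (d a)*` for `a` in `Ω⁰`, and an embedding `ι` of the
`*`-algebra `Ω⁰` as a dense unital `*`-subalgebra of the C*-algebra `A`, such that elements of `Ω⁰`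
that are invertible in `A` are invertible in `Ω⁰`. (No rule for `(α β)*` is imposed when `α` and `β`
both have positive degree, so that all the usual sign conventions are covered.) -/
structure StarStructure (Ω : CDGA.{u}) (A : Type v) [CommCStarAlgebra A] where
  star : Ω →ₛₗ[starRingEnd ℂ] Ω
  star_star : ∀ ω, star (star ω) = ω
  star_mem : ∀ {k : ℕ} {ω : Ω}, ω ∈ Ω.gr k → star ω ∈ Ω.gr k
  star_mul : ∀ a ∈ Ω.gr 0, ∀ ω : Ω, star (a * ω) = star ω * star a
  d_star : ∀ a ∈ Ω.gr 0, Ω.d (star a) = star (Ω.d a)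
  ι : Ω.gr 0 →ₐ[ℂ] A
  ι_star : ∀ a : Ω.gr 0, ι ⟨star a, star_mem a.2⟩ = Star.star (ι a)
  ι_injective : Function.Injective ι
  ι_dense : DenseRange ι
  isUnit_of_isUnit : ∀ a : Ω.gr 0, IsUnit (ι a) → IsUnit a

/-- Property Q of `Ω` with respect to `ι : Ω⁰ → A`: if `a, a₁, …, aₛ` in `Ω⁰` satisfy `a ≥ 0` and
`|aᵢ| ≤ a` in `A`, and `d a = ∑ aᵢ ωᵢ` for some `ω₁, …, ωₛ` in `Ω¹`, then `a = 0` or `a` is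
invertible. -/
def PropertyQ (Ω : CDGA.{u}) {A : Type v} [CommCStarAlgebra A] [PartialOrder A] [StarOrderedRing A]
    (ι : Ω.gr 0 →ₐ[ℂ] A) : Prop :=
  ∀ (a : Ω.gr 0) (s : ℕ) (b : Fin s → Ω.gr 0) (ω : Fin s → Ω),
    0 ≤ ι a → (∀ i, CFC.abs (ι (b i)) ≤ ι a) → (∀ i, ω i ∈ Ω.gr 1) →
    Ω.d a = ∑ i, (b i : Ω) * ω i → a = 0 ∨ IsUnit a

/-- The base point of `Ω` given by a point of the Gelfand spectrum of `A`. -/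
noncomputable def StarStructure.point {Ω : CDGA.{u}} {A : Type v} [CommCStarAlgebra A]
    (S : StarStructure Ω A) (p : WeakDual.characterSpace ℂ A) : Ω.gr 0 →ₐ[ℂ] ℂ :=
  (WeakDual.CharacterSpace.toAlgHom p).comp S.ι

/-! ### Base points of `⋀ V` and `Ω ⊗ ⋀ V` -/

section Points

variable (V : Type u) [AddCommGroup V] [Module ℂ V]

/-- The projection of `⋀ V` onto its degree `0` part `ℂ`. -/
noncomputable def exteriorCounit : CDGA.exterior V →ₐ[ℂ] ℂ :=
  ExteriorAlgebra.algebraMapInv (R := ℂ) (M := V)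

/-- The base point of `⋀ V`: the identification of its degree `0` part with `ℂ`. -/
noncomputable def exteriorPoint : (CDGA.exterior V).gr 0 →ₐ[ℂ] ℂ :=
  (exteriorCounit V).comp (SetLike.GradeZero.subalgebra (CDGA.exterior V).gr).val

theorem algebraMapInv_eq_zero {k : ℕ} (hk : k ≠ 0) {x : ExteriorAlgebra ℂ V}
    (hx : x ∈ ⋀[ℂ]^k V) : ExteriorAlgebra.algebraMapInv x = (0 : ℂ) := by
  induction hx using Submodule.pow_induction_on_left' with
  | algebraMap r => exact absurd rfl hk
  | add x y i hx hy ihx ihy => rw [map_add, ihx hk, ihy hk, add_zero]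
  | mem_mul m hm i x hx ih =>
    obtain ⟨v, rfl⟩ := hm
    rw [map_mul]
    simp [ExteriorAlgebra.algebraMapInv]

theorem exteriorCounit_eq_zero {k : ℕ} (hk : k ≠ 0) {x : CDGA.exterior V}
    (hx : x ∈ (CDGA.exterior V).gr k) : exteriorCounit V x = 0 :=
  algebraMapInv_eq_zero V hk hx

/-- The augmentation `Ω ⊗ ⋀ V → Ω`, `α ⊗ x ↦ ε(x) α`, where `ε : ⋀ V → ℂ` is the projection
onto degree `0`. -/
noncomputable def augmentation (Ω : CDGA.{u}) :
    CDGA.TensorCarrier Ω (CDGA.exterior V) →ₐ[ℂ] Ω :=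
  GradedTensorProduct.lift Ω.gr (CDGA.exterior V).gr (AlgHom.id ℂ Ω)
    ((Algebra.ofId ℂ Ω).comp (exteriorCounit V)) <| by
    intro k l α x
    by_cases hl : l = 0
    · subst hl
      rw [zero_mul, uzpow_zero, one_smul]
      exact (Algebra.commutes _ _).symm
    · have h : ((Algebra.ofId ℂ Ω).comp (exteriorCounit V))
          x.1 = 0 := by
        rw [AlgHom.comp_apply, exteriorCounit_eq_zero V hl x.2, map_zero]
      erw [h]
      simp

theorem augmentation_tm (Ω : CDGA.{u}) (α : Ω) (x : CDGA.exterior V) :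
    augmentation V Ω (CDGA.tm α x) =
      α * algebraMap ℂ Ω (exteriorCounit V x) := rfl

theorem augmentation_mem (Ω : CDGA.{u}) {k : ℕ} {x : CDGA.TensorCarrier Ω (CDGA.exterior V)}
    (hx : x ∈ CDGA.tGr Ω (CDGA.exterior V) k) : augmentation V Ω x ∈ Ω.gr k := by
  refine CDGA.tGr_induction (P := fun x => augmentation V Ω x ∈ Ω.gr k) ?_
    (by rw [map_zero]; exact zero_mem _)
    (fun a b ha hb => by rw [map_add]; exact add_mem ha hb)
    (fun c a ha => by rw [map_smul]; exact Submodule.smul_mem _ _ ha) hx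
  rintro k l rfl α hα β hβ
  rw [augmentation_tm]
  by_cases hl : l = 0
  · subst hl
    rw [← Algebra.commutes, ← Algebra.smul_def]
    exact Submodule.smul_mem _ _ hα
  · rw [exteriorCounit_eq_zero V hl hβ, map_zero, mul_zero]
    exact zero_mem _

/-- The augmentation in degree `0`, the identification `(Ω ⊗ ⋀ V)⁰ = Ω⁰`. -/
noncomputable def augmentation₀ (Ω : CDGA.{u}) :
    (CDGA.tensor Ω (CDGA.exterior V)).gr 0 →ₐ[ℂ] Ω.gr 0 :=
  AlgHom.codRestrict
    (AlgHom.comp (B := CDGA.tensor Ω (CDGA.exterior V)) (augmentation V Ω)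
      (SetLike.GradeZero.subalgebra (CDGA.tensor Ω (CDGA.exterior V)).gr).val)
    (SetLike.GradeZero.subalgebra Ω.gr) fun x => augmentation_mem V Ω x.2

end Points

end NCG

/-!
Let `B` be a graded commutative dga with closed elements `v_j` of degree one and contractions
`c_j`, which are derivations of degree `-1` on factors of degree at most one, anticommute with `d`
and satisfy `c_j v_i = δ_ij` (`CDGA.Cartan`). A flat connection `E` over `B` has residues `N_j =
c_j ∘ ∇` in degree zero. They extend to commuting parallel endomorphisms of `E`, are natural in
`E` and satisfy the Leibniz rule on tensor products; so their exponential is an action of `ℝⁿ` on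
the fibre of `E` by tensor automorphisms. Conversely, commuting endomorphisms `N_j` of a
finite-dimensional space `W` define the flat connection `d + ∑ v_j N_j` on `W ⊗ B`
(`FlatBundle.linBundle`), and every continuous representation of `ℝⁿ` is the exponential of
commuting endomorphisms (`exists_eq_expRep`). So tensor automorphisms of the fibre functor
restrict to tensor automorphisms of the representations of `ℝⁿ`.

The connection `∇ - ∑ v_j N_j` on `E` is again flat, and it has no residues. The main step is
`FlatBundle.aut_eq_conj_mul_conj`: on the fibre of `E`, a tensor automorphism is the product of
its value on `d + ∑ v_j N_j`, for the residues on the fibre, and its value on `∇ - ∑ v_j N_j`. Let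
`P` be the algebra of parallel endomorphisms of `E`. The evaluation `P ⊗ E → E` is a morphism of
flat connections from the tensor product of `P ⊗ B` with the connection given by multiplication by
the residues, and of `E` with `∇ - ∑ v_j N_j`; it determines the value on `E`, because `1 ∈ P`
acts as the identity. This requires that `P` is finite-dimensional, hence that parallel
endomorphisms are determined by their action on the fibre. If the base point is injective this is
clear; under property Q it holds because the matrix coefficients `f_i` of a parallel endomorphism
satisfy `d f_i = ∑ f_j θ_ij`, and property Q, applied to `∑ f_i* f_i`, shows that they vanish if
they vanish at `p` (`StarStructure.eq_zero_of_d_eq`).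

For `B = ⋀ V` the connection `∇ - ∑ v_j N_j` is trivial, and tensor automorphisms over `B` are the
same as those of the representations of `ℝⁿ`. For `B = Ω ⊗ ⋀ V` it is the base change of a flat
connection over `Ω`, along the augmentation `B → Ω` followed by the inclusion `Ω → B`. A tensor
automorphism over `B` is therefore a pair of tensor automorphisms, one over `Ω` and one of the
representations of `ℝⁿ`.

The algebraic hull of `π¹(Ω, p) × ℝⁿ` is treated in the same way: a tensor automorphism of the
representations of `G × H` is the product of its values on representations of `H` and of `G`
(`ProdRep.aut_eq_mul`). For the group `G` of tensor automorphisms of a fibre functor `ω` it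
remains to see that a tensor automorphism `η` of the representations of `G` is trivial if it is
trivial on the tautological representations `ω(X)`. The group `G` has a universal point over the
algebra generated by the matrix coefficients of the `ω(X)`; the category of flat connections is
essentially small, so that this algebra lies in the universe of the scalars `R`. Each matrix
coefficient of a representation `X` is a matrix coefficient of a representation `M` obtained from
the `ω(X)` by sums, tensor products and duals, and the kernel of the difference of the two
coefficients is a subrepresentation of `X ⊕ M`, which `η` preserves
(`ProdRep.aut_eq_one_of_taut`).
-/

namespace NCG

/-! ### Restriction of tensor automorphisms -/

section Conjugation

variable {R S : Type u} [CommRing R] [Algebra ℂ R] [CommRing S] [Algebra ℂ S]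
  {W W' : Type u} [AddCommGroup W] [Module ℂ W] [AddCommGroup W'] [Module ℂ W']

variable (R) in
/-- Transport of `GL_{W'}(R)` to `GL_W(R)` along a linear isomorphism `e : W ≃ W'`. -/
noncomputable def GLPoints.conj (e : W ≃ₗ[ℂ] W') : GLPoints R W' →* GLPoints R W :=
  Units.map (LinearEquiv.conjRingEquiv (LinearEquiv.baseChange ℂ R W W' e).symm).toMonoidHom

theorem GLPoints.baseChange_conj (e : W ≃ₗ[ℂ] W') (g : GLPoints R W') :
    e.toLinearMap.baseChange R ∘ₗ (GLPoints.conj R e g).val =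
      g.val ∘ₗ e.toLinearMap.baseChange R := by
  refine LinearMap.ext fun x => ?_
  change (LinearEquiv.baseChange ℂ R W W' e) ((LinearEquiv.baseChange ℂ R W W' e).symm
    (g.val ((LinearEquiv.baseChange ℂ R W W' e).symm.symm x))) = _
  rw [LinearEquiv.apply_symm_apply]
  rfl

theorem baseChange_injective (R : Type u) [CommRing R] [Algebra ℂ R] {f : W →ₗ[ℂ] W'}
    (hf : Function.Injective f) : Function.Injective (f.baseChange R) :=
  Module.Flat.lTensor_preserves_injective_linearMap (M := R) f hf

/-- The transported automorphism is the only one that `e` intertwines with `g`. -/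
theorem GLPoints.eq_conj (e : W ≃ₗ[ℂ] W') (g : GLPoints R W') (h : GLPoints R W)
    (H : e.toLinearMap.baseChange R ∘ₗ h.val = g.val ∘ₗ e.toLinearMap.baseChange R) :
    h = GLPoints.conj R e g := by
  refine Units.ext (LinearMap.ext fun x => baseChange_injective R e.injective ?_)
  exact LinearMap.congr_fun (H.trans (GLPoints.baseChange_conj e g).symm) x

theorem GLPoints.conj_refl (g : GLPoints R W) :
    GLPoints.conj R (LinearEquiv.refl ℂ W) g = g := by
  refine (GLPoints.eq_conj _ _ _ ?_).symm
  have h : (LinearEquiv.refl ℂ W).toLinearMap.baseChange R = LinearMap.id :=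
    LinearMap.baseChange_id
  rw [h, LinearMap.id_comp, LinearMap.comp_id]

theorem GLPoints.map_conj (f : R →ₐ[ℂ] S) (e : W ≃ₗ[ℂ] W') (g : GLPoints R W') :
    GLPoints.map W f (GLPoints.conj R e g) = GLPoints.conj S e (GLPoints.map W' f g) := by
  refine GLPoints.eq_conj _ _ _ ?_
  exact (extendScalars_intertwine f e.toLinearMap (GLPoints.baseChange_conj e g).symm).symm

/-- `φ ⊗_R ψ` intertwines `f ⊗ g` when `φ` intertwines `f` and `ψ` intertwines `g`. -/
theorem boxTensor_intertwine {U U' : Type u} [AddCommGroup U] [Module ℂ U] [AddCommGroup U']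
    [Module ℂ U'] (f : W →ₗ[ℂ] W') (g : U →ₗ[ℂ] U')
    {φ : Module.End R (R ⊗[ℂ] W)} {φ' : Module.End R (R ⊗[ℂ] W')}
    {ψ : Module.End R (R ⊗[ℂ] U)} {ψ' : Module.End R (R ⊗[ℂ] U')}
    (hφ : φ' ∘ₗ f.baseChange R = f.baseChange R ∘ₗ φ)
    (hψ : ψ' ∘ₗ g.baseChange R = g.baseChange R ∘ₗ ψ) :
    boxTensor φ' ψ' ∘ₗ (TensorProduct.map f g).baseChange R =
      (TensorProduct.map f g).baseChange R ∘ₗ boxTensor φ ψ := by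
  have key : ∀ (x : R ⊗[ℂ] W) (y : R ⊗[ℂ] U), (TensorProduct.map f g).baseChange R
      ((TensorProduct.AlgebraTensorModule.distribBaseChange ℂ R W U).symm (x ⊗ₜ[R] y)) =
      (TensorProduct.AlgebraTensorModule.distribBaseChange ℂ R W' U').symm
        (f.baseChange R x ⊗ₜ[R] g.baseChange R y) := by
    intro x y
    induction x using TensorProduct.induction_on with
    | zero => simp
    | add x x' hx hx' => simp only [TensorProduct.add_tmul, map_add, hx, hx']
    | tmul r w =>
      induction y using TensorProduct.induction_on with
      | zero => simp
      | add y y' hy hy' => simp only [TensorProduct.tmul_add, map_add, hy, hy']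
      | tmul r' w' => simp [TensorProduct.AlgebraTensorModule.distribBaseChange_symm_tmul]
  refine end_ext₂ fun w w' => ?_
  have h1 := LinearMap.congr_fun hφ ((1 : R) ⊗ₜ[ℂ] w)
  have h2 := LinearMap.congr_fun hψ ((1 : R) ⊗ₜ[ℂ] w')
  simp only [LinearMap.comp_apply, LinearMap.baseChange_tmul, TensorProduct.map_tmul] at h1 h2 ⊢
  rw [boxTensor_one_tmul, boxTensor_one_tmul, h1, h2, key]

/-- An automorphism that is compatible with an action `X ⊗ W₀ → W` is determined by the
automorphisms of `X` and of `W₀`. -/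
theorem GLPoints.eq_mul_of_act {R : Type u} [CommRing R] [Algebra ℂ R] {X W W₀ : Type u}
    [AddCommGroup X] [Module ℂ X] [AddCommGroup W] [Module ℂ W] [AddCommGroup W₀] [Module ℂ W₀]
    {μ : X ⊗[ℂ] W₀ →ₗ[ℂ] W} {e : W ≃ₗ[ℂ] W₀} {x₀ : X} (hx₀ : ∀ w, μ (x₀ ⊗ₜ e w) = w)
    {η κ : GLPoints R W} {φ : GLPoints R X} {ψ : GLPoints R W₀}
    (hη : η.val ∘ₗ μ.baseChange R = μ.baseChange R ∘ₗ boxTensor φ.val ψ.val)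
    (hκ : ∀ y, κ.val ∘ₗ (μ ∘ₗ (TensorProduct.mk ℂ X W₀).flip y).baseChange R =
      (μ ∘ₗ (TensorProduct.mk ℂ X W₀).flip y).baseChange R ∘ₗ φ.val) :
    η = κ * GLPoints.conj R e ψ := by
  -- `hκ` at the vector `x₀` computes `μ` on `φ(x₀) ⊗ y`, first for `y` in `W₀`, then, by
  -- `R`-linearity, for all `y` in `R ⊗ W₀`.
  have key : ∀ x : R ⊗[ℂ] W₀, μ.baseChange R
      ((TensorProduct.AlgebraTensorModule.distribBaseChange ℂ R X W₀).symm
        (φ.val ((1 : R) ⊗ₜ x₀) ⊗ₜ[R] x)) = κ.val (e.symm.toLinearMap.baseChange R x) := by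
    intro x
    induction x using TensorProduct.induction_on with
    | zero => simp
    | add x y hx hy => rw [TensorProduct.tmul_add, map_add, map_add, map_add, map_add, hx, hy]
    | tmul r y =>
      have h1 : ∀ z : R ⊗[ℂ] X, μ.baseChange R
          ((TensorProduct.AlgebraTensorModule.distribBaseChange ℂ R X W₀).symm
            (z ⊗ₜ[R] (r ⊗ₜ y))) =
          r • (μ ∘ₗ (TensorProduct.mk ℂ X W₀).flip y).baseChange R z := by
        intro z
        induction z using TensorProduct.induction_on with
        | zero => simp
        | add x y hx hy => rw [TensorProduct.add_tmul, map_add, map_add, map_add, smul_add, hx, hy]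
        | tmul s x =>
          simp [TensorProduct.AlgebraTensorModule.distribBaseChange_symm_tmul,
            TensorProduct.smul_tmul', mul_comm]
      have h2 := LinearMap.congr_fun (hκ y) ((1 : R) ⊗ₜ x₀)
      have h3 : μ (x₀ ⊗ₜ y) = e.symm y := by
        have := hx₀ (e.symm y)
        rwa [e.apply_symm_apply] at this
      rw [LinearMap.comp_apply, LinearMap.comp_apply, LinearMap.baseChange_tmul,
        LinearMap.comp_apply, LinearMap.flip_apply, TensorProduct.mk_apply, h3] at h2
      rw [h1, ← h2, LinearMap.baseChange_tmul, ← map_smul, TensorProduct.smul_tmul', smul_eq_mul,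
        mul_one]
      rfl
  refine Units.ext (end_ext fun w => ?_)
  -- Since `w = μ (x₀ ⊗ e w)`, `hη` gives `η(w) = μ (φ(x₀) ⊗ ψ(e w))`.
  have h4 := LinearMap.congr_fun hη ((1 : R) ⊗ₜ (x₀ ⊗ₜ e w))
  rw [LinearMap.comp_apply, LinearMap.comp_apply, LinearMap.baseChange_tmul, hx₀,
    boxTensor_one_tmul, key] at h4
  rw [h4, Units.val_mul, Module.End.mul_apply]
  rfl

/-- Intertwining with a transported automorphism. -/
theorem GLPoints.conj_intertwine {R : Type u} [CommRing R] [Algebra ℂ R] {X W W' : Type u}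
    [AddCommGroup X] [Module ℂ X] [AddCommGroup W] [Module ℂ W] [AddCommGroup W'] [Module ℂ W']
    (e : W ≃ₗ[ℂ] W') {f : X →ₗ[ℂ] W} {g : GLPoints R W'} {φ : Module.End R (R ⊗[ℂ] X)}
    {m : X →ₗ[ℂ] W'} (hm : ∀ x, m x = e (f x))
    (H : g.val ∘ₗ m.baseChange R = m.baseChange R ∘ₗ φ) :
    (GLPoints.conj R e g).val ∘ₗ f.baseChange R = f.baseChange R ∘ₗ φ := by
  obtain rfl : m = e.toLinearMap ∘ₗ f := LinearMap.ext hm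
  refine LinearMap.ext fun x => baseChange_injective R (f := e.toLinearMap) e.injective ?_
  have h1 := LinearMap.congr_fun (GLPoints.baseChange_conj e g) (f.baseChange R x)
  have h2 := LinearMap.congr_fun H x
  rw [LinearMap.baseChange_comp] at h2
  exact h1.trans h2

end Conjugation

namespace FibreFunctorData

variable {C C' : Type (u + 1)} [Category.{u} C] [Category.{u} C']

section Points

variable {D : FibreFunctorData C} {R : Type u} [CommRing R] [Algebra ℂ R]

/-- Naturality of a tensor automorphism. -/
theorem aut_nat (η : D.autPoints R) {X Y : C} (f : X ⟶ Y) :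
    (η.1 Y).val ∘ₗ (D.ω.map f).hom.baseChange R = (D.ω.map f).hom.baseChange R ∘ₗ (η.1 X).val :=
  η.2.1 X Y f

theorem aut_unit (η : D.autPoints R) : η.1 D.unit = 1 := η.2.2.1

theorem aut_tensor (η : D.autPoints R) (X Y : C) :
    (η.1 (D.tensor X Y)).val ∘ₗ (D.μ X Y).baseChange R =
      (D.μ X Y).baseChange R ∘ₗ boxTensor (η.1 X).val (η.1 Y).val :=
  η.2.2.2 X Y

end Points

/-- A comparison of two fibre functors: a map on objects with isomorphisms of the fibres, such
that morphisms, the unit object and tensor products correspond to each other as far as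
is needed to restrict tensor automorphisms. The map on objects need not be a functor, and it is
compatible with tensor products only up to morphisms `m`, `m'` to a common object `T`, of which `m`
is injective on fibres. -/
structure Comparison (D : FibreFunctorData C) (D' : FibreFunctorData C') where
  obj : C → C'
  iso : ∀ X, (D.ω.obj X : Type u) ≃ₗ[ℂ] (D'.ω.obj (obj X) : Type u)
  nat : ∀ {X Y : C} (f : X ⟶ Y), ∃ f' : obj X ⟶ obj Y,
    (D'.ω.map f').hom ∘ₗ (iso X).toLinearMap = (iso Y).toLinearMap ∘ₗ (D.ω.map f).hom
  unit : ∃ f : obj D.unit ⟶ D'.unit, Function.Injective (D'.ω.map f).hom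
  tensor : ∀ X Y : C, ∃ (T : C') (m : obj (D.tensor X Y) ⟶ T)
    (m' : D'.tensor (obj X) (obj Y) ⟶ T), Function.Injective (D'.ω.map m).hom ∧
    (D'.ω.map m).hom ∘ₗ (iso (D.tensor X Y)).toLinearMap ∘ₗ D.μ X Y =
      (D'.ω.map m').hom ∘ₗ D'.μ (obj X) (obj Y) ∘ₗ
        TensorProduct.map (iso X).toLinearMap (iso Y).toLinearMap

namespace Comparison

variable {D : FibreFunctorData C} {D' : FibreFunctorData C'} (F : Comparison D D')
variable (R : Type u) [CommRing R] [Algebra ℂ R]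

/-- Restriction of tensor automorphisms along a comparison. -/
noncomputable def restrict : D'.autPoints R →* D.autPoints R where
  toFun θ := ⟨fun X => GLPoints.conj R (F.iso X) (θ.1 (F.obj X)), by
    refine ⟨fun X Y f => ?_, ?_, fun X Y => ?_⟩
    · obtain ⟨f', hf'⟩ := F.nat f
      have hf := congrArg (LinearMap.baseChange R) hf'
      rw [LinearMap.baseChange_comp, LinearMap.baseChange_comp] at hf
      refine LinearMap.ext fun x => baseChange_injective R (F.iso Y).injective ?_
      have h1 := LinearMap.congr_fun (GLPoints.baseChange_conj (F.iso Y) (θ.1 (F.obj Y)))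
        ((D.ω.map f).hom.baseChange R x)
      have h2 := LinearMap.congr_fun (GLPoints.baseChange_conj (F.iso X) (θ.1 (F.obj X))) x
      have h3 := LinearMap.congr_fun (aut_nat θ f') ((F.iso X).toLinearMap.baseChange R x)
      have h4 := LinearMap.congr_fun hf x
      have h5 := LinearMap.congr_fun hf ((GLPoints.conj R (F.iso X) (θ.1 (F.obj X))).val x)
      simp only [LinearMap.comp_apply] at h1 h2 h3 h4 h5
      change (F.iso Y).toLinearMap.baseChange R _ = (F.iso Y).toLinearMap.baseChange R _
      simp only [LinearMap.comp_apply]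
      rw [h1, ← h4, h3, ← h5, h2]
    · obtain ⟨f, hf⟩ := F.unit
      refine (GLPoints.eq_conj _ _ _ ?_).symm
      refine LinearMap.ext fun x => baseChange_injective R hf ?_
      have h := LinearMap.congr_fun (aut_nat θ f) ((F.iso D.unit).toLinearMap.baseChange R x)
      rw [aut_unit] at h
      exact h
    · obtain ⟨T, m, m', hm, h⟩ := F.tensor X Y
      have hR := congrArg (LinearMap.baseChange R) h
      simp only [LinearMap.baseChange_comp] at hR
      refine LinearMap.ext fun x => baseChange_injective R (F.iso _).injective
        (baseChange_injective R hm ?_)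
      have h1 := LinearMap.congr_fun (GLPoints.baseChange_conj (F.iso (D.tensor X Y))
        (θ.1 (F.obj (D.tensor X Y)))) ((D.μ X Y).baseChange R x)
      have h2 := LinearMap.congr_fun (boxTensor_intertwine (F.iso X).toLinearMap
        (F.iso Y).toLinearMap (GLPoints.baseChange_conj (F.iso X) (θ.1 (F.obj X))).symm
        (GLPoints.baseChange_conj (F.iso Y) (θ.1 (F.obj Y))).symm) x
      have h3 := LinearMap.congr_fun hR x
      have h4 := LinearMap.congr_fun hR (boxTensor (GLPoints.conj R (F.iso X) (θ.1 (F.obj X))).val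
        (GLPoints.conj R (F.iso Y) (θ.1 (F.obj Y))).val x)
      have h5 := fun y => LinearMap.congr_fun (aut_nat θ m) y
      have h6 := fun y => LinearMap.congr_fun (aut_nat θ m') y
      have h7 := fun y => LinearMap.congr_fun (aut_tensor θ (F.obj X) (F.obj Y)) y
      simp only [LinearMap.comp_apply] at h1 h2 h3 h4 h5 h6 h7
      change (D'.ω.map m).hom.baseChange R ((F.iso _).toLinearMap.baseChange R _) =
        (D'.ω.map m).hom.baseChange R ((F.iso _).toLinearMap.baseChange R
          ((D.μ X Y).baseChange R (boxTensor _ _ x)))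
      simp only [LinearMap.comp_apply]
      rw [h1, ← h5, h3, h6, h7, h2, ← h4]⟩
  map_one' := Subtype.ext (funext fun X => map_one _)
  map_mul' θ θ' := Subtype.ext (funext fun X => map_mul _ _ _)

variable {R}

/-- The defining property of the restriction. -/
theorem iso_restrict (θ : D'.autPoints R) (X : C) (x : R ⊗[ℂ] (D.ω.obj X : Type u)) :
    (F.iso X).toLinearMap.baseChange R (((F.restrict R θ).1 X).val x) =
      (θ.1 (F.obj X)).val ((F.iso X).toLinearMap.baseChange R x) :=
  LinearMap.congr_fun (GLPoints.baseChange_conj (F.iso X) (θ.1 (F.obj X))) x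

theorem restrict_autMap {S : Type u} [CommRing S] [Algebra ℂ S] (f : R →ₐ[ℂ] S)
    (θ : D'.autPoints R) : F.restrict S (D'.autMap f θ) = D.autMap f (F.restrict R θ) :=
  Subtype.ext (funext fun X => (GLPoints.map_conj f (F.iso X) (θ.1 (F.obj X))).symm)

/-- A comparison along which restriction is bijective gives an isomorphism of group schemes. -/
theorem nonempty_iso (h : ∀ (R : Type u) [CommRing R] [Algebra ℂ R],
    Function.Bijective (F.restrict R)) : Nonempty (D.aut ≅ D'.aut) :=
  ⟨(NatIso.ofComponents (F := D'.aut) (G := D.aut)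
    (fun R => (MulEquiv.ofBijective (F.restrict R) (h R)).toGrpIso) (by
      intro R S f
      refine GrpCat.hom_ext (MonoidHom.ext fun θ => ?_)
      exact F.restrict_autMap f.hom θ)).symm⟩

end Comparison

end FibreFunctorData

end NCG

namespace NCG

/-! ### Frames of finitely generated projective bimodules -/

theorem CDGA.mul_comm_zero (Ω : CDGA.{u}) {a : Ω} (ha : a ∈ Ω.gr 0) (β : Ω) : a * β = β * a := by
  refine graded_induction Ω.iSup_gr (P := fun β => a * β = β * a) ?_
    (fun x y hx hy => by rw [mul_add, add_mul, hx, hy]) β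
  intro k β hβ
  simpa using Ω.comm ha hβ

theorem gradedProj_mem {M : Type*} [AddCommGroup M] [Module ℂ M] {gr : ℕ → Submodule ℂ M}
    (h : DirectSum.IsInternal gr) (l : ℕ) (x : M) : gradedProj h l x ∈ gr l := by
  refine graded_induction h.submodule_iSup_eq_top (P := fun x => gradedProj h l x ∈ gr l) ?_
    (fun x y hx hy => by rw [map_add]; exact add_mem hx hy) x
  intro k x hx
  by_cases hkl : k = l
  · subst hkl
    rwa [gradedProj_same h hx]
  · rw [gradedProj_ne h hkl hx]
    exact zero_mem _

namespace GradedBimodule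

variable {Ω : CDGA.{u}}

/-- The left and right multiplication agree on elements of degree `0`, since they do in a free
bimodule. -/
theorem IsFGP.lact_of_mem_zero {E : GradedBimodule Ω} (h : E.IsFGP) {e : E} (he : e ∈ E.gr 0)
    (α : Ω) : E.lact α e = E.ract e α := by
  refine graded_induction Ω.iSup_gr (P := fun α => E.lact α e = E.ract e α) ?_
    (fun x y hx hy => by rw [map_add, LinearMap.add_apply, map_add, hx, hy]) α
  intro k α hα
  simpa using h.lact_eq hα he

/-- A frame of a graded bimodule: finitely many elements of degree `0` and
coordinate functions of degree `0` with `e = ∑ x_a ξ_a(e)`. -/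
structure Frame (E : GradedBimodule Ω) where
  n : ℕ
  x : Fin n → E
  ξ : Fin n → E →ₗ[ℂ] Ω
  x_mem : ∀ a, x a ∈ E.gr 0
  ξ_mem : ∀ {k : ℕ} {e : E}, e ∈ E.gr k → ∀ a, ξ a e ∈ Ω.gr k
  ξ_lact : ∀ a α e, ξ a (E.lact α e) = α * ξ a e
  ξ_ract : ∀ a e α, ξ a (E.ract e α) = ξ a e * α
  sum_eq : ∀ e, ∑ a, E.ract (x a) (ξ a e) = e

theorem IsFGP.nonempty_frame {E : GradedBimodule Ω} (h : E.IsFGP) : Nonempty E.Frame := by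
  obtain ⟨n, i, r, i_mem, i_l, i_r, r_mem, r_l, r_r, hri⟩ := isFGP_iff.1 h
  refine ⟨⟨n, fun a => r (Pi.single a 1), fun a => LinearMap.proj a ∘ₗ i, fun a => ?_, ?_, ?_, ?_,
    ?_⟩⟩
  · exact r_mem (mem_freeGr.1 (single_mem_freeGr a Ω.one_mem))
  · exact fun he a => i_mem he a
  · exact fun a α e => i_l α e a
  · exact fun a e α => i_r e α a
  · intro e
    conv_rhs => rw [← hri e, ← Finset.univ_sum_single (i e), map_sum]
    refine Finset.sum_congr rfl fun a _ => ?_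
    rw [← r_r]
    congr 1
    funext b
    by_cases hb : b = a
    · subst hb; simp
    · simp [hb]

/-- A frame of a finitely generated projective bimodule. -/
noncomputable def IsFGP.frame {E : GradedBimodule Ω} (h : E.IsFGP) : E.Frame :=
  h.nonempty_frame.some

/-- A linear map that is determined by its values in degree `0` is a bimodule morphism. -/
def Hom.ofZero {E F : GradedBimodule Ω} (hE : E.IsFGP) (hF : F.IsFGP) (f : E →ₗ[ℂ] F)
    (h₀ : ∀ e ∈ E.gr 0, f e ∈ F.gr 0)
    (h : ∀ e ∈ E.gr 0, ∀ α, f (E.ract e α) = F.ract (f e) α) : Hom E F where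
  toLin := f
  map_mem := fun {k e} he => by
    have X := hE.frame
    rw [← X.sum_eq e, map_sum]
    refine sum_mem fun a _ => ?_
    rw [h _ (X.x_mem a)]
    have := F.ract_mem (h₀ _ (X.x_mem a)) (X.ξ_mem he a)
    rwa [zero_add] at this
  map_lact := fun α e => by
    have X := hE.frame
    rw [← X.sum_eq e, map_sum, map_sum, map_sum, map_sum]
    refine Finset.sum_congr rfl fun a _ => ?_
    rw [← E.ract_lact, hE.lact_of_mem_zero (X.x_mem a), ← E.ract_mul, h _ (X.x_mem a),
      h _ (X.x_mem a), F.ract_mul, ← hF.lact_of_mem_zero (h₀ _ (X.x_mem a)), F.ract_lact]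
  map_ract := fun e α => by
    have X := hE.frame
    rw [← X.sum_eq e, map_sum, map_sum, LinearMap.sum_apply, map_sum, map_sum,
      LinearMap.sum_apply]
    refine Finset.sum_congr rfl fun a _ => ?_
    rw [← E.ract_mul, h _ (X.x_mem a), h _ (X.x_mem a), F.ract_mul]

theorem Hom.gradedProj {E F : GradedBimodule Ω} (f : Hom E F) (l : ℕ) (e : E) :
    f.toLin (NCG.gradedProj E.internal l e) = NCG.gradedProj F.internal l (f.toLin e) := by
  refine graded_induction E.iSup_gr (P := fun e => f.toLin (NCG.gradedProj E.internal l e) =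
    NCG.gradedProj F.internal l (f.toLin e)) ?_
    (fun x y hx hy => by rw [map_add, map_add, hx, hy, map_add, map_add]) e
  intro k e he
  by_cases hkl : k = l
  · subst hkl
    rw [gradedProj_same _ he, gradedProj_same _ (f.map_mem he)]
  · rw [gradedProj_ne _ hkl he, gradedProj_ne _ hkl (f.map_mem he), map_zero]

section OfIdem

variable (F : GradedBimodule Ω) (T : Hom F F) (hT : ∀ x, T.toLin (T.toLin x) = T.toLin x)

/-- The image of an idempotent, as the subspace of its fixed points. -/
def fixed : Submodule ℂ F := LinearMap.ker (T.toLin - LinearMap.id)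

theorem mem_fixed {x : F} : x ∈ fixed F T ↔ T.toLin x = x := by
  rw [fixed, LinearMap.mem_ker, LinearMap.sub_apply, sub_eq_zero, LinearMap.id_apply]

/-- The image of an idempotent endomorphism of a graded bimodule. -/
def ofIdem : GradedBimodule Ω where
  carrier := fixed F T
  gr := fun k => (F.gr k).comap (fixed F T).subtype
  -- The projections to the graded pieces commute with `T`, hence restrict to the fixed points.
  internal := by
    have hp : ∀ l x, x ∈ fixed F T → NCG.gradedProj F.internal l x ∈ fixed F T := by
      intro l x hx
      rw [mem_fixed] at hx ⊢
      rw [T.gradedProj, hx]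
    refine isInternal_of_proj _ (fun l => (NCG.gradedProj F.internal l).restrict (hp l)) ?_ ?_ ?_
    · intro k x hx
      exact Subtype.ext (gradedProj_same F.internal hx)
    · intro k l hkl x hx
      exact Subtype.ext (gradedProj_ne F.internal hkl hx)
    · let T' : F →ₗ[ℂ] fixed F T :=
        T.toLin.codRestrict (fixed F T) fun x => (mem_fixed F T).2 (hT x)
      have hs : Function.Surjective T' := fun x => ⟨x, Subtype.ext ((mem_fixed F T).1 x.2)⟩
      rw [eq_top_iff, ← LinearMap.range_eq_top.2 hs, ← Submodule.map_top, ← F.iSup_gr,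
        Submodule.map_iSup]
      refine iSup_mono fun k => ?_
      rintro _ ⟨x, hx, rfl⟩
      exact T.map_mem hx
  lact := LinearMap.mk₂ ℂ (fun α e => ⟨F.lact α e, by
      rw [mem_fixed, T.map_lact, (mem_fixed F T).1 e.2]⟩)
    (fun _ _ _ => Subtype.ext (by simp)) (fun _ _ _ => Subtype.ext (by simp))
    (fun _ _ _ => Subtype.ext (by simp)) (fun _ _ _ => Subtype.ext (by simp))
  ract := LinearMap.mk₂ ℂ (fun e α => ⟨F.ract e α, by
      rw [mem_fixed, T.map_ract, (mem_fixed F T).1 e.2]⟩)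
    (fun _ _ _ => Subtype.ext (by simp)) (fun _ _ _ => Subtype.ext (by simp))
    (fun _ _ _ => Subtype.ext (by simp)) (fun _ _ _ => Subtype.ext (by simp))
  one_lact := fun e => Subtype.ext (F.one_lact e)
  mul_lact := fun α β e => Subtype.ext (F.mul_lact α β e)
  ract_one := fun e => Subtype.ext (F.ract_one e)
  ract_mul := fun e α β => Subtype.ext (F.ract_mul e α β)
  ract_lact := fun α e β => Subtype.ext (F.ract_lact α e β)
  lact_mem := fun hα he => F.lact_mem hα he
  ract_mem := fun he hα => F.ract_mem he hα

end OfIdem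

theorem ofIdem_free_isFGP (n : ℕ) (T : Hom (free Ω n) (free Ω n))
    (hT : ∀ x, T.toLin (T.toLin x) = T.toLin x) : (ofIdem (free Ω n) T hT).IsFGP :=
  ⟨n, ⟨(fixed (free Ω n) T).subtype, fun he => he, fun _ _ => rfl, fun _ _ => rfl⟩,
    ⟨T.toLin.codRestrict (fixed _ T) fun x => (mem_fixed _ T).2 (hT x), fun he => T.map_mem he,
      fun α e => Subtype.ext (T.map_lact α e), fun e α => Subtype.ext (T.map_ract e α)⟩,
    fun e => Subtype.ext ((mem_fixed _ T).1 e.2)⟩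

end GradedBimodule

/-! ### Base change of flat connections -/

/-- A morphism of graded commutative dgas. -/
structure CDGA.Hom (Ω Ω' : CDGA.{u}) where
  toAlg : Ω →ₐ[ℂ] Ω'
  map_mem : ∀ {k : ℕ} {α : Ω}, α ∈ Ω.gr k → toAlg α ∈ Ω'.gr k
  map_d : ∀ α, toAlg (Ω.d α) = Ω'.d (toAlg α)

namespace CDGA.Hom

variable {Ω Ω' Ω'' : CDGA.{u}}

/-- The identity. -/
def id (Ω : CDGA.{u}) : Hom Ω Ω := ⟨AlgHom.id ℂ Ω, fun h => h, fun _ => rfl⟩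

/-- The composition `g ∘ f`. -/
def comp (g : Hom Ω' Ω'') (f : Hom Ω Ω') : Hom Ω Ω'' :=
  ⟨g.toAlg.comp f.toAlg, fun h => g.map_mem (f.map_mem h), fun α =>
    (congrArg g.toAlg (f.map_d α)).trans (g.map_d _)⟩

/-- The map in degree `0`. -/
def map₀ (f : Hom Ω Ω') (a : Ω.gr 0) : Ω'.gr 0 := ⟨f.toAlg a, f.map_mem a.2⟩

end CDGA.Hom

namespace FlatBundle

variable {Ω Ω' Ω'' : CDGA.{u}}

/-- A frame of the underlying bimodule of a flat connection. -/
noncomputable def frame (X : FlatBundle Ω) : X.toGradedBimodule.Frame := X.fgp.frame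

theorem conn_ract_zero (X : FlatBundle Ω) {e : X.carrier} (he : e ∈ X.gr 0) (α : Ω) :
    X.conn (X.ract e α) = X.ract (X.conn e) α + X.ract e (Ω.d α) := by
  simpa using X.conn_ract he α

/-- A map from a flat connection over `Ω` to a flat connection over `Ω'` that is semilinear along
`f : Ω → Ω'`, of degree `0`, and commutes with the connections. -/
structure SHom (f : CDGA.Hom Ω Ω') (X : FlatBundle Ω) (Y : FlatBundle Ω') where
  toLin : X.carrier →ₗ[ℂ] Y.carrier
  map_mem : ∀ {k : ℕ} {e : X.carrier}, e ∈ X.gr k → toLin e ∈ Y.gr k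
  map_lact : ∀ α e, toLin (X.lact α e) = Y.lact (f.toAlg α) (toLin e)
  map_ract : ∀ e α, toLin (X.ract e α) = Y.ract (toLin e) (f.toAlg α)
  map_conn : ∀ e, toLin (X.conn e) = Y.conn (toLin e)

namespace SHom

/-- Semilinear maps compose. -/
def comp {f : CDGA.Hom Ω Ω'} {g : CDGA.Hom Ω' Ω''} {X : FlatBundle Ω} {Y : FlatBundle Ω'}
    {Z : FlatBundle Ω''} (ψ : SHom g Y Z) (φ : SHom f X Y) : SHom (g.comp f) X Z where
  toLin := ψ.toLin ∘ₗ φ.toLin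
  map_mem := fun he => ψ.map_mem (φ.map_mem he)
  map_lact := fun α e => by
    rw [LinearMap.comp_apply, φ.map_lact, ψ.map_lact]; rfl
  map_ract := fun e α => by
    rw [LinearMap.comp_apply, φ.map_ract, ψ.map_ract]; rfl
  map_conn := fun e => by
    rw [LinearMap.comp_apply, φ.map_conn, ψ.map_conn]; rfl

/-- A morphism of flat connections as a semilinear map. -/
def ofHom {X Y : FlatBundle Ω} (φ : X ⟶ Y) : SHom (CDGA.Hom.id Ω) X Y :=
  ⟨Hom.toHom φ |>.toLin, (Hom.toHom φ).map_mem, (Hom.toHom φ).map_lact, (Hom.toHom φ).map_ract,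
    Hom.map_conn φ⟩

/-- A semilinear map along the identity is a morphism. -/
def toHom {X Y : FlatBundle Ω} (φ : SHom (CDGA.Hom.id Ω) X Y) : X ⟶ Y :=
  (⟨⟨φ.toLin, φ.map_mem, φ.map_lact, φ.map_ract⟩, φ.map_conn⟩ : Hom X Y)

end SHom

section BaseChange

open GradedBimodule

variable (f : CDGA.Hom Ω Ω') (X : FlatBundle Ω)

/-- The map `X → (Ω')ⁿ` given by the coordinates. -/
noncomputable def bcCoord : X.carrier →ₗ[ℂ] (Fin X.frame.n → Ω') :=
  LinearMap.pi fun b => f.toAlg.toLinearMap ∘ₗ X.frame.ξ b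

theorem bcCoord_apply (x : X.carrier) (b) : bcCoord f X x b = f.toAlg (X.frame.ξ b x) := rfl

theorem bcCoord_mem {k : ℕ} {x : X.carrier} (hx : x ∈ X.gr k) (b) :
    bcCoord f X x b ∈ Ω'.gr k := f.map_mem (X.frame.ξ_mem hx b)

theorem bcCoord_ract (x : X.carrier) (α : Ω) (b) :
    bcCoord f X (X.ract x α) b = bcCoord f X x b * f.toAlg α := by
  rw [bcCoord_apply, X.frame.ξ_ract, map_mul]; rfl

theorem bcCoord_x_comm (a b) (β : Ω') :
    bcCoord f X (X.frame.x a) b * β = β * bcCoord f X (X.frame.x a) b :=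
  Ω'.mul_comm_zero (bcCoord_mem f X (X.frame.x_mem a) b) β

/-- The idempotent endomorphism of `(Ω')ⁿ` whose image is the base change. -/
noncomputable def bcProj : (Fin X.frame.n → Ω') →ₗ[ℂ] (Fin X.frame.n → Ω') :=
  LinearMap.pi fun b => ∑ a,
    LinearMap.mulLeft ℂ (bcCoord f X (X.frame.x a) b) ∘ₗ LinearMap.proj a

theorem bcProj_apply (w : Fin X.frame.n → Ω') (b) :
    bcProj f X w b = ∑ a, bcCoord f X (X.frame.x a) b * w a := by
  simp only [bcProj, LinearMap.pi_apply, LinearMap.sum_apply]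
  rfl

theorem bcProj_ract (w : Fin X.frame.n → Ω') (α : Ω') :
    bcProj f X (fun b => w b * α) = fun b => bcProj f X w b * α := by
  funext b
  rw [bcProj_apply, bcProj_apply, Finset.sum_mul]
  exact Finset.sum_congr rfl fun a _ => (mul_assoc _ _ _).symm

theorem bcProj_lact (α : Ω') (w : Fin X.frame.n → Ω') :
    bcProj f X (fun b => α * w b) = fun b => α * bcProj f X w b := by
  funext b
  rw [bcProj_apply, bcProj_apply, Finset.mul_sum]
  refine Finset.sum_congr rfl fun a _ => ?_
  rw [← mul_assoc, bcCoord_x_comm, mul_assoc]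

theorem bcProj_mem {k : ℕ} {w : Fin X.frame.n → Ω'} (hw : ∀ a, w a ∈ Ω'.gr k) (b) :
    bcProj f X w b ∈ Ω'.gr k := by
  rw [bcProj_apply]
  refine sum_mem fun a _ => ?_
  have h := Ω'.mul_mem (bcCoord_mem f X (X.frame.x_mem a) b) (hw a)
  rwa [zero_add] at h

/-- The idempotent as a bimodule morphism. -/
noncomputable def bcIdem : GradedBimodule.Hom (free Ω' X.frame.n) (free Ω' X.frame.n) where
  toLin := bcProj f X
  map_mem := fun hw => mem_freeGr.2 (bcProj_mem f X (mem_freeGr.1 hw))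
  map_lact := fun α w => bcProj_lact f X α w
  map_ract := fun w α => bcProj_ract f X w α

/-- The idempotent fixes the coordinates of elements of `X`. -/
theorem bcProj_bcCoord (x : X.carrier) : bcProj f X (bcCoord f X x) = bcCoord f X x := by
  funext b
  rw [bcProj_apply]
  conv_rhs => rw [← X.frame.sum_eq x, map_sum, Finset.sum_apply]
  refine Finset.sum_congr rfl fun a _ => ?_
  rw [bcCoord_ract]
  rfl

/-- The idempotent fixes right multiples of coordinates of elements of `X`. -/
theorem bcProj_bcCoord_mul (x : X.carrier) (β : Ω') :
    bcProj f X (fun b => bcCoord f X x b * β) = fun b => bcCoord f X x b * β := by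
  have h := bcProj_ract f X (bcCoord f X x) β
  rw [bcProj_bcCoord] at h
  exact h

theorem bcProj_bcProj (w : Fin X.frame.n → Ω') :
    bcProj f X (bcProj f X w) = bcProj f X w := by
  have h : bcProj f X w = ∑ a, fun b => bcCoord f X (X.frame.x a) b * w a := by
    funext b
    rw [bcProj_apply, Finset.sum_apply]
  conv_lhs => rw [h, map_sum]
  rw [h]
  exact Finset.sum_congr rfl fun a _ => bcProj_bcCoord_mul f X _ _

/-- The underlying bimodule of the base change. -/
noncomputable def bcBimodule : GradedBimodule Ω' :=
  ofIdem (free Ω' X.frame.n) (bcIdem f X) (bcProj_bcProj f X)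

/-- The connection on `(Ω')ⁿ`, `w ↦ ∑ (∇ x_a) w_a + x_a dw_a`. -/
noncomputable def bcConnAux : (Fin X.frame.n → Ω') →ₗ[ℂ] (Fin X.frame.n → Ω') :=
  LinearMap.pi fun b => ∑ a,
    (LinearMap.mulLeft ℂ (bcCoord f X (X.conn (X.frame.x a)) b) ∘ₗ LinearMap.proj a +
    LinearMap.mulLeft ℂ (bcCoord f X (X.frame.x a) b) ∘ₗ Ω'.d ∘ₗ LinearMap.proj a)

theorem bcConnAux_apply (w : Fin X.frame.n → Ω') (b) :
    bcConnAux f X w b = ∑ a, (bcCoord f X (X.conn (X.frame.x a)) b * w a +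
      bcCoord f X (X.frame.x a) b * Ω'.d (w a)) := by
  simp only [bcConnAux, LinearMap.pi_apply, LinearMap.sum_apply]
  rfl

theorem bcConnAux_bcCoord (x : X.carrier) :
    bcConnAux f X (bcCoord f X x) = bcCoord f X (X.conn x) := by
  funext b
  rw [bcConnAux_apply]
  conv_rhs => rw [← X.frame.sum_eq x, map_sum, map_sum, Finset.sum_apply]
  refine Finset.sum_congr rfl fun a _ => ?_
  rw [X.conn_ract_zero (X.frame.x_mem a), map_add, Pi.add_apply, bcCoord_ract, bcCoord_ract,
    f.map_d]
  rfl

theorem bcConnAux_mem_fixed (w : Fin X.frame.n → Ω') :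
    bcProj f X (bcConnAux f X w) = bcConnAux f X w := by
  have h : bcConnAux f X w = ∑ a, ((fun b => bcCoord f X (X.conn (X.frame.x a)) b * w a) +
      fun b => bcCoord f X (X.frame.x a) b * Ω'.d (w a)) := by
    funext b
    rw [bcConnAux_apply, Finset.sum_apply]
    rfl
  rw [h, map_sum]
  refine Finset.sum_congr rfl fun a _ => ?_
  rw [map_add, bcProj_bcCoord_mul, bcProj_bcCoord_mul]

theorem bcConnAux_ract {k : ℕ} {w : Fin X.frame.n → Ω'} (hw : ∀ a, w a ∈ Ω'.gr k)
    (hT : bcProj f X w = w) (α : Ω') :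
    bcConnAux f X (fun b => w b * α) =
      fun b => bcConnAux f X w b * α + (-1 : ℂ) ^ k • (w b * Ω'.d α) := by
  funext b
  have hb : w b = ∑ a, bcCoord f X (X.frame.x a) b * w a := by
    rw [← bcProj_apply, hT]
  rw [bcConnAux_apply, bcConnAux_apply]
  conv_rhs => rw [hb, Finset.sum_mul, Finset.sum_mul, Finset.smul_sum, ← Finset.sum_add_distrib]
  refine Finset.sum_congr rfl fun a _ => ?_
  rw [Ω'.leibniz (hw a), mul_add, add_mul, mul_smul_comm, mul_assoc, mul_assoc, mul_assoc,
    add_assoc]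

theorem bcConnAux_mem {k : ℕ} {w : Fin X.frame.n → Ω'} (hw : ∀ a, w a ∈ Ω'.gr k) (b) :
    bcConnAux f X w b ∈ Ω'.gr (k + 1) := by
  rw [bcConnAux_apply]
  refine sum_mem fun a _ => add_mem ?_ ?_
  · have h := Ω'.mul_mem (bcCoord_mem f X (X.conn_mem (X.frame.x_mem a)) b) (hw a)
    rwa [show 0 + 1 + k = k + 1 by omega] at h
  · have h := Ω'.mul_mem (bcCoord_mem f X (X.frame.x_mem a) b) (Ω'.d_mem (hw a))
    rwa [zero_add] at h

theorem bcConnAux_lact {k : ℕ} {α : Ω'} (hα : α ∈ Ω'.gr k) {w : Fin X.frame.n → Ω'}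
    (hT : bcProj f X w = w) :
    bcConnAux f X (fun b => α * w b) =
      fun b => Ω'.d α * w b + (-1 : ℂ) ^ k • (α * bcConnAux f X w b) := by
  funext b
  have hb : w b = ∑ a, bcCoord f X (X.frame.x a) b * w a := by
    rw [← bcProj_apply, hT]
  rw [bcConnAux_apply, bcConnAux_apply]
  conv_rhs => rw [hb, Finset.mul_sum, Finset.mul_sum, Finset.smul_sum, ← Finset.sum_add_distrib]
  refine Finset.sum_congr rfl fun a _ => ?_
  have h1 := Ω'.comm (bcCoord_mem f X (X.conn_mem (X.frame.x_mem a)) b) hα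
  rw [Ω'.leibniz hα, ← mul_assoc, h1, mul_add, mul_add, ← mul_assoc _ (Ω'.d α), bcCoord_x_comm,
    mul_smul_comm, ← mul_assoc _ α, bcCoord_x_comm, smul_add]
  simp only [zero_add, one_mul, smul_mul_assoc, mul_assoc]
  abel

theorem bcConnAux_flat {w : Fin X.frame.n → Ω'} (hT : bcProj f X w = w) :
    bcConnAux f X (bcConnAux f X w) = 0 := by
  have hw : w = ∑ a, fun b => bcCoord f X (X.frame.x a) b * w a := by
    conv_lhs => rw [← hT]
    funext b
    rw [Finset.sum_apply, ← bcProj_apply]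
  rw [hw, map_sum, map_sum]
  refine Finset.sum_eq_zero fun a _ => ?_
  have h0 := bcConnAux_ract f X (bcCoord_mem f X (X.frame.x_mem a)) (bcProj_bcCoord f X _) (w a)
  have h1 := bcConnAux_ract f X (bcCoord_mem f X (X.conn_mem (X.frame.x_mem a)))
    (bcProj_bcCoord f X _) (w a)
  have h2 := bcConnAux_ract f X (bcCoord_mem f X (X.frame.x_mem a)) (bcProj_bcCoord f X _)
    (Ω'.d (w a))
  simp only [bcConnAux_bcCoord, X.flat, map_zero, Pi.zero_apply, zero_mul, zero_add, Ω'.d_d,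
    mul_zero, smul_zero, add_zero, pow_zero, one_smul, pow_one] at h0 h1 h2
  have h3 : (fun b => bcCoord f X (X.conn (X.frame.x a)) b * w a +
      bcCoord f X (X.frame.x a) b * Ω'.d (w a)) =
      (fun b => bcCoord f X (X.conn (X.frame.x a)) b * w a) +
      fun b => bcCoord f X (X.frame.x a) b * Ω'.d (w a) := rfl
  rw [h0, h3, map_add, h1, h2]
  funext b
  simp

theorem bcProj_fixed (w : (bcBimodule f X).carrier) : bcProj f X w.1 = w.1 :=
  (mem_fixed _ _).1 w.2

/-- The base change of a flat connection along a morphism of graded commutative dgas. -/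
noncomputable def baseChange : FlatBundle Ω' where
  toGradedBimodule := bcBimodule f X
  fgp := ofIdem_free_isFGP _ _ _
  conn := (bcConnAux f X).restrict fun w _ => (mem_fixed _ _).2 (bcConnAux_mem_fixed f X w)
  conn_mem := fun hw => mem_freeGr.2 (bcConnAux_mem f X (mem_freeGr.1 hw))
  conn_ract := fun {_ w} hw α =>
    Subtype.ext (bcConnAux_ract f X (mem_freeGr.1 hw) (bcProj_fixed f X w) α)
  conn_lact := fun hα w => Subtype.ext (bcConnAux_lact f X hα (bcProj_fixed f X w))
  flat := fun w => Subtype.ext (bcConnAux_flat f X (bcProj_fixed f X w))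

/-- The linear map underlying `toBaseChange`. -/
noncomputable def toBaseChangeLin : X.carrier →ₗ[ℂ] (baseChange f X).carrier :=
  LinearMap.codRestrict (fixed (free Ω' X.frame.n) (bcIdem f X)) (bcCoord f X) fun x =>
    (mem_fixed _ _).2 (bcProj_bcCoord f X x)

/-- The canonical map from `X` to its base change. -/
noncomputable def toBaseChange : SHom f X (baseChange f X) where
  toLin := toBaseChangeLin f X
  map_mem := fun hx => mem_freeGr.2 (bcCoord_mem f X hx)
  map_lact := fun α x => Subtype.ext <| funext fun b => by
    change f.toAlg (X.frame.ξ b (X.lact α x)) = f.toAlg α * f.toAlg (X.frame.ξ b x)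
    rw [X.frame.ξ_lact, map_mul]
  map_ract := fun x α => Subtype.ext <| funext fun b => bcCoord_ract f X x α b
  map_conn := fun x => Subtype.ext (bcConnAux_bcCoord f X x).symm

/-- An element of the base change as a vector of coordinates. -/
def bcVec (w : (baseChange f X).carrier) : Fin X.frame.n → Ω' := w.1

theorem bcVec_mem {k : ℕ} {w : (baseChange f X).carrier} (hw : w ∈ (baseChange f X).gr k) (a) :
    bcVec f X w a ∈ Ω'.gr k := mem_freeGr.1 hw a

theorem toBaseChange_sum (w : (baseChange f X).carrier) :
    ∑ a, (baseChange f X).ract ((toBaseChange f X).toLin (X.frame.x a)) (bcVec f X w a) = w := by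
  refine Subtype.ext (Eq.trans ?_ (bcProj_fixed f X w))
  refine (map_sum (fixed _ _).subtype _ _).trans ?_
  funext b
  refine (Finset.sum_apply b _ _).trans ?_
  exact (bcProj_apply f X w.1 b).symm

variable {f X} in
/-- The linear map `w ↦ ∑ φ(x_a) w_a`. -/
noncomputable def SHom.liftAux {g : CDGA.Hom Ω' Ω''} {Y : FlatBundle Ω''}
    (φ : SHom (g.comp f) X Y) : (Fin X.frame.n → Ω') →ₗ[ℂ] Y.carrier :=
  ∑ a, Y.ract (φ.toLin (X.frame.x a)) ∘ₗ g.toAlg.toLinearMap ∘ₗ LinearMap.proj a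

variable {f X} in
theorem SHom.liftAux_apply {g : CDGA.Hom Ω' Ω''} {Y : FlatBundle Ω''}
    (φ : SHom (g.comp f) X Y) (w : Fin X.frame.n → Ω') :
    φ.liftAux w = ∑ a, Y.ract (φ.toLin (X.frame.x a)) (g.toAlg (w a)) := by
  rw [liftAux, LinearMap.sum_apply]
  rfl

variable {f X} in
theorem SHom.liftAux_conn {g : CDGA.Hom Ω' Ω''} {Y : FlatBundle Ω''}
    (φ : SHom (g.comp f) X Y) (w : Fin X.frame.n → Ω') :
    φ.liftAux (bcConnAux f X w) = Y.conn (φ.liftAux w) := by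
  have key : ∀ x : X.carrier, ∀ β : Ω', ∑ b, Y.ract (φ.toLin (X.frame.x b))
      (g.toAlg (bcCoord f X x b * β)) = Y.ract (φ.toLin x) (g.toAlg β) := by
    intro x β
    conv_rhs => rw [← X.frame.sum_eq x, map_sum, map_sum, LinearMap.sum_apply]
    refine Finset.sum_congr rfl fun b _ => ?_
    rw [φ.map_ract, ← Y.ract_mul, map_mul]
    rfl
  rw [liftAux_apply, liftAux_apply]
  simp only [bcConnAux_apply, map_sum, map_add]
  rw [Finset.sum_comm]
  refine Finset.sum_congr rfl fun a _ => ?_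
  rw [Finset.sum_add_distrib, key, key, Y.conn_ract_zero (φ.map_mem (X.frame.x_mem a)),
    φ.map_conn, g.map_d]

variable {f X} in
/-- The universal property of the base change. -/
noncomputable def SHom.baseChangeLift {g : CDGA.Hom Ω' Ω''} {Y : FlatBundle Ω''}
    (φ : SHom (g.comp f) X Y) : SHom g (baseChange f X) Y where
  toLin := φ.liftAux ∘ₗ (fixed _ _).subtype
  map_mem := fun {k w} hw => by
    change φ.liftAux (bcVec f X w) ∈ _
    rw [liftAux_apply]
    refine sum_mem fun a _ => ?_
    have h := Y.ract_mem (φ.map_mem (X.frame.x_mem a)) (g.map_mem (bcVec_mem f X hw a))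
    rwa [zero_add] at h
  map_lact := fun α w => by
    change φ.liftAux (fun a => α * bcVec f X w a) = Y.lact _ (φ.liftAux (bcVec f X w))
    rw [liftAux_apply, liftAux_apply, map_sum]
    refine Finset.sum_congr rfl fun a _ => ?_
    rw [map_mul, Y.ract_mul, ← Y.fgp.lact_of_mem_zero (φ.map_mem (X.frame.x_mem a)), Y.ract_lact]
  map_ract := fun w α => by
    change φ.liftAux (fun a => bcVec f X w a * α) = Y.ract (φ.liftAux (bcVec f X w)) _
    rw [liftAux_apply, liftAux_apply, map_sum, LinearMap.sum_apply]
    refine Finset.sum_congr rfl fun a _ => ?_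
    rw [map_mul, Y.ract_mul]
  map_conn := fun w => φ.liftAux_conn (bcVec f X w)

variable {f X} in
theorem SHom.baseChangeLift_apply {g : CDGA.Hom Ω' Ω''} {Y : FlatBundle Ω''}
    (φ : SHom (g.comp f) X Y) (x : X.carrier) :
    φ.baseChangeLift.toLin ((toBaseChange f X).toLin x) = φ.toLin x := by
  change φ.liftAux (bcCoord f X x) = _
  conv_rhs => rw [← X.frame.sum_eq x, map_sum]
  rw [liftAux_apply]
  refine Finset.sum_congr rfl fun b _ => ?_
  rw [φ.map_ract]
  rfl

end BaseChange

end FlatBundle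

end NCG

namespace NCG

namespace FlatBundle

variable {Ω Ω' Ω'' : CDGA.{u}}

/-! ### Fibres of tensor products and of base changes -/

section Fibre

variable (p : Ω.gr 0 →ₐ[ℂ] ℂ)

/-- The class in the fibre of an element of degree `0`. -/
def fibreMk (X : FlatBundle Ω) : X.gr 0 →ₗ[ℂ] Fibre p X := (fibreRel p X).mkQ

theorem fibreMk_surjective (X : FlatBundle Ω) : Function.Surjective (fibreMk p X) :=
  (fibreRel p X).mkQ_surjective

theorem fibreMk_act (X : FlatBundle Ω) (a : Ω.gr 0) (e : X.gr 0) :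
    fibreMk p X (act₀ X a e) = p a • fibreMk p X e := by
  rw [← sub_eq_zero, ← map_smul, ← map_sub, fibreMk, Submodule.mkQ_apply,
    Submodule.Quotient.mk_eq_zero]
  exact Submodule.subset_span ⟨a, e, rfl⟩

/-- Linear maps on a fibre agree if they agree on the classes of elements of degree `0`. -/
theorem fibre_ext {X : FlatBundle Ω} {P : Type*} [AddCommGroup P] [Module ℂ P]
    {f g : Fibre p X →ₗ[ℂ] P} (h : ∀ e, f (fibreMk p X e) = g (fibreMk p X e)) : f = g :=
  LinearMap.ext fun x => by
    obtain ⟨e, rfl⟩ := fibreMk_surjective p X x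
    exact h e

/-- The linear map on a fibre induced by a map in degree `0`. -/
def fibreLift {X : FlatBundle Ω} {P : Type*} [AddCommGroup P] [Module ℂ P]
    (f : X.gr 0 →ₗ[ℂ] P) (h : ∀ a e, f (act₀ X a e) = p a • f e) : Fibre p X →ₗ[ℂ] P :=
  (fibreRel p X).liftQ f <| by
    rw [fibreRel, Submodule.span_le]
    rintro _ ⟨a, e, rfl⟩
    rw [SetLike.mem_coe, LinearMap.mem_ker, map_sub, h, map_smul, sub_self]

theorem fibreFunctor_map_mk {X Y : FlatBundle Ω} (φ : X ⟶ Y) (e : X.gr 0) :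
    ((fibreFunctor p).map φ).hom (fibreMk p X e) = fibreMk p Y (Hom.map₀ φ e) := rfl

theorem fibreTensor_mk {X Y : FlatBundle Ω} (e : X.gr 0) (f : Y.gr 0) :
    fibreTensor p X Y (fibreMk p X e ⊗ₜ fibreMk p Y f) =
      fibreMk p (tensor X Y) ⟨GradedBimodule.tm _ _ (e : X.carrier) (f : Y.carrier),
        GradedBimodule.tm_mem (k := 0) (l := 0) e.2 f.2⟩ := rfl

/-- The component of degree `0`. -/
noncomputable def proj₀ (X : FlatBundle Ω) : X.carrier →ₗ[ℂ] X.gr 0 :=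
  (gradedProj X.internal 0).codRestrict (X.gr 0) (gradedProj_mem X.internal 0)

theorem proj₀_of_mem (X : FlatBundle Ω) {e : X.carrier} (he : e ∈ X.gr 0) :
    proj₀ X e = ⟨e, he⟩ := Subtype.ext (gradedProj_same X.internal he)

theorem proj₀_of_pos (X : FlatBundle Ω) {k : ℕ} (hk : k ≠ 0) {e : X.carrier} (he : e ∈ X.gr k) :
    proj₀ X e = 0 := Subtype.ext (gradedProj_ne X.internal hk he)

/-- The composition of the projection of `Ω` to degree `0` with `p`. -/
noncomputable def pointProj : Ω →ₗ[ℂ] ℂ :=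
  p.toLinearMap ∘ₗ (gradedProj Ω.internal 0).codRestrict (Ω.gr 0) (gradedProj_mem Ω.internal 0)

theorem pointProj_of_mem {a : Ω} (ha : a ∈ Ω.gr 0) : pointProj p a = p ⟨a, ha⟩ :=
  congrArg p (Subtype.ext (gradedProj_same Ω.internal ha))

theorem pointProj_of_pos {k : ℕ} (hk : k ≠ 0) {a : Ω} (ha : a ∈ Ω.gr k) : pointProj p a = 0 := by
  have : (gradedProj Ω.internal 0).codRestrict (Ω.gr 0) (gradedProj_mem Ω.internal 0) a = 0 :=
    Subtype.ext (gradedProj_ne Ω.internal hk ha)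
  rw [pointProj, LinearMap.comp_apply, this, map_zero]

/-- On the fibre, `Ω` acts through the projection to degree `0` followed by `p`. -/
theorem fibreMk_proj₀_lact (X : FlatBundle Ω) (α : Ω) (e : X.carrier) :
    fibreMk p X (proj₀ X (X.lact α e)) = pointProj p α • fibreMk p X (proj₀ X e) := by
  refine graded_induction Ω.iSup_gr (P := fun α => fibreMk p X (proj₀ X (X.lact α e)) =
    pointProj p α • fibreMk p X (proj₀ X e)) ?_
    (fun x y hx hy => by
      simp only [map_add, LinearMap.add_apply, hx, hy, add_smul]) α
  intro k α hα
  refine graded_induction X.iSup_gr (P := fun e => fibreMk p X (proj₀ X (X.lact α e)) =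
    pointProj p α • fibreMk p X (proj₀ X e)) ?_
    (fun x y hx hy => by simp only [map_add, hx, hy, smul_add]) e
  intro l e he
  have h := X.lact_mem hα he
  by_cases hl : l = 0
  · subst hl
    by_cases hk : k = 0
    · subst hk
      rw [proj₀_of_mem X h, proj₀_of_mem X he, pointProj_of_mem p hα, ← fibreMk_act]
      rfl
    · rw [proj₀_of_pos X (by omega) h, pointProj_of_pos p hk hα, zero_smul, map_zero]
  · rw [proj₀_of_pos X (by omega) h, proj₀_of_pos X hl he, map_zero, smul_zero]

theorem fibreMk_proj₀_ract (X : FlatBundle Ω) (α : Ω) (e : X.carrier) :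
    fibreMk p X (proj₀ X (X.ract e α)) = pointProj p α • fibreMk p X (proj₀ X e) := by
  rw [← fibreMk_proj₀_lact]
  refine graded_induction X.iSup_gr (P := fun e => fibreMk p X (proj₀ X (X.ract e α)) =
    fibreMk p X (proj₀ X (X.lact α e))) ?_
    (fun x y hx hy => by simp only [map_add, LinearMap.add_apply, hx, hy]) e
  intro l e he
  refine graded_induction Ω.iSup_gr (P := fun α => fibreMk p X (proj₀ X (X.ract e α)) =
    fibreMk p X (proj₀ X (X.lact α e))) ?_
    (fun x y hx hy => by simp only [map_add, LinearMap.add_apply, hx, hy]) α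
  intro k α hα
  by_cases hl : l = 0
  · subst hl
    rw [X.fgp.lact_of_mem_zero he]
  · rw [proj₀_of_pos X (by omega) (X.ract_mem he hα), proj₀_of_pos X (by omega) (X.lact_mem hα he)]

/-- The canonical map from the tensor product of fibres to the fibre of the tensor product is
bijective. The inverse is induced by the projections to degree `0`, which make sense on the tensor
product over `Ω`; surjectivity holds because only products of elements of degree `0` have degree
`0`. -/
theorem fibreTensor_bijective (X Y : FlatBundle Ω) : Function.Bijective (fibreTensor p X Y) := by
  constructor
  · let B : X.carrier →ₗ[ℂ] Y.carrier →ₗ[ℂ] Fibre p X ⊗[ℂ] Fibre p Y :=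
      ((TensorProduct.mk ℂ (Fibre p X) (Fibre p Y)).compl₂ (fibreMk p Y ∘ₗ proj₀ Y)) ∘ₗ
        (fibreMk p X ∘ₗ proj₀ X)
    have hB : ∀ e f, B e f = fibreMk p X (proj₀ X e) ⊗ₜ fibreMk p Y (proj₀ Y f) := fun _ _ => rfl
    let ψ := GradedBimodule.tLift (E := X.toGradedBimodule) (F := Y.toGradedBimodule) B
      (fun e α f => by
        rw [hB, hB, fibreMk_proj₀_ract, fibreMk_proj₀_lact, TensorProduct.smul_tmul])
    have hψ : ∀ e f, ψ (GradedBimodule.tm _ _ e f) =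
        fibreMk p X (proj₀ X e) ⊗ₜ fibreMk p Y (proj₀ Y f) := fun _ _ => rfl
    have hact : ∀ (a : Ω.gr 0) (x : (tensor X Y).carrier),
        ψ ((tensor X Y).lact a x) = p a • ψ x := by
      intro a x
      refine GradedBimodule.tm_induction
        (P := fun x => ψ (GradedBimodule.tL _ _ (a : Ω) x) = p a • ψ x) (fun e f => ?_)
        (fun x y hx hy => by rw [map_add, map_add, map_add, hx, hy, smul_add]) x
      rw [GradedBimodule.tL_tm, hψ, hψ, fibreMk_proj₀_lact, pointProj_of_mem p a.2,
        TensorProduct.smul_tmul']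
    let ψ' : Fibre p (tensor X Y) →ₗ[ℂ] Fibre p X ⊗[ℂ] Fibre p Y :=
      fibreLift p (X := tensor X Y) (ψ ∘ₗ ((tensor X Y).gr 0).subtype) fun a e => hact a e
    have h : ψ' ∘ₗ fibreTensor p X Y = LinearMap.id := by
      refine TensorProduct.ext' fun x y => ?_
      obtain ⟨e, rfl⟩ := fibreMk_surjective p X x
      obtain ⟨f, rfl⟩ := fibreMk_surjective p Y y
      rw [LinearMap.comp_apply, fibreTensor_mk]
      change ψ (GradedBimodule.tm _ _ (e : X.carrier) (f : Y.carrier)) = _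
      rw [hψ, proj₀_of_mem X e.2, proj₀_of_mem Y f.2]
      rfl
    exact Function.LeftInverse.injective (g := ψ') fun x => LinearMap.congr_fun h x
  · intro z
    obtain ⟨⟨x, hx⟩, rfl⟩ := fibreMk_surjective p (tensor X Y) z
    have key : ∃ h : x ∈ (tensor X Y).gr 0, fibreMk p (tensor X Y) ⟨x, h⟩ ∈
        LinearMap.range (fibreTensor p X Y) := by
      refine GradedBimodule.tGr_induction (E := X.toGradedBimodule) (F := Y.toGradedBimodule)
        (P := fun x => ∃ h : x ∈ (tensor X Y).gr 0,
        fibreMk p (tensor X Y) ⟨x, h⟩ ∈ LinearMap.range (fibreTensor p X Y)) ?_ ?_ ?_ ?_ hx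
      · intro k l hkl e he f hf
        obtain ⟨rfl, rfl⟩ : k = 0 ∧ l = 0 := by omega
        exact ⟨GradedBimodule.tm_mem (k := 0) (l := 0) he hf,
          ⟨fibreMk p X ⟨e, he⟩ ⊗ₜ fibreMk p Y ⟨f, hf⟩, fibreTensor_mk p _ _⟩⟩
      · exact ⟨zero_mem _, zero_mem _⟩
      · rintro x y ⟨hx, hx'⟩ ⟨hy, hy'⟩
        exact ⟨add_mem hx hy, add_mem hx' hy'⟩
      · rintro c x ⟨hx, hx'⟩
        exact ⟨Submodule.smul_mem _ c hx, Submodule.smul_mem _ c hx'⟩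
    exact key.2

end Fibre

namespace SHom

variable {f : CDGA.Hom Ω Ω'} {X : FlatBundle Ω} {Y : FlatBundle Ω'}

/-- The map in degree `0`. -/
def map₀ (φ : SHom f X Y) : X.gr 0 →ₗ[ℂ] Y.gr 0 := φ.toLin.restrict fun _ he => φ.map_mem he

variable {p : Ω.gr 0 →ₐ[ℂ] ℂ} {p' : Ω'.gr 0 →ₐ[ℂ] ℂ}

/-- The map on fibres induced by a semilinear map. -/
def fibreMap (φ : SHom f X Y) (h : ∀ a, p' (f.map₀ a) = p a) : Fibre p X →ₗ[ℂ] Fibre p' Y :=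
  fibreLift p (fibreMk p' Y ∘ₗ φ.map₀) fun a e => by
    rw [← h, LinearMap.comp_apply, LinearMap.comp_apply, ← fibreMk_act]
    congr 1
    exact Subtype.ext (φ.map_lact a e)

/-- A semilinear map that is bijective in degree `0`, along a morphism that is surjective in
degree `0`, is bijective on fibres. -/
theorem fibreMap_bijective (φ : SHom f X Y) (h : ∀ a, p' (f.map₀ a) = p a)
    (hf : Function.Surjective f.map₀) (hφ : Function.Bijective φ.map₀) :
    Function.Bijective (φ.fibreMap h) := by
  let e := LinearEquiv.ofBijective φ.map₀ hφ
  let ψ : Fibre p' Y →ₗ[ℂ] Fibre p X :=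
    fibreLift p' (fibreMk p X ∘ₗ e.symm.toLinearMap) fun a y => by
      obtain ⟨a, rfl⟩ := hf a
      obtain ⟨x, rfl⟩ := e.surjective y
      have : act₀ Y (f.map₀ a) (e x) = e (act₀ X a x) := Subtype.ext (φ.map_lact a x).symm
      rw [this, LinearMap.comp_apply, LinearMap.comp_apply]
      simp only [LinearEquiv.coe_coe, LinearEquiv.symm_apply_apply]
      rw [fibreMk_act, h]
  refine Function.bijective_iff_has_inverse.2 ⟨ψ, fun x => ?_, fun y => ?_⟩
  · obtain ⟨x, rfl⟩ := fibreMk_surjective p X x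
    change fibreMk p X (e.symm (e x)) = _
    rw [e.symm_apply_apply]
  · obtain ⟨y, rfl⟩ := fibreMk_surjective p' Y y
    change fibreMk p' Y (e (e.symm y)) = _
    rw [e.apply_symm_apply]

end SHom

section Comparison

variable (f : CDGA.Hom Ω Ω') (hf : Function.Bijective f.map₀)

/-- In degree `0`, the base change along a morphism that is bijective in degree `0` changes
nothing. -/
theorem toBaseChange_map₀_bijective (hf : Function.Bijective f.map₀) (X : FlatBundle Ω) :
    Function.Bijective (toBaseChange f X).map₀ := by
  constructor
  · rw [injective_iff_map_eq_zero]
    intro x hx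
    have h0 : bcCoord f X x = 0 := congrArg (fun z => bcVec f X (z : (baseChange f X).gr 0).1) hx
    have h1 : ∀ a, X.frame.ξ a x = 0 := by
      intro a
      have h2 : f.map₀ ⟨X.frame.ξ a x, X.frame.ξ_mem x.2 a⟩ = f.map₀ 0 :=
        Subtype.ext ((congrFun h0 a).trans (map_zero f.toAlg).symm)
      exact congrArg Subtype.val (hf.1 h2)
    refine Subtype.ext ?_
    rw [← X.frame.sum_eq (x : X.carrier)]
    exact Finset.sum_eq_zero fun a _ => by rw [h1, map_zero]
  · intro w
    choose α hα using fun a => hf.2 ⟨bcVec f X w.1 a, bcVec_mem f X w.2 a⟩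
    refine ⟨∑ a, ⟨X.ract (X.frame.x a) (α a), X.ract_mem (X.frame.x_mem a) (α a).2⟩,
      Subtype.ext ?_⟩
    rw [map_sum, AddSubmonoidClass.coe_finsetSum]
    conv_rhs => rw [← toBaseChange_sum f X w.1]
    refine Finset.sum_congr rfl fun a _ => ?_
    change (toBaseChange f X).toLin (X.ract _ _) = _
    rw [(toBaseChange f X).map_ract]
    congr 1
    exact congrArg Subtype.val (hα a)

variable {p : Ω.gr 0 →ₐ[ℂ] ℂ} {p' : Ω'.gr 0 →ₐ[ℂ] ℂ} (h : ∀ a, p' (f.map₀ a) = p a)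

/-- The isomorphism of the fibre of `X` with the fibre of its base change. -/
noncomputable def baseChangeFibre (X : FlatBundle Ω) : Fibre p X ≃ₗ[ℂ] Fibre p' (baseChange f X) :=
  LinearEquiv.ofBijective ((toBaseChange f X).fibreMap h)
    ((toBaseChange f X).fibreMap_bijective h hf.2 (toBaseChange_map₀_bijective f hf X))

/-- The morphism of base changes induced by a semilinear map. -/
noncomputable def SHom.bcHom {f : CDGA.Hom Ω Ω'} {X : FlatBundle Ω} {Y : FlatBundle Ω'}
    (φ : SHom f X Y) : baseChange f X ⟶ Y :=
  (SHom.baseChangeLift (g := CDGA.Hom.id Ω') (f := f) φ).toHom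

theorem SHom.bcHom_fibre {f : CDGA.Hom Ω Ω'} (hf : Function.Bijective f.map₀)
    (h : ∀ a, p' (f.map₀ a) = p a) {X : FlatBundle Ω} {Y : FlatBundle Ω'} (φ : SHom f X Y) :
    ((fibreFunctor p').map φ.bcHom).hom ∘ₗ (baseChangeFibre f hf h X).toLinearMap =
      φ.fibreMap h := by
  refine fibre_ext p fun e => ?_
  change fibreMk p' Y _ = fibreMk p' Y _
  congr 1
  exact Subtype.ext (SHom.baseChangeLift_apply (g := CDGA.Hom.id Ω') (f := f) φ e)

variable (Ω) in
/-- The morphism `f` as a semilinear map of the unit objects. -/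
noncomputable def SHom.unit : SHom f (FlatBundle.unit Ω) (FlatBundle.unit Ω') where
  toLin := f.toAlg.toLinearMap
  map_mem := f.map_mem
  map_lact := map_mul f.toAlg
  map_ract := map_mul f.toAlg
  map_conn := f.map_d

/-- The linear map underlying the tensor product of two semilinear maps. -/
noncomputable def SHom.tensorLin {f : CDGA.Hom Ω Ω'} {X Y : FlatBundle Ω} {X' Y' : FlatBundle Ω'}
    (φ : SHom f X X') (ψ : SHom f Y Y') :
    GradedBimodule.TensorCarrier X.toGradedBimodule Y.toGradedBimodule →ₗ[ℂ]
      GradedBimodule.TensorCarrier X'.toGradedBimodule Y'.toGradedBimodule :=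
  GradedBimodule.tLift
    ((GradedBimodule.tm X'.toGradedBimodule Y'.toGradedBimodule).compl₁₂ φ.toLin ψ.toLin)
    fun e α g => by
      simp only [LinearMap.compl₁₂_apply]
      rw [φ.map_ract, ψ.map_lact, GradedBimodule.tm_balanced]

theorem SHom.tensorLin_tm {f : CDGA.Hom Ω Ω'} {X Y : FlatBundle Ω} {X' Y' : FlatBundle Ω'}
    (φ : SHom f X X') (ψ : SHom f Y Y') (e : X.carrier) (g : Y.carrier) :
    φ.tensorLin ψ (GradedBimodule.tm _ _ e g) =
      GradedBimodule.tm _ _ (φ.toLin e) (ψ.toLin g) := rfl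

/-- The tensor product of two semilinear maps. -/
noncomputable def SHom.tensor {f : CDGA.Hom Ω Ω'} {X Y : FlatBundle Ω} {X' Y' : FlatBundle Ω'}
    (φ : SHom f X X') (ψ : SHom f Y Y') :
    SHom f (FlatBundle.tensor X Y) (FlatBundle.tensor X' Y') where
  toLin := φ.tensorLin ψ
  map_mem := fun {r x} hx => by
    refine GradedBimodule.tGr_induction (E := X.toGradedBimodule) (F := Y.toGradedBimodule)
      (P := fun x => φ.tensorLin ψ x ∈ GradedBimodule.tGr _ _ r) ?_
      (by rw [map_zero]; exact zero_mem _)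
      (fun a b ha hb => by rw [map_add]; exact add_mem ha hb)
      (fun c a ha => by rw [map_smul]; exact Submodule.smul_mem _ _ ha) hx
    rintro k l rfl e he g hg
    exact GradedBimodule.tm_mem (φ.map_mem he) (ψ.map_mem hg)
  map_lact := fun α x => by
    refine GradedBimodule.tm_induction (P := fun x => φ.tensorLin ψ
      (GradedBimodule.tL _ _ α x) = GradedBimodule.tL _ _ (f.toAlg α)
        (φ.tensorLin ψ x)) (fun e g => ?_)
      (fun x y hx hy => by simp only [map_add, hx, hy]) x
    rw [GradedBimodule.tL_tm, SHom.tensorLin_tm, SHom.tensorLin_tm, φ.map_lact,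
      GradedBimodule.tL_tm]
  map_ract := fun x α => by
    refine GradedBimodule.tm_induction (P := fun x => φ.tensorLin ψ
      (GradedBimodule.tR _ _ x α) = GradedBimodule.tR _ _
        (φ.tensorLin ψ x) (f.toAlg α)) (fun e g => ?_)
      (fun x y hx hy => by simp only [map_add, LinearMap.add_apply, hx, hy]) x
    rw [GradedBimodule.tR_tm, SHom.tensorLin_tm, SHom.tensorLin_tm, ψ.map_ract,
      GradedBimodule.tR_tm]
  map_conn := fun x => by
    refine tm_hom_induction (P := fun x => φ.tensorLin ψ (tConn X Y x) =
      tConn X' Y' (φ.tensorLin ψ x)) (fun k e he g => ?_)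
      (fun x y hx hy => by simp only [map_add, hx, hy]) x
    rw [tConn_tm he, map_add, map_smul, SHom.tensorLin_tm, SHom.tensorLin_tm, SHom.tensorLin_tm,
      tConn_tm (φ.map_mem he), φ.map_conn, ψ.map_conn]

theorem SHom.bcHom_bijective {f : CDGA.Hom Ω Ω'} (hf : Function.Bijective f.map₀)
    (h : ∀ a, p' (f.map₀ a) = p a) {X : FlatBundle Ω} {Y : FlatBundle Ω'} (φ : SHom f X Y)
    (hφ : Function.Bijective (φ.fibreMap h)) :
    Function.Bijective ((fibreFunctor p').map φ.bcHom).hom := by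
  rw [← SHom.bcHom_fibre hf h φ] at hφ
  exact (Function.Bijective.of_comp_iff _ (baseChangeFibre f hf h X).bijective).1 hφ

theorem SHom.tensor_fibreMap {f : CDGA.Hom Ω Ω'} (h : ∀ a, p' (f.map₀ a) = p a)
    {X Y : FlatBundle Ω} {X' Y' : FlatBundle Ω'} (φ : SHom f X X') (ψ : SHom f Y Y') :
    (φ.tensor ψ).fibreMap h ∘ₗ fibreTensor p X Y =
      fibreTensor p' X' Y' ∘ₗ TensorProduct.map (φ.fibreMap h) (ψ.fibreMap h) := by
  refine TensorProduct.ext' fun x y => ?_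
  obtain ⟨e, rfl⟩ := fibreMk_surjective p X x
  obtain ⟨g, rfl⟩ := fibreMk_surjective p Y y
  rfl

/-- The tensor product of semilinear maps that are bijective on fibres is bijective on fibres. -/
theorem SHom.tensor_fibreMap_bijective {f : CDGA.Hom Ω Ω'} (h : ∀ a, p' (f.map₀ a) = p a)
    {X Y : FlatBundle Ω} {X' Y' : FlatBundle Ω'} (φ : SHom f X X') (ψ : SHom f Y Y')
    (hφ : Function.Bijective (φ.fibreMap h)) (hψ : Function.Bijective (ψ.fibreMap h)) :
    Function.Bijective ((φ.tensor ψ).fibreMap h) := by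
  have h3 : Function.Bijective (fibreTensor p' X' Y' ∘ₗ
      TensorProduct.map (φ.fibreMap h) (ψ.fibreMap h)) :=
    (fibreTensor_bijective p' _ _).comp
      (TensorProduct.congr (LinearEquiv.ofBijective _ hφ)
        (LinearEquiv.ofBijective _ hψ)).bijective
  rw [← SHom.tensor_fibreMap h] at h3
  exact (Function.Bijective.of_comp_iff _ (fibreTensor_bijective p X Y)).1 h3

/-- Base change along a morphism that is bijective in degree `0` as a comparison of fibre
functors. -/
noncomputable def baseChangeComparison :
    FibreFunctorData.Comparison (fibreData p) (fibreData p') where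
  obj := baseChange f
  iso := baseChangeFibre f hf h
  nat := fun {X Y} φ => by
    refine ⟨SHom.bcHom (f := f) ((toBaseChange f Y).comp (SHom.ofHom φ)), ?_⟩
    refine (SHom.bcHom_fibre hf h (f := f) ((toBaseChange f Y).comp (SHom.ofHom φ))).trans ?_
    exact fibre_ext p fun e => rfl
  unit := ⟨(SHom.unit Ω f).bcHom, (SHom.bcHom_bijective hf h (SHom.unit Ω f)
    ((SHom.unit Ω f).fibreMap_bijective h hf.2 hf)).1⟩
  tensor := fun X Y => by
    refine ⟨_, SHom.bcHom ((toBaseChange f X).tensor (toBaseChange f Y)), 𝟙 _, ?_, ?_⟩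
    · exact (SHom.bcHom_bijective hf h _ (SHom.tensor_fibreMap_bijective h _ _
        (baseChangeFibre f hf h X).bijective (baseChangeFibre f hf h Y).bijective)).1
    · have h1 := SHom.bcHom_fibre hf h ((toBaseChange f X).tensor (toBaseChange f Y))
      refine (congrArg (fun q => q ∘ₗ fibreTensor p X Y) h1).trans
        ((SHom.tensor_fibreMap h _ _).trans ?_)
      refine TensorProduct.ext' fun x y => ?_
      obtain ⟨e, rfl⟩ := fibreMk_surjective p X x
      obtain ⟨g, rfl⟩ := fibreMk_surjective p Y y
      rfl

end Comparison

end FlatBundle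

end NCG

namespace NCG

/-! ### Contractions and the residues of a flat connection -/

/-- Closed elements `v_j` of degree `1` with contractions `c_j`: the `c_j` are of
degree `-1`, satisfy the signed Leibniz rule against factors of degree `0` and `1`,
anticommute with `d`, and `c_j v_i = δ_{ij}`. -/
structure CDGA.Cartan (B : CDGA.{u}) (n : ℕ) where
  v : Fin n → B
  v_mem : ∀ j, v j ∈ B.gr 1
  d_v : ∀ j, B.d (v j) = 0
  c : Fin n → B →ₗ[ℂ] B
  c_mem : ∀ j {γ : B}, γ ∈ B.gr 1 → c j γ ∈ B.gr 0
  c_zero : ∀ j {a : B}, a ∈ B.gr 0 → c j a = 0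
  c_mul_zero : ∀ j {a : B}, a ∈ B.gr 0 → ∀ β, c j (a * β) = a * c j β
  c_mul_one : ∀ j {γ : B}, γ ∈ B.gr 1 → ∀ β, c j (γ * β) = c j γ * β - γ * c j β
  c_v : ∀ i j, c j (v i) = if i = j then 1 else 0
  c_d : ∀ j β, c j (B.d β) + B.d (c j β) = 0

namespace FlatBundle

open GradedBimodule

variable {B : CDGA.{u}}

/-- The algebra of parallel endomorphisms of a flat connection. -/
def parallel (E : FlatBundle B) : Subalgebra ℂ (Module.End ℂ E.carrier) where
  carrier := {T | (∀ k, ∀ e ∈ E.gr k, T e ∈ E.gr k) ∧ (∀ α e, T (E.lact α e) = E.lact α (T e)) ∧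
    (∀ e α, T (E.ract e α) = E.ract (T e) α) ∧ ∀ e, T (E.conn e) = E.conn (T e)}
  mul_mem' := by
    rintro S T ⟨s1, s2, s3, s4⟩ ⟨t1, t2, t3, t4⟩
    exact ⟨fun k e he => s1 k _ (t1 k e he), fun α e => by simp [s2, t2],
      fun e α => by simp [s3, t3], fun e => by simp [s4, t4]⟩
  add_mem' := by
    rintro S T ⟨s1, s2, s3, s4⟩ ⟨t1, t2, t3, t4⟩
    exact ⟨fun k e he => add_mem (s1 k e he) (t1 k e he), fun α e => by simp [s2, t2],
      fun e α => by simp [s3, t3], fun e => by simp [s4, t4]⟩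
  algebraMap_mem' := fun c => ⟨fun k e he => Submodule.smul_mem _ c he,
    fun α e => by simp [Module.algebraMap_end_apply], fun e α => by
      simp [Module.algebraMap_end_apply], fun e => by simp [Module.algebraMap_end_apply]⟩

/-- A parallel endomorphism as a morphism. -/
def parallelHom {E : FlatBundle B} {T : Module.End ℂ E.carrier} (hT : T ∈ E.parallel) : E ⟶ E :=
  (⟨⟨T, fun {k _} he => hT.1 k _ he, hT.2.1, hT.2.2.1⟩, hT.2.2.2⟩ : Hom E E)

/-- The action of parallel endomorphisms on the fibre. -/
def parallelFibre (p : B.gr 0 →ₐ[ℂ] ℂ) (E : FlatBundle B) :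
    E.parallel →ₐ[ℂ] Module.End ℂ (Fibre p E) :=
  AlgHom.ofLinearMap
    { toFun := fun T => Hom.fibreMap p (parallelHom T.2)
      map_add' := fun _ _ => fibre_ext p fun _ => rfl
      map_smul' := fun _ _ => fibre_ext p fun _ => rfl }
    (fibre_ext p fun _ => rfl) (fun _ _ => fibre_ext p fun _ => rfl)

theorem parallelFibre_mk (p : B.gr 0 →ₐ[ℂ] ℂ) (E : FlatBundle B) (T : E.parallel) (e : E.gr 0) :
    parallelFibre p E T (fibreMk p E e) = fibreMk p E ⟨T.1 e, T.2.1 0 e e.2⟩ := rfl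

/-- An endomorphism that is linear over `B` on elements of degree `0` and commutes with the
connection is parallel. -/
theorem mem_parallel_of_zero {E : FlatBundle B} {T : Module.End ℂ E.carrier}
    (h₀ : ∀ e ∈ E.gr 0, T e ∈ E.gr 0) (h : ∀ e ∈ E.gr 0, ∀ α, T (E.ract e α) = E.ract (T e) α)
    (hc : ∀ e, T (E.conn e) = E.conn (T e)) : T ∈ E.parallel := by
  exact ⟨fun k e he => (GradedBimodule.Hom.ofZero E.fgp E.fgp T h₀ h).map_mem he,
    (GradedBimodule.Hom.ofZero E.fgp E.fgp T h₀ h).map_lact,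
    (GradedBimodule.Hom.ofZero E.fgp E.fgp T h₀ h).map_ract, hc⟩

section Cartan

variable {n : ℕ} (K : B.Cartan n)

/-- The contraction on a finitely generated projective bimodule, `e β ↦ e c_j(β)` for `e`
of degree `0`. -/
noncomputable def contr (E : FlatBundle B) (j : Fin n) : Module.End ℂ E.carrier :=
  ∑ a, E.ract (E.frame.x a) ∘ₗ K.c j ∘ₗ E.frame.ξ a

theorem contr_apply (E : FlatBundle B) (j : Fin n) (x : E.carrier) :
    contr K E j x = ∑ a, E.ract (E.frame.x a) (K.c j (E.frame.ξ a x)) := by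
  rw [contr, LinearMap.sum_apply]
  rfl

theorem contr_ract_zero (E : FlatBundle B) (j : Fin n) {e : E.carrier} (he : e ∈ E.gr 0) (β : B) :
    contr K E j (E.ract e β) = E.ract e (K.c j β) := by
  rw [contr_apply]
  conv_rhs => rw [← E.frame.sum_eq e, map_sum, LinearMap.sum_apply]
  refine Finset.sum_congr rfl fun a _ => ?_
  rw [E.frame.ξ_ract, K.c_mul_zero j (E.frame.ξ_mem he a), E.ract_mul]

theorem contr_zero (E : FlatBundle B) (j : Fin n) {e : E.carrier} (he : e ∈ E.gr 0) :
    contr K E j e = 0 := by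
  rw [← E.ract_one e, contr_ract_zero K E j he, K.c_zero j B.one_mem, map_zero]

theorem contr_mem (E : FlatBundle B) (j : Fin n) {y : E.carrier} (hy : y ∈ E.gr 1) :
    contr K E j y ∈ E.gr 0 := by
  rw [contr_apply]
  refine sum_mem fun a _ => ?_
  exact E.ract_mem (k := 0) (l := 0) (E.frame.x_mem a) (K.c_mem j (E.frame.ξ_mem hy a))

theorem contr_ract_one (E : FlatBundle B) (j : Fin n) {y : E.carrier} (hy : y ∈ E.gr 1) (β : B) :
    contr K E j (E.ract y β) = E.ract (contr K E j y) β - E.ract y (K.c j β) := by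
  have h : E.ract y (K.c j β) = ∑ a, E.ract (E.frame.x a) (E.frame.ξ a y * K.c j β) := by
    conv_lhs => rw [← E.frame.sum_eq y, map_sum, LinearMap.sum_apply]
    exact Finset.sum_congr rfl fun a _ => (E.ract_mul _ _ _).symm
  rw [contr_apply, contr_apply, h, map_sum, LinearMap.sum_apply, ← Finset.sum_sub_distrib]
  refine Finset.sum_congr rfl fun a _ => ?_
  rw [E.frame.ξ_ract, K.c_mul_one j (E.frame.ξ_mem hy a), map_sub, E.ract_mul]

theorem contr_nat {E F : FlatBundle B} (φ : FlatBundle.Hom E F) (j : Fin n) (x : E.carrier) :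
    φ.toLin (contr K E j x) = contr K F j (φ.toLin x) := by
  conv_rhs => rw [← E.frame.sum_eq x, map_sum, map_sum]
  rw [contr_apply, map_sum]
  refine Finset.sum_congr rfl fun a _ => ?_
  rw [φ.map_ract, φ.map_ract, contr_ract_zero K F j (φ.map_mem (E.frame.x_mem a))]

/-- The residue `N_j = ∇ c_j + c_j ∇` of a flat connection, the component of the
connection in the direction of `v_j`. -/
noncomputable def residue (E : FlatBundle B) (j : Fin n) : Module.End ℂ E.carrier :=
  E.conn ∘ₗ contr K E j + contr K E j ∘ₗ E.conn

theorem residue_apply (E : FlatBundle B) (j : Fin n) (x : E.carrier) :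
    residue K E j x = E.conn (contr K E j x) + contr K E j (E.conn x) := rfl

theorem residue_zero (E : FlatBundle B) (j : Fin n) {e : E.carrier} (he : e ∈ E.gr 0) :
    residue K E j e = contr K E j (E.conn e) := by
  rw [residue_apply, contr_zero K E j he, map_zero, zero_add]

theorem residue_mem_zero (E : FlatBundle B) (j : Fin n) {e : E.carrier} (he : e ∈ E.gr 0) :
    residue K E j e ∈ E.gr 0 := by
  rw [residue_zero K E j he]
  exact contr_mem K E j (E.conn_mem he)

theorem residue_ract_zero (E : FlatBundle B) (j : Fin n) {e : E.carrier} (he : e ∈ E.gr 0)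
    (β : B) : residue K E j (E.ract e β) = E.ract (residue K E j e) β := by
  rw [residue_zero K E j he, residue_apply, contr_ract_zero K E j he, E.conn_ract_zero he,
    E.conn_ract_zero he, map_add, contr_ract_one K E j (E.conn_mem he), contr_ract_zero K E j he]
  have h : E.ract e (K.c j (B.d β)) = - E.ract e (B.d (K.c j β)) := by
    rw [eq_neg_iff_add_eq_zero, ← map_add, K.c_d, map_zero]
  rw [h]
  abel

/-- The residues are parallel: `c_j` anticommutes with `d`, and `∇² = 0`. -/
theorem residue_mem_parallel (E : FlatBundle B) (j : Fin n) : residue K E j ∈ E.parallel :=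
  mem_parallel_of_zero (fun _ he => residue_mem_zero K E j he)
    (fun _ he => residue_ract_zero K E j he) fun e => by
    rw [residue_apply, residue_apply, E.flat, map_zero, add_zero, map_add, E.flat, zero_add]

theorem residue_contr (E : FlatBundle B) (i j : Fin n) (x : E.carrier) :
    residue K E i (contr K E j x) = contr K E j (residue K E i x) := by
  conv_lhs => rw [← E.frame.sum_eq x, map_sum, map_sum]
  conv_rhs => rw [← E.frame.sum_eq x, map_sum, map_sum]
  refine Finset.sum_congr rfl fun a _ => ?_
  have hx := E.frame.x_mem a
  rw [contr_ract_zero K E j hx, residue_ract_zero K E i hx, residue_ract_zero K E i hx,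
    contr_ract_zero K E j (residue_mem_zero K E i hx)]

/-- The residues commute, since they are parallel and the contractions are natural. -/
theorem residue_comm (E : FlatBundle B) (i j : Fin n) :
    Commute (residue K E i) (residue K E j) := by
  refine LinearMap.ext fun x => ?_
  have h := (residue_mem_parallel K E i).2.2.2
  rw [Module.End.mul_apply, Module.End.mul_apply, residue_apply K E j, map_add, h,
    residue_contr, residue_contr, h, ← residue_apply]

theorem residue_nat {E F : FlatBundle B} (φ : FlatBundle.Hom E F) (j : Fin n) (x : E.carrier) :
    φ.toLin (residue K E j x) = residue K F j (φ.toLin x) := by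
  rw [residue_apply, residue_apply, map_add, φ.map_conn, contr_nat, contr_nat, φ.map_conn]

/-- The residues satisfy the Leibniz rule on tensor products. -/
theorem residue_tensor (E F : FlatBundle B) (j : Fin n) {e : E.carrier} (he : e ∈ E.gr 0)
    {f : F.carrier} (hf : f ∈ F.gr 0) :
    residue K (tensor E F) j (GradedBimodule.tm _ _ e f : TensorCarrier _ _) =
      (GradedBimodule.tm E.toGradedBimodule F.toGradedBimodule (residue K E j e) f +
        GradedBimodule.tm _ _ e (residue K F j f) : TensorCarrier _ _) := by
  have hef : ∀ {e f}, e ∈ E.gr 0 → f ∈ F.gr 0 →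
      GradedBimodule.tm E.toGradedBimodule F.toGradedBimodule e f ∈ (tensor E F).gr 0 :=
    fun he hf => GradedBimodule.tm_mem (k := 0) (l := 0) he hf
  -- For `e`, `f` of degree `0` and `y`, `z` of degree `1` the contraction acts on one factor of
  -- `y ⊗ f` and `e ⊗ z`: expand `y` and `z` in frames and move the coordinates to the right.
  have h1 : ∀ y ∈ E.gr 1, contr K (tensor E F) j
      (GradedBimodule.tm E.toGradedBimodule F.toGradedBimodule y f) =
      GradedBimodule.tm E.toGradedBimodule F.toGradedBimodule (contr K E j y) f := by
    intro y hy
    have h : GradedBimodule.tm E.toGradedBimodule F.toGradedBimodule y f = ∑ a,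
        (tensor E F).ract (GradedBimodule.tm E.toGradedBimodule F.toGradedBimodule
          (E.frame.x a) f) (E.frame.ξ a y) := by
      conv_lhs => rw [← E.frame.sum_eq y, map_sum, LinearMap.sum_apply]
      refine Finset.sum_congr rfl fun a _ => ?_
      rw [tm_balanced, F.fgp.lact_of_mem_zero hf]
      rfl
    rw [contr_apply K E, map_sum, LinearMap.sum_apply]
    refine (congrArg (contr K (tensor E F) j) h).trans ((map_sum _ _ _).trans ?_)
    refine Finset.sum_congr rfl fun a _ => ?_
    rw [contr_ract_zero K _ j (hef (E.frame.x_mem a) hf), tm_balanced, F.fgp.lact_of_mem_zero hf]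
    rfl
  have h2 : ∀ z ∈ F.gr 1, contr K (tensor E F) j
      (GradedBimodule.tm E.toGradedBimodule F.toGradedBimodule e z) =
      GradedBimodule.tm E.toGradedBimodule F.toGradedBimodule e (contr K F j z) := by
    intro z hz
    have h : GradedBimodule.tm E.toGradedBimodule F.toGradedBimodule e z = ∑ a,
        (tensor E F).ract (GradedBimodule.tm E.toGradedBimodule F.toGradedBimodule
          e (F.frame.x a)) (F.frame.ξ a z) := by
      conv_lhs => rw [← F.frame.sum_eq z, map_sum]
      rfl
    rw [contr_apply K F, map_sum]
    refine (congrArg (contr K (tensor E F) j) h).trans ((map_sum _ _ _).trans ?_)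
    refine Finset.sum_congr rfl fun a _ => ?_
    rw [contr_ract_zero K _ j (hef he (F.frame.x_mem a))]
    rfl
  rw [residue_zero K _ j (hef he hf), residue_zero K E j he, residue_zero K F j hf,
    ← h1 _ (E.conn_mem he), ← h2 _ (F.conn_mem hf)]
  have h3 : (tensor E F).conn (GradedBimodule.tm E.toGradedBimodule F.toGradedBimodule e f) =
      GradedBimodule.tm E.toGradedBimodule F.toGradedBimodule (E.conn e) f +
        GradedBimodule.tm E.toGradedBimodule F.toGradedBimodule e (F.conn f) := by
    have := tConn_tm he f
    rwa [pow_zero, one_smul] at this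
  exact (congrArg (contr K (tensor E F) j) h3).trans (map_add _ _ _)

theorem residue_unit (j : Fin n) {e : B} (he : e ∈ B.gr 0) :
    residue K (FlatBundle.unit B) j e = (0 : B) := by
  have h : ∀ β : B, contr K (FlatBundle.unit B) j β = K.c j β := by
    intro β
    have := contr_ract_zero K (FlatBundle.unit B) j (e := (1 : B)) B.one_mem β
    have e1 : ∀ γ : B, (FlatBundle.unit B).ract (1 : B) γ = γ := one_mul
    rwa [e1, e1] at this
  refine (residue_zero K (FlatBundle.unit B) j he).trans ((h _).trans ?_)
  change K.c j (B.d e) = 0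
  have := K.c_d j e
  rwa [K.c_zero j he, map_zero, add_zero] at this

/-! ### Twisting a flat connection by commuting parallel endomorphisms -/

section Twist

variable (E : FlatBundle B) (N : Fin n → Module.End ℂ E.carrier)

/-- The operator `e ↦ ∑ v_j N_j(e)`. -/
noncomputable def twistOp : Module.End ℂ E.carrier := ∑ j, E.lact (K.v j) ∘ₗ N j

theorem twistOp_apply (e : E.carrier) :
    twistOp K E N e = ∑ j, E.lact (K.v j) (N j e) := by
  rw [twistOp, LinearMap.sum_apply]
  rfl

variable (hN : ∀ j, N j ∈ E.parallel) (hc : ∀ i j, Commute (N i) (N j))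

theorem twistOp_ract (hN : ∀ j, N j ∈ E.parallel) (e : E.carrier) (α : B) :
    twistOp K E N (E.ract e α) = E.ract (twistOp K E N e) α := by
  rw [twistOp_apply, twistOp_apply, map_sum, LinearMap.sum_apply]
  refine Finset.sum_congr rfl fun j _ => ?_
  rw [(hN j).2.2.1, E.ract_lact]

theorem twistOp_lact (hN : ∀ j, N j ∈ E.parallel) {k : ℕ} {α : B} (hα : α ∈ B.gr k)
    (e : E.carrier) :
    twistOp K E N (E.lact α e) = (-1 : ℂ) ^ k • E.lact α (twistOp K E N e) := by
  rw [twistOp_apply, twistOp_apply, map_sum, Finset.smul_sum]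
  refine Finset.sum_congr rfl fun j _ => ?_
  rw [(hN j).2.1, ← E.mul_lact, ← E.mul_lact, B.comm (K.v_mem j) hα, one_mul, map_smul,
    LinearMap.smul_apply]

theorem conn_twistOp (hN : ∀ j, N j ∈ E.parallel) (e : E.carrier) :
    E.conn (twistOp K E N e) = - twistOp K E N (E.conn e) := by
  rw [twistOp_apply, twistOp_apply, map_sum, ← Finset.sum_neg_distrib]
  refine Finset.sum_congr rfl fun j _ => ?_
  rw [E.conn_lact (K.v_mem j), K.d_v, map_zero, LinearMap.zero_apply, zero_add, (hN j).2.2.2,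
    pow_one, neg_smul, one_smul]

theorem twistOp_twistOp (hN : ∀ j, N j ∈ E.parallel) (hc : ∀ i j, Commute (N i) (N j))
    (e : E.carrier) : twistOp K E N (twistOp K E N e) = 0 := by
  have h : twistOp K E N (twistOp K E N e) =
      ∑ i, ∑ j, E.lact (K.v i * K.v j) (N i (N j e)) := by
    rw [twistOp_apply]
    refine Finset.sum_congr rfl fun i _ => ?_
    rw [twistOp_apply, map_sum, map_sum]
    refine Finset.sum_congr rfl fun j _ => ?_
    rw [(hN i).2.1, E.mul_lact]
  have h' : twistOp K E N (twistOp K E N e) = - twistOp K E N (twistOp K E N e) := by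
    conv_rhs => rw [h, Finset.sum_comm, ← Finset.sum_neg_distrib]
    rw [h]
    refine Finset.sum_congr rfl fun i _ => ?_
    rw [← Finset.sum_neg_distrib]
    refine Finset.sum_congr rfl fun j _ => ?_
    have h1 : N i (N j e) = N j (N i e) := LinearMap.congr_fun (hc i j) e
    rw [B.comm (K.v_mem i) (K.v_mem j), h1]
    simp
  have h2 : (2 : ℂ) • twistOp K E N (twistOp K E N e) = 0 := by
    rw [two_smul]
    nth_rewrite 1 [h']
    exact neg_add_cancel _
  exact (smul_eq_zero.1 h2).resolve_left two_ne_zero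

theorem twistOp_mem (hN : ∀ j, N j ∈ E.parallel) {k : ℕ} {e : E.carrier} (he : e ∈ E.gr k) :
    twistOp K E N e ∈ E.gr (k + 1) := by
  rw [twistOp_apply, add_comm k 1]
  exact sum_mem fun j _ => E.lact_mem (K.v_mem j) ((hN j).1 k e he)

/-- The flat connection `∇ + ∑ v_j N_j`. -/
noncomputable def twist : FlatBundle B where
  toGradedBimodule := E.toGradedBimodule
  fgp := E.fgp
  conn := E.conn + twistOp K E N
  conn_mem := fun he => add_mem (E.conn_mem he) (twistOp_mem K E N hN he)
  conn_ract := fun he α => by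
    rw [LinearMap.add_apply, LinearMap.add_apply, E.conn_ract he, twistOp_ract K E N hN, map_add,
      LinearMap.add_apply]
    abel
  conn_lact := fun hα e => by
    rw [LinearMap.add_apply, LinearMap.add_apply, E.conn_lact hα, twistOp_lact K E N hN hα,
      map_add, smul_add]
    abel
  flat := fun e => by
    rw [LinearMap.add_apply, LinearMap.add_apply, map_add, map_add, E.flat,
      conn_twistOp K E N hN, twistOp_twistOp K E N hN hc]
    abel

theorem twist_conn (e : E.carrier) :
    (twist K E N hN hc).conn e = E.conn e + ∑ j, E.lact (K.v j) (N j e) := by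
  rw [← twistOp_apply]
  rfl

theorem residue_twist (j : Fin n) {e : E.carrier} (he : e ∈ E.gr 0) :
    residue K (twist K E N hN hc) j e = residue K E j e + N j e := by
  refine (residue_zero K (twist K E N hN hc) j he).trans ?_
  refine (congrArg (contr K E j) (twist_conn K E N hN hc e)).trans ?_
  rw [map_add, residue_zero K E j he, map_sum]
  congr 1
  rw [Finset.sum_eq_single j]
  · have h := (hN j).1 0 e he
    rw [E.fgp.lact_of_mem_zero h, contr_ract_zero K E j h, K.c_v, if_pos rfl, E.ract_one]
  · intro i _ hij
    have h := (hN i).1 0 e he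
    rw [E.fgp.lact_of_mem_zero h, contr_ract_zero K E j h, K.c_v, if_neg hij, map_zero]
  · exact fun h => absurd (Finset.mem_univ j) h

end Twist

end Cartan

end FlatBundle

end NCG

namespace NCG

/-! ### Continuous representations of `ℝⁿ` and commuting endomorphisms -/

section OneParameter

open NormedSpace

/-- A continuous one-parameter group in a Banach algebra is of the form `t ↦ exp (t a)`. The
averages `∫₀^ε f` show that `f` is differentiable. -/
theorem exists_eq_exp_of_continuous {𝔸 : Type*} [NormedRing 𝔸] [NormedAlgebra ℝ 𝔸]
    [CompleteSpace 𝔸] (f : ℝ → 𝔸) (hf : Continuous f) (h0 : f 0 = 1)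
    (hadd : ∀ s t, f (s + t) = f s * f t) : ∃ a : 𝔸, ∀ t : ℝ, f t = exp (t • a) := by
  let F : ℝ → 𝔸 := fun x => ∫ s in (0 : ℝ)..x, f s
  have hF : ∀ x, HasDerivAt F (f x) x := fun x => hf.integral_hasStrictDerivAt 0 x |>.hasDerivAt
  have hF0 : F 0 = 0 := intervalIntegral.integral_same
  have hmul : ∀ t x, f t * F x = F (t + x) - F t := by
    intro t x
    have h1 : f t * F x = ∫ s in (0 : ℝ)..x, f (t + s) := by
      simp only [F, hadd]
      exact ((ContinuousLinearMap.mul ℝ 𝔸 (f t)).intervalIntegral_comp_comm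
        (hf.intervalIntegrable 0 x)).symm
    rw [h1, intervalIntegral.integral_comp_add_left (fun s => f s) t, add_zero]
    exact (intervalIntegral.integral_interval_sub_left (hf.intervalIntegrable _ _)
      (hf.intervalIntegrable _ _)).symm
  -- `F ε / ε` tends to `f 0 = 1`, so that `F ε` is invertible for small `ε`.
  obtain ⟨ε, hε⟩ : ∃ ε, IsUnit (F ε) := by
    have h1 := (hF 0).tendsto_slope_zero
    simp only [zero_add, hF0, sub_zero, h0] at h1
    have h2 := (h1.eventually (Units.nhds (1 : 𝔸ˣ))).and self_mem_nhdsWithin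
    obtain ⟨ε, hε, hε0⟩ := h2.exists
    refine ⟨ε, ?_⟩
    have h3 : F ε = (algebraMap ℝ 𝔸 ε) * (ε⁻¹ • F ε) := by
      rw [← Algebra.smul_def, smul_smul, mul_inv_cancel₀ hε0, one_smul]
    rw [h3]
    exact ((isUnit_iff_ne_zero.2 hε0).map (algebraMap ℝ 𝔸)).mul hε
  obtain ⟨c, hc⟩ := hε
  let a : 𝔸 := (f ε - 1) * (c⁻¹ : 𝔸ˣ)
  -- Hence `f` is differentiable, being a combination of translates of `F`, and `f' = f a`.
  have hfe : ∀ t, f t = (F (t + ε) - F t) * (c⁻¹ : 𝔸ˣ) := by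
    intro t
    rw [← hmul, ← hc, mul_assoc, Units.mul_inv, mul_one]
  have hd : ∀ t, HasDerivAt f (f t * a) t := by
    intro t
    have h1 : HasDerivAt (fun t => (F (t + ε) - F t) * (c⁻¹ : 𝔸ˣ)) ((f (t + ε) - f t) *
        (c⁻¹ : 𝔸ˣ)) t :=
      (((hF (t + ε)).comp_add_const t ε).sub (hF t)).mul_const _
    have h2 : (f (t + ε) - f t) * (c⁻¹ : 𝔸ˣ) = f t * a := by
      rw [hadd, ← mul_assoc, mul_sub, mul_one]
    rw [h2] at h1
    exact h1.congr_of_eventuallyEq (Filter.Eventually.of_forall hfe)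
  refine ⟨a, fun t => ?_⟩
  have he : ∀ t : ℝ, HasDerivAt (fun s : ℝ => exp (s • (-a))) ((-a) * exp (t • (-a))) t :=
    fun t => hasDerivAt_exp_smul_const' (𝕂 := ℝ) (-a) t
  -- The product `f(t) exp(-t a)` has derivative `0`.
  have hg : ∀ t, HasDerivAt (fun s => f s * exp (s • (-a))) 0 t := by
    intro t
    have h1 := (hd t).mul (he t)
    have h2 : f t * a * exp (t • (-a)) + f t * (-a * exp (t • (-a))) = 0 := by
      rw [mul_assoc, ← mul_add, neg_mul, add_neg_cancel, mul_zero]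
    rwa [h2] at h1
  have hconst := is_const_of_deriv_eq_zero (fun t => (hg t).differentiableAt)
    (fun t => (hg t).deriv) t 0
  simp only [zero_smul, exp_zero, mul_one, h0] at hconst
  have h3 : exp (t • (-a)) * exp (t • a) = 1 := by
    let _ : NormedAlgebra ℚ 𝔸 := NormedAlgebra.restrictScalars ℚ ℝ 𝔸
    rw [← exp_add_of_commute, smul_neg, neg_add_cancel, exp_zero]
    rw [smul_neg]
    exact (Commute.refl _).neg_left
  calc f t = f t * (exp (t • (-a)) * exp (t • a)) := by rw [h3, mul_one]
    _ = exp (t • a) := by rw [← mul_assoc, hconst, one_mul]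

end OneParameter

section EndExp

variable {W W' : Type u} [AddCommGroup W] [Module ℂ W] [AddCommGroup W'] [Module ℂ W']

section

variable [FiniteDimensional ℂ W']

theorem end_ext_dual {φ ψ : W →ₗ[ℂ] W'} (h : ∀ (ℓ : W' →ₗ[ℂ] ℂ) w, ℓ (φ w) = ℓ (ψ w)) :
    φ = ψ := by
  refine LinearMap.ext fun w => ?_
  rw [← sub_eq_zero, ← Module.forall_dual_apply_eq_zero_iff ℂ]
  intro ℓ
  rw [map_sub, h, sub_self]

end

variable [FiniteDimensional ℂ W] [FiniteDimensional ℂ W']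

/-- The matrix of an endomorphism in the chosen basis of `W`. -/
noncomputable def endMat : Module.End ℂ W ≃ₐ[ℂ]
    Matrix (Fin (Module.finrank ℂ W)) (Fin (Module.finrank ℂ W)) ℂ :=
  LinearMap.toMatrixAlgEquiv (Module.finBasis ℂ W)

/-- The exponential of an endomorphism of a finite-dimensional space. -/
noncomputable def endExp (T : Module.End ℂ W) : Module.End ℂ W :=
  endMat.symm (NormedSpace.exp (endMat T))

theorem endMat_endExp (T : Module.End ℂ W) : endMat (endExp T) = NormedSpace.exp (endMat T) :=
  endMat.apply_symm_apply _

theorem endExp_zero : endExp (0 : Module.End ℂ W) = 1 := by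
  rw [endExp, map_zero, NormedSpace.exp_zero, map_one]

theorem endExp_add {S T : Module.End ℂ W} (h : Commute S T) :
    endExp (S + T) = endExp S * endExp T := by
  rw [endExp, map_add, Matrix.exp_add_of_commute _ _ (h.map endMat), map_mul]
  rfl

theorem continuous_dual_endMat (L : Module.End ℂ W →ₗ[ℂ] ℂ) :
    Continuous fun M => L (endMat.symm M) :=
  LinearMap.continuous_of_finiteDimensional (L ∘ₗ endMat.symm.toLinearMap)

section

attribute [local instance] Matrix.linftyOpNormedRing Matrix.linftyOpNormedAlgebra

/-- The exponential series, tested against linear functionals. -/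
theorem hasSum_endExp (T : Module.End ℂ W) (L : Module.End ℂ W →ₗ[ℂ] ℂ) :
    HasSum (fun k : ℕ => L (((k.factorial : ℂ)⁻¹) • T ^ k)) (L (endExp T)) := by
  have h := NormedSpace.exp_series_hasSum_exp' (𝕂 := ℂ) (endMat T)
  have h' := h.map (L ∘ₗ endMat.symm.toLinearMap) (continuous_dual_endMat L)
  have e : (⇑(L ∘ₗ endMat.symm.toLinearMap) ∘ fun k : ℕ => ((k.factorial : ℂ)⁻¹) • endMat T ^ k) =
      fun k : ℕ => L (((k.factorial : ℂ)⁻¹) • T ^ k) := by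
    funext k
    change L (endMat.symm _) = _
    rw [map_smul, map_pow, AlgEquiv.symm_apply_apply]
  exact e ▸ h'

theorem continuous_dual_endExp {X : Type*} [TopologicalSpace X] {T : X → Module.End ℂ W}
    (hT : ∀ L : Module.End ℂ W →ₗ[ℂ] ℂ, Continuous fun x => L (T x))
    (L : Module.End ℂ W →ₗ[ℂ] ℂ) : Continuous fun x => L (endExp (T x)) := by
  have h1 : Continuous fun x => endMat (T x) := by
    refine continuous_matrix fun i j => ?_
    exact hT (Matrix.entryLinearMap ℂ ℂ i j ∘ₗ endMat.toLinearMap)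
  refine (continuous_dual_endMat L).comp ?_
  exact NormedSpace.exp_continuous.comp h1

theorem hasDerivAt_endExp (T : Module.End ℂ W) (L : Module.End ℂ W →ₗ[ℂ] ℂ) :
    HasDerivAt (fun s : ℝ => L (endExp ((s : ℂ) • T))) (L T) 0 := by
  have h := hasDerivAt_exp_smul_const (𝕂 := ℝ) (endMat T) (0 : ℝ)
  rw [zero_smul, NormedSpace.exp_zero, one_mul] at h
  let L' : Matrix (Fin (Module.finrank ℂ W)) (Fin (Module.finrank ℂ W)) ℂ →L[ℝ] ℂ :=
    ⟨(L ∘ₗ endMat.symm.toLinearMap).restrictScalars ℝ, continuous_dual_endMat L⟩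
  have h' := L'.hasFDerivAt.comp_hasDerivAt (0 : ℝ) h
  have e : L' (endMat T) = L T := congrArg L (endMat.symm_apply_apply T)
  refine (h'.congr_deriv e).congr_of_eventuallyEq (Filter.Eventually.of_forall fun s => ?_)
  change L (endMat.symm _) = L (endMat.symm _)
  rw [map_smul]
  rfl

/-- A continuous one-parameter group of endomorphisms is an exponential. -/
theorem exists_eq_endExp (f : ℝ → Module.End ℂ W)
    (hf : ∀ L : Module.End ℂ W →ₗ[ℂ] ℂ, Continuous fun x => L (f x)) (h0 : f 0 = 1)
    (hadd : ∀ s t, f (s + t) = f s * f t) :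
    ∃ T : Module.End ℂ W, ∀ t : ℝ, f t = endExp ((t : ℂ) • T) := by
  have h1 : Continuous fun x => endMat (f x) := by
    refine continuous_matrix fun i j => ?_
    exact hf (Matrix.entryLinearMap ℂ ℂ i j ∘ₗ endMat.toLinearMap)
  obtain ⟨a, ha⟩ := exists_eq_exp_of_continuous (fun x => endMat (f x)) h1 (by rw [h0, map_one])
    fun s t => by rw [hadd, map_mul]
  refine ⟨endMat.symm a, fun t => endMat.injective ?_⟩
  rw [ha, endMat_endExp, map_smul, AlgEquiv.apply_symm_apply]
  rfl

end

/-- An exponential lies in every subspace that contains all powers. -/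
theorem endExp_mem {T : Module.End ℂ W} (S : Submodule ℂ (Module.End ℂ W))
    (h : ∀ k : ℕ, T ^ k ∈ S) : endExp T ∈ S := by
  by_contra hS
  obtain ⟨L, hL, hL'⟩ := Submodule.exists_le_ker_of_notMem hS
  have h1 := hasSum_endExp T L
  have h2 : (fun k : ℕ => L (((k.factorial : ℂ)⁻¹) • T ^ k)) = fun _ => 0 :=
    funext fun k => hL' (S.smul_mem _ (h k))
  rw [h2] at h1
  exact hL (h1.unique hasSum_zero)

/-- Intertwiners of endomorphisms intertwine the exponentials. -/
theorem endExp_intertwine {T : Module.End ℂ W} {T' : Module.End ℂ W'} {φ : W →ₗ[ℂ] W'}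
    (h : φ ∘ₗ T = T' ∘ₗ φ) : φ ∘ₗ endExp T = endExp T' ∘ₗ φ := by
  have hk : ∀ k : ℕ, φ ∘ₗ (T ^ k) = (T' ^ k) ∘ₗ φ := by
    intro k
    induction k with
    | zero => rfl
    | succ k ih =>
      rw [pow_succ, pow_succ, Module.End.mul_eq_comp, Module.End.mul_eq_comp,
        ← LinearMap.comp_assoc, ih, LinearMap.comp_assoc, h, LinearMap.comp_assoc]
  refine end_ext_dual fun ℓ w => ?_
  have h1 := hasSum_endExp T (ℓ ∘ₗ φ ∘ₗ LinearMap.applyₗ w)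
  have h2 := hasSum_endExp T' (ℓ ∘ₗ LinearMap.applyₗ (φ w))
  have e : (fun k : ℕ => (ℓ ∘ₗ φ ∘ₗ LinearMap.applyₗ w) (((k.factorial : ℂ)⁻¹) • T ^ k)) =
      fun k : ℕ => (ℓ ∘ₗ LinearMap.applyₗ (φ w)) (((k.factorial : ℂ)⁻¹) • T' ^ k) := by
    funext k
    rw [map_smul, map_smul]
    exact congrArg (fun x => ((k.factorial : ℂ)⁻¹) • ℓ x) (LinearMap.congr_fun (hk k) w)
  exact h1.unique (e ▸ h2)

/-- Intertwiners of one-parameter groups intertwine the generators. -/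
theorem generator_intertwine {T : Module.End ℂ W} {T' : Module.End ℂ W'} {φ : W →ₗ[ℂ] W'}
    (h : ∀ s : ℝ, φ ∘ₗ endExp ((s : ℂ) • T) = endExp ((s : ℂ) • T') ∘ₗ φ) :
    φ ∘ₗ T = T' ∘ₗ φ := by
  refine end_ext_dual fun ℓ w => ?_
  have h1 := hasDerivAt_endExp T (ℓ ∘ₗ φ ∘ₗ LinearMap.applyₗ w)
  have h2 := hasDerivAt_endExp T' (ℓ ∘ₗ LinearMap.applyₗ (φ w))
  have e : (fun s : ℝ => (ℓ ∘ₗ φ ∘ₗ LinearMap.applyₗ w) (endExp ((s : ℂ) • T))) =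
      fun s : ℝ => (ℓ ∘ₗ LinearMap.applyₗ (φ w)) (endExp ((s : ℂ) • T')) :=
    funext fun s => congrArg ℓ (LinearMap.congr_fun (h s) w)
  exact h1.unique (e ▸ h2)

end EndExp

theorem continuous_dual_end {H : Type} [TopologicalSpace H] {W : Type u} [AddCommGroup W]
    [Module ℂ W] [FiniteDimensional ℂ W]
    {T : H → Module.End ℂ W} (hT : ∀ w (ℓ : W →ₗ[ℂ] ℂ), Continuous fun h => ℓ (T h w))
    (ζ : Module.End ℂ W →ₗ[ℂ] ℂ) : Continuous fun h => ζ (T h) := by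
  let b := Module.finBasis ℂ W
  have h1 : ∀ S : Module.End ℂ W,
      ζ S = ∑ i, ∑ j, b.coord i (S (b j)) * ζ ((b.coord j).smulRight (b i)) := by
    intro S
    have h2 : S = ∑ i, ∑ j, b.coord i (S (b j)) • (b.coord j).smulRight (b i) := by
      refine b.ext fun k => ?_
      rw [← b.sum_repr (S (b k)), LinearMap.sum_apply]
      refine Finset.sum_congr rfl fun i _ => ?_
      rw [LinearMap.sum_apply, Finset.sum_eq_single k]
      · simp
      · intro j _ hj
        simp [Finsupp.single_eq_of_ne hj]
      · exact fun h => absurd (Finset.mem_univ k) h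
    conv_lhs => rw [h2]
    simp only [map_sum, map_smul, smul_eq_mul]
  refine Continuous.congr ?_ fun h => (h1 (T h)).symm
  exact continuous_finsetSum _ fun i _ => continuous_finsetSum _ fun j _ =>
    (hT _ _).mul continuous_const

section ExpRep

variable {n : ℕ} {W W' : Type u} [AddCommGroup W] [Module ℂ W]
  [AddCommGroup W'] [Module ℂ W']

/-- The combination `∑ t_j N_j`. -/
noncomputable def linComb (N : Fin n → Module.End ℂ W) (t : Fin n → ℝ) : Module.End ℂ W :=
  ∑ j, (t j : ℂ) • N j

theorem linComb_add (N : Fin n → Module.End ℂ W) (s t : Fin n → ℝ) :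
    linComb N (s + t) = linComb N s + linComb N t := by
  simp [linComb, add_smul, Finset.sum_add_distrib]

theorem linComb_single (N : Fin n → Module.End ℂ W) (j : Fin n) (s : ℝ) :
    linComb N (Pi.single j s) = (s : ℂ) • N j := by
  rw [linComb, Finset.sum_eq_single j]
  · simp
  · intro i _ hij
    simp [hij]
  · exact fun h => absurd (Finset.mem_univ j) h

theorem linComb_commute {N : Fin n → Module.End ℂ W} (hc : ∀ i j, Commute (N i) (N j))
    (s t : Fin n → ℝ) : Commute (linComb N s) (linComb N t) :=
  Commute.sum_left _ _ _ fun i _ => Commute.sum_right _ _ _ fun j _ =>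
    ((hc i j).smul_left _).smul_right _

variable [FiniteDimensional ℂ W] [FiniteDimensional ℂ W']

/-- The representation `t ↦ exp (∑ t_j N_j)` of `ℝⁿ`. -/
noncomputable def expRep (N : Fin n → Module.End ℂ W) (hc : ∀ i j, Commute (N i) (N j)) :
    Multiplicative (Fin n → ℝ) →* Module.End ℂ W where
  toFun t := endExp (linComb N t.toAdd)
  map_one' := by
    have : linComb N (0 : Fin n → ℝ) = 0 := by simp [linComb]
    rw [toAdd_one, this, endExp_zero]
  map_mul' s t := by
    rw [toAdd_mul, linComb_add, endExp_add (linComb_commute hc _ _)]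

theorem expRep_apply (N : Fin n → Module.End ℂ W) (hc : ∀ i j, Commute (N i) (N j))
    (t : Fin n → ℝ) : expRep N hc (Multiplicative.ofAdd t) = endExp (linComb N t) := rfl

theorem expRep_continuous (N : Fin n → Module.End ℂ W) (hc : ∀ i j, Commute (N i) (N j)) :
    ContinuousRep (expRep N hc) := by
  intro w ℓ
  refine continuous_dual_endExp (T := fun t : Multiplicative (Fin n → ℝ) => linComb N t.toAdd)
    (fun L => ?_) (ℓ ∘ₗ LinearMap.applyₗ w)
  simp only [linComb, map_sum, map_smul, smul_eq_mul]
  refine continuous_finsetSum _ fun j _ => Continuous.mul ?_ continuous_const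
  exact Complex.continuous_ofReal.comp ((continuous_apply j).comp continuous_toAdd)

theorem expRep_intertwine {N : Fin n → Module.End ℂ W} {hc : ∀ i j, Commute (N i) (N j)}
    {N' : Fin n → Module.End ℂ W'} {hc' : ∀ i j, Commute (N' i) (N' j)} {φ : W →ₗ[ℂ] W'}
    (h : ∀ j, φ ∘ₗ N j = N' j ∘ₗ φ) (t) : φ ∘ₗ expRep N hc t = expRep N' hc' t ∘ₗ φ := by
  refine endExp_intertwine ?_
  refine LinearMap.ext fun w => ?_
  simp only [linComb, LinearMap.comp_apply, LinearMap.sum_apply, LinearMap.smul_apply, map_sum,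
    map_smul]
  exact Finset.sum_congr rfl fun j _ => congrArg _ (LinearMap.congr_fun (h j) w)

theorem expRep_generator {N : Fin n → Module.End ℂ W} {hc : ∀ i j, Commute (N i) (N j)}
    {N' : Fin n → Module.End ℂ W'} {hc' : ∀ i j, Commute (N' i) (N' j)} {φ : W →ₗ[ℂ] W'}
    (h : ∀ t, φ ∘ₗ expRep N hc t = expRep N' hc' t ∘ₗ φ) (j) : φ ∘ₗ N j = N' j ∘ₗ φ := by
  refine generator_intertwine fun s => ?_
  have := h (Multiplicative.ofAdd (Pi.single j s))
  rwa [expRep_apply, expRep_apply, linComb_single, linComb_single] at this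

/-- An `R`-linear map that commutes with the `N_j` commutes with `exp (∑ t_j N_j)`. -/
theorem expRep_comm {R : Type u} [CommRing R] [Algebra ℂ R] {N : Fin n → Module.End ℂ W}
    {hc : ∀ i j, Commute (N i) (N j)} {T : Module.End R (R ⊗[ℂ] W)}
    (h : ∀ j, T ∘ₗ (N j).baseChange R = (N j).baseChange R ∘ₗ T) (t) :
    T ∘ₗ (expRep N hc t).baseChange R = (expRep N hc t).baseChange R ∘ₗ T := by
  let S : Subalgebra ℂ (Module.End ℂ W) :=
    { carrier := {A | T ∘ₗ A.baseChange R = A.baseChange R ∘ₗ T}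
      mul_mem' := fun {A B} hA hB => by
        simp only [Set.mem_ofPred_eq, Module.End.mul_eq_comp, LinearMap.baseChange_comp] at *
        rw [← LinearMap.comp_assoc, hA, LinearMap.comp_assoc, hB, LinearMap.comp_assoc]
      add_mem' := fun {A B} hA hB => by
        simp only [Set.mem_ofPred_eq, LinearMap.baseChange_add, LinearMap.comp_add,
          LinearMap.add_comp] at *
        rw [hA, hB]
      algebraMap_mem' := fun c => by
        simp only [Set.mem_ofPred_eq, Algebra.algebraMap_eq_smul_one, LinearMap.baseChange_smul,
          Module.End.one_eq_id, LinearMap.baseChange_id]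
        refine LinearMap.ext fun x => ?_
        exact LinearMap.map_smul_of_tower T c x }
  have hS : linComb N t.toAdd ∈ S := sum_mem fun j _ => S.smul_mem (h j) _
  exact endExp_mem S.toSubmodule fun k => pow_mem hS k

/-- The tensor product of exponential representations has the generators
`N_j ⊗ 1 + 1 ⊗ N'_j`. -/
theorem expRep_tensor {N : Fin n → Module.End ℂ W} (hc : ∀ i j, Commute (N i) (N j))
    {N' : Fin n → Module.End ℂ W'} (hc' : ∀ i j, Commute (N' i) (N' j))
    (hc'' : ∀ i j, Commute (TensorProduct.map (N i) LinearMap.id +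
      TensorProduct.map LinearMap.id (N' i) : Module.End ℂ (W ⊗[ℂ] W'))
      (TensorProduct.map (N j) LinearMap.id + TensorProduct.map LinearMap.id (N' j))) :
    expRep _ hc'' = tensorRep (expRep N hc) (expRep N' hc') := by
  refine MonoidHom.ext fun t => ?_
  let A := linComb N t.toAdd
  let A' := linComb N' t.toAdd
  have h1 : linComb (fun j => (TensorProduct.map (N j) LinearMap.id +
      TensorProduct.map LinearMap.id (N' j) : Module.End ℂ (W ⊗[ℂ] W'))) t.toAdd =
      TensorProduct.map A LinearMap.id + TensorProduct.map LinearMap.id A' := by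
    refine TensorProduct.ext' fun w w' => ?_
    simp only [A, A', linComb, LinearMap.add_apply, LinearMap.sum_apply, LinearMap.smul_apply,
      TensorProduct.map_tmul, LinearMap.id_apply, TensorProduct.sum_tmul, TensorProduct.tmul_sum,
      smul_add, Finset.sum_add_distrib, TensorProduct.smul_tmul', TensorProduct.tmul_smul]
  have h2 : Commute (TensorProduct.map A LinearMap.id : Module.End ℂ (W ⊗[ℂ] W'))
      (TensorProduct.map LinearMap.id A') := by
    refine TensorProduct.ext' fun w w' => ?_
    simp
  have h3 : endExp (TensorProduct.map A LinearMap.id : Module.End ℂ (W ⊗[ℂ] W')) =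
      TensorProduct.map (endExp A) LinearMap.id := by
    refine TensorProduct.ext' fun w w' => ?_
    have := endExp_intertwine (T := A)
      (T' := (TensorProduct.map A LinearMap.id : Module.End ℂ (W ⊗[ℂ] W')))
      (φ := (TensorProduct.mk ℂ W W').flip w') (LinearMap.ext fun x => by simp)
    exact (LinearMap.congr_fun this w).symm
  have h4 : endExp (TensorProduct.map LinearMap.id A' : Module.End ℂ (W ⊗[ℂ] W')) =
      TensorProduct.map LinearMap.id (endExp A') := by
    refine TensorProduct.ext' fun w w' => ?_
    have := endExp_intertwine (T := A')
      (T' := (TensorProduct.map LinearMap.id A' : Module.End ℂ (W ⊗[ℂ] W')))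
      (φ := TensorProduct.mk ℂ W W' w) (LinearMap.ext fun x => by simp)
    exact (LinearMap.congr_fun this w').symm
  change endExp (linComb _ t.toAdd) = TensorProduct.map (endExp A) (endExp A')
  rw [h1, endExp_add h2, h3, h4]
  refine TensorProduct.ext' fun w w' => ?_
  simp

/-- Every continuous representation of `ℝⁿ` is an exponential. -/
theorem exists_eq_expRep (σ : Multiplicative (Fin n → ℝ) →* Module.End ℂ W)
    (hσ : ContinuousRep σ) :
    ∃ (N : Fin n → Module.End ℂ W) (hc : ∀ i j, Commute (N i) (N j)), σ = expRep N hc := by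
  have hL : ∀ L : Module.End ℂ W →ₗ[ℂ] ℂ, Continuous fun t => L (σ t) :=
    continuous_dual_end hσ
  -- The generators are those of the restrictions to the coordinate axes.
  have hj : ∀ j, ∃ T : Module.End ℂ W, ∀ s : ℝ,
      σ (Multiplicative.ofAdd (Pi.single j s)) = endExp ((s : ℂ) • T) := by
    intro j
    refine exists_eq_endExp _ (fun L => ?_) ?_ fun s t => ?_
    · exact (hL L).comp (continuous_ofAdd.comp (continuous_single (A := fun _ : Fin n => ℝ) j))
    · rw [Pi.single_zero, ofAdd_zero, map_one]
    · rw [Pi.single_add, ofAdd_add, map_mul]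
  choose N hN using hj
  -- Differentiate `exp(s N_i) exp(t N_j) = exp(t N_j) exp(s N_i)` in `s` and in `t`.
  have hc : ∀ i j, Commute (N i) (N j) := by
    intro i j
    have h1 : ∀ t : ℝ, Commute (endExp ((t : ℂ) • N j)) (N i) := by
      intro t
      refine generator_intertwine fun s => ?_
      rw [← hN, ← hN]
      exact (σ.map_mul _ _).symm.trans ((congrArg σ (mul_comm _ _)).trans (σ.map_mul _ _))
    exact (generator_intertwine (T := N j) (T' := N j) (φ := N i) fun t => (h1 t).symm)
  refine ⟨N, hc, MonoidHom.ext fun t => ?_⟩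
  have key : ∀ s : Finset (Fin n),
      σ (Multiplicative.ofAdd (∑ j ∈ s, Pi.single j (t.toAdd j))) =
      expRep N hc (Multiplicative.ofAdd (∑ j ∈ s, Pi.single j (t.toAdd j))) := by
    intro s
    induction s using Finset.induction_on with
    | empty => simp
    | insert j s hjs ih =>
      rw [Finset.sum_insert hjs, ofAdd_add, map_mul, map_mul, ih, hN,
        expRep_apply N hc (Pi.single j _), linComb_single]
  have h := key Finset.univ
  rw [Finset.univ_sum_single] at h
  exact h

end ExpRep

end NCG

namespace NCG

namespace FlatBundle

open GradedBimodule

variable {B : CDGA.{u}}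

/-! ### The flat connection defined by commuting endomorphisms -/

section Free

theorem lact_algebraMap (E : FlatBundle B) (c : ℂ) (e : E.carrier) :
    E.lact (algebraMap ℂ B c) e = c • e := by
  rw [Algebra.algebraMap_eq_smul_one, map_smul, LinearMap.smul_apply, E.one_lact]

theorem algebraMap_mem (c : ℂ) : algebraMap ℂ B c ∈ B.gr 0 := by
  rw [Algebra.algebraMap_eq_smul_one]
  exact Submodule.smul_mem _ _ B.one_mem

theorem d_algebraMap (c : ℂ) : B.d (algebraMap ℂ B c) = 0 := by
  rw [Algebra.algebraMap_eq_smul_one, map_smul, B.d_one, smul_zero]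

variable (B) in
/-- The differential on `Bᵐ`. -/
noncomputable def freeD (m : ℕ) : (Fin m → B) →ₗ[ℂ] (Fin m → B) :=
  LinearMap.pi fun a => B.d ∘ₗ LinearMap.proj a

variable (B) in
/-- The trivial flat connection on `Bᵐ`. -/
noncomputable def trivial (m : ℕ) : FlatBundle B where
  toGradedBimodule := free B m
  fgp := ⟨m, ⟨LinearMap.id, fun h => h, fun _ _ => rfl, fun _ _ => rfl⟩,
    ⟨LinearMap.id, fun h => h, fun _ _ => rfl, fun _ _ => rfl⟩, fun _ => rfl⟩
  conn := freeD B m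
  conn_mem := fun h => mem_freeGr.2 fun a => B.d_mem (mem_freeGr.1 h a)
  conn_ract := fun h α => funext fun a => B.leibniz (mem_freeGr.1 h a) α
  conn_lact := fun hα u => funext fun a => B.leibniz hα (u a)
  flat := fun u => funext fun a => B.d_d (u a)

variable {W : Type u} [AddCommGroup W] [Module ℂ W] [FiniteDimensional ℂ W]

variable (B W) in
/-- The vector with constant coordinates that is given by an element of `W`, in terms of the
chosen basis of `W`. -/
noncomputable def constVec : W →ₗ[ℂ] (Fin (Module.finrank ℂ W) → B) :=
  LinearMap.pi fun a => Algebra.linearMap ℂ B ∘ₗ (Module.finBasis ℂ W).coord a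

theorem constVec_apply (w : W) (a) :
    constVec B W w a = algebraMap ℂ B ((Module.finBasis ℂ W).repr w a) := rfl

theorem constVec_mem (w : W) :
    constVec B W w ∈ freeGr B (Module.finrank ℂ W) 0 :=
  mem_freeGr.2 fun _ => algebraMap_mem _

theorem freeD_constVec (w : W) : freeD B _ (constVec B W w) = 0 :=
  funext fun _ => d_algebraMap _

/-- The extension of a linear map `g : W → E` to a `B`-linear map. -/
noncomputable def linLift (E : FlatBundle B) (g : W →ₗ[ℂ] E.carrier) :
    (Fin (Module.finrank ℂ W) → B) →ₗ[ℂ] E.carrier :=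
  ∑ a, E.lact.flip (g (Module.finBasis ℂ W a)) ∘ₗ LinearMap.proj a

theorem linLift_apply (E : FlatBundle B) (g : W →ₗ[ℂ] E.carrier) (u) :
    linLift E g u = ∑ a, E.lact (u a) (g (Module.finBasis ℂ W a)) := by
  rw [linLift, LinearMap.sum_apply]
  rfl

theorem linLift_constVec (E : FlatBundle B) (g : W →ₗ[ℂ] E.carrier) (w : W) :
    linLift E g (constVec B W w) = g w := by
  rw [linLift_apply]
  conv_rhs => rw [← (Module.finBasis ℂ W).sum_repr w, map_sum]
  refine Finset.sum_congr rfl fun a _ => ?_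
  rw [constVec_apply, lact_algebraMap, map_smul]

theorem linLift_lact (E : FlatBundle B) (g : W →ₗ[ℂ] E.carrier) (α : B) (u) :
    linLift E g (fun a => α * u a) = E.lact α (linLift E g u) := by
  rw [linLift_apply, linLift_apply, map_sum]
  exact Finset.sum_congr rfl fun a _ => E.mul_lact _ _ _

theorem linLift_eq_ract (E : FlatBundle B) {g : W →ₗ[ℂ] E.carrier} (hg : ∀ w, g w ∈ E.gr 0)
    (u) : linLift E g u = ∑ a, E.ract (g (Module.finBasis ℂ W a)) (u a) := by
  rw [linLift_apply]
  exact Finset.sum_congr rfl fun a _ => E.fgp.lact_of_mem_zero (hg _) _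

theorem linLift_ract (E : FlatBundle B) {g : W →ₗ[ℂ] E.carrier} (hg : ∀ w, g w ∈ E.gr 0)
    (u) (α : B) : linLift E g (fun a => u a * α) = E.ract (linLift E g u) α := by
  rw [linLift_eq_ract E hg, linLift_eq_ract E hg, map_sum, LinearMap.sum_apply]
  exact Finset.sum_congr rfl fun a _ => E.ract_mul _ _ _

theorem linLift_mem (E : FlatBundle B) {g : W →ₗ[ℂ] E.carrier} (hg : ∀ w, g w ∈ E.gr 0)
    {k : ℕ} {u : Fin (Module.finrank ℂ W) → B} (hu : ∀ a, u a ∈ B.gr k) :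
    linLift E g u ∈ E.gr k := by
  rw [linLift_apply]
  exact sum_mem fun a _ => E.lact_mem (l := 0) (hu a) (hg _)

theorem linLift_conn (E : FlatBundle B) {g : W →ₗ[ℂ] E.carrier} (hg : ∀ w, g w ∈ E.gr 0) (u) :
    E.conn (linLift E g u) =
      ∑ a, E.ract (E.conn (g (Module.finBasis ℂ W a))) (u a) + linLift E g (freeD B _ u) := by
  rw [linLift_eq_ract E hg, linLift_eq_ract E hg, map_sum, ← Finset.sum_add_distrib]
  exact Finset.sum_congr rfl fun a _ => E.conn_ract_zero (hg _) _

theorem linLift_conn_flat (E : FlatBundle B) {g : W →ₗ[ℂ] E.carrier} (hg : ∀ w, g w ∈ E.gr 0)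
    (h : ∀ w, E.conn (g w) = 0) (u) : E.conn (linLift E g u) = linLift E g (freeD B _ u) := by
  rw [linLift_conn E hg]
  simp [h]

theorem sum_lact_constVec (u : Fin (Module.finrank ℂ W) → B) :
    u = ∑ a, fun b => u a * constVec B W (Module.finBasis ℂ W a) b := by
  funext b
  rw [Finset.sum_apply, Finset.sum_eq_single b]
  · rw [constVec_apply, Module.Basis.repr_self, Finsupp.single_eq_same, map_one, mul_one]
  · intro a _ hab
    rw [constVec_apply, Module.Basis.repr_self, Finsupp.single_eq_of_ne (Ne.symm hab), map_zero,
      mul_zero]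
  · exact fun h => absurd (Finset.mem_univ b) h

/-- Left linear maps on `Bᵐ` agree if they agree on constant vectors. -/
theorem linear_ext (E : FlatBundle B) {f g : (Fin (Module.finrank ℂ W) → B) →ₗ[ℂ] E.carrier}
    (hf : ∀ (α : B) u, f (fun a => α * u a) = E.lact α (f u))
    (hg : ∀ (α : B) u, g (fun a => α * u a) = E.lact α (g u))
    (h : ∀ w, f (constVec B W w) = g (constVec B W w)) : f = g := by
  refine LinearMap.ext fun u => ?_
  rw [sum_lact_constVec u, map_sum, map_sum]
  exact Finset.sum_congr rfl fun a _ => by rw [hf, hg, h]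

variable (B) in
/-- The action on `Bᵐ` of an endomorphism of `W`. -/
noncomputable def matEnd (T : Module.End ℂ W) :
    Module.End ℂ (trivial B (Module.finrank ℂ W)).carrier :=
  linLift (trivial B (Module.finrank ℂ W)) (constVec B W ∘ₗ T)

theorem matEnd_constVec (T : Module.End ℂ W) (w : W) :
    matEnd B T (constVec B W w) = constVec B W (T w) :=
  linLift_constVec (trivial B (Module.finrank ℂ W)) (constVec B W ∘ₗ T) w

theorem linLift_matEnd (E : FlatBundle B) (g : W →ₗ[ℂ] E.carrier) (T : Module.End ℂ W) (u) :
    linLift E g (matEnd B T u) = linLift E (g ∘ₗ T) u := by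
  refine LinearMap.congr_fun (f := linLift E g ∘ₗ matEnd B T) (linear_ext E (fun α u => ?_)
    (linLift_lact E _) fun w => ?_) u
  · refine (congrArg (linLift E g) (linLift_lact (trivial B _) (constVec B W ∘ₗ T) α u)).trans ?_
    exact linLift_lact E g α _
  · refine (congrArg (linLift E g) (matEnd_constVec T w)).trans ?_
    rw [linLift_constVec, linLift_constVec]
    rfl

theorem matEnd_parallel (T : Module.End ℂ W) :
    matEnd B T ∈ (trivial B (Module.finrank ℂ W)).parallel := by
  have hg : ∀ w, (constVec B W ∘ₗ T) w ∈ (trivial B (Module.finrank ℂ W)).gr 0 :=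
    fun w => constVec_mem (T w)
  refine ⟨fun k u hu => linLift_mem _ hg (mem_freeGr.1 hu), fun α u => linLift_lact _ _ α u,
    fun u α => linLift_ract _ hg u α, fun u => ?_⟩
  exact (linLift_conn_flat (trivial B (Module.finrank ℂ W)) hg (fun w => freeD_constVec (T w))
    u).symm

theorem matEnd_comm {S T : Module.End ℂ W} (h : Commute S T) :
    Commute (matEnd B S) (matEnd B T) := by
  refine linear_ext (trivial B (Module.finrank ℂ W)) (fun α u => ?_) (fun α u => ?_) fun w => ?_
  · exact (mul_mem (matEnd_parallel S) (matEnd_parallel T)).2.1 α u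
  · exact (mul_mem (matEnd_parallel T) (matEnd_parallel S)).2.1 α u
  · exact (congrArg (matEnd B S) (matEnd_constVec T w)).trans ((matEnd_constVec S _).trans
      ((congrArg (constVec B W) (LinearMap.congr_fun h w)).trans ((matEnd_constVec T _).symm.trans
        (congrArg (matEnd B T) (matEnd_constVec S w)).symm)))

end Free

section Lin

variable {n : ℕ} (K : B.Cartan n) {W : Type u} [AddCommGroup W] [Module ℂ W]
  [FiniteDimensional ℂ W] (N : Fin n → Module.End ℂ W) (hc : ∀ i j, Commute (N i) (N j))

/-- The flat connection `d + ∑ v_j N_j` on `W ⊗ B`, in coordinates. -/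
noncomputable def linBundle : FlatBundle B :=
  twist K (trivial B (Module.finrank ℂ W)) (fun j => matEnd B (N j))
    (fun j => matEnd_parallel (N j)) fun i j => matEnd_comm (hc i j)

/-- The constant section given by an element of `W`. -/
noncomputable def constSec : W →ₗ[ℂ] (linBundle K N hc).carrier := constVec B W

theorem constSec_mem (w : W) : constSec K N hc w ∈ (linBundle K N hc).gr 0 := constVec_mem w

theorem conn_constSec (w : W) : (linBundle K N hc).conn (constSec K N hc w) =
    ∑ j, (linBundle K N hc).lact (K.v j) (constSec K N hc (N j w)) := by
  refine (twist_conn K (trivial B (Module.finrank ℂ W)) _ _ _ _).trans ?_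
  have h : (trivial B (Module.finrank ℂ W)).conn (constVec B W w) = 0 := freeD_constVec w
  refine (congrArg (fun z => z + _) h).trans ((zero_add _).trans ?_)
  refine Finset.sum_congr rfl fun j _ => ?_
  exact congrArg _ (matEnd_constVec (N j) w)

/-- The universal property of `linBundle`: a morphism is determined by the images of the
constant sections. -/
noncomputable def linHom {E : FlatBundle B} (g : W →ₗ[ℂ] E.carrier) (hg : ∀ w, g w ∈ E.gr 0)
    (h : ∀ w, E.conn (g w) = ∑ j, E.lact (K.v j) (g (N j w))) : linBundle K N hc ⟶ E :=
  (⟨⟨linLift E g, fun hu => linLift_mem E hg (mem_freeGr.1 hu), linLift_lact E g,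
    linLift_ract E hg⟩, fun u => by
      refine Eq.trans ?_ (linLift_conn E hg u).symm
      refine (congrArg (linLift E g) (twist_conn K (trivial B (Module.finrank ℂ W)) _ _ _
        u)).trans ((map_add (linLift E g) _ _).trans ((add_comm _ _).trans ?_))
      refine congrArg (fun z => z + _) ((map_sum (linLift E g) _ _).trans ?_)
      simp only [h, map_sum, LinearMap.sum_apply]
      rw [Finset.sum_comm]
      refine Finset.sum_congr rfl fun j _ => ?_
      refine (linLift_lact E g (K.v j) (matEnd B (N j) u)).trans ?_
      refine (congrArg (E.lact (K.v j)) ((linLift_matEnd E g (N j) u).trans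
        (linLift_apply E _ u))).trans ((map_sum _ _ _).trans ?_)
      refine Finset.sum_congr rfl fun a _ => ?_
      rw [E.ract_lact]
      exact congrArg (E.lact (K.v j)) (E.fgp.lact_of_mem_zero (hg _) _)⟩ : Hom (linBundle K N hc) E)

theorem linHom_constSec {E : FlatBundle B} (g : W →ₗ[ℂ] E.carrier) (hg : ∀ w, g w ∈ E.gr 0)
    (h : ∀ w, E.conn (g w) = ∑ j, E.lact (K.v j) (g (N j w))) (w : W) :
    Hom.toLin (Hom.toHom (linHom K N hc g hg h)) (constSec K N hc w) = g w :=
  linLift_constVec E g w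

variable (p : B.gr 0 →ₐ[ℂ] ℂ)

/-- The class of a constant section. -/
noncomputable def linFibreMap : W →ₗ[ℂ] Fibre p (linBundle K N hc) :=
  fibreMk p (linBundle K N hc) ∘ₗ (constSec K N hc).codRestrict _ (constSec_mem K N hc)

/-- The coordinates of a section of degree `0`. -/
def linCoord (a : Fin (Module.finrank ℂ W)) : (linBundle K N hc).gr 0 →ₗ[ℂ] B.gr 0 where
  toFun u := ⟨(show Fin (Module.finrank ℂ W) → B from u.1) a, mem_freeGr.1 u.2 a⟩
  map_add' _ _ := rfl
  map_smul' _ _ := rfl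

theorem linCoord_act (a : Fin (Module.finrank ℂ W)) (b : B.gr 0) (e : (linBundle K N hc).gr 0) :
    linCoord K N hc a (act₀ (linBundle K N hc) b e) = b * linCoord K N hc a e := rfl

/-- The values at `p` of the coordinates of a section. -/
noncomputable def linEval : (linBundle K N hc).gr 0 →ₗ[ℂ] W :=
  ∑ a, (p.toLinearMap ∘ₗ linCoord K N hc a).smulRight (Module.finBasis ℂ W a)

theorem linEval_apply (u : (linBundle K N hc).gr 0) :
    linEval K N hc p u = ∑ a, p (linCoord K N hc a u) • Module.finBasis ℂ W a := by
  rw [linEval, LinearMap.sum_apply]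
  rfl

theorem linEval_act (a : B.gr 0) (e : (linBundle K N hc).gr 0) :
    linEval K N hc p (act₀ (linBundle K N hc) a e) = p a • linEval K N hc p e := by
  rw [linEval_apply, linEval_apply, Finset.smul_sum]
  refine Finset.sum_congr rfl fun b _ => ?_
  rw [linCoord_act, map_mul, smul_smul]

theorem linEval_constSec (w : W) :
    linEval K N hc p ⟨constSec K N hc w, constSec_mem K N hc w⟩ = w := by
  rw [linEval_apply]
  conv_rhs => rw [← (Module.finBasis ℂ W).sum_repr w]
  refine Finset.sum_congr rfl fun a _ => ?_
  congr 1
  exact p.commutes ((Module.finBasis ℂ W).repr w a)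

theorem eq_sum_act_constSec (u : (linBundle K N hc).gr 0) :
    u = ∑ a, act₀ (linBundle K N hc) (linCoord K N hc a u)
      ⟨constSec K N hc (Module.finBasis ℂ W a), constSec_mem K N hc _⟩ := by
  refine Subtype.ext ((sum_lact_constVec (show Fin (Module.finrank ℂ W) → B from u.1)).trans ?_)
  exact (map_sum ((linBundle K N hc).gr 0).subtype (fun a => act₀ (linBundle K N hc)
    (linCoord K N hc a u) ⟨constSec K N hc (Module.finBasis ℂ W a), constSec_mem K N hc _⟩)
    Finset.univ).symm

theorem linFibreMap_bijective : Function.Bijective (linFibreMap K N hc p) := by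
  let ψ : Fibre p (linBundle K N hc) →ₗ[ℂ] W :=
    fibreLift p (linEval K N hc p) (linEval_act K N hc p)
  have h1 : ∀ w, ψ (linFibreMap K N hc p w) = w := linEval_constSec K N hc p
  refine ⟨Function.LeftInverse.injective h1, fun y => ?_⟩
  obtain ⟨u, rfl⟩ := fibreMk_surjective p _ y
  refine ⟨linEval K N hc p u, ?_⟩
  conv_rhs => rw [eq_sum_act_constSec K N hc u, map_sum]
  rw [linEval_apply, map_sum]
  refine Finset.sum_congr rfl fun a _ => ?_
  rw [fibreMk_act, map_smul]
  rfl

/-- The fibre of `linBundle` is `W`. -/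
noncomputable def linFibre : W ≃ₗ[ℂ] Fibre p (linBundle K N hc) :=
  LinearEquiv.ofBijective (linFibreMap K N hc p) (linFibreMap_bijective K N hc p)

theorem linHom_fibre {E : FlatBundle B} (g : W →ₗ[ℂ] E.carrier) (hg : ∀ w, g w ∈ E.gr 0)
    (h : ∀ w, E.conn (g w) = ∑ j, E.lact (K.v j) (g (N j w))) (w : W) :
    ((fibreFunctor p).map (linHom K N hc g hg h)).hom (linFibre K N hc p w) =
      fibreMk p E ⟨g w, hg w⟩ := by
  refine (fibreFunctor_map_mk p (linHom K N hc g hg h) _).trans ?_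
  congr 1
  exact Subtype.ext (linHom_constSec K N hc g hg h w)

theorem residue_constSec (j : Fin n) (w : W) :
    residue K (linBundle K N hc) j (constSec K N hc w) = constSec K N hc (N j w) := by
  refine (residue_twist K (trivial B (Module.finrank ℂ W)) _ _ _ j (constVec_mem w)).trans ?_
  have h : residue K (trivial B (Module.finrank ℂ W)) j (constVec B W w) = 0 := by
    rw [residue_zero K (trivial B (Module.finrank ℂ W)) j (constVec_mem w)]
    refine (congrArg (contr K (trivial B (Module.finrank ℂ W)) j) (freeD_constVec w)).trans ?_
    exact map_zero _
  refine (congrArg (fun z => z + _) h).trans ((zero_add _).trans ?_)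
  exact matEnd_constVec (N j) w

end Lin

/-! ### Representations of `ℝⁿ` as flat connections -/

section LinComparison

variable {n : ℕ}

/-- Generators of a continuous representation of `ℝⁿ`. -/
noncomputable def _root_.NCG.ContRep.gen (X : ContRep.{u} (Multiplicative (Fin n → ℝ))) :
    Fin n → Module.End ℂ X.carrier := (exists_eq_expRep X.σ X.σ_cont).choose

theorem _root_.NCG.ContRep.gen_comm (X : ContRep.{u} (Multiplicative (Fin n → ℝ))) (i j) :
    Commute (X.gen i) (X.gen j) := (exists_eq_expRep X.σ X.σ_cont).choose_spec.choose i j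

theorem _root_.NCG.ContRep.eq_gen (X : ContRep.{u} (Multiplicative (Fin n → ℝ))) :
    X.σ = expRep X.gen X.gen_comm := (exists_eq_expRep X.σ X.σ_cont).choose_spec.choose_spec

/-- Intertwiners of representations of `ℝⁿ` intertwine the generators. -/
theorem _root_.NCG.ContRep.gen_intertwine {X Y : ContRep.{u} (Multiplicative (Fin n → ℝ))}
    {φ : X.carrier →ₗ[ℂ] Y.carrier} (h : ∀ t x, φ (X.σ t x) = Y.σ t (φ x)) (j) (x) :
    φ (X.gen j x) = Y.gen j (φ x) := by
  refine LinearMap.congr_fun (expRep_generator (hc := X.gen_comm) (hc' := Y.gen_comm)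
    (φ := φ) (fun t => ?_) j) x
  rw [← X.eq_gen, ← Y.eq_gen]
  exact LinearMap.ext (h t)

/-- The generators are determined by the representation. -/
theorem _root_.NCG.ContRep.gen_eq (X : ContRep.{u} (Multiplicative (Fin n → ℝ)))
    {N : Fin n → Module.End ℂ X.carrier} {hc : ∀ i j, Commute (N i) (N j)}
    (h : X.σ = expRep N hc) : X.gen = N := by
  refine funext fun j => expRep_generator (hc := X.gen_comm) (hc' := hc) (φ := LinearMap.id)
    (fun t => ?_) j
  rw [← X.eq_gen, h]
  rfl

theorem expRep_zero {W : Type u} [AddCommGroup W] [Module ℂ W] [FiniteDimensional ℂ W]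
    (hc : ∀ i j, Commute ((0 : Fin n → Module.End ℂ W) i) ((0 : Fin n → Module.End ℂ W) j)) :
    expRep (0 : Fin n → Module.End ℂ W) hc = 1 := by
  refine MonoidHom.ext fun t => ?_
  have h : linComb (0 : Fin n → Module.End ℂ W) t.toAdd = 0 := by simp [linComb]
  exact (congrArg endExp h).trans endExp_zero

variable (K : B.Cartan n) (p : B.gr 0 →ₐ[ℂ] ℂ)

/-- The flat connection of a continuous representation of `ℝⁿ`. -/
noncomputable def ofContRep (X : ContRep.{u} (Multiplicative (Fin n → ℝ))) : FlatBundle B :=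
  linBundle K X.gen X.gen_comm

variable {E F : FlatBundle B}

theorem conn_tm_zero {e : E.carrier} (he : e ∈ E.gr 0) (f : F.carrier) :
    (tensor E F).conn (GradedBimodule.tm E.toGradedBimodule F.toGradedBimodule e f) =
      (GradedBimodule.tm E.toGradedBimodule F.toGradedBimodule (E.conn e) f +
        GradedBimodule.tm E.toGradedBimodule F.toGradedBimodule e (F.conn f) :
        TensorCarrier _ _) := by
  have := tConn_tm he f
  rwa [pow_zero, one_smul] at this

/-- In a tensor product, the left action may be moved past a factor of degree `0`. -/
theorem tm_lact_right {e : E.carrier} (he : e ∈ E.gr 0) (α : B) (f : F.carrier) :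
    GradedBimodule.tm E.toGradedBimodule F.toGradedBimodule e (F.lact α f) =
      GradedBimodule.tL _ _ α (GradedBimodule.tm E.toGradedBimodule F.toGradedBimodule e f) := by
  rw [← tm_balanced, ← E.fgp.lact_of_mem_zero he]
  rfl

theorem conn_tm_of_conn {e : E.carrier} (he : e ∈ E.gr 0) {f : F.carrier}
    {e' : Fin n → E.carrier} (h : E.conn e = ∑ j, E.lact (K.v j) (e' j))
    {f' : Fin n → F.carrier} (h' : F.conn f = ∑ j, F.lact (K.v j) (f' j)) :
    (tensor E F).conn (GradedBimodule.tm E.toGradedBimodule F.toGradedBimodule e f) =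
      ∑ j, (tensor E F).lact (K.v j)
        (GradedBimodule.tm E.toGradedBimodule F.toGradedBimodule (e' j) f +
          GradedBimodule.tm E.toGradedBimodule F.toGradedBimodule e (f' j) :
          TensorCarrier _ _) := by
  refine (conn_tm_zero he f).trans ?_
  rw [h, h', map_sum, map_sum, LinearMap.sum_apply, ← Finset.sum_add_distrib]
  refine Finset.sum_congr rfl fun j _ => ?_
  rw [tm_lact_right he]
  exact (map_add (tL E.toGradedBimodule F.toGradedBimodule (K.v j))
    (GradedBimodule.tm E.toGradedBimodule F.toGradedBimodule (e' j) f)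
    (GradedBimodule.tm E.toGradedBimodule F.toGradedBimodule e (f' j))).symm

theorem gen_tensor (X Y : ContRep.{u} (Multiplicative (Fin n → ℝ))) (j : Fin n)
    (z : X.carrier ⊗[ℂ] Y.carrier) :
    ((ContRep.fibreData _).tensor X Y).gen j z = TensorProduct.map (X.gen j) LinearMap.id z +
      TensorProduct.map LinearMap.id (Y.gen j) z := by
  have hc : ∀ i j, Commute (TensorProduct.map (X.gen i) LinearMap.id +
      TensorProduct.map LinearMap.id (Y.gen i) : Module.End ℂ (X.carrier ⊗[ℂ] Y.carrier))
      (TensorProduct.map (X.gen j) LinearMap.id + TensorProduct.map LinearMap.id (Y.gen j)) := by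
    intro i j
    refine TensorProduct.ext' fun x y => ?_
    have h1 : X.gen i (X.gen j x) = X.gen j (X.gen i x) := LinearMap.congr_fun (X.gen_comm i j) x
    have h2 : Y.gen i (Y.gen j y) = Y.gen j (Y.gen i y) := LinearMap.congr_fun (Y.gen_comm i j) y
    simp only [Module.End.mul_apply, LinearMap.add_apply, TensorProduct.map_tmul,
      LinearMap.id_apply, map_add, h1, h2]
    abel
  have h := expRep_tensor X.gen_comm Y.gen_comm hc
  rw [← X.eq_gen, ← Y.eq_gen] at h
  exact LinearMap.congr_fun (congrFun
    (ContRep.gen_eq ((ContRep.fibreData _).tensor X Y) (hc := hc) h.symm) j) z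

/-- The bilinear map `(x, y) ↦ x ⊗ y` of constant sections. -/
noncomputable def constTensor (X Y : ContRep.{u} (Multiplicative (Fin n → ℝ))) :
    X.carrier ⊗[ℂ] Y.carrier →ₗ[ℂ] (tensor (ofContRep K X) (ofContRep K Y)).carrier :=
  TensorProduct.lift ((GradedBimodule.tm (ofContRep K X).toGradedBimodule
    (ofContRep K Y).toGradedBimodule).compl₁₂ (constSec K X.gen X.gen_comm)
      (constSec K Y.gen Y.gen_comm))

theorem constTensor_mem (X Y : ContRep.{u} (Multiplicative (Fin n → ℝ)))
    (z : X.carrier ⊗[ℂ] Y.carrier) :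
    constTensor K X Y z ∈ (tensor (ofContRep K X) (ofContRep K Y)).gr 0 := by
  induction z using TensorProduct.induction_on with
  | zero => rw [map_zero]; exact zero_mem _
  | add x y hx hy => rw [map_add]; exact add_mem hx hy
  | tmul x y =>
    exact GradedBimodule.tm_mem (k := 0) (l := 0) (E := (ofContRep K X).toGradedBimodule)
      (F := (ofContRep K Y).toGradedBimodule) (constSec_mem K X.gen X.gen_comm x)
      (constSec_mem K Y.gen Y.gen_comm y)

theorem constTensor_conn (X Y : ContRep.{u} (Multiplicative (Fin n → ℝ)))
    (z : X.carrier ⊗[ℂ] Y.carrier) :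
    (tensor (ofContRep K X) (ofContRep K Y)).conn (constTensor K X Y z) =
      ∑ j, (tensor (ofContRep K X) (ofContRep K Y)).lact (K.v j)
        (constTensor K X Y (((ContRep.fibreData _).tensor X Y).gen j z)) := by
  have hg := gen_tensor X Y
  generalize ((ContRep.fibreData _).tensor X Y).gen = G at hg
  simp only [hg]
  induction z using TensorProduct.induction_on with
  | zero => simp
  | add x y hx hy =>
    rw [map_add, map_add, hx, hy, ← Finset.sum_add_distrib]
    refine Finset.sum_congr rfl fun j _ => ?_
    rw [← map_add, ← map_add]
    simp only [map_add]
    abel_nf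
  | tmul x y =>
    refine (conn_tm_of_conn K (E := ofContRep K X) (F := ofContRep K Y)
      (constSec_mem K X.gen X.gen_comm x)
      (conn_constSec K X.gen X.gen_comm x) (conn_constSec K Y.gen Y.gen_comm y)).trans ?_
    refine Finset.sum_congr rfl fun j _ => ?_
    rw [TensorProduct.map_tmul, TensorProduct.map_tmul, map_add]
    rfl

/-- The functor from continuous representations of `ℝⁿ` to flat connections as a comparison of
fibre functors. -/
noncomputable def linComparison : FibreFunctorData.Comparison
    (ContRep.fibreData.{u} (Multiplicative (Fin n → ℝ))) (fibreData p) where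
  obj := ofContRep K
  iso X := linFibre K X.gen X.gen_comm p
  nat := fun {X Y} f => by
    let φ := ContRep.Hom.toLin f
    have hφ : ∀ j x, φ (X.gen j x) = Y.gen j (φ x) :=
      ContRep.gen_intertwine (ContRep.Hom.map_σ f)
    refine ⟨linHom K X.gen X.gen_comm (E := ofContRep K Y)
      (constSec K Y.gen Y.gen_comm ∘ₗ φ) (fun w => constSec_mem K _ _ _) fun w => ?_, ?_⟩
    · refine (conn_constSec K Y.gen Y.gen_comm (φ w)).trans ?_
      refine Finset.sum_congr rfl fun j _ => ?_
      rw [← hφ]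
      rfl
    · refine LinearMap.ext fun w => ?_
      exact linHom_fibre K X.gen X.gen_comm p _ _ _ w
  unit := by
    let U := (ContRep.fibreData.{u} (Multiplicative (Fin n → ℝ))).unit
    let g : U.carrier →ₗ[ℂ] (FlatBundle.unit B).carrier :=
      Algebra.linearMap ℂ B ∘ₗ (ULift.moduleEquiv (R := ℂ) (M := ℂ)).toLinearMap
    have hU : U.gen = 0 := U.gen_eq (hc := fun _ _ => rfl) (expRep_zero _).symm
    have hg : ∀ w, (FlatBundle.unit B).conn (g w) =
        ∑ j, (FlatBundle.unit B).lact (K.v j) (g (U.gen j w)) := by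
      intro w
      refine (d_algebraMap _).trans (Finset.sum_eq_zero fun j _ => ?_).symm
      rw [hU]
      exact (congrArg _ (map_zero g)).trans (map_zero _)
    refine ⟨linHom K U.gen U.gen_comm g (fun w => algebraMap_mem _) hg, ?_⟩
    · rw [injective_iff_map_eq_zero]
      intro x hx
      obtain ⟨w, rfl⟩ := (linFibre K U.gen U.gen_comm p).surjective x
      have h := linHom_fibre K U.gen U.gen_comm p g (fun w => algebraMap_mem _) hg w
      have h2 : p (algebraMap ℂ _ w.down) = 0 :=
        (congrArg (fibreLift p (X := FlatBundle.unit B) p.toLinearMap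
          (fun a e => map_mul p a e)) (h.symm.trans hx)).trans (map_zero _)
      rw [p.commutes] at h2
      have h3 : w = 0 := ULift.ext _ _ h2
      rw [h3]
      exact map_zero _
  tensor := fun X Y => by
    let Z := (ContRep.fibreData (Multiplicative (Fin n → ℝ))).tensor X Y
    let m := linHom K Z.gen Z.gen_comm (constTensor K X Y) (constTensor_mem K X Y)
      (constTensor_conn K X Y)
    have hm : ((fibreFunctor p).map m).hom ∘ₗ (linFibre K Z.gen Z.gen_comm p).toLinearMap =
        fibreTensor p (ofContRep K X) (ofContRep K Y) ∘ₗ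
          TensorProduct.map (linFibre K X.gen X.gen_comm p).toLinearMap
            (linFibre K Y.gen Y.gen_comm p).toLinearMap := by
      refine TensorProduct.ext' fun x y => ?_
      exact linHom_fibre K Z.gen Z.gen_comm p _ _ _ (x ⊗ₜ y)
    refine ⟨_, m, 𝟙 _, ?_, ?_⟩
    · have h3 : Function.Bijective (fibreTensor p (ofContRep K X) (ofContRep K Y) ∘ₗ
          TensorProduct.map (linFibre K X.gen X.gen_comm p).toLinearMap
            (linFibre K Y.gen Y.gen_comm p).toLinearMap) :=
        (fibreTensor_bijective p _ _).comp (TensorProduct.congr (linFibre K X.gen X.gen_comm p)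
          (linFibre K Y.gen Y.gen_comm p)).bijective
      rw [← hm] at h3
      exact ((Function.Bijective.of_comp_iff ((fibreFunctor p).map m).hom
        (linFibre K Z.gen Z.gen_comm p).bijective).1 h3).1
    · refine TensorProduct.ext' fun x y => ?_
      exact LinearMap.congr_fun hm (x ⊗ₜ y)

end LinComparison

end FlatBundle

end NCG

namespace NCG

/-! ### Property Q and faithfulness of the fibre functor -/

/-- Property Q for sums over an arbitrary finite type. -/
theorem PropertyQ.of_fintype {Ω : CDGA.{u}} {A : Type v} [CommCStarAlgebra A] [PartialOrder A]
    [StarOrderedRing A] {ι : Ω.gr 0 →ₐ[ℂ] A} (hQ : PropertyQ Ω ι) {I : Type*} [Fintype I]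
    (a : Ω.gr 0) (b : I → Ω.gr 0) (ω : I → Ω) (h0 : 0 ≤ ι a)
    (hb : ∀ i, CFC.abs (ι (b i)) ≤ ι a) (hω : ∀ i, ω i ∈ Ω.gr 1)
    (h : Ω.d a = ∑ i, (b i : Ω) * ω i) : a = 0 ∨ IsUnit a := by
  refine hQ a (Fintype.card I) (b ∘ (Fintype.equivFin I).symm) (ω ∘ (Fintype.equivFin I).symm) h0
    (fun i => hb _) (fun i => hω _) (h.trans ?_)
  exact ((Fintype.equivFin I).symm.sum_comp (fun i => (b i : Ω) * ω i)).symm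

/-- In a commutative C*-algebra, `|x* y| ≤ a` if `x* x ≤ a` and `y* y ≤ a`. -/
theorem abs_star_mul_le {A : Type v} [CommCStarAlgebra A] [PartialOrder A] [StarOrderedRing A]
    {x y a : A} (hx : Star.star x * x ≤ a) (hy : Star.star y * y ≤ a) :
    CFC.abs (Star.star x * y) ≤ a := by
  have hx0 := star_mul_self_nonneg x
  have ha : 0 ≤ a := hx0.trans hx
  have h1 : Star.star (Star.star x * y) * (Star.star x * y) ≤ a * a := by
    rw [← sub_nonneg]
    have h2 : a * a - Star.star (Star.star x * y) * (Star.star x * y) =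
        (a - Star.star x * x) * a + Star.star x * x * (a - Star.star y * y) := by
      rw [star_mul, star_star]
      ring
    rw [h2]
    exact add_nonneg ((Commute.all _ _).mul_nonneg (sub_nonneg.2 hx) ha)
      ((Commute.all _ _).mul_nonneg hx0 (sub_nonneg.2 hy))
  calc CFC.abs (Star.star x * y) ≤ CFC.sqrt (a * a) := CFC.sqrt_le_sqrt _ _ h1
    _ = a := CFC.sqrt_mul_self a ha

namespace StarStructure

variable {Ω : CDGA.{u}} {A : Type v} [CommCStarAlgebra A] (S : StarStructure Ω A)

/-- The involution in degree `0`. -/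
def star₀ (a : Ω.gr 0) : Ω.gr 0 := ⟨S.star a, S.star_mem a.2⟩

theorem ι_star₀ (a : Ω.gr 0) : S.ι (S.star₀ a) = Star.star (S.ι a) := S.ι_star a

/-- Property Q forces solutions of a linear differential equation that vanish at a point to vanish
identically: apply it to `a = ∑ f_i* f_i`. -/
theorem eq_zero_of_d_eq [PartialOrder A] [StarOrderedRing A] (hQ : PropertyQ Ω S.ι)
    (p : WeakDual.characterSpace ℂ A) {I : Type*} [Fintype I] (f : I → Ω.gr 0) (θ : I → I → Ω)
    (hθ : ∀ i j, θ i j ∈ Ω.gr 1) (hd : ∀ i, Ω.d (f i) = ∑ j, (f j : Ω) * θ i j)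
    (hp : ∀ i, S.point p (f i) = 0) (i : I) : f i = 0 := by
  -- `da = ∑ f_i* f_j θ_{ij} + ∑ f_j* f_i θ_{ij}*`, and all `|f_i* f_j|` are at most `a`; the
  -- boolean in the index set tells the two sums apart.
  let a : Ω.gr 0 := ∑ i, S.star₀ (f i) * f i
  have hle : ∀ i, Star.star (S.ι (f i)) * S.ι (f i) ≤ S.ι a := by
    intro i
    simp only [a, map_sum, map_mul, ι_star₀]
    exact Finset.single_le_sum (f := fun i => Star.star (S.ι (f i)) * S.ι (f i))
      (fun j _ => star_mul_self_nonneg _) (Finset.mem_univ i)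
  have ha : 0 ≤ S.ι a := (star_mul_self_nonneg _).trans (hle i)
  let b : I × I × Bool → Ω.gr 0 := fun q =>
    if q.2.2 then S.star₀ (f q.1) * f q.2.1 else S.star₀ (f q.2.1) * f q.1
  let ω : I × I × Bool → Ω := fun q => if q.2.2 then θ q.1 q.2.1 else S.star (θ q.1 q.2.1)
  have hda : Ω.d a = ∑ q, (b q : Ω) * ω q := by
    have h1 : Ω.d a = ∑ i, Ω.d (S.star (f i) * (f i : Ω)) := by
      have : (a : Ω) = ∑ i, S.star (f i) * (f i : Ω) :=
        map_sum (Ω.gr 0).subtype (fun i => S.star₀ (f i) * f i) Finset.univ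
      rw [this, map_sum]
    rw [h1, Fintype.sum_prod_type]
    refine Finset.sum_congr rfl fun i _ => ?_
    have h2 : Ω.d (S.star (f i)) = ∑ j, S.star (f j) * S.star (θ i j) := by
      rw [S.d_star _ (f i).2, hd, map_sum]
      refine Finset.sum_congr rfl fun j _ => ?_
      rw [S.star_mul _ (f j).2]
      exact (Ω.mul_comm_zero (S.star_mem (f j).2) _).symm
    rw [Fintype.sum_prod_type]
    have h3 := Ω.leibniz (S.star_mem (f i).2) (f i : Ω)
    rw [pow_zero, one_smul] at h3
    rw [h3, h2, hd, Finset.sum_mul, Finset.mul_sum, ← Finset.sum_add_distrib]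
    refine Finset.sum_congr rfl fun j _ => ?_
    rw [Fintype.sum_bool, add_comm]
    congr 1
    · exact (mul_assoc _ _ _).symm
    · change _ = S.star (f j) * (f i : Ω) * S.star (θ i j)
      rw [mul_assoc, mul_assoc, ← Ω.mul_comm_zero (f i).2]
  have hb : ∀ q, CFC.abs (S.ι (b q)) ≤ S.ι a := by
    intro q
    by_cases hq : q.2.2
    · simp only [b, if_pos hq, map_mul, ι_star₀]
      exact abs_star_mul_le (hle _) (hle _)
    · simp only [b, if_neg hq, map_mul, ι_star₀]
      exact abs_star_mul_le (hle _) (hle _)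
  have hω : ∀ q, ω q ∈ Ω.gr 1 := by
    intro q
    by_cases hq : q.2.2
    · simp only [ω, if_pos hq]
      exact hθ _ _
    · simp only [ω, if_neg hq]
      exact S.star_mem (hθ _ _)
  -- If `a = 0`, then all `f_i` vanish; and `a` is not invertible, as `p(a) = 0`.
  rcases hQ.of_fintype a b ω ha hb hω hda with h | h
  · have h0 : Star.star (S.ι (f i)) * S.ι (f i) = 0 := by
      refine le_antisymm ?_ (star_mul_self_nonneg _)
      have := hle i
      rwa [h, map_zero] at this
    exact S.ι_injective ((CStarRing.star_mul_self_eq_zero_iff _).1 h0 |>.trans (map_zero S.ι).symm)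
  · refine absurd (h.map (S.point p)) ?_
    have : S.point p a = 0 := by
      simp only [a, map_sum, map_mul, hp, mul_zero, Finset.sum_const_zero]
    rw [this]
    exact not_isUnit_zero

end StarStructure

namespace FlatBundle

variable {Ω Ω' : CDGA.{u}}

/-- The matrix coefficients of a parallel endomorphism in a frame satisfy a linear differential
equation. -/
theorem d_coeff {X : FlatBundle Ω} (T : X.parallel) (a b : Fin X.frame.n) :
    Ω.d (X.frame.ξ b (T.1 (X.frame.x a))) =
      ∑ c, X.frame.ξ b (T.1 (X.frame.x c)) * X.frame.ξ c (X.conn (X.frame.x a)) +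
      ∑ c, X.frame.ξ c (T.1 (X.frame.x a)) *
        (Ω.d (X.frame.ξ b (X.frame.x c)) - X.frame.ξ b (X.conn (X.frame.x c))) := by
  have hx := X.frame.x_mem
  have hT : T.1 (X.frame.x a) ∈ X.gr 0 := T.2.1 0 _ (hx a)
  have h1 : X.frame.ξ b (X.conn (T.1 (X.frame.x a))) =
      ∑ c, X.frame.ξ b (T.1 (X.frame.x c)) * X.frame.ξ c (X.conn (X.frame.x a)) := by
    rw [← T.2.2.2.2]
    conv_lhs => rw [← X.frame.sum_eq (X.conn (X.frame.x a)), map_sum, map_sum]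
    refine Finset.sum_congr rfl fun c _ => ?_
    rw [T.2.2.2.1, X.frame.ξ_ract]
  have h2 : X.frame.ξ b (X.conn (T.1 (X.frame.x a))) =
      ∑ c, (X.frame.ξ b (X.conn (X.frame.x c)) * X.frame.ξ c (T.1 (X.frame.x a)) +
        X.frame.ξ b (X.frame.x c) * Ω.d (X.frame.ξ c (T.1 (X.frame.x a)))) := by
    conv_lhs => rw [← X.frame.sum_eq (T.1 (X.frame.x a)), map_sum, map_sum]
    refine Finset.sum_congr rfl fun c _ => ?_
    rw [X.conn_ract_zero (hx c), map_add, X.frame.ξ_ract, X.frame.ξ_ract]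
  have h3 : Ω.d (X.frame.ξ b (T.1 (X.frame.x a))) =
      ∑ c, (Ω.d (X.frame.ξ b (X.frame.x c)) * X.frame.ξ c (T.1 (X.frame.x a)) +
        X.frame.ξ b (X.frame.x c) * Ω.d (X.frame.ξ c (T.1 (X.frame.x a)))) := by
    conv_lhs => rw [← X.frame.sum_eq (T.1 (X.frame.x a)), map_sum, map_sum]
    refine Finset.sum_congr rfl fun c _ => ?_
    have := Ω.leibniz (X.frame.ξ_mem (hx c) b) (X.frame.ξ c (T.1 (X.frame.x a)))
    rw [X.frame.ξ_ract, this, pow_zero, one_smul]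
  rw [← h1, h2, h3, ← Finset.sum_add_distrib]
  refine Finset.sum_congr rfl fun c _ => ?_
  rw [mul_sub, ← Ω.mul_comm_zero (X.frame.ξ_mem hT c) (Ω.d _),
    ← Ω.mul_comm_zero (X.frame.ξ_mem hT c) (X.frame.ξ b (X.conn _))]
  abel

/-- A parallel endomorphism that vanishes on a frame is zero. -/
theorem parallel_eq_zero {X : FlatBundle Ω} {T : X.parallel}
    (h : ∀ a, T.1 (X.frame.x a) = 0) : T = 0 := by
  refine Subtype.ext (LinearMap.ext fun e => ?_)
  rw [← X.frame.sum_eq e, map_sum]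
  refine (Finset.sum_eq_zero fun a _ => ?_).trans (LinearMap.zero_apply _).symm
  rw [T.2.2.2.1, h, map_zero, LinearMap.zero_apply]

/-- Under property Q a parallel endomorphism is determined by its action on a fibre: its matrix
coefficients in a frame solve a linear differential equation. -/
theorem parallelFibre_injective_of_propertyQ {A : Type v} [CommCStarAlgebra A] [PartialOrder A]
    [StarOrderedRing A] (S : StarStructure Ω A) (hQ : PropertyQ Ω S.ι)
    (p : WeakDual.characterSpace ℂ A) (X : FlatBundle Ω) :
    Function.Injective (parallelFibre (S.point p) X) := by
  rw [injective_iff_map_eq_zero]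
  intro T hT
  let N := X.frame.n
  have hmem : ∀ a b, X.frame.ξ b (T.1 (X.frame.x a)) ∈ Ω.gr 0 :=
    fun a b => X.frame.ξ_mem (T.2.1 0 _ (X.frame.x_mem a)) b
  let f : Fin N × Fin N → Ω.gr 0 := fun q => ⟨X.frame.ξ q.1 (T.1 (X.frame.x q.2)), hmem _ _⟩
  let θ : Fin N × Fin N → Fin N × Fin N → Ω := fun q r =>
    (if r.1 = q.1 then X.frame.ξ r.2 (X.conn (X.frame.x q.2)) else 0) +
      (if r.2 = q.2 then Ω.d (X.frame.ξ q.1 (X.frame.x r.1)) -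
        X.frame.ξ q.1 (X.conn (X.frame.x r.1)) else 0)
  have hθ : ∀ q r, θ q r ∈ Ω.gr 1 := by
    intro q r
    have h1 : ∀ a b, X.frame.ξ b (X.conn (X.frame.x a)) ∈ Ω.gr 1 :=
      fun a b => X.frame.ξ_mem (X.conn_mem (X.frame.x_mem a)) b
    refine add_mem ?_ ?_
    · split_ifs
      exacts [h1 _ _, zero_mem _]
    · split_ifs
      exacts [sub_mem (Ω.d_mem (X.frame.ξ_mem (X.frame.x_mem _) _)) (h1 _ _), zero_mem _]
  have hd : ∀ q, Ω.d (f q) = ∑ r, (f r : Ω) * θ q r := by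
    rintro ⟨b, a⟩
    refine (d_coeff T a b).trans ?_
    simp only [θ, mul_add, Finset.sum_add_distrib]
    congr 1
    · symm
      rw [Fintype.sum_prod_type, Finset.sum_eq_single b]
      · simp [f]
        rfl
      · intro c _ hc
        simp [hc]
      · exact fun h => absurd (Finset.mem_univ b) h
    · symm
      rw [Fintype.sum_prod_type_right, Finset.sum_eq_single a]
      · simp [f]
        rfl
      · intro c _ hc
        simp [hc]
      · exact fun h => absurd (Finset.mem_univ a) h
  -- The coefficients at `p` are read off from the action on the fibre, which is zero.
  have hp : ∀ q, S.point p (f q) = 0 := by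
    rintro ⟨b, a⟩
    let ζ : X.gr 0 →ₗ[ℂ] ℂ := (S.point p).toLinearMap ∘ₗ
      ((X.frame.ξ b).restrict fun e (he : e ∈ X.gr 0) => X.frame.ξ_mem he b)
    have hζ : ∀ c e, ζ (act₀ X c e) = S.point p c • ζ e := by
      intro c e
      rw [smul_eq_mul]
      change S.point p _ = S.point p c * S.point p _
      rw [← map_mul]
      congr 1
      exact Subtype.ext (X.frame.ξ_lact b c e)
    have h1 := LinearMap.congr_fun hT (fibreMk (S.point p) X ⟨X.frame.x a, X.frame.x_mem a⟩)
    exact (congrArg (fibreLift (S.point p) ζ hζ) h1).trans (map_zero _)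
  refine parallel_eq_zero fun a => ?_
  rw [← X.frame.sum_eq (T.1 (X.frame.x a))]
  refine Finset.sum_eq_zero fun b _ => ?_
  have h := congrArg Subtype.val (S.eq_zero_of_d_eq hQ p f θ hθ hd hp (b, a))
  exact (congrArg (X.ract (X.frame.x b)) h).trans (map_zero _)

/-- If parallel endomorphisms of the base change of `X` are determined by their action on the
fibre, so are those of `X`. -/
theorem parallelFibre_injective_of_baseChange (f : CDGA.Hom Ω Ω') (hf : Function.Bijective f.map₀)
    {p : Ω.gr 0 →ₐ[ℂ] ℂ} {p' : Ω'.gr 0 →ₐ[ℂ] ℂ} (h : ∀ a, p' (f.map₀ a) = p a) (X : FlatBundle Ω)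
    (hX : Function.Injective (parallelFibre p' (baseChange f X))) :
    Function.Injective (parallelFibre p X) := by
  rw [injective_iff_map_eq_zero] at hX ⊢
  intro T hT
  let φ : SHom f X (baseChange f X) := (toBaseChange f X).comp (SHom.ofHom (parallelHom T.2))
  let ψ : FlatBundle.Hom (baseChange f X) (baseChange f X) := φ.bcHom
  let T' : (baseChange f X).parallel :=
    ⟨ψ.toLin, fun k e he => ψ.map_mem he, ψ.map_lact, ψ.map_ract, ψ.map_conn⟩
  have h1 : parallelFibre p' (baseChange f X) T' ∘ₗ (baseChangeFibre f hf h X).toLinearMap = 0 := by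
    refine (SHom.bcHom_fibre hf h φ).trans (fibre_ext p fun e => ?_)
    have h2 := LinearMap.congr_fun hT (fibreMk p X e)
    exact (congrArg (baseChangeFibre f hf h X) h2).trans (map_zero _)
  have h3 : T' = 0 := by
    refine hX T' (LinearMap.ext fun x => ?_)
    obtain ⟨y, rfl⟩ := (baseChangeFibre f hf h X).surjective x
    exact LinearMap.congr_fun h1 y
  refine parallel_eq_zero fun a => ?_
  have h4 : (toBaseChange f X).toLin (T.1 (X.frame.x a)) = 0 := by
    refine (SHom.baseChangeLift_apply (g := CDGA.Hom.id Ω') (f := f) φ (X.frame.x a)).symm.trans ?_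
    exact LinearMap.congr_fun (congrArg Subtype.val h3) _
  have h5 := (toBaseChange_map₀_bijective f hf X).1 (a₁ := ⟨T.1 (X.frame.x a),
    T.2.1 0 _ (X.frame.x_mem a)⟩) (a₂ := 0) (Subtype.ext (h4.trans (map_zero _).symm))
  exact congrArg Subtype.val h5

/-- If the base point is injective, then the fibre is all of `X⁰`, and a parallel endomorphism is
determined by its action on it. -/
theorem parallelFibre_injective_of_point {p : Ω.gr 0 →ₐ[ℂ] ℂ} (hp : Function.Injective p)
    (X : FlatBundle Ω) : Function.Injective (parallelFibre p X) := by
  have hrel : fibreRel p X = ⊥ := by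
    rw [eq_bot_iff, fibreRel, Submodule.span_le]
    rintro _ ⟨a, e, rfl⟩
    have ha : a = algebraMap ℂ _ (p a) := hp (p.commutes (p a)).symm
    refine (Submodule.mem_bot ℂ).2 (sub_eq_zero.2 (Subtype.ext ?_))
    have h : (a : Ω) = algebraMap ℂ Ω (p a) := congrArg Subtype.val ha
    exact (congrArg (fun z => X.lact z e) h).trans (lact_algebraMap X (p a) e)
  rw [injective_iff_map_eq_zero]
  intro T hT
  refine parallel_eq_zero fun a => ?_
  have h1 := LinearMap.congr_fun hT (fibreMk p X ⟨X.frame.x a, X.frame.x_mem a⟩)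
  have h2 := (Submodule.Quotient.mk_eq_zero (fibreRel p X)).1 h1
  rw [hrel, Submodule.mem_bot] at h2
  exact congrArg Subtype.val h2

end FlatBundle

end NCG

namespace NCG

namespace FlatBundle

open GradedBimodule

variable {B : CDGA.{u}}

/-! ### Splitting a flat connection into its residues and a connection without residues -/

/-- A frame of `E` spans the fibre. -/
instance fibre_finiteDimensional (p : B.gr 0 →ₐ[ℂ] ℂ) (E : FlatBundle B) :
    FiniteDimensional ℂ (Fibre p E) := by
  refine Module.Finite.of_surjective (M := Fin E.frame.n → ℂ)
    (Fintype.linearCombination ℂ fun a => fibreMk p E ⟨E.frame.x a, E.frame.x_mem a⟩) fun y => ?_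
  obtain ⟨e, rfl⟩ := fibreMk_surjective p E y
  refine ⟨fun a => p ⟨E.frame.ξ a e, E.frame.ξ_mem e.2 a⟩, ?_⟩
  rw [Fintype.linearCombination_apply]
  simp only [← fibreMk_act]
  rw [← map_sum]
  congr 1
  refine Subtype.ext ((map_sum (E.gr 0).subtype _ _).trans ?_)
  conv_rhs => rw [← E.frame.sum_eq (e : E.carrier)]
  exact Finset.sum_congr rfl fun a _ => E.fgp.lact_of_mem_zero (E.frame.x_mem a) _

/-- A linear map that is determined by its values in degree `0`, and commutes with the connections
there, is a morphism. -/
def homOfZero {E F : FlatBundle B} (f : E.carrier →ₗ[ℂ] F.carrier)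
    (h₀ : ∀ e ∈ E.gr 0, f e ∈ F.gr 0)
    (h : ∀ e ∈ E.gr 0, ∀ α, f (E.ract e α) = F.ract (f e) α)
    (hc : ∀ e ∈ E.gr 0, f (E.conn e) = F.conn (f e)) : E ⟶ F :=
  (⟨GradedBimodule.Hom.ofZero E.fgp F.fgp f h₀ h, fun e => by
    have hr : ∀ e α, f (E.ract e α) = F.ract (f e) α :=
      (GradedBimodule.Hom.ofZero E.fgp F.fgp f h₀ h).map_ract
    change f (E.conn e) = F.conn (f e)
    rw [← E.frame.sum_eq e, map_sum, map_sum, map_sum, map_sum]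
    refine Finset.sum_congr rfl fun a _ => ?_
    have hx := E.frame.x_mem a
    rw [E.conn_ract_zero hx, map_add, hr, hr, hr, hc _ hx, F.conn_ract_zero (h₀ _ hx)]⟩ : Hom E F)

theorem homOfZero_fibre (p : B.gr 0 →ₐ[ℂ] ℂ) {E F : FlatBundle B}
    (f : E.carrier →ₗ[ℂ] F.carrier) (h₀ : ∀ e ∈ E.gr 0, f e ∈ F.gr 0)
    (h : ∀ e ∈ E.gr 0, ∀ α, f (E.ract e α) = F.ract (f e) α)
    (hc : ∀ e ∈ E.gr 0, f (E.conn e) = F.conn (f e)) (e : E.gr 0) :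
    ((fibreFunctor p).map (homOfZero f h₀ h hc)).hom (fibreMk p E e) =
      fibreMk p F ⟨f e, h₀ e e.2⟩ := rfl

theorem conn_ract_of_flat {E : FlatBundle B} {e : E.carrier} (he : e ∈ E.gr 0)
    (hc : E.conn e = 0) (a : B) : E.conn (E.ract e a) = E.ract e (B.d a) := by
  rw [E.conn_ract_zero he, hc, map_zero, LinearMap.zero_apply, zero_add]

/-- The morphism from the unit object given by a flat element of degree `0`. -/
noncomputable def ofFlat {E : FlatBundle B} {e : E.carrier} (he : e ∈ E.gr 0)
    (hc : E.conn e = 0) : FlatBundle.unit B ⟶ E :=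
  homOfZero (E := FlatBundle.unit B) (E.ract e)
    (fun _ ha => E.ract_mem (k := 0) (l := 0) he ha)
    (fun _ _ β => E.ract_mul e _ β)
    (fun _ _ => (conn_ract_of_flat he hc _).symm)

section Points

variable {p : B.gr 0 →ₐ[ℂ] ℂ} {R : Type u} [CommRing R] [Algebra ℂ R]

/-- Tensor automorphisms fix the classes of flat elements. -/
theorem aut_flat (θ : (fibreData p).autPoints R) {E : FlatBundle B} {e : E.carrier}
    (he : e ∈ E.gr 0) (hc : E.conn e = 0) :
    (θ.1 E).val ((1 : R) ⊗ₜ fibreMk p E ⟨e, he⟩) = (1 : R) ⊗ₜ fibreMk p E ⟨e, he⟩ := by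
  have h1 : ((fibreData p).ω.map (ofFlat he hc)).hom
      (fibreMk p (FlatBundle.unit B) (⟨(1 : B), B.one_mem⟩ : B.gr 0)) = fibreMk p E ⟨e, he⟩ :=
    congrArg (fibreMk p E) (Subtype.ext (E.ract_one e))
  have h2 := LinearMap.congr_fun (FibreFunctorData.aut_nat θ (ofFlat he hc))
    ((1 : R) ⊗ₜ fibreMk p (FlatBundle.unit B) (⟨(1 : B), B.one_mem⟩ : B.gr 0))
  have h3 : θ.1 (FlatBundle.unit B) = 1 := FibreFunctorData.aut_unit θ
  rw [h3] at h2
  have h4 : ((fibreData p).ω.map (ofFlat he hc)).hom.baseChange R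
      ((1 : R) ⊗ₜ fibreMk p (FlatBundle.unit B) (⟨(1 : B), B.one_mem⟩ : B.gr 0)) =
      (1 : R) ⊗ₜ fibreMk p E ⟨e, he⟩ :=
    (LinearMap.baseChange_tmul (R := ℂ) (A := R) (f := ((fibreData p).ω.map (ofFlat he hc)).hom)
      (1 : R) _).trans (congrArg (fun z => (1 : R) ⊗ₜ[ℂ] z) h1)
  exact (congrArg (θ.1 E).val h4).symm.trans (h2.trans h4)

/-- Tensor automorphisms act trivially if all elements of degree `0` are flat. -/
theorem aut_eq_one_of_flat (θ : (fibreData p).autPoints R) {E : FlatBundle B}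
    (hc : ∀ e ∈ E.gr 0, E.conn e = 0) : θ.1 E = 1 := by
  refine Units.ext (end_ext fun w => ?_)
  obtain ⟨e, rfl⟩ := fibreMk_surjective p E w
  exact aut_flat θ e.2 (hc e e.2)

end Points

/-- Morphisms out of a tensor product. -/
noncomputable def tensorLift {X Y Z : FlatBundle B}
    (b : X.carrier →ₗ[ℂ] Y.carrier →ₗ[ℂ] Z.carrier)
    (hb : ∀ x α y, b (X.ract x α) y = b x (Y.lact α y))
    (hmem : ∀ {k l : ℕ} {x y}, x ∈ X.gr k → y ∈ Y.gr l → b x y ∈ Z.gr (k + l))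
    (hl : ∀ α x y, b (X.lact α x) y = Z.lact α (b x y))
    (hr : ∀ x y α, b x (Y.ract y α) = Z.ract (b x y) α)
    (hconn : ∀ {k : ℕ} {x}, x ∈ X.gr k → ∀ y,
      b (X.conn x) y + (-1 : ℂ) ^ k • b x (Y.conn y) = Z.conn (b x y)) : tensor X Y ⟶ Z :=
  let f : TensorCarrier X.toGradedBimodule Y.toGradedBimodule →ₗ[ℂ] Z.carrier := tLift b hb
  (⟨⟨f,
    fun {k} {x} hx => tGr_induction (P := fun x => f x ∈ Z.gr k)
      (fun i j hij u hu e he => by rw [← hij]; exact hmem hu he)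
      (by rw [map_zero]; exact zero_mem _)
      (fun a b ha hb => by rw [map_add]; exact add_mem ha hb)
      (fun c a ha => by rw [map_smul]; exact Submodule.smul_mem _ _ ha) hx,
    fun α x => tm_induction (P := fun x => f (tL _ _ α x) = Z.lact α (f x)) (fun u e => hl α u e)
      (fun x y hx hy => by rw [map_add, map_add, hx, hy, map_add, map_add]) x,
    fun x α => tm_induction (P := fun x => f (tR _ _ x α) = Z.ract (f x) α)
      (fun u e => hr u e α)
      (fun x y hx hy => by
        rw [map_add, LinearMap.add_apply, map_add, hx, hy, map_add, map_add,
          LinearMap.add_apply]) x⟩,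
    fun x => tm_hom_induction (P := fun x => f (tConn _ _ x) = Z.conn (f x))
      (fun k u hu e => by
        rw [tConn_tm hu, map_add, map_smul]
        exact hconn hu e)
      (fun x y hx hy => by rw [map_add, map_add, hx, hy, map_add, map_add]) x⟩ : Hom _ Z)

section Eval

variable {n : ℕ} (K : B.Cartan n) (E : FlatBundle B)

/-- The residues as elements of the algebra of parallel endomorphisms. -/
noncomputable def res (j : Fin n) : E.parallel := ⟨residue K E j, residue_mem_parallel K E j⟩

/-- The residues are central in the algebra of parallel endomorphisms. -/
theorem res_central (j : Fin n) (T : E.parallel) : Commute (res K E j) T :=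
  Subtype.ext (LinearMap.ext fun x => (residue_nat K (F := E) (parallelHom T.2) j x).symm)

/-- Multiplication by the residues. -/
noncomputable def resMul (j : Fin n) : Module.End ℂ E.parallel := LinearMap.mulLeft ℂ (res K E j)

theorem resMul_comm (i j : Fin n) : Commute (resMul K E i) (resMul K E j) := by
  refine LinearMap.ext fun a => ?_
  change res K E i * (res K E j * a) = res K E j * (res K E i * a)
  rw [← mul_assoc, (res_central K E i _).eq, mul_assoc]

/-- The connection `∇ - ∑ v_j N_j`, where the `N_j` are the residues of `∇`. -/
noncomputable def untwist : FlatBundle B :=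
  twist K E (fun j => -residue K E j) (fun j => neg_mem (residue_mem_parallel K E j))
    (fun i j => Commute.neg_left (Commute.neg_right (residue_comm K E i j)))

theorem untwist_conn (e : E.carrier) : (untwist K E).conn e =
    (E.conn e - ∑ j, E.lact (K.v j) (residue K E j e) : E.carrier) := by
  refine (twist_conn K E _ _ _ e).trans ?_
  rw [sub_eq_add_neg, ← Finset.sum_neg_distrib]
  refine congrArg (fun z => E.conn e + z) (Finset.sum_congr rfl fun j _ => ?_)
  exact map_neg (E.lact (K.v j)) (residue K E j e)

/-- The evaluation of parallel endomorphisms at `e`. -/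
def applyAt (e : E.carrier) : E.parallel →ₗ[ℂ] E.carrier :=
  LinearMap.applyₗ e ∘ₗ E.parallel.val.toLinearMap

variable [FiniteDimensional ℂ E.parallel]

/-- The evaluation `(u, e) ↦ ∑ u_a b_a(e)`, for the basis `b_a` of the algebra of parallel
endomorphisms. -/
noncomputable def evalAux :
    (Fin (Module.finrank ℂ E.parallel) → B) →ₗ[ℂ] E.carrier →ₗ[ℂ] E.carrier :=
  ∑ a, (E.lact.compl₂ (Module.finBasis ℂ E.parallel a : Module.End ℂ E.carrier)) ∘ₗ
    LinearMap.proj a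

theorem evalAux_apply (u : Fin (Module.finrank ℂ E.parallel) → B) (e : E.carrier) :
    evalAux E u e =
      ∑ a, E.lact (u a) ((Module.finBasis ℂ E.parallel a : Module.End ℂ E.carrier) e) := by
  rw [evalAux, LinearMap.sum_apply, LinearMap.sum_apply]
  rfl

theorem evalAux_eq (u : Fin (Module.finrank ℂ E.parallel) → B) (e : E.carrier) :
    evalAux E u e = linLift E (applyAt E e) u := by
  rw [evalAux_apply, linLift_apply]
  rfl

theorem evalAux_mem {k l : ℕ} {u : Fin (Module.finrank ℂ E.parallel) → B}
    (hu : ∀ a, u a ∈ B.gr k) {e : E.carrier} (he : e ∈ E.gr l) : evalAux E u e ∈ E.gr (k + l) := by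
  rw [evalAux_apply]
  exact sum_mem fun a _ => E.lact_mem (hu a) ((Module.finBasis ℂ E.parallel a).2.1 l e he)

theorem evalAux_balanced (u : Fin (Module.finrank ℂ E.parallel) → B) (α : B)
    (e : E.carrier) : evalAux E (fun a => u a * α) e = evalAux E u (E.lact α e) := by
  rw [evalAux_apply, evalAux_apply]
  refine Finset.sum_congr rfl fun a _ => ?_
  rw [E.mul_lact, (Module.finBasis ℂ E.parallel a).2.2.1]

theorem evalAux_lact (α : B) (u : Fin (Module.finrank ℂ E.parallel) → B) (e : E.carrier) :
    evalAux E (fun a => α * u a) e = E.lact α (evalAux E u e) := by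
  rw [evalAux_eq, evalAux_eq, linLift_lact]

theorem evalAux_ract (u : Fin (Module.finrank ℂ E.parallel) → B) (e : E.carrier)
    (α : B) : evalAux E u (E.ract e α) = E.ract (evalAux E u e) α := by
  rw [evalAux_apply, evalAux_apply, map_sum, LinearMap.sum_apply]
  refine Finset.sum_congr rfl fun a _ => ?_
  rw [(Module.finBasis ℂ E.parallel a).2.2.2.1, E.ract_lact]

theorem evalAux_conn {k : ℕ} {u : Fin (Module.finrank ℂ E.parallel) → B}
    (hu : ∀ a, u a ∈ B.gr k) (e : E.carrier) :
    evalAux E ((linBundle K (resMul K E) (resMul_comm K E)).conn u) e +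
      (-1 : ℂ) ^ k • evalAux E u ((untwist K E).conn e) = E.conn (evalAux E u e) := by
  have h1 : evalAux E ((linBundle K (resMul K E) (resMul_comm K E)).conn u) e =
      evalAux E (freeD B _ u) e + ∑ j, E.lact (K.v j)
        (linLift E (applyAt E e ∘ₗ resMul K E j) u) := by
    refine (evalAux_eq E _ e).trans ?_
    refine (congrArg (linLift E (applyAt E e))
      (twist_conn K (trivial B (Module.finrank ℂ E.parallel)) _ _ _ u)).trans ?_
    refine (map_add (linLift E (applyAt E e)) _ _).trans ?_
    refine congrArg₂ (· + ·) (evalAux_eq E _ e).symm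
      ((map_sum (linLift E (applyAt E e)) _ _).trans ?_)
    refine Finset.sum_congr rfl fun j _ => ?_
    refine (linLift_lact E (applyAt E e) (K.v j) (matEnd B (resMul K E j) u)).trans ?_
    exact congrArg (E.lact (K.v j)) (linLift_matEnd E (applyAt E e) (resMul K E j) u)
  have h2 : ∀ j, E.lact (K.v j) (linLift E (applyAt E e ∘ₗ resMul K E j) u) =
      (-1 : ℂ) ^ k • evalAux E u (E.lact (K.v j) (residue K E j e)) := by
    intro j
    rw [linLift_apply, evalAux_apply, map_sum, Finset.smul_sum]
    refine Finset.sum_congr rfl fun a _ => ?_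
    have hcomm : (Module.finBasis ℂ E.parallel a : Module.End ℂ E.carrier) (residue K E j e)
        = (applyAt E e ∘ₗ resMul K E j) (Module.finBasis ℂ E.parallel a) :=
      residue_nat K (F := E) (parallelHom (Module.finBasis ℂ E.parallel a).2) j e
    rw [(Module.finBasis ℂ E.parallel a).2.2.1, ← E.mul_lact, ← E.mul_lact,
      B.comm (hu a) (K.v_mem j), mul_one, map_smul,
      LinearMap.smul_apply, smul_smul, ← mul_pow, neg_one_mul, neg_neg, one_pow, one_smul, hcomm]
  have h3 : E.conn (evalAux E u e) = evalAux E (freeD B _ u) e +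
      (-1 : ℂ) ^ k • evalAux E u (E.conn e) := by
    rw [evalAux_apply, evalAux_apply, evalAux_apply, map_sum, Finset.smul_sum,
      ← Finset.sum_add_distrib]
    refine Finset.sum_congr rfl fun a _ => ?_
    rw [E.conn_lact (hu a), (Module.finBasis ℂ E.parallel a).2.2.2.2]
    rfl
  have h4 : evalAux E u ((untwist K E).conn e) = evalAux E u (E.conn e) -
      ∑ j, evalAux E u (E.lact (K.v j) (residue K E j e)) :=
    (congrArg (evalAux E u) (untwist_conn K E e)).trans (by rw [map_sub, map_sum])
  rw [h4, smul_sub, Finset.smul_sum, h1, h3]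
  simp only [h2]
  abel

/-- The evaluation as a morphism `(L, d + ∑ v_j N_j) ⊗ (E, ∇ - ∑ v_j N_j) → (E, ∇)`, where `L` is
the trivial bundle with fibre the algebra of parallel endomorphisms. -/
noncomputable def evalHom :
    tensor (linBundle K (resMul K E) (resMul_comm K E)) (untwist K E) ⟶ E :=
  tensorLift (X := linBundle K (resMul K E) (resMul_comm K E)) (Y := untwist K E) (evalAux E)
    (evalAux_balanced E) (fun hu he => evalAux_mem E (mem_freeGr.1 hu) he) (evalAux_lact E)
    (evalAux_ract E) (fun hu e => evalAux_conn K E (mem_freeGr.1 hu) e)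

theorem evalAux_constVec (T : E.parallel) (e : E.carrier) :
    evalAux E (constVec B E.parallel T) e = T.1 e := by
  rw [evalAux_eq, linLift_constVec]
  rfl

end Eval

section EvalPoints

variable {n : ℕ} (K : B.Cartan n) (p : B.gr 0 →ₐ[ℂ] ℂ) (E : FlatBundle B)

/-- The residues on the fibre. -/
noncomputable def fibreRes (j : Fin n) : Module.End ℂ (Fibre p E) :=
  parallelFibre p E (res K E j)

theorem fibreRes_comm (i j : Fin n) : Commute (fibreRes K p E i) (fibreRes K p E j) :=
  (res_central K E i (res K E j)).map (parallelFibre p E)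

theorem fibreRes_mk (j : Fin n) (e : E.gr 0) : fibreRes K p E j (fibreMk p E e) =
    fibreMk p E ⟨residue K E j e, residue_mem_zero K E j e.2⟩ := rfl

/-- The fibre does not depend on the connection. -/
def untwistFibre : Fibre p E ≃ₗ[ℂ] Fibre p (untwist K E) := LinearEquiv.refl ℂ (Fibre p E)

variable {R : Type u} [CommRing R] [Algebra ℂ R]

/-- If parallel endomorphisms are determined by their values on the fibre, then a tensor
automorphism is the product of a factor that depends on the residues only and its value on
`∇ - ∑ v_j N_j`.

The algebra `P` of parallel endomorphisms of `E`, on which the residues act by multiplication,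
defines a connection `d + ∑ v_j N_j` on `P ⊗ B`, and evaluation is a morphism from its tensor
product with `∇ - ∑ v_j N_j` to `E`. So the value of the automorphism on `E` is determined by the
values on the two factors, by `GLPoints.eq_mul_of_act`; the value on `P ⊗ B` is compared with that
on the connection `d + ∑ v_j N_j` on the fibre of `E` through the orbit maps of vectors. -/
theorem aut_eq_conj_mul_conj [FiniteDimensional ℂ E.parallel]
    (θ : (fibreData p).autPoints R) :
    θ.1 E = GLPoints.conj R (linFibre K (fibreRes K p E) (fibreRes_comm K p E) p)
        (θ.1 (linBundle K (fibreRes K p E) (fibreRes_comm K p E))) *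
      GLPoints.conj R (untwistFibre K p E) (θ.1 (untwist K E)) := by
  let L := linBundle K (resMul K E) (resMul_comm K E)
  let μ : Fibre p L ⊗[ℂ] Fibre p (untwist K E) →ₗ[ℂ] Fibre p E :=
    ((fibreFunctor p).map (evalHom K E)).hom ∘ₗ fibreTensor p L (untwist K E)
  -- `μ` is the evaluation on fibres.
  have hμ : ∀ (T : E.parallel) (y : Fibre p (untwist K E)),
      μ (linFibre K (resMul K E) (resMul_comm K E) p T ⊗ₜ y) =
        parallelFibre p E T ((untwistFibre K p E).symm y) := by
    intro T y
    obtain ⟨e, rfl⟩ := fibreMk_surjective p _ y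
    refine (congrArg ((fibreFunctor p).map (evalHom K E)).hom (fibreTensor_mk p (X := L)
      (Y := untwist K E) _ e)).trans ?_
    refine (fibreFunctor_map_mk p (evalHom K E) _).trans ?_
    refine (congrArg (fibreMk p E) (Subtype.ext ?_)).trans (parallelFibre_mk p E T e).symm
    exact evalAux_constVec E T e.1
  refine GLPoints.eq_mul_of_act (μ := μ) (x₀ := linFibre K (resMul K E) (resMul_comm K E) p 1)
    (φ := θ.1 L) (fun w => ?_) ?_ fun y => ?_
  · refine (hμ 1 _).trans ?_
    rw [map_one, LinearEquiv.symm_apply_apply]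
    rfl
  · have h1 := FibreFunctorData.aut_nat θ (evalHom K E)
    have h2 := FibreFunctorData.aut_tensor θ L (untwist K E)
    refine (congrArg ((θ.1 E).val ∘ₗ ·) (LinearMap.baseChange_comp _ _)).trans ?_
    refine (congrArg (fun f => f ∘ₗ (fibreTensor p L (untwist K E)).baseChange R) h1).trans ?_
    refine (congrArg (((fibreFunctor p).map (evalHom K E)).hom.baseChange R ∘ₗ ·) h2).trans ?_
    exact congrArg (· ∘ₗ boxTensor (θ.1 L).val (θ.1 (untwist K E)).val)
      (LinearMap.baseChange_comp _ _).symm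
  -- The orbit map `T ↦ T y` is equivariant for the residues, hence a morphism of connections.
  · let g : E.parallel →ₗ[ℂ] Fibre p E :=
      LinearMap.applyₗ ((untwistFibre K p E).symm y) ∘ₗ (parallelFibre p E).toLinearMap
    have hg : ∀ j T, g (resMul K E j T) = fibreRes K p E j (g T) := fun j T =>
      LinearMap.congr_fun (map_mul (parallelFibre p E) (res K E j) T) _
    let m := linHom K (resMul K E) (resMul_comm K E)
      (constSec K (fibreRes K p E) (fibreRes_comm K p E) ∘ₗ g) (fun T => constSec_mem K _ _ _)
      (fun T => (conn_constSec K _ _ _).trans (Finset.sum_congr rfl fun j _ =>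
        congrArg _ (congrArg (constSec K (fibreRes K p E) (fibreRes_comm K p E)) (hg j T).symm)))
    refine GLPoints.conj_intertwine _ (fun x => ?_) (FibreFunctorData.aut_nat θ m)
    obtain ⟨T, rfl⟩ := (linFibre K (resMul K E) (resMul_comm K E) p).surjective x
    refine (linHom_fibre K (resMul K E) (resMul_comm K E) p _ _ _ T).trans ?_
    exact congrArg (linFibre K (fibreRes K p E) (fibreRes_comm K p E) p) (hμ T y).symm

end EvalPoints

end FlatBundle

end NCG

namespace NCG

/-! ### Split extensions by elements of degree one -/

/-- Morphisms `incl : Ω → B` and `ret : B → Ω` with `ret ∘ incl = id` that are inverse to each other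
in degree `0`, and elements `v_j` of `B¹` with contractions such that every element of `B¹` is
the sum of an element of `Ω¹` and a combination of the `v_j`. -/
structure CDGA.Split (Ω B : CDGA.{u}) (n : ℕ) where
  K : B.Cartan n
  incl : CDGA.Hom Ω B
  ret : CDGA.Hom B Ω
  ret_incl : ∀ α, ret.toAlg (incl.toAlg α) = α
  incl_ret : ∀ {a}, a ∈ B.gr 0 → incl.toAlg (ret.toAlg a) = a
  ret_v : ∀ j, ret.toAlg (K.v j) = 0
  c_incl : ∀ j {α}, α ∈ Ω.gr 1 → K.c j (incl.toAlg α) = 0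
  eq_sum : ∀ {γ}, γ ∈ B.gr 1 → γ = incl.toAlg (ret.toAlg γ) + ∑ j, K.v j * K.c j γ

/-- Extension of scalars preserves the relation `f ∘ g ∘ h = id`. -/
theorem baseChange_leftInverse (R : Type u) [CommRing R] [Algebra ℂ R] {W₁ W₂ W₃ : Type u}
    [AddCommGroup W₁] [Module ℂ W₁] [AddCommGroup W₂] [Module ℂ W₂] [AddCommGroup W₃]
    [Module ℂ W₃] {f : W₃ →ₗ[ℂ] W₁} {g : W₂ →ₗ[ℂ] W₃} {h : W₁ →ₗ[ℂ] W₂}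
    (H : ∀ x, f (g (h x)) = x) (y : R ⊗[ℂ] W₁) :
    f.baseChange R (g.baseChange R (h.baseChange R y)) = y := by
  have h' := congrArg (LinearMap.baseChange R) (LinearMap.ext H : f ∘ₗ g ∘ₗ h = LinearMap.id)
  rw [LinearMap.baseChange_comp, LinearMap.baseChange_comp, LinearMap.baseChange_id] at h'
  exact LinearMap.congr_fun h' y

namespace FlatBundle

open GradedBimodule

variable {B : CDGA.{u}}

section Cartan

variable {n : ℕ} (K : B.Cartan n) (E : FlatBundle B)

/-- In degree `0`, the connection `∇ - ∑ v_j N_j` is the part of `∇` without the `v_j`. -/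
theorem untwist_conn_zero {e : E.carrier} (he : e ∈ E.gr 0) : (untwist K E).conn e =
    (∑ a, E.ract (E.frame.x a) (E.frame.ξ a (E.conn e) -
      ∑ j, K.v j * K.c j (E.frame.ξ a (E.conn e))) : E.carrier) := by
  refine (untwist_conn K E e).trans ?_
  have h : ∀ j, E.lact (K.v j) (residue K E j e) =
      ∑ a, E.ract (E.frame.x a) (K.v j * K.c j (E.frame.ξ a (E.conn e))) := by
    intro j
    rw [residue_zero K E j he, contr_apply, map_sum]
    refine Finset.sum_congr rfl fun a _ => ?_
    rw [← E.ract_lact, E.fgp.lact_of_mem_zero (E.frame.x_mem a), ← E.ract_mul]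
  simp only [h, map_sub, map_sum, Finset.sum_sub_distrib, E.frame.sum_eq]
  rw [Finset.sum_comm]

/-- If `B¹` is generated by the `v_j`, then the connection `∇ - ∑ v_j N_j` is trivial. -/
theorem untwist_conn_eq_zero (hK : ∀ γ ∈ B.gr 1, γ = ∑ j, K.v j * K.c j γ) {e : E.carrier}
    (he : e ∈ E.gr 0) : (untwist K E).conn e = (0 : E.carrier) := by
  refine (untwist_conn_zero K E he).trans (Finset.sum_eq_zero fun a _ => ?_)
  rw [← hK _ (E.frame.ξ_mem (E.conn_mem he) a), sub_self]
  exact map_zero (E.ract (E.frame.x a))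

end Cartan

section Split

variable {Ω : CDGA.{u}} {n : ℕ} (s : CDGA.Split Ω B n)

theorem _root_.NCG.CDGA.Split.incl_bijective : Function.Bijective s.incl.map₀ :=
  ⟨fun a b h => Subtype.ext (by
    have h1 := congrArg s.ret.toAlg (congrArg Subtype.val h)
    exact (s.ret_incl a).symm.trans (h1.trans (s.ret_incl b))),
  fun a => ⟨s.ret.map₀ a, Subtype.ext (s.incl_ret a.2)⟩⟩

theorem _root_.NCG.CDGA.Split.ret_bijective : Function.Bijective s.ret.map₀ :=
  ⟨fun a b h => Subtype.ext (by
    have h1 := congrArg s.incl.toAlg (congrArg Subtype.val h)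
    exact (s.incl_ret a.2).symm.trans (h1.trans (s.incl_ret b.2))),
  fun a => ⟨s.incl.map₀ a, Subtype.ext (s.ret_incl a)⟩⟩

variable (E : FlatBundle B)

/-- The canonical map to the base change along `incl ∘ ret`. -/
noncomputable def retIncl : SHom (s.incl.comp s.ret) E (baseChange s.incl (baseChange s.ret E)) :=
  (toBaseChange s.incl (baseChange s.ret E)).comp (toBaseChange s.ret E)

theorem retIncl_ract (e : E.carrier) (α : B) : (retIncl s E).toLin (E.ract e α) =
    (baseChange s.incl (baseChange s.ret E)).ract ((retIncl s E).toLin e)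
      (s.incl.toAlg (s.ret.toAlg α)) := (retIncl s E).map_ract e α

/-- The `B`-linear extension of the canonical map in degree `0`. -/
noncomputable def untwistLin :
    E.carrier →ₗ[ℂ] (baseChange s.incl (baseChange s.ret E)).carrier :=
  ∑ a, (baseChange s.incl (baseChange s.ret E)).ract ((retIncl s E).toLin (E.frame.x a)) ∘ₗ
    E.frame.ξ a

theorem untwistLin_apply (e : E.carrier) : untwistLin s E e =
    ∑ a, (baseChange s.incl (baseChange s.ret E)).ract ((retIncl s E).toLin (E.frame.x a))
      (E.frame.ξ a e) := by
  rw [untwistLin, LinearMap.sum_apply]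
  rfl

theorem untwistLin_zero {e : E.carrier} (he : e ∈ E.gr 0) :
    untwistLin s E e = (retIncl s E).toLin e := by
  rw [untwistLin_apply]
  conv_rhs => rw [← E.frame.sum_eq e, map_sum]
  refine Finset.sum_congr rfl fun a _ => ?_
  rw [retIncl_ract, s.incl_ret (E.frame.ξ_mem he a)]

theorem untwistLin_mem {e : E.carrier} (he : e ∈ E.gr 0) :
    untwistLin s E e ∈ (baseChange s.incl (baseChange s.ret E)).gr 0 := by
  rw [untwistLin_zero s E he]
  exact (retIncl s E).map_mem he

theorem untwistLin_ract (e : E.carrier) (α : B) :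
    untwistLin s E (E.ract e α) =
      (baseChange s.incl (baseChange s.ret E)).ract (untwistLin s E e) α := by
  rw [untwistLin_apply, untwistLin_apply, map_sum, LinearMap.sum_apply]
  refine Finset.sum_congr rfl fun a _ => ?_
  rw [E.frame.ξ_ract, GradedBimodule.ract_mul]

theorem untwistLin_conn {e : E.carrier} (he : e ∈ E.gr 0) :
    untwistLin s E ((untwist s.K E).conn e) =
      (baseChange s.incl (baseChange s.ret E)).conn (untwistLin s E e) := by
  rw [untwistLin_zero s E he, ← (retIncl s E).map_conn]
  refine (congrArg (untwistLin s E) (untwist_conn_zero s.K E he)).trans ?_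
  conv_rhs => rw [← E.frame.sum_eq (E.conn e), map_sum]
  rw [map_sum]
  refine Finset.sum_congr rfl fun a _ => ?_
  rw [untwistLin_ract s E, untwistLin_zero s E (E.frame.x_mem a), retIncl_ract]
  congr 1
  rw [sub_eq_iff_eq_add]
  exact s.eq_sum (E.frame.ξ_mem (E.conn_mem he) a)

/-- The connection `∇ - ∑ v_j N_j` is isomorphic to the base change of `∇` along `incl ∘ ret`. -/
noncomputable def untwistHom : untwist s.K E ⟶ baseChange s.incl (baseChange s.ret E) :=
  homOfZero (E := untwist s.K E) (untwistLin s E)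
    (fun _ he => untwistLin_mem s E he)
    (fun e _ α => untwistLin_ract s E e α) (fun _ he => untwistLin_conn s E he)

variable {p : B.gr 0 →ₐ[ℂ] ℂ} {q : Ω.gr 0 →ₐ[ℂ] ℂ} (hi : ∀ a, p (s.incl.map₀ a) = q a)
  (hr : ∀ a, q (s.ret.map₀ a) = p a) {R : Type u} [CommRing R] [Algebra ℂ R]

/-- Restriction of tensor automorphisms along `incl`. -/
noncomputable abbrev _root_.NCG.CDGA.Split.resIncl (R : Type u) [CommRing R] [Algebra ℂ R] :
    (fibreData p).autPoints R →* (fibreData q).autPoints R :=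
  (baseChangeComparison s.incl s.incl_bijective hi).restrict R

/-- Restriction of tensor automorphisms along `ret`. -/
noncomputable abbrev _root_.NCG.CDGA.Split.resRet (R : Type u) [CommRing R] [Algebra ℂ R] :
    (fibreData q).autPoints R →* (fibreData p).autPoints R :=
  (baseChangeComparison s.ret s.ret_bijective hr).restrict R

/-- The value of a tensor automorphism on `∇ - ∑ v_j N_j` depends on its restriction to `Ω`
only. -/
theorem conj_untwist (θ : (fibreData p).autPoints R) :
    GLPoints.conj R (untwistFibre s.K p E) (θ.1 (untwist s.K E)) =
      (s.resRet hr R (s.resIncl hi R θ)).1 E := by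
  let e₁ := baseChangeFibre s.ret s.ret_bijective hr E
  let e₂ := baseChangeFibre s.incl s.incl_bijective hi (baseChange s.ret E)
  have hm : ∀ x, (((fibreFunctor p).map (untwistHom s E)).hom ∘ₗ
      (untwistFibre s.K p E).toLinearMap) x = e₂ (e₁ x) := by
    intro x
    obtain ⟨e, rfl⟩ := fibreMk_surjective p E x
    refine (homOfZero_fibre p (E := untwist s.K E) (untwistLin s E) _ _ _ e).trans ?_
    exact congrArg (fibreMk p _) (Subtype.ext (untwistLin_zero s E e.2))
  refine GLPoints.eq_conj e₁ _ _ (GLPoints.conj_intertwine e₂ (f := e₁.toLinearMap) hm ?_).symm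
  have h1 := GLPoints.baseChange_conj (untwistFibre s.K p E) (θ.1 (untwist s.K E))
  have h2 := FibreFunctorData.aut_nat θ (untwistHom s E)
  refine (congrArg ((θ.1 _).val ∘ₗ ·) (LinearMap.baseChange_comp _ _)).trans ?_
  refine (congrArg (· ∘ₗ (untwistFibre s.K p E).toLinearMap.baseChange R) h2).trans ?_
  refine (congrArg (((fibreFunctor p).map (untwistHom s E)).hom.baseChange R ∘ₗ ·) h1.symm).trans ?_
  exact congrArg (· ∘ₗ (GLPoints.conj R (untwistFibre s.K p E) (θ.1 (untwist s.K E))).val)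
    (LinearMap.baseChange_comp _ _).symm

/-- The identity as a semilinear map along `ret ∘ incl`. -/
def idSHom (X : FlatBundle Ω) : SHom (s.ret.comp s.incl) X X where
  toLin := LinearMap.id
  map_mem := fun he => he
  map_lact := fun α e => by
    change X.lact α e = X.lact (s.ret.toAlg (s.incl.toAlg α)) e
    rw [s.ret_incl]
  map_ract := fun e α => by
    change X.ract e α = X.ract e (s.ret.toAlg (s.incl.toAlg α))
    rw [s.ret_incl]
  map_conn := fun _ => rfl

/-- The restriction along `ret` is a section of the restriction along `incl`, as
`ret ∘ incl = id`. -/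
theorem resIncl_resRet (g : (fibreData q).autPoints R) :
    s.resIncl hi R (s.resRet hr R g) = g := by
  refine Subtype.ext (funext fun X => ?_)
  let e₁ := baseChangeFibre s.incl s.incl_bijective hi X
  let e₂ := baseChangeFibre s.ret s.ret_bijective hr (baseChange s.incl X)
  let φ : baseChange s.ret (baseChange s.incl X) ⟶ X := (idSHom s X).baseChangeLift.bcHom
  have hφ : ∀ x, ((fibreFunctor q).map φ).hom (e₂ (e₁ x)) = x := by
    intro x
    obtain ⟨e, rfl⟩ := fibreMk_surjective q X x
    refine congrArg (fibreMk q X) (Subtype.ext ?_)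
    refine (SHom.baseChangeLift_apply (g := CDGA.Hom.id Ω) (f := s.ret)
      (idSHom s X).baseChangeLift _).trans ?_
    exact SHom.baseChangeLift_apply (idSHom s X) _
  have hφ' : ∀ y, ((fibreFunctor q).map φ).hom.baseChange R (e₂.toLinearMap.baseChange R
      (e₁.toLinearMap.baseChange R y)) = y :=
    baseChange_leftInverse R hφ
  refine Units.ext (LinearMap.ext fun y => ?_)
  refine (hφ' _).symm.trans ?_
  have h1 := (baseChangeComparison s.incl s.incl_bijective hi).iso_restrict (s.resRet hr R g) X y
  have h2 := (baseChangeComparison s.ret s.ret_bijective hr).iso_restrict g (baseChange s.incl X)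
    (e₁.toLinearMap.baseChange R y)
  refine (congrArg _ ((congrArg _ h1).trans h2)).trans ?_
  refine (LinearMap.congr_fun (FibreFunctorData.aut_nat g φ) _).symm.trans ?_
  exact congrArg (g.1 X).val (hφ' y)

/-- The restriction along `ret` is trivial on the connections `d + ∑ v_j N_j`. -/
theorem resRet_linBundle {W : Type u} [AddCommGroup W] [Module ℂ W]
    [FiniteDimensional ℂ W] (N : Fin n → Module.End ℂ W) (hc : ∀ i j, Commute (N i) (N j))
    (g : (fibreData q).autPoints R) : (s.resRet hr R g).1 (linBundle s.K N hc) = 1 := by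
  refine (GLPoints.eq_conj (baseChangeFibre s.ret s.ret_bijective hr (linBundle s.K N hc)) _ _
    ?_).symm
  refine end_ext fun y => ?_
  obtain ⟨w, rfl⟩ := (linFibre s.K N hc p).surjective y
  have h0 : (toBaseChange s.ret (linBundle s.K N hc)).toLin (constSec s.K N hc w) ∈
      (baseChange s.ret (linBundle s.K N hc)).gr 0 :=
    (toBaseChange s.ret _).map_mem (constSec_mem s.K N hc w)
  have h1 : (baseChange s.ret (linBundle s.K N hc)).conn
      ((toBaseChange s.ret (linBundle s.K N hc)).toLin (constSec s.K N hc w)) = 0 := by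
    rw [← (toBaseChange s.ret _).map_conn, conn_constSec, map_sum]
    refine Finset.sum_eq_zero fun j _ => ?_
    rw [(toBaseChange s.ret _).map_lact, s.ret_v, map_zero, LinearMap.zero_apply]
  exact (aut_flat g h0 h1).symm

/-- The base change along `incl` has no residues. -/
theorem fibreRes_baseChange (X : FlatBundle Ω) (j : Fin n) :
    fibreRes s.K p (baseChange s.incl X) j = 0 := by
  refine fibre_ext p fun e => ?_
  obtain ⟨x, rfl⟩ := (toBaseChange_map₀_bijective s.incl s.incl_bijective X).2 e
  have h : residue s.K (baseChange s.incl X) j ((toBaseChange s.incl X).toLin x) = 0 := by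
    rw [residue_zero s.K _ j ((toBaseChange s.incl X).map_mem x.2),
      ← (toBaseChange s.incl X).map_conn, ← X.frame.sum_eq (X.conn x), map_sum, map_sum]
    refine Finset.sum_eq_zero fun a _ => ?_
    rw [(toBaseChange s.incl X).map_ract, contr_ract_zero s.K _ j
      ((toBaseChange s.incl X).map_mem (X.frame.x_mem a)),
      s.c_incl j (X.frame.ξ_mem (X.conn_mem x.2) a), map_zero]
  refine (fibreRes_mk s.K p _ j _).trans ?_
  exact (congrArg (fibreMk p _) (Subtype.ext h)).trans (map_zero _)

end Split

end FlatBundle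

end NCG

namespace NCG

/-! ### Matrix coefficients -/

section Coefficients

variable {R S : Type u} [CommRing R] [Algebra ℂ R] [CommRing S] [Algebra ℂ S]
  {W W' : Type u} [AddCommGroup W] [Module ℂ W] [AddCommGroup W'] [Module ℂ W']

variable (R) in
/-- The extension of a linear form on `W` to an `R`-linear form on `R ⊗ W`. -/
noncomputable def evalAt (ζ : W →ₗ[ℂ] ℂ) : R ⊗[ℂ] W →ₗ[R] R :=
  LinearMap.liftBaseChange R (Algebra.linearMap ℂ R ∘ₗ ζ)

theorem evalAt_tmul (ζ : W →ₗ[ℂ] ℂ) (r : R) (w : W) :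
    evalAt R ζ (r ⊗ₜ w) = r * algebraMap ℂ R (ζ w) := by
  simp [evalAt]

theorem evalAt_one_tmul (ζ : W →ₗ[ℂ] ℂ) (w : W) :
    evalAt R ζ ((1 : R) ⊗ₜ w) = algebraMap ℂ R (ζ w) := by
  rw [evalAt_tmul, one_mul]

theorem evalAt_scalarMap (f : R →ₐ[ℂ] S) (ζ : W →ₗ[ℂ] ℂ) (x : R ⊗[ℂ] W) :
    evalAt S ζ (scalarMap W f x) = f (evalAt R ζ x) := by
  induction x using TensorProduct.induction_on with
  | zero => simp
  | tmul r w => rw [scalarMap_tmul, evalAt_tmul, evalAt_tmul, map_mul, AlgHom.commutes]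
  | add x y hx hy => rw [map_add, map_add, hx, hy, map_add, map_add]

theorem evalAt_baseChange (ζ : W' →ₗ[ℂ] ℂ) (f : W →ₗ[ℂ] W') (x : R ⊗[ℂ] W) :
    evalAt R ζ (f.baseChange R x) = evalAt R (ζ ∘ₗ f) x := by
  induction x using TensorProduct.induction_on with
  | zero => simp
  | tmul r w => rw [LinearMap.baseChange_tmul, evalAt_tmul, evalAt_tmul, LinearMap.comp_apply]
  | add x y hx hy => rw [map_add, map_add, hx, hy, map_add]

theorem evalAt_add (ζ ζ' : W →ₗ[ℂ] ℂ) (x : R ⊗[ℂ] W) :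
    evalAt R (ζ + ζ') x = evalAt R ζ x + evalAt R ζ' x := by
  induction x using TensorProduct.induction_on with
  | zero => simp
  | tmul r w => simp only [evalAt_tmul, LinearMap.add_apply, map_add, mul_add]
  | add x y hx hy => rw [map_add, map_add, hx, hy, map_add]; abel

theorem evalAt_neg (ζ : W →ₗ[ℂ] ℂ) (x : R ⊗[ℂ] W) : evalAt R (-ζ) x = -evalAt R ζ x := by
  induction x using TensorProduct.induction_on with
  | zero => simp
  | tmul r w => simp only [evalAt_tmul, LinearMap.neg_apply, map_neg, mul_neg]
  | add x y hx hy => rw [map_add, map_add, hx, hy]; abel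

theorem eq_sum_evalAt [FiniteDimensional ℂ W] (x : R ⊗[ℂ] W) :
    x = ∑ i, evalAt R ((Module.finBasis ℂ W).coord i) x ⊗ₜ[ℂ] Module.finBasis ℂ W i := by
  induction x using TensorProduct.induction_on with
  | zero => simp
  | tmul r w =>
    conv_lhs => rw [← (Module.finBasis ℂ W).sum_repr w, TensorProduct.tmul_sum]
    refine Finset.sum_congr rfl fun i _ => ?_
    rw [evalAt_tmul, ← TensorProduct.smul_tmul, Module.Basis.coord_apply, mul_comm,
      ← Algebra.smul_def]
  | add x y hx hy =>
    conv_lhs => rw [hx, hy]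
    simp only [map_add, TensorProduct.add_tmul, Finset.sum_add_distrib]

theorem eq_of_evalAt [FiniteDimensional ℂ W] {x y : R ⊗[ℂ] W}
    (h : ∀ ζ, evalAt R ζ x = evalAt R ζ y) : x = y := by
  rw [eq_sum_evalAt x, eq_sum_evalAt y]
  simp only [h]

/-- The matrix coefficient `ζ (φ (1 ⊗ w))`. -/
noncomputable def coef (φ : Module.End R (R ⊗[ℂ] W)) (ζ : W →ₗ[ℂ] ℂ) (w : W) : R :=
  evalAt R ζ (φ ((1 : R) ⊗ₜ w))

theorem coef_extendScalars (f : R →ₐ[ℂ] S) (φ : Module.End R (R ⊗[ℂ] W)) (ζ : W →ₗ[ℂ] ℂ) (w : W) :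
    coef (extendScalars f φ) ζ w = f (coef φ ζ w) := by
  rw [coef, extendScalars_one_tmul, evalAt_scalarMap]
  rfl

theorem end_eq_of_coef [FiniteDimensional ℂ W] {φ ψ : Module.End R (R ⊗[ℂ] W)}
    (h : ∀ ζ w, coef φ ζ w = coef ψ ζ w) : φ = ψ :=
  end_ext fun w => eq_of_evalAt fun ζ => h ζ w

end Coefficients

/-! ### The universal point of the group of tensor automorphisms -/

namespace FibreFunctorData

variable {C : Type (u + 1)} [Category.{u} C] [EssentiallySmall.{u} C] (D : FibreFunctorData C)

/-- Indices for the matrix coefficients of `g` and `g⁻¹`, over a small set of objects: an object,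
`true` for `g` and `false` for `g⁻¹`, a linear form and a vector. -/
abbrev CoefIndex : Type u :=
  Σ s : SmallModel.{u} C, ULift.{u} Bool ×
    (((D.ω.obj ((equivSmallModel C).inverse.obj s) : Type u) →ₗ[ℂ] ℂ) ×
      (D.ω.obj ((equivSmallModel C).inverse.obj s) : Type u))

variable {D} in
/-- The values of the matrix coefficients at a point `g`. -/
noncomputable def evCoef {R : Type u} [CommRing R] [Algebra ℂ R] (g : D.autPoints R) :
    MvPolynomial (CoefIndex D) ℂ →ₐ[ℂ] R :=
  MvPolynomial.aeval fun i => bif i.2.1.down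
    then coef (g.1 ((equivSmallModel C).inverse.obj i.1)).val i.2.2.1 i.2.2.2
    else coef (g⁻¹.1 ((equivSmallModel C).inverse.obj i.1)).val i.2.2.1 i.2.2.2

/-- The polynomials in the matrix coefficients that vanish at all points. -/
noncomputable def coefIdeal : Ideal (MvPolynomial (CoefIndex D) ℂ) where
  carrier := {P | ∀ (R : CommAlgCat.{u} ℂ) (g : D.autPoints R), evCoef g P = 0}
  add_mem' hP hQ R g := by rw [map_add, hP, hQ, add_zero]
  zero_mem' R g := map_zero _
  smul_mem' P Q hQ R g := by rw [smul_eq_mul, map_mul, hQ, mul_zero]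

/-- The coordinate algebra of the group scheme of tensor automorphisms: the algebra generated by
the matrix coefficients. -/
abbrev CoordAlg : Type u := MvPolynomial (CoefIndex D) ℂ ⧸ coefIdeal D

variable {D} {R : Type u} [CommRing R] [Algebra ℂ R]

/-- The evaluation of functions at a point. -/
noncomputable def evPt (g : D.autPoints R) : CoordAlg D →ₐ[ℂ] R :=
  Ideal.Quotient.liftₐ (coefIdeal D) (evCoef g) fun _ hP => hP (CommAlgCat.of ℂ R) g

theorem evPt_mk (g : D.autPoints R) (P : MvPolynomial (CoefIndex D) ℂ) :
    evPt g (Ideal.Quotient.mk _ P) = evCoef g P := rfl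

/-- Functions on the group scheme are determined by their values at points. -/
theorem coordAlg_ext {f f' : CoordAlg D}
    (h : ∀ (R : CommAlgCat.{u} ℂ) (g : D.autPoints R), evPt g f = evPt g f') : f = f' := by
  obtain ⟨P, rfl⟩ := Ideal.Quotient.mk_surjective f
  obtain ⟨Q, rfl⟩ := Ideal.Quotient.mk_surjective f'
  refine Ideal.Quotient.eq.2 fun R g => ?_
  rw [map_sub, ← evPt_mk, ← evPt_mk, h, sub_self]

variable (D) in
/-- The generators of the coordinate algebra. -/
noncomputable def genCoef (i : CoefIndex D) : CoordAlg D :=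
  Ideal.Quotient.mk _ (MvPolynomial.X i)

theorem evPt_genCoef_true (g : D.autPoints R) (s : SmallModel.{u} C) (ζ w) :
    evPt g (genCoef D ⟨s, ⟨true⟩, ζ, w⟩) =
      coef (g.1 ((equivSmallModel C).inverse.obj s)).val ζ w := by
  rw [genCoef, evPt_mk, evCoef, MvPolynomial.aeval_X]
  rfl

theorem evPt_genCoef_false (g : D.autPoints R) (s : SmallModel.{u} C) (ζ w) :
    evPt g (genCoef D ⟨s, ⟨false⟩, ζ, w⟩) =
      coef (g⁻¹.1 ((equivSmallModel C).inverse.obj s)).val ζ w := by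
  rw [genCoef, evPt_mk, evCoef, MvPolynomial.aeval_X]
  rfl

/-- Induction over the coordinate algebra. -/
theorem coordAlg_induction {P : CoordAlg D → Prop} (const : ∀ c : ℂ, P (algebraMap ℂ _ c))
    (add : ∀ f f', P f → P f' → P (f + f')) (mul : ∀ f f', P f → P f' → P (f * f'))
    (gen : ∀ i, P (genCoef D i)) (f : CoordAlg D) : P f := by
  obtain ⟨Q, rfl⟩ := Ideal.Quotient.mk_surjective f
  induction Q using MvPolynomial.induction_on with
  | C c => exact const c
  | add p q hp hq => rw [map_add]; exact add _ _ hp hq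
  | mul_X p i hp => rw [map_mul]; exact mul _ _ hp (gen i)

section Universal

theorem linear_coordAlg_ext {W W' : Type u} [AddCommGroup W] [Module ℂ W] [AddCommGroup W']
    [Module ℂ W'] [FiniteDimensional ℂ W']
    {φ ψ : CoordAlg D ⊗[ℂ] W →ₗ[CoordAlg D] CoordAlg D ⊗[ℂ] W'}
    (h : ∀ (R : CommAlgCat.{u} ℂ) (g : D.autPoints R) w,
      scalarMap W' (evPt g) (φ (1 ⊗ₜ w)) = scalarMap W' (evPt g) (ψ (1 ⊗ₜ w))) : φ = ψ := by
  refine end_ext fun w => eq_of_evalAt fun ζ => coordAlg_ext fun R g => ?_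
  rw [← evalAt_scalarMap, ← evalAt_scalarMap, h]

theorem end_coordAlg_ext {W : Type u} [AddCommGroup W] [Module ℂ W] [FiniteDimensional ℂ W]
    {φ ψ : Module.End (CoordAlg D) (CoordAlg D ⊗[ℂ] W)}
    (h : ∀ (R : CommAlgCat.{u} ℂ) (g : D.autPoints R),
      extendScalars (evPt g) φ = extendScalars (evPt g) ψ) : φ = ψ := by
  refine linear_coordAlg_ext fun R g w => ?_
  rw [← extendScalars_one_tmul, h, extendScalars_one_tmul]

/-- An endomorphism with given matrix coefficients. -/
noncomputable def endOfCoef {W : Type u} [AddCommGroup W] [Module ℂ W] [FiniteDimensional ℂ W]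
    (x : (W →ₗ[ℂ] ℂ) → W → CoordAlg D)
    (T : ∀ (R : CommAlgCat.{u} ℂ) (_ : D.autPoints R), Module.End R (R ⊗[ℂ] W))
    (hx : ∀ (R : CommAlgCat.{u} ℂ) (g : D.autPoints R) ζ w, evPt g (x ζ w) = coef (T R g) ζ w) :
    Module.End (CoordAlg D) (CoordAlg D ⊗[ℂ] W) :=
  LinearMap.liftBaseChange (CoordAlg D)
    { toFun := fun w => ∑ i, x ((Module.finBasis ℂ W).coord i) w ⊗ₜ[ℂ] Module.finBasis ℂ W i
      map_add' := fun w w' => by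
        rw [← Finset.sum_add_distrib]
        refine Finset.sum_congr rfl fun i _ => ?_
        rw [← TensorProduct.add_tmul]
        congr 1
        refine coordAlg_ext fun R g => ?_
        rw [map_add, hx, hx, hx, coef, coef, coef, TensorProduct.tmul_add, map_add, map_add]
      map_smul' := fun c w => by
        rw [Finset.smul_sum]
        refine Finset.sum_congr rfl fun i _ => ?_
        rw [RingHom.id_apply, TensorProduct.smul_tmul']
        congr 1
        refine coordAlg_ext fun R g => ?_
        have h : (1 : R) ⊗ₜ[ℂ] (c • w) = algebraMap ℂ R c • ((1 : R) ⊗ₜ[ℂ] w) := by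
          rw [TensorProduct.tmul_smul, algebraMap_smul]
        rw [map_smul, hx, hx, coef, coef, h, map_smul, map_smul, algebraMap_smul] }

theorem extendScalars_endOfCoef {W : Type u} [AddCommGroup W] [Module ℂ W]
    [FiniteDimensional ℂ W] {x : (W →ₗ[ℂ] ℂ) → W → CoordAlg D}
    {T : ∀ (R : CommAlgCat.{u} ℂ) (_ : D.autPoints R), Module.End R (R ⊗[ℂ] W)}
    (hx : ∀ (R : CommAlgCat.{u} ℂ) (g : D.autPoints R) ζ w, evPt g (x ζ w) = coef (T R g) ζ w)
    (R : CommAlgCat.{u} ℂ) (g : D.autPoints R) :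
    extendScalars (evPt g) (endOfCoef x T hx) = T R g := by
  refine end_ext fun w => ?_
  have h : endOfCoef x T hx (1 ⊗ₜ w) =
      ∑ i, x ((Module.finBasis ℂ W).coord i) w ⊗ₜ[ℂ] Module.finBasis ℂ W i := by
    rw [endOfCoef, LinearMap.liftBaseChange_tmul, one_smul]
    rfl
  rw [extendScalars_one_tmul, h, map_sum, eq_sum_evalAt (T R g ((1 : R) ⊗ₜ w))]
  refine Finset.sum_congr rfl fun i _ => ?_
  rw [scalarMap_tmul, hx]
  rfl

variable (D) in
/-- The comparison of the fibre of an object with that of its representative. -/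
noncomputable def smallIso (X : C) : (D.ω.obj X : Type u) ≃ₗ[ℂ]
    (D.ω.obj ((equivSmallModel C).inverse.obj ((equivSmallModel C).functor.obj X)) : Type u) :=
  (D.ω.mapIso ((equivSmallModel C).unitIso.app X)).toLinearEquiv

theorem eq_conj_smallIso (g : D.autPoints R) (X : C) :
    g.1 X = GLPoints.conj R (smallIso D X)
      (g.1 ((equivSmallModel C).inverse.obj ((equivSmallModel C).functor.obj X))) :=
  GLPoints.eq_conj _ _ _ (aut_nat g ((equivSmallModel C).unitIso.hom.app X)).symm

variable [hfin : ∀ X : C, FiniteDimensional ℂ (D.ω.obj X)]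

variable (D) in
/-- The universal point on an object of the small model. -/
noncomputable def univSmall (s : SmallModel.{u} C) :
    GLPoints (CoordAlg D) (D.ω.obj ((equivSmallModel C).inverse.obj s)) where
  val := endOfCoef (fun ζ w => genCoef D ⟨s, ⟨true⟩, ζ, w⟩)
    (fun _ g => (g.1 ((equivSmallModel C).inverse.obj s)).val)
    fun _ g ζ w => evPt_genCoef_true g s ζ w
  -- The coordinate algebra contains the matrix coefficients of the inverse as well.
  inv := endOfCoef (fun ζ w => genCoef D ⟨s, ⟨false⟩, ζ, w⟩)
    (fun _ g => (g⁻¹.1 ((equivSmallModel C).inverse.obj s)).val)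
    fun _ g ζ w => evPt_genCoef_false g s ζ w
  val_inv := end_coordAlg_ext fun R g => by
    refine (map_mul (extendScalarsHom _ (evPt g)) _ _).trans ?_
    refine (congrArg₂ (· * ·) (extendScalars_endOfCoef _ R g)
      (extendScalars_endOfCoef _ R g)).trans ?_
    exact (Units.mul_inv (g.1 _)).trans (map_one (extendScalarsHom _ (evPt g))).symm
  inv_val := end_coordAlg_ext fun R g => by
    refine (map_mul (extendScalarsHom _ (evPt g)) _ _).trans ?_
    refine (congrArg₂ (· * ·) (extendScalars_endOfCoef _ R g)
      (extendScalars_endOfCoef _ R g)).trans ?_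
    exact (Units.inv_mul (g.1 _)).trans (map_one (extendScalarsHom _ (evPt g))).symm

theorem map_univSmall (s : SmallModel.{u} C) (R : CommAlgCat.{u} ℂ) (g : D.autPoints R) :
    GLPoints.map _ (evPt g) (univSmall D s) = g.1 ((equivSmallModel C).inverse.obj s) :=
  Units.ext (extendScalars_endOfCoef (T := fun _ g => (g.1 ((equivSmallModel C).inverse.obj s)).val)
    (fun _ g ζ w => evPt_genCoef_true g s ζ w) R g)

variable (D) in
/-- The universal point on an object. -/
noncomputable def univObj (X : C) : GLPoints (CoordAlg D) (D.ω.obj X) :=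
  GLPoints.conj _ (smallIso D X) (univSmall D ((equivSmallModel C).functor.obj X))

theorem map_univObj (X : C) (R : CommAlgCat.{u} ℂ) (g : D.autPoints R) :
    GLPoints.map _ (evPt g) (univObj D X) = g.1 X := by
  rw [univObj, GLPoints.map_conj, map_univSmall, ← eq_conj_smallIso]

theorem extendScalars_univObj (X : C) (R : CommAlgCat.{u} ℂ) (g : D.autPoints R) :
    extendScalars (evPt g) (univObj D X).val = (g.1 X).val :=
  congrArg Units.val (map_univObj X R g)

theorem scalarMap_univObj (X : C) (R : CommAlgCat.{u} ℂ) (g : D.autPoints R) (w) :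
    scalarMap (D.ω.obj X) (evPt g) ((univObj D X).val (1 ⊗ₜ w)) =
      (g.1 X).val ((1 : R) ⊗ₜ w) := by
  rw [← extendScalars_one_tmul, extendScalars_univObj]

variable (D) in
/-- The universal point of the group scheme of tensor automorphisms. -/
noncomputable def univPt : D.autPoints (CoordAlg D) :=
  ⟨univObj D, fun X Y f => linear_coordAlg_ext fun R g w => by
      have h1 := LinearMap.congr_fun (aut_nat g f) ((1 : R) ⊗ₜ w)
      rw [LinearMap.comp_apply, LinearMap.comp_apply] at h1 ⊢
      rw [LinearMap.baseChange_tmul, scalarMap_univObj, scalarMap_baseChange, scalarMap_univObj]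
      rw [LinearMap.baseChange_tmul] at h1
      exact h1,
    Units.ext (end_coordAlg_ext fun R g => by
      rw [extendScalars_univObj, aut_unit]
      exact (map_one (extendScalarsHom _ (evPt g))).symm),
    fun X Y => linear_coordAlg_ext fun R g w => by
      have h1 := LinearMap.congr_fun (aut_tensor g X Y) ((1 : R) ⊗ₜ w)
      rw [LinearMap.comp_apply, LinearMap.comp_apply] at h1 ⊢
      rw [LinearMap.baseChange_tmul, scalarMap_univObj, scalarMap_baseChange]
      rw [LinearMap.baseChange_tmul] at h1
      refine h1.trans (congrArg _ ?_)
      rw [← extendScalars_univObj X R g, ← extendScalars_univObj Y R g, ← extendScalars_boxTensor,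
        extendScalars_one_tmul]
      rfl⟩

/-- Every point is the image of the universal point. -/
theorem autMap_univPt (R : CommAlgCat.{u} ℂ) (g : D.autPoints R) :
    D.autMap (evPt g) (univPt D) = g :=
  Subtype.ext (funext fun X => map_univObj X R g)

theorem genCoef_true (s : SmallModel.{u} C) (ζ w) : genCoef D ⟨s, ⟨true⟩, ζ, w⟩ =
    coef ((univPt D).1 ((equivSmallModel C).inverse.obj s)).val ζ w := by
  refine coordAlg_ext fun R g => ?_
  rw [evPt_genCoef_true, ← coef_extendScalars]
  exact congrArg (fun φ => coef φ ζ w) (extendScalars_univObj _ R g).symm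

theorem genCoef_false (s : SmallModel.{u} C) (ζ w) : genCoef D ⟨s, ⟨false⟩, ζ, w⟩ =
    coef ((univPt D)⁻¹.1 ((equivSmallModel C).inverse.obj s)).val ζ w := by
  refine coordAlg_ext fun R g => ?_
  rw [evPt_genCoef_false, ← coef_extendScalars]
  refine congrArg (fun φ => coef φ ζ w) ?_
  have h := (map_inv (D.autMap (evPt g)) (univPt D)).trans
    (congrArg (·⁻¹) (autMap_univPt R g))
  exact (congrArg (fun a : D.autPoints R => (a.1 ((equivSmallModel C).inverse.obj s)).val) h).symm

end Universal

end FibreFunctorData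

end NCG

namespace NCG

namespace ProdRep

variable {G : CommAlgCat.{u} ℂ ⥤ GrpCat.{u + 1}} {H : Type} [Group H] [TopologicalSpace H]

/-! ### Separating the two factors of a representation of a product -/

/-- The restriction of a representation of `G × H` to `G`. -/
noncomputable def algPart (X : ProdRep G H) : ProdRep G H where
  carrier := X.carrier
  ρ := X.ρ
  ρ_nat := X.ρ_nat
  σ := 1
  σ_cont := fun w ℓ => (continuous_const : Continuous fun _ : H => ℓ w)
  comm := fun R g _ => by
    rw [MonoidHom.one_apply, Module.End.one_eq_id, LinearMap.baseChange_id, LinearMap.comp_id,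
      LinearMap.id_comp]

variable (G) in
/-- A continuous representation of `H` as a representation of `G × H`. -/
noncomputable def ofCont {W : Type u} [AddCommGroup W] [Module ℂ W] [FiniteDimensional ℂ W]
    (σ : H →* Module.End ℂ W) (hσ : ContinuousRep σ) : ProdRep G H where
  carrier := W
  ρ := fun _ => 1
  ρ_nat := fun f _ => (map_one (GLPoints.map _ f.hom)).symm
  σ := σ
  σ_cont := hσ
  comm := fun R _ h => by
    rw [MonoidHom.one_apply, Units.val_one, Module.End.one_eq_id, LinearMap.comp_id,
      LinearMap.id_comp]

/-- The endomorphisms that commute with the action of `G`. -/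
def commutant (X : ProdRep G H) : Subalgebra ℂ (Module.End ℂ X.carrier) where
  carrier := {T | ∀ (R : CommAlgCat.{u} ℂ) (g : G.obj R),
    (X.ρ R g).val ∘ₗ T.baseChange R = T.baseChange R ∘ₗ (X.ρ R g).val}
  mul_mem' := fun {S T} hS hT R g => by
    rw [Module.End.mul_eq_comp, LinearMap.baseChange_comp, ← LinearMap.comp_assoc, hS,
      LinearMap.comp_assoc, hT, LinearMap.comp_assoc]
  add_mem' := fun {S T} hS hT R g => by
    rw [LinearMap.baseChange_add, LinearMap.comp_add, LinearMap.add_comp, hS, hT]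
  algebraMap_mem' := fun c R g => by
    rw [Module.algebraMap_end_eq_smul_id, LinearMap.baseChange_smul, LinearMap.baseChange_id,
      LinearMap.comp_smul, LinearMap.smul_comp, LinearMap.comp_id, LinearMap.id_comp]

/-- The action of `H` on the commutant by left multiplication. -/
noncomputable def commutantRep (X : ProdRep G H) : H →* Module.End ℂ X.commutant :=
  ((Algebra.lmul ℂ X.commutant : X.commutant →* Module.End ℂ X.commutant)).comp
    (X.σ.codRestrict X.commutant fun h R g => X.comm R g h)

theorem commutantRep_continuous (X : ProdRep G H) : ContinuousRep X.commutantRep := by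
  intro a ℓ
  obtain ⟨ℓ', hℓ'⟩ := LinearMap.exists_extend (p := Subalgebra.toSubmodule X.commutant) ℓ
  have h : ∀ h, ℓ (X.commutantRep h a) = ℓ' (X.σ h ∘ₗ a.1) := fun h =>
    (LinearMap.congr_fun hℓ' (X.commutantRep h a)).symm
  simp only [h]
  exact continuous_dual_end (T := fun h => X.σ h ∘ₗ a.1) (fun w ζ => X.σ_cont (a.1 w) ζ) ℓ'

/-- The evaluation `A ⊗ W → W`, where `A` is the commutant of `G` in `W`. -/
noncomputable def evalLin (X : ProdRep G H) : X.commutant ⊗[ℂ] X.carrier →ₗ[ℂ] X.carrier :=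
  TensorProduct.lift X.commutant.val.toLinearMap

theorem evalLin_tmul (X : ProdRep G H) (a : X.commutant) (w : X.carrier) :
    X.evalLin (a ⊗ₜ w) = a.1 w := rfl

/-- The evaluation is a morphism from the tensor product of a representation of `H` and a
representation of `G`. -/
noncomputable def evalHom (X : ProdRep G H) :
    tensor (ofCont G X.commutantRep X.commutantRep_continuous) X.algPart ⟶ X :=
  (⟨X.evalLin, fun R g => by
      have key : ∀ (a : X.commutant) (x : R ⊗[ℂ] X.carrier), X.evalLin.baseChange R
          ((TensorProduct.AlgebraTensorModule.distribBaseChange ℂ R X.commutant X.carrier).symm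
            (((1 : R) ⊗ₜ[ℂ] a) ⊗ₜ[R] x)) = a.1.baseChange R x := by
        intro a x
        induction x using TensorProduct.induction_on with
        | zero => simp
        | add x y hx hy => rw [TensorProduct.tmul_add, map_add, map_add, map_add, hx, hy]
        | tmul r w =>
          simp [TensorProduct.AlgebraTensorModule.distribBaseChange_symm_tmul, evalLin_tmul]
      have h : X.evalLin.baseChange R ∘ₗ
          boxTensor (1 : Module.End R (R ⊗[ℂ] X.commutant)) (X.ρ R g).val =
          (X.ρ R g).val ∘ₗ X.evalLin.baseChange R := by
        refine end_ext₂ fun a w => ?_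
        rw [LinearMap.comp_apply, LinearMap.comp_apply, boxTensor_one_tmul, Module.End.one_apply,
          key, LinearMap.baseChange_tmul, evalLin_tmul]
        have h1 := LinearMap.congr_fun (a.2 R g) ((1 : R) ⊗ₜ w)
        rw [LinearMap.comp_apply, LinearMap.comp_apply, LinearMap.baseChange_tmul] at h1
        exact h1.symm
      exact h,
    fun h z => by
      have h1 : X.evalLin ∘ₗ TensorProduct.map (X.commutantRep h) 1 = X.σ h ∘ₗ X.evalLin :=
        TensorProduct.ext' fun a w => rfl
      exact LinearMap.congr_fun h1 z⟩ : Hom _ X)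

/-- The orbit map of a vector, from the commutant. -/
noncomputable def orbitHom (X : ProdRep G H) (w : X.carrier) :
    ofCont G X.commutantRep X.commutantRep_continuous ⟶ ofCont G X.σ X.σ_cont :=
  (⟨LinearMap.applyₗ w ∘ₗ X.commutant.val.toLinearMap, fun _ _ => rfl, fun _ _ => rfl⟩ :
    Hom _ _)

variable {R : Type u} [CommRing R] [Algebra ℂ R]

theorem aut_tensor_eq (η : (fibreData G H).autPoints R) (X Y : ProdRep G H) :
    (η.1 (tensor X Y)).val = boxTensor (η.1 X).val (η.1 Y).val := by
  have h3 : ∀ {M : Type u} [AddCommGroup M] [Module ℂ M]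
      {φ ψ : Module.End R (R ⊗[ℂ] M)}, φ ∘ₗ (LinearMap.id : M →ₗ[ℂ] M).baseChange R =
        (LinearMap.id : M →ₗ[ℂ] M).baseChange R ∘ₗ ψ → φ = ψ := by
    intro M _ _ φ ψ h
    rwa [LinearMap.baseChange_id, LinearMap.comp_id, LinearMap.id_comp] at h
  exact h3 (FibreFunctorData.aut_tensor η X Y)

/-- A tensor automorphism is determined by its values on the representations of the factors. The
commutant of `G` in `X` is a representation of `H`, and `GLPoints.eq_mul_of_act` applies to its
action on `X`. -/
theorem aut_eq_mul (η : (fibreData G H).autPoints R) (X : ProdRep G H) :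
    η.1 X = (show GLPoints R X.carrier from η.1 (ofCont G X.σ X.σ_cont)) *
      (show GLPoints R X.carrier from η.1 X.algPart) := by
  have h := GLPoints.eq_mul_of_act (μ := X.evalLin) (e := LinearEquiv.refl ℂ X.carrier)
    (x₀ := (1 : X.commutant)) (fun _ => rfl) (η := η.1 X)
    (κ := (show GLPoints R X.carrier from η.1 (ofCont G X.σ X.σ_cont)))
    (φ := η.1 (ofCont G X.commutantRep X.commutantRep_continuous)) (ψ := η.1 X.algPart) ?_
    fun y => FibreFunctorData.aut_nat η (X.orbitHom y)
  · exact h.trans (congrArg (_ * ·) (GLPoints.conj_refl _))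
  · have h1 := FibreFunctorData.aut_nat η X.evalHom
    have h2 := aut_tensor_eq η (ofCont G X.commutantRep X.commutantRep_continuous) X.algPart
    exact h1.trans (congrArg (X.evalLin.baseChange R ∘ₗ ·) h2)

end ProdRep

end NCG

namespace NCG

namespace ProdRep

section Constructions

variable {G : CommAlgCat.{u} ℂ ⥤ GrpCat.{u + 1}} {H : Type} [Group H] [TopologicalSpace H]

/-! ### Constructions with representations of a group scheme -/

variable (H) in
/-- An algebraic representation of `G`, with the trivial action of `H`. -/
noncomputable def ofAlg (W : Type u) [AddCommGroup W] [Module ℂ W] [FiniteDimensional ℂ W]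
    (ρ : ∀ R : CommAlgCat.{u} ℂ, G.obj R →* Module.End R (R ⊗[ℂ] W))
    (nat : ∀ {R S : CommAlgCat.{u} ℂ} (f : R ⟶ S) (g : G.obj R),
      ρ S ((G.map f).hom g) = extendScalars f.hom (ρ R g)) : ProdRep G H where
  carrier := W
  ρ := fun R => (ρ R).toHomUnits
  ρ_nat := fun f g => Units.ext (nat f g)
  σ := 1
  σ_cont := fun w ℓ => (continuous_const : Continuous fun _ : H => ℓ w)
  comm := fun R g _ => by
    rw [MonoidHom.one_apply, Module.End.one_eq_id, LinearMap.baseChange_id, LinearMap.comp_id,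
      LinearMap.id_comp]

section Sum

variable {R S : Type u} [CommRing R] [Algebra ℂ R] [CommRing S] [Algebra ℂ S]
  {W W' : Type u} [AddCommGroup W] [Module ℂ W] [AddCommGroup W'] [Module ℂ W']

/-- The direct sum of two endomorphisms. -/
noncomputable def endSum (φ : Module.End R (R ⊗[ℂ] W)) (ψ : Module.End R (R ⊗[ℂ] W')) :
    Module.End R (R ⊗[ℂ] (W × W')) :=
  (LinearMap.inl ℂ W W').baseChange R ∘ₗ φ ∘ₗ (LinearMap.fst ℂ W W').baseChange R +
    (LinearMap.inr ℂ W W').baseChange R ∘ₗ ψ ∘ₗ (LinearMap.snd ℂ W W').baseChange R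

theorem endSum_tmul (φ : Module.End R (R ⊗[ℂ] W)) (ψ : Module.End R (R ⊗[ℂ] W')) (x : W × W') :
    endSum φ ψ ((1 : R) ⊗ₜ x) = (LinearMap.inl ℂ W W').baseChange R (φ ((1 : R) ⊗ₜ x.1)) +
      (LinearMap.inr ℂ W W').baseChange R (ψ ((1 : R) ⊗ₜ x.2)) := rfl

theorem endSum_inl (φ : Module.End R (R ⊗[ℂ] W)) (ψ : Module.End R (R ⊗[ℂ] W')) :
    endSum φ ψ ∘ₗ (LinearMap.inl ℂ W W').baseChange R =
      (LinearMap.inl ℂ W W').baseChange R ∘ₗ φ := by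
  refine end_ext fun w => ?_
  rw [LinearMap.comp_apply, LinearMap.comp_apply, LinearMap.baseChange_tmul, endSum_tmul]
  simp

theorem endSum_inr (φ : Module.End R (R ⊗[ℂ] W)) (ψ : Module.End R (R ⊗[ℂ] W')) :
    endSum φ ψ ∘ₗ (LinearMap.inr ℂ W W').baseChange R =
      (LinearMap.inr ℂ W W').baseChange R ∘ₗ ψ := by
  refine end_ext fun w => ?_
  rw [LinearMap.comp_apply, LinearMap.comp_apply, LinearMap.baseChange_tmul, endSum_tmul]
  simp

theorem baseChange_prod (x : W × W') : (1 : R) ⊗ₜ[ℂ] x =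
    (LinearMap.inl ℂ W W').baseChange R ((1 : R) ⊗ₜ x.1) +
      (LinearMap.inr ℂ W W').baseChange R ((1 : R) ⊗ₜ x.2) := by
  rw [LinearMap.baseChange_tmul, LinearMap.baseChange_tmul, ← TensorProduct.tmul_add]
  simp

theorem endSum_one : endSum (1 : Module.End R (R ⊗[ℂ] W)) (1 : Module.End R (R ⊗[ℂ] W')) = 1 :=
  end_ext fun x => (baseChange_prod x).symm

theorem endSum_mul (φ φ' : Module.End R (R ⊗[ℂ] W)) (ψ ψ' : Module.End R (R ⊗[ℂ] W')) :
    endSum (φ * φ') (ψ * ψ') = endSum φ ψ * endSum φ' ψ' := by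
  refine end_ext fun x => ?_
  rw [Module.End.mul_apply, endSum_tmul φ', map_add]
  exact congrArg₂ (· + ·) (LinearMap.congr_fun (endSum_inl φ ψ) _).symm
    (LinearMap.congr_fun (endSum_inr φ ψ) _).symm

theorem extendScalars_endSum (f : R →ₐ[ℂ] S) (φ : Module.End R (R ⊗[ℂ] W))
    (ψ : Module.End R (R ⊗[ℂ] W')) :
    extendScalars f (endSum φ ψ) = endSum (extendScalars f φ) (extendScalars f ψ) := by
  refine end_ext fun x => ?_
  rw [extendScalars_one_tmul, endSum_tmul, endSum_tmul, map_add, scalarMap_baseChange,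
    scalarMap_baseChange, extendScalars_one_tmul, extendScalars_one_tmul]

end Sum

/-- The direct sum of two algebraic representations. -/
noncomputable def sum (X Y : ProdRep G H) : ProdRep G H :=
  ofAlg H (X.carrier × Y.carrier)
    (fun R =>
      { toFun := fun g => endSum (X.ρ R g).val (Y.ρ R g).val
        map_one' := by rw [map_one, map_one]; exact endSum_one
        map_mul' := fun g h => by rw [map_mul, map_mul]; exact endSum_mul _ _ _ _ })
    fun {R S} f g => by
      change endSum (X.ρ S _).val (Y.ρ S _).val = extendScalars _ (endSum _ _)
      rw [X.ρ_nat, Y.ρ_nat, extendScalars_endSum]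
      rfl

/-- The first inclusion. -/
noncomputable def inl {X : ProdRep G H} (hX : X.σ = 1) (Y : ProdRep G H) : X ⟶ sum X Y :=
  (⟨LinearMap.inl ℂ X.carrier Y.carrier,
    fun R g => (endSum_inl (X.ρ R g).val (Y.ρ R g).val).symm,
    fun t x => congrArg (fun y => (y, (0 : Y.carrier)))
      (LinearMap.congr_fun (DFunLike.congr_fun hX t) x)⟩ : Hom X (sum X Y))

/-- The second inclusion. -/
noncomputable def inr (X : ProdRep G H) {Y : ProdRep G H} (hY : Y.σ = 1) : Y ⟶ sum X Y :=
  (⟨LinearMap.inr ℂ X.carrier Y.carrier,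
    fun R g => (endSum_inr (X.ρ R g).val (Y.ρ R g).val).symm,
    fun t y => congrArg (fun x => ((0 : X.carrier), x))
      (LinearMap.congr_fun (DFunLike.congr_fun hY t) y)⟩ : Hom Y (sum X Y))

/-- The subrepresentation on the image of `ι`, where `r` is a retraction of `ι`. -/
noncomputable def sub (X : ProdRep G H) {W : Type u} [AddCommGroup W] [Module ℂ W]
    [FiniteDimensional ℂ W] (ι : W →ₗ[ℂ] X.carrier) (r : X.carrier →ₗ[ℂ] W)
    (hr : r ∘ₗ ι = LinearMap.id)
    (h : ∀ (R : CommAlgCat.{u} ℂ) (g : G.obj R), (ι ∘ₗ r).baseChange R ∘ₗ (X.ρ R g).val ∘ₗ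
      ι.baseChange R = (X.ρ R g).val ∘ₗ ι.baseChange R) : ProdRep G H :=
  ofAlg H W
    (fun R =>
      { toFun := fun g => r.baseChange R ∘ₗ (X.ρ R g).val ∘ₗ ι.baseChange R
        map_one' := by
          rw [map_one, Units.val_one, Module.End.one_eq_id, LinearMap.id_comp,
            ← LinearMap.baseChange_comp, hr, LinearMap.baseChange_id]
          rfl
        map_mul' := fun g g' => by
          have h' := h R g'
          rw [LinearMap.baseChange_comp] at h'
          rw [map_mul, Units.val_mul]
          refine LinearMap.ext fun x => ?_
          exact congrArg (fun z => r.baseChange R ((X.ρ R g).val z))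
            (LinearMap.congr_fun h' x).symm })
    fun {R S} f g => by
      refine end_ext fun w => ?_
      rw [extendScalars_one_tmul]
      change r.baseChange S ((X.ρ S _).val (ι.baseChange S (1 ⊗ₜ w))) =
        scalarMap W _ (r.baseChange R ((X.ρ R g).val (ι.baseChange R (1 ⊗ₜ w))))
      rw [scalarMap_baseChange, X.ρ_nat, LinearMap.baseChange_tmul, LinearMap.baseChange_tmul,
        ← extendScalars_one_tmul]
      rfl

/-- The inclusion of a subrepresentation. -/
noncomputable def subHom {X : ProdRep G H} (hX : X.σ = 1) {W : Type u} [AddCommGroup W]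
    [Module ℂ W] [FiniteDimensional ℂ W] (ι : W →ₗ[ℂ] X.carrier) (r : X.carrier →ₗ[ℂ] W)
    (hr : r ∘ₗ ι = LinearMap.id)
    (h : ∀ (R : CommAlgCat.{u} ℂ) (g : G.obj R), (ι ∘ₗ r).baseChange R ∘ₗ (X.ρ R g).val ∘ₗ
      ι.baseChange R = (X.ρ R g).val ∘ₗ ι.baseChange R) : X.sub ι r hr h ⟶ X :=
  (⟨ι, fun R g => by
      have h' := h R g
      rw [LinearMap.baseChange_comp] at h'
      exact h',
    fun t x => by rw [hX]; rfl⟩ : Hom (X.sub ι r hr h) X)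

section Dual

variable {R S : Type u} [CommRing R] [Algebra ℂ R] [CommRing S] [Algebra ℂ S]
  {W : Type u} [AddCommGroup W] [Module ℂ W] [FiniteDimensional ℂ W]

/-- The transpose of an endomorphism, in the chosen basis of `W`. -/
noncomputable def endTranspose (φ : Module.End R (R ⊗[ℂ] W)) : Module.End R (R ⊗[ℂ] W) :=
  LinearMap.liftBaseChange R (∑ j, ∑ i, ((Module.finBasis ℂ W).coord j).smulRight
    (coef φ ((Module.finBasis ℂ W).coord j) (Module.finBasis ℂ W i) ⊗ₜ[ℂ] Module.finBasis ℂ W i))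

theorem endTranspose_basis (φ : Module.End R (R ⊗[ℂ] W)) (j) :
    endTranspose φ ((1 : R) ⊗ₜ Module.finBasis ℂ W j) =
      ∑ i, coef φ ((Module.finBasis ℂ W).coord j) (Module.finBasis ℂ W i) ⊗ₜ[ℂ]
        Module.finBasis ℂ W i := by
  rw [endTranspose, LinearMap.liftBaseChange_tmul, one_smul, LinearMap.sum_apply,
    Finset.sum_eq_single j]
  · rw [LinearMap.sum_apply]
    simp
  · intro k _ hk
    rw [LinearMap.sum_apply]
    simp [Finsupp.single_eq_of_ne hk]
  · exact fun h => absurd (Finset.mem_univ j) h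

theorem end_ext_basis {φ ψ : Module.End R (R ⊗[ℂ] W)}
    (h : ∀ j, φ ((1 : R) ⊗ₜ Module.finBasis ℂ W j) = ψ ((1 : R) ⊗ₜ Module.finBasis ℂ W j)) :
    φ = ψ := by
  refine (Algebra.TensorProduct.basis R (Module.finBasis ℂ W)).ext fun j => ?_
  rw [Algebra.TensorProduct.basis_apply]
  exact h j

theorem evalAt_coord_sum (c : Fin (Module.finrank ℂ W) → R) (i) :
    evalAt R ((Module.finBasis ℂ W).coord i) (∑ k, c k ⊗ₜ[ℂ] Module.finBasis ℂ W k) = c i := by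
  rw [map_sum, Finset.sum_eq_single i]
  · rw [evalAt_tmul]
    simp
  · intro k _ hk
    rw [evalAt_tmul]
    simp [Finsupp.single_eq_of_ne (Ne.symm hk)]
  · exact fun h => absurd (Finset.mem_univ i) h

theorem coef_endTranspose (φ : Module.End R (R ⊗[ℂ] W)) (i j) :
    coef (endTranspose φ) ((Module.finBasis ℂ W).coord i) (Module.finBasis ℂ W j) =
      coef φ ((Module.finBasis ℂ W).coord j) (Module.finBasis ℂ W i) := by
  rw [coef, endTranspose_basis]
  exact evalAt_coord_sum _ i

theorem end_eq_of_coef_basis {φ ψ : Module.End R (R ⊗[ℂ] W)}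
    (h : ∀ i j, coef φ ((Module.finBasis ℂ W).coord i) (Module.finBasis ℂ W j) =
      coef ψ ((Module.finBasis ℂ W).coord i) (Module.finBasis ℂ W j)) : φ = ψ := by
  refine end_ext_basis fun j => ?_
  rw [eq_sum_evalAt (φ _), eq_sum_evalAt (ψ _)]
  exact Finset.sum_congr rfl fun i _ => congrArg (· ⊗ₜ[ℂ] Module.finBasis ℂ W i) (h i j)

theorem evalAt_end (φ : Module.End R (R ⊗[ℂ] W)) (ζ : W →ₗ[ℂ] ℂ) (y : R ⊗[ℂ] W) :
    evalAt R ζ (φ y) = ∑ k, coef φ ζ (Module.finBasis ℂ W k) *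
      evalAt R ((Module.finBasis ℂ W).coord k) y := by
  conv_lhs => rw [eq_sum_evalAt y, map_sum, map_sum]
  refine Finset.sum_congr rfl fun k _ => ?_
  have h : ∀ r : R, r ⊗ₜ[ℂ] Module.finBasis ℂ W k = r • ((1 : R) ⊗ₜ[ℂ] Module.finBasis ℂ W k) := by
    intro r
    rw [TensorProduct.smul_tmul', smul_eq_mul, mul_one]
  rw [h, map_smul, map_smul, smul_eq_mul, mul_comm]
  rfl

theorem coef_mul_basis (φ ψ : Module.End R (R ⊗[ℂ] W)) (ζ : W →ₗ[ℂ] ℂ) (w : W) :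
    coef (φ * ψ) ζ w = ∑ k, coef φ ζ (Module.finBasis ℂ W k) *
      coef ψ ((Module.finBasis ℂ W).coord k) w :=
  evalAt_end φ ζ _

theorem endTranspose_mul (φ ψ : Module.End R (R ⊗[ℂ] W)) :
    endTranspose (φ * ψ) = endTranspose ψ * endTranspose φ := by
  refine end_eq_of_coef_basis fun i j => ?_
  rw [coef_endTranspose, coef_mul_basis, coef_mul_basis]
  refine Finset.sum_congr rfl fun k _ => ?_
  rw [coef_endTranspose, coef_endTranspose, mul_comm]

theorem coef_one_basis (i j) : coef (1 : Module.End R (R ⊗[ℂ] W))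
    ((Module.finBasis ℂ W).coord i) (Module.finBasis ℂ W j) = if i = j then 1 else 0 := by
  rw [coef, Module.End.one_apply, evalAt_one_tmul, Module.Basis.coord_apply,
    Module.Basis.repr_self, Finsupp.single_apply]
  by_cases h : i = j
  · simp [h]
  · simp [h, Ne.symm h]

theorem endTranspose_one : endTranspose (1 : Module.End R (R ⊗[ℂ] W)) = 1 := by
  refine end_eq_of_coef_basis fun i j => ?_
  rw [coef_endTranspose, coef_one_basis, coef_one_basis]
  simp [eq_comm]

theorem extendScalars_endTranspose (f : R →ₐ[ℂ] S) (φ : Module.End R (R ⊗[ℂ] W)) :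
    extendScalars f (endTranspose φ) = endTranspose (extendScalars f φ) := by
  refine end_eq_of_coef_basis fun i j => ?_
  rw [coef_extendScalars, coef_endTranspose, coef_endTranspose, coef_extendScalars]

variable (W) in
/-- The pairing of `W` with itself for which the chosen basis is orthonormal. -/
noncomputable def pairing : W ⊗[ℂ] W →ₗ[ℂ] ULift.{u} ℂ :=
  ULift.moduleEquiv.symm.toLinearMap ∘ₗ
    TensorProduct.lift (∑ i, ((Module.finBasis ℂ W).coord i).smulRight
      ((Module.finBasis ℂ W).coord i))

theorem evalAt_pairing (x y : R ⊗[ℂ] W) :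
    evalAt R ULift.moduleEquiv.toLinearMap ((pairing W).baseChange R
      ((TensorProduct.AlgebraTensorModule.distribBaseChange ℂ R W W).symm (x ⊗ₜ[R] y))) =
      ∑ i, evalAt R ((Module.finBasis ℂ W).coord i) x *
        evalAt R ((Module.finBasis ℂ W).coord i) y := by
  rw [evalAt_baseChange]
  induction x using TensorProduct.induction_on with
  | zero => simp
  | add x x' hx hx' =>
    rw [TensorProduct.add_tmul, map_add, map_add, hx, hx', ← Finset.sum_add_distrib]
    simp only [map_add, add_mul]
  | tmul r w =>
    induction y using TensorProduct.induction_on with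
    | zero => simp
    | add y y' hy hy' =>
      rw [TensorProduct.tmul_add, map_add, map_add, hy, hy', ← Finset.sum_add_distrib]
      simp only [map_add, mul_add]
    | tmul r' w' =>
      have h : (ULift.moduleEquiv.toLinearMap ∘ₗ pairing W) (w ⊗ₜ w') =
          ∑ i, (Module.finBasis ℂ W).coord i w * (Module.finBasis ℂ W).coord i w' := by
        simp [pairing, LinearMap.sum_apply]
      rw [TensorProduct.AlgebraTensorModule.distribBaseChange_symm_tmul, evalAt_tmul, h, map_sum,
        Finset.mul_sum]
      refine Finset.sum_congr rfl fun i _ => ?_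
      rw [evalAt_tmul, evalAt_tmul, map_mul]
      ring

end Dual

end Constructions

end ProdRep

end NCG

namespace NCG

namespace ProdRep

section Dual

variable {R : Type u} [CommRing R] [Algebra ℂ R] {W : Type u} [AddCommGroup W] [Module ℂ W]
  [FiniteDimensional ℂ W]

theorem evalAt_eq_sum (ζ : W →ₗ[ℂ] ℂ) (y : R ⊗[ℂ] W) :
    evalAt R ζ y = ∑ k, algebraMap ℂ R (ζ (Module.finBasis ℂ W k)) *
      evalAt R ((Module.finBasis ℂ W).coord k) y := by
  have h := evalAt_end (1 : Module.End R (R ⊗[ℂ] W)) ζ y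
  simp only [coef, Module.End.one_apply, evalAt_one_tmul] at h
  exact h

theorem coef_eq_sum (φ : Module.End R (R ⊗[ℂ] W)) (ζ : W →ₗ[ℂ] ℂ) (w : W) :
    coef φ ζ w = ∑ j, (∑ i, algebraMap ℂ R (ζ (Module.finBasis ℂ W i)) *
      coef φ ((Module.finBasis ℂ W).coord i) (Module.finBasis ℂ W j)) *
        algebraMap ℂ R ((Module.finBasis ℂ W).coord j w) := by
  rw [coef, evalAt_end]
  refine Finset.sum_congr rfl fun j _ => ?_
  rw [evalAt_one_tmul, coef, evalAt_eq_sum]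
  rfl

/-- The transpose is the adjoint for the pairing. -/
theorem sum_endTranspose (φ : Module.End R (R ⊗[ℂ] W)) (x y : R ⊗[ℂ] W) :
    ∑ i, evalAt R ((Module.finBasis ℂ W).coord i) (endTranspose φ x) *
        evalAt R ((Module.finBasis ℂ W).coord i) y =
      ∑ i, evalAt R ((Module.finBasis ℂ W).coord i) x *
        evalAt R ((Module.finBasis ℂ W).coord i) (φ y) := by
  simp only [evalAt_end, coef_endTranspose, Finset.sum_mul, Finset.mul_sum]
  rw [Finset.sum_comm]
  refine Finset.sum_congr rfl fun i _ => Finset.sum_congr rfl fun j _ => ?_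
  ring

theorem evalAt_ulift_injective : Function.Injective
    (evalAt R (ULift.moduleEquiv : ULift.{u} ℂ ≃ₗ[ℂ] ℂ).toLinearMap) := by
  have h : ∀ x : R ⊗[ℂ] ULift.{u} ℂ,
      x = evalAt R (ULift.moduleEquiv : ULift.{u} ℂ ≃ₗ[ℂ] ℂ).toLinearMap x ⊗ₜ ULift.up 1 := by
    intro x
    induction x using TensorProduct.induction_on with
    | zero => simp
    | tmul r c =>
      rw [evalAt_tmul, mul_comm, ← Algebra.smul_def, TensorProduct.smul_tmul]
      congr 1
      exact ULift.ext _ _ (mul_one _).symm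
    | add x y hx hy =>
      conv_lhs => rw [hx, hy]
      rw [map_add, TensorProduct.add_tmul]
  intro x y hxy
  rw [h x, h y, hxy]

/-- The pairing is perfect: an endomorphism of the first factor that preserves it is trivial. -/
theorem eq_one_of_pairing {φ : Module.End R (R ⊗[ℂ] W)}
    (h : (pairing W).baseChange R ∘ₗ boxTensor φ (1 : Module.End R (R ⊗[ℂ] W)) =
      (pairing W).baseChange R) : φ = 1 := by
  refine end_ext fun w => eq_of_evalAt fun ζ => ?_
  rw [evalAt_eq_sum, evalAt_eq_sum ζ]
  refine Finset.sum_congr rfl fun i _ => congrArg (_ * ·) ?_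
  have h5 := LinearMap.congr_fun h ((1 : R) ⊗ₜ (w ⊗ₜ Module.finBasis ℂ W i))
  have h6 := evalAt_pairing ((1 : R) ⊗ₜ[ℂ] w) ((1 : R) ⊗ₜ[ℂ] Module.finBasis ℂ W i)
  rw [TensorProduct.AlgebraTensorModule.distribBaseChange_symm_tmul, mul_one] at h6
  have h7 : ∀ x : R ⊗[ℂ] W, ∑ k, evalAt R ((Module.finBasis ℂ W).coord k) x *
      evalAt R ((Module.finBasis ℂ W).coord k)
        ((1 : R) ⊗ₜ[ℂ] Module.finBasis ℂ W i) =
      evalAt R ((Module.finBasis ℂ W).coord i) x := by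
    intro x
    rw [Finset.sum_eq_single i]
    · rw [evalAt_one_tmul]; simp
    · intro k _ hk
      rw [evalAt_one_tmul]
      simp [Finsupp.single_eq_of_ne hk]
    · exact fun h => absurd (Finset.mem_univ i) h
  rw [LinearMap.comp_apply, boxTensor_one_tmul] at h5
  have h8 := congrArg (evalAt R ULift.moduleEquiv.toLinearMap) h5
  rw [h6, evalAt_pairing, Module.End.one_apply, h7, h7] at h8
  exact h8

theorem evalAt_mul' {W W' : Type u} [AddCommGroup W] [Module ℂ W] [AddCommGroup W'] [Module ℂ W']
    (ζ : W →ₗ[ℂ] ℂ) (ζ' : W' →ₗ[ℂ] ℂ) (x : R ⊗[ℂ] W) (y : R ⊗[ℂ] W') :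
    evalAt R (LinearMap.mul' ℂ ℂ ∘ₗ TensorProduct.map ζ ζ')
      ((TensorProduct.AlgebraTensorModule.distribBaseChange ℂ R W W').symm (x ⊗ₜ[R] y)) =
      evalAt R ζ x * evalAt R ζ' y := by
  induction x using TensorProduct.induction_on with
  | zero => simp
  | add x x' hx hx' => rw [TensorProduct.add_tmul, map_add, map_add, hx, hx', map_add, add_mul]
  | tmul r w =>
    induction y using TensorProduct.induction_on with
    | zero => simp
    | add y y' hy hy' => rw [TensorProduct.tmul_add, map_add, map_add, hy, hy', map_add, mul_add]
    | tmul r' w' =>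
      rw [TensorProduct.AlgebraTensorModule.distribBaseChange_symm_tmul, evalAt_tmul, evalAt_tmul,
        evalAt_tmul, LinearMap.comp_apply, TensorProduct.map_tmul, LinearMap.mul'_apply, map_mul]
      ring

end Dual

variable {G : CommAlgCat.{u} ℂ ⥤ GrpCat.{u + 1}} {H : Type} [Group H] [TopologicalSpace H]

/-- The contragredient representation, on the same space, through the chosen basis. -/
noncomputable def dual (X : ProdRep G H) : ProdRep G H :=
  ofAlg H X.carrier
    (fun R =>
      { toFun := fun g => endTranspose (X.ρ R g⁻¹).val
        map_one' := by rw [inv_one, map_one]; exact endTranspose_one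
        map_mul' := fun g h => by
          rw [mul_inv_rev, map_mul, Units.val_mul, endTranspose_mul] })
    fun {R S} f g => by
      change endTranspose (X.ρ S ((G.map f).hom g)⁻¹).val = extendScalars _ (endTranspose _)
      rw [extendScalars_endTranspose, ← map_inv, X.ρ_nat]
      rfl

/-- The invariant pairing of a representation with its contragredient. -/
noncomputable def pairHom {X : ProdRep G H} (hX : X.σ = 1) : tensor X.dual X ⟶ unit G H :=
  (⟨pairing X.carrier, fun R g => by
      have h : (pairing X.carrier).baseChange R ∘ₗ
          boxTensor (endTranspose (X.ρ R g⁻¹).val) (X.ρ R g).val =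
          (pairing X.carrier).baseChange R := by
        refine end_ext₂ fun w w' => evalAt_ulift_injective ?_
        have h1 := evalAt_pairing ((1 : R) ⊗ₜ[ℂ] w) ((1 : R) ⊗ₜ[ℂ] w')
        rw [TensorProduct.AlgebraTensorModule.distribBaseChange_symm_tmul, mul_one] at h1
        rw [LinearMap.comp_apply, boxTensor_one_tmul, h1, evalAt_pairing, sum_endTranspose,
          map_inv, ← Module.End.mul_apply, Units.inv_mul, Module.End.one_apply]
      exact h,
    fun t x => by
      have h : TensorProduct.map (1 : Module.End ℂ X.carrier) (X.σ t) = LinearMap.id := by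
        rw [hX]; exact TensorProduct.map_one
      exact congrArg (pairing X.carrier) (LinearMap.congr_fun h x)⟩ : Hom _ (unit G H))

section Trivial

variable {R : Type u} [CommRing R] [Algebra ℂ R] (η : (fibreData G H).autPoints R)

theorem aut_sum {X Y : ProdRep G H} (hX : X.σ = 1) (hY : Y.σ = 1) (x : X.carrier) (y : Y.carrier) :
    (η.1 (sum X Y)).val ((1 : R) ⊗ₜ (x, y)) =
      (LinearMap.inl ℂ X.carrier Y.carrier).baseChange R ((η.1 X).val ((1 : R) ⊗ₜ x)) +
        (LinearMap.inr ℂ X.carrier Y.carrier).baseChange R ((η.1 Y).val ((1 : R) ⊗ₜ y)) := by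
  have h1 := LinearMap.congr_fun (FibreFunctorData.aut_nat η (inl hX Y)) ((1 : R) ⊗ₜ x)
  have h2 := LinearMap.congr_fun (FibreFunctorData.aut_nat η (inr X hY)) ((1 : R) ⊗ₜ y)
  refine (congrArg (η.1 (sum X Y)).val (baseChange_prod (R := R) (x, y))).trans ?_
  exact (map_add _ _ _).trans (congrArg₂ (· + ·) h1 h2)

theorem aut_sum_eq_one {X Y : ProdRep G H} (hX : X.σ = 1) (hY : Y.σ = 1) (h : η.1 X = 1)
    (h' : η.1 Y = 1) : η.1 (sum X Y) = 1 := by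
  refine Units.ext (end_ext fun z => ?_)
  refine (aut_sum η hX hY z.1 z.2).trans ?_
  rw [h, h']
  exact (baseChange_prod z).symm

theorem aut_tensor_eq_one {X Y : ProdRep G H} (h : η.1 X = 1) (h' : η.1 Y = 1) :
    η.1 (tensor X Y) = 1 := by
  refine Units.ext ((aut_tensor_eq η X Y).trans ?_)
  rw [h, h']
  exact boxTensor_one

theorem aut_dual_eq_one {X : ProdRep G H} (hX : X.σ = 1) (h : η.1 X = 1) : η.1 X.dual = 1 := by
  have h1 : (pairing X.carrier).baseChange R ∘ₗ boxTensor (η.1 X.dual).val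
      (1 : Module.End R (R ⊗[ℂ] X.carrier)) = (pairing X.carrier).baseChange R := by
    have h2 := FibreFunctorData.aut_nat η (pairHom hX)
    have h3 : η.1 (unit G H) = 1 := FibreFunctorData.aut_unit η
    have h4 := aut_tensor_eq η X.dual X
    rw [h] at h4
    refine (congrArg ((pairing X.carrier).baseChange R ∘ₗ ·) h4).symm.trans (h2.symm.trans ?_)
    exact congrArg (fun a : GLPoints R (ULift.{u} ℂ) =>
      a.val ∘ₗ (pairing X.carrier).baseChange R) h3
  exact Units.ext (eq_one_of_pairing (W := X.carrier) h1)

end Trivial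

/-! ### Matrix coefficients of the tautological representations -/

section Tautological

variable {C : Type (u + 1)} [Category.{u} C] (D : FibreFunctorData C)
  [hfin : ∀ X : C, FiniteDimensional ℂ (D.ω.obj X)]

variable (H) in
/-- The tautological representation of the tensor automorphisms on the fibre of an object. -/
noncomputable def taut (X : C) : ProdRep D.aut H :=
  ofAlg H (D.ω.obj X)
    (fun R =>
      { toFun := fun g : D.autPoints R => (g.1 X).val
        map_one' := rfl
        map_mul' := fun _ _ => rfl })
    fun _ _ => rfl

variable [EssentiallySmall.{u} C] {D} {R : Type u} [CommRing R] [Algebra ℂ R]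
  (η : (fibreData D.aut H).autPoints R)

/-- The universal point, for the group functor `D.aut`. -/
noncomputable abbrev univ (D : FibreFunctorData C) [∀ X : C, FiniteDimensional ℂ (D.ω.obj X)] :
    D.aut.obj (CommAlgCat.of ℂ D.CoordAlg) := D.univPt

/-- The coordinate functions that are matrix coefficients of representations on which `η` is
trivial. -/
noncomputable def trivialCoef : Subalgebra ℂ D.CoordAlg where
  carrier := {f | ∃ M : ProdRep D.aut H, M.σ = 1 ∧ η.1 M = 1 ∧ ∃ ζ z,
    f = coef (M.ρ _ (univ D)).val ζ z}
  algebraMap_mem' := fun c => ⟨unit D.aut H, rfl, FibreFunctorData.aut_unit η,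
    c • ULift.moduleEquiv.toLinearMap, ULift.up 1, by
      refine Eq.trans ?_ (evalAt_one_tmul _ _).symm
      exact congrArg (algebraMap ℂ _) (mul_one c).symm⟩
  add_mem' := by
    rintro _ _ ⟨M, hM, hM', ζ, z, rfl⟩ ⟨N, hN, hN', ξ, w, rfl⟩
    refine ⟨sum M N, rfl, aut_sum_eq_one η hM hN hM' hN',
      ζ ∘ₗ LinearMap.fst ℂ _ _ + ξ ∘ₗ LinearMap.snd ℂ _ _, (z, w), ?_⟩
    have h : coef (endSum (M.ρ _ (univ D)).val (N.ρ _ (univ D)).val)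
        (ζ ∘ₗ LinearMap.fst ℂ _ _ + ξ ∘ₗ LinearMap.snd ℂ _ _) (z, w) =
        coef (M.ρ _ (univ D)).val ζ z + coef (N.ρ _ (univ D)).val ξ w := by
      rw [coef, endSum_tmul, map_add, evalAt_baseChange, evalAt_baseChange,
        LinearMap.add_comp, LinearMap.add_comp, LinearMap.comp_assoc, LinearMap.comp_assoc,
        LinearMap.comp_assoc, LinearMap.comp_assoc, LinearMap.fst_comp_inl, LinearMap.snd_comp_inl,
        LinearMap.fst_comp_inr, LinearMap.snd_comp_inr, LinearMap.comp_zero, LinearMap.comp_zero,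
        add_zero, zero_add]
      rfl
    exact h.symm
  mul_mem' := by
    rintro _ _ ⟨M, hM, hM', ζ, z, rfl⟩ ⟨N, hN, hN', ξ, w, rfl⟩
    refine ⟨tensor M N, ?_, aut_tensor_eq_one η hM' hN',
      LinearMap.mul' ℂ ℂ ∘ₗ TensorProduct.map ζ ξ, z ⊗ₜ w, ?_⟩
    · refine MonoidHom.ext fun t => ?_
      change TensorProduct.map (M.σ t) (N.σ t) = 1
      rw [hM, hN]
      exact TensorProduct.map_one
    · refine (evalAt_mul' ζ ξ _ _).symm.trans (congrArg (evalAt _ _) ?_)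
      exact (boxTensor_one_tmul _ _ _ _).symm

theorem genCoef_mem_trivialCoef (h : ∀ X : C, η.1 (taut H D X) = 1) (i : D.CoefIndex) :
    D.genCoef i ∈ trivialCoef η := by
  obtain ⟨s, ⟨b⟩, ζ, w⟩ := i
  cases b
  · rw [FibreFunctorData.genCoef_false, coef_eq_sum]
    refine sum_mem fun j _ => mul_mem (sum_mem fun i _ => mul_mem (algebraMap_mem _ _) ?_)
      (algebraMap_mem _ _)
    refine ⟨(taut H D _).dual, rfl, aut_dual_eq_one η rfl (h _),
      (Module.finBasis ℂ (D.ω.obj ((equivSmallModel C).inverse.obj s))).coord j,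
      Module.finBasis ℂ (D.ω.obj ((equivSmallModel C).inverse.obj s)) i, ?_⟩
    exact (coef_endTranspose _ j i).symm
  · rw [FibreFunctorData.genCoef_true]
    exact ⟨taut H D _, rfl, h _, ζ, w, rfl⟩

/-- The matrix coefficients of the tautological representations generate all functions; those of the
inverse are matrix coefficients of the dual representations. -/
theorem trivialCoef_eq_top (h : ∀ X : C, η.1 (taut H D X) = 1) (f : D.CoordAlg) :
    f ∈ trivialCoef η :=
  FibreFunctorData.coordAlg_induction (P := fun f => f ∈ trivialCoef η)
    (algebraMap_mem _) (fun _ _ => add_mem) (fun _ _ => mul_mem) (genCoef_mem_trivialCoef η h) f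

end Tautological

end ProdRep

end NCG

namespace NCG

namespace ProdRep

/-! ### Tensor automorphisms that are trivial on the tautological representations -/

section Raw

variable {A R : Type u} [CommRing A] [Algebra ℂ A] [CommRing R] [Algebra ℂ R]
  {W : Type u} [AddCommGroup W] [Module ℂ W]

/-- The matrix coefficients of `φ` for a fixed linear form. -/
noncomputable def coefMap (φ : Module.End A (A ⊗[ℂ] W)) (ζ : W →ₗ[ℂ] ℂ) : W →ₗ[ℂ] A :=
  ((evalAt A ζ ∘ₗ φ).restrictScalars ℂ) ∘ₗ TensorProduct.mk ℂ A W 1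

theorem baseChange_coefMap (φ : Module.End A (A ⊗[ℂ] W)) (ζ : W →ₗ[ℂ] ℂ) (y : R ⊗[ℂ] W) :
    (coefMap φ ζ).baseChange R y = evalAt (R ⊗[ℂ] A) ζ
      (extendScalars (Algebra.TensorProduct.includeRight : A →ₐ[ℂ] R ⊗[ℂ] A) φ
        (scalarMap W (Algebra.TensorProduct.includeLeft : R →ₐ[ℂ] R ⊗[ℂ] A) y)) := by
  induction y using TensorProduct.induction_on with
  | zero => simp
  | add x y hx hy => rw [map_add, hx, hy, map_add, map_add, map_add]
  | tmul r w =>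
    have h : (Algebra.TensorProduct.includeLeft : R →ₐ[ℂ] R ⊗[ℂ] A) r ⊗ₜ[ℂ] w =
        (r ⊗ₜ[ℂ] (1 : A)) • ((1 : R ⊗[ℂ] A) ⊗ₜ[ℂ] w) := by
      rw [TensorProduct.smul_tmul', smul_eq_mul, mul_one]
      rfl
    rw [LinearMap.baseChange_tmul, scalarMap_tmul, h, map_smul, map_smul, extendScalars_one_tmul,
      evalAt_scalarMap, Algebra.TensorProduct.includeRight_apply, smul_eq_mul,
      Algebra.TensorProduct.tmul_mul_tmul, mul_one, one_mul]
    rfl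

theorem evalAt_zero (y : R ⊗[ℂ] W) : evalAt R (0 : W →ₗ[ℂ] ℂ) y = 0 := by
  simp [evalAt]

/-- A linear form that vanishes on the kernel of `Δ` vanishes, after extension of scalars, on the
kernel of the extension of `Δ`. -/
theorem evalAt_eq_zero_of_baseChange {W' : Type u} [AddCommGroup W'] [Module ℂ W']
    {Δ : W →ₗ[ℂ] W'} {ζ : W →ₗ[ℂ] ℂ} (h : LinearMap.ker Δ ≤ LinearMap.ker ζ) {y : R ⊗[ℂ] W}
    (hy : Δ.baseChange R y = 0) : evalAt R ζ y = 0 := by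
  have h' : ζ ∈ (LinearMap.ker Δ).dualAnnihilator :=
    (Submodule.mem_dualAnnihilator ζ).2 fun x hx => h hx
  rw [← LinearMap.range_dualMap_eq_dualAnnihilator_ker] at h'
  obtain ⟨θ, rfl⟩ := h'
  change evalAt R (θ ∘ₗ Δ) y = 0
  rw [← evalAt_baseChange, hy, map_zero]

end Raw

section Trivial

variable {H : Type} [Group H] [TopologicalSpace H] {C : Type (u + 1)} [Category.{u} C]
  {D : FibreFunctorData C} [hfin : ∀ X : C, FiniteDimensional ℂ (D.ω.obj X)]
  [EssentiallySmall.{u} C] {R : Type u} [CommRing R] [Algebra ℂ R]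
  (η : (fibreData D.aut H).autPoints R)

/-- A matrix coefficient is determined by its value at the universal point. -/
theorem coef_univ (P : ProdRep D.aut H) (ζ : P.carrier →ₗ[ℂ] ℂ) (x : P.carrier)
    (S : CommAlgCat.{u} ℂ) (g : D.autPoints S) :
    coef (P.ρ S g).val ζ x = FibreFunctorData.evPt g (coef (P.ρ _ (univ D)).val ζ x) := by
  rw [← coef_extendScalars]
  have h := P.ρ_nat (CommAlgCat.ofHom (FibreFunctorData.evPt g)) (univ D)
  have h2 : (D.aut.map (CommAlgCat.ofHom (FibreFunctorData.evPt g))).hom (univ D) = g :=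
    FibreFunctorData.autMap_univPt S g
  rw [h2] at h
  exact congrArg (fun a : GLPoints S P.carrier => coef a.val ζ x) h

/-- If the matrix coefficient of `x` for `ζ` vanishes, then `x` lies in a subrepresentation on
which `ζ` vanishes, and `η` preserves it. The subrepresentation is the kernel of the map `Δ` that
sends a vector to its matrix coefficient for `ζ`. -/
theorem evalAt_aut_eq_zero {P : ProdRep D.aut H} (hP : P.σ = 1) (ζ : P.carrier →ₗ[ℂ] ℂ)
    (x : P.carrier) (hx : coef (P.ρ _ (univ D)).val ζ x = 0) :
    evalAt R ζ ((η.1 P).val ((1 : R) ⊗ₜ x)) = 0 := by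
  let Δ : P.carrier →ₗ[ℂ] D.CoordAlg := coefMap (P.ρ _ (univ D)).val ζ
  -- The kernel is stable under a point `g`: `Δ (g k)` is the matrix coefficient of `k` at the
  -- product of the universal point and `g`, over `S ⊗ D.CoordAlg`, and it vanishes.
  have hΔ : ∀ (S : CommAlgCat.{u} ℂ) (g : D.autPoints S) (k : LinearMap.ker Δ),
      Δ.baseChange S ((P.ρ S g).val ((1 : S) ⊗ₜ k.1)) = 0 := by
    intro S g k
    let T : CommAlgCat.{u} ℂ := CommAlgCat.of ℂ (S ⊗[ℂ] D.CoordAlg)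
    let j₁ : S ⟶ T := CommAlgCat.ofHom Algebra.TensorProduct.includeLeft
    let j₂ : CommAlgCat.of ℂ D.CoordAlg ⟶ T := CommAlgCat.ofHom Algebra.TensorProduct.includeRight
    refine (baseChange_coefMap _ ζ _).trans ?_
    have h1 := congrArg Units.val (P.ρ_nat j₂ (univ D))
    have h2 := congrArg Units.val (P.ρ_nat j₁ g)
    have h3 := coef_univ P ζ k.1 T ((D.aut.map j₂).hom (univ D) * (D.aut.map j₁).hom g)
    have h4 : coef (P.ρ _ (univ D)).val ζ k.1 = 0 := k.2
    rw [h4, map_zero] at h3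
    refine Eq.trans ?_ h3
    have h5 := map_mul (P.ρ T) ((D.aut.map j₂).hom (univ D)) ((D.aut.map j₁).hom g)
    refine Eq.trans ?_ (congrArg (fun a : GLPoints T P.carrier => coef a.val ζ k.1) h5).symm
    refine congrArg (evalAt _ ζ) ?_
    refine Eq.trans ?_ (congrArg₂ (fun a b : Module.End T (T ⊗[ℂ] P.carrier) =>
      a (b ((1 : T) ⊗ₜ k.1))) h1 h2).symm
    exact congrArg _ (extendScalars_one_tmul _ _ _).symm
  -- With a projection `r` to the kernel, stability is an identity of endomorphisms.
  obtain ⟨r, hr⟩ := LinearMap.exists_leftInverse_of_injective (LinearMap.ker Δ).subtype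
    (LinearMap.ker_eq_bot.2 (LinearMap.ker Δ).injective_subtype)
  have hst : ∀ (S : CommAlgCat.{u} ℂ) (g : D.aut.obj S),
      ((LinearMap.ker Δ).subtype ∘ₗ r).baseChange S ∘ₗ (P.ρ S g).val ∘ₗ
        (LinearMap.ker Δ).subtype.baseChange S =
      (P.ρ S g).val ∘ₗ (LinearMap.ker Δ).subtype.baseChange S := by
    intro S g
    refine end_ext fun k => eq_of_evalAt fun ξ => ?_
    have h1 : (LinearMap.ker Δ).subtype.baseChange S ((1 : S) ⊗ₜ k) = (1 : S) ⊗ₜ k.1 :=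
      LinearMap.baseChange_tmul _ _ _
    rw [LinearMap.comp_apply, LinearMap.comp_apply, h1, evalAt_baseChange, ← sub_eq_zero,
      sub_eq_add_neg, ← evalAt_neg, ← evalAt_add]
    refine evalAt_eq_zero_of_baseChange (Δ := Δ) (fun y hy => ?_) (hΔ S g k)
    have h2 : r y = ⟨y, hy⟩ := LinearMap.congr_fun hr ⟨y, hy⟩
    change ξ (r y).1 + -ξ y = 0
    rw [h2, add_neg_cancel]
  -- The value of a vanishing matrix coefficient at `g = 1` is `ζ k`.
  have h1 : ζ ∘ₗ (LinearMap.ker Δ).subtype = 0 := by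
    refine LinearMap.ext fun k => ?_
    have h := coef_univ P ζ k.1 (CommAlgCat.of ℂ (ULift.{u} ℂ)) 1
    have h4 : coef (P.ρ _ (univ D)).val ζ k.1 = 0 := k.2
    rw [h4, map_zero] at h
    have h5 := congrArg (fun a : GLPoints (ULift.{u} ℂ) P.carrier => coef a.val ζ k.1)
      (map_one (P.ρ (CommAlgCat.of ℂ (ULift.{u} ℂ))))
    have h6 : algebraMap ℂ (ULift.{u} ℂ) (ζ k.1) = 0 :=
      (evalAt_one_tmul ζ k.1).symm.trans (h5.symm.trans h)
    exact (map_eq_zero_iff _ (algebraMap ℂ (ULift.{u} ℂ)).injective).1 h6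
  have h2 : ∀ {K : Type u} [AddCommGroup K] [Module ℂ K] (ι : K →ₗ[ℂ] P.carrier) (z : R ⊗[ℂ] K),
      ζ ∘ₗ ι = 0 → evalAt R ζ (ι.baseChange R z) = 0 := by
    intro K _ _ ι z h
    rw [evalAt_baseChange, h, evalAt_zero]
  refine (congrArg (evalAt R ζ) (LinearMap.congr_fun (FibreFunctorData.aut_nat η
    (subHom hP (LinearMap.ker Δ).subtype r hr hst))
      ((1 : R) ⊗ₜ (⟨x, hx⟩ : LinearMap.ker Δ)))).trans ?_
  exact h2 _ _ h1

/-- A tensor automorphism that is trivial on the tautological representations is trivial on all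
representations of the group scheme. Every matrix coefficient of `X` is also a matrix coefficient
of a representation `M` on which `η` is trivial, and `evalAt_aut_eq_zero`, applied to the difference
of the two coefficients on `X ⊕ M`, shows that `η` has the coefficients of `1` on `X`. -/
theorem aut_eq_one_of_taut (h : ∀ X : C, η.1 (taut H D X) = 1) {X : ProdRep D.aut H}
    (hX : X.σ = 1) : η.1 X = 1 := by
  have key : ∀ (ζ : X.carrier →ₗ[ℂ] ℂ) (w : X.carrier), coef (η.1 X).val ζ w =
      coef (1 : Module.End R (R ⊗[ℂ] X.carrier)) ζ w := by
    intro ζ w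
    obtain ⟨M, hM, hM', ξ, z, hf⟩ := trivialCoef_eq_top η h (coef (X.ρ _ (univ D)).val ζ w)
    have h0 : ∀ {S : Type u} [CommRing S] [Algebra ℂ S] (φ : Module.End S (S ⊗[ℂ] X.carrier))
        (ψ : Module.End S (S ⊗[ℂ] M.carrier)),
        evalAt S (ζ ∘ₗ LinearMap.fst ℂ _ _ + -(ξ ∘ₗ LinearMap.snd ℂ X.carrier M.carrier))
          ((LinearMap.inl ℂ X.carrier M.carrier).baseChange S (φ ((1 : S) ⊗ₜ w)) +
            (LinearMap.inr ℂ X.carrier M.carrier).baseChange S (ψ ((1 : S) ⊗ₜ z))) =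
          coef φ ζ w - coef ψ ξ z := by
      intro S _ _ φ ψ
      rw [map_add, evalAt_baseChange, evalAt_baseChange,
        LinearMap.add_comp, LinearMap.add_comp, LinearMap.neg_comp, LinearMap.neg_comp,
        LinearMap.comp_assoc, LinearMap.comp_assoc,
        LinearMap.comp_assoc, LinearMap.comp_assoc, LinearMap.fst_comp_inl, LinearMap.snd_comp_inl,
        LinearMap.fst_comp_inr, LinearMap.snd_comp_inr, LinearMap.comp_zero, LinearMap.comp_zero,
        neg_zero, add_zero, zero_add, evalAt_neg, sub_eq_add_neg]
      rfl
    have h1 := evalAt_aut_eq_zero η (P := sum X M) rfl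
      (ζ ∘ₗ LinearMap.fst ℂ _ _ + -(ξ ∘ₗ LinearMap.snd ℂ X.carrier M.carrier)) (w, z)
      ((h0 (X.ρ _ (univ D)).val (M.ρ _ (univ D)).val).trans (by rw [hf, sub_self]))
    have h2 := (congrArg (evalAt R _) (aut_sum η hX hM w z)).symm.trans h1
    have h3 := (h0 (η.1 X).val (η.1 M).val).symm.trans h2
    refine (sub_eq_zero.1 h3).trans ?_
    rw [hM']
    -- Both sides are the value of the same function at the point `1`.
    have h4 : ∀ Y : ProdRep D.aut H, ∀ (ζ : Y.carrier →ₗ[ℂ] ℂ) w,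
        coef (1 : Module.End R (R ⊗[ℂ] Y.carrier)) ζ w = FibreFunctorData.evPt
          (1 : D.autPoints R) (coef (Y.ρ _ (univ D)).val ζ w) := fun Y ζ w => by
      rw [← coef_univ Y ζ w (CommAlgCat.of ℂ R) 1]
      exact (congrArg (fun a : GLPoints R Y.carrier => coef a.val ζ w)
        (map_one (Y.ρ (CommAlgCat.of ℂ R)))).symm
    exact (h4 M ξ z).trans ((congrArg _ hf.symm).trans (h4 X ζ w).symm)
  exact Units.ext (end_eq_of_coef (W := X.carrier) key)

end Trivial

end ProdRep

end NCG

namespace NCG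

/-! ### Smallness of the category of flat connections -/

namespace FlatBundle

variable {Ω : CDGA.{u}}

/-- A presentation of a flat bundle as the image of an idempotent endomorphism of a free module:
the rank, the idempotent, and the connection. -/
def IsPresentation (E : FlatBundle Ω)
    (t : Σ n : ℕ, ((Fin n → Ω) →ₗ[ℂ] (Fin n → Ω)) × ((Fin n → Ω) →ₗ[ℂ] (Fin n → Ω))) : Prop :=
  ∃ (i : GradedBimodule.Hom E.toGradedBimodule (GradedBimodule.free Ω t.1))
    (r : GradedBimodule.Hom (GradedBimodule.free Ω t.1) E.toGradedBimodule),
    (∀ e, r.toLin (i.toLin e) = e) ∧ (∀ x, t.2.1 x = i.toLin (r.toLin x)) ∧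
      ∀ x, t.2.2 x = i.toLin (E.conn (r.toLin x))

theorem exists_isPresentation (E : FlatBundle Ω) : ∃ t, IsPresentation E t := by
  obtain ⟨n, i, r, h⟩ := E.fgp
  exact ⟨⟨n, i.toLin ∘ₗ r.toLin, i.toLin ∘ₗ E.conn ∘ₗ r.toLin⟩, i, r, h, fun _ => rfl,
    fun _ => rfl⟩

theorem IsPresentation.congr {E : FlatBundle Ω} {t t'} (h : IsPresentation E t) (ht : t = t') :
    IsPresentation E t' := ht ▸ h

/-- Flat bundles with the same presentation are isomorphic. -/
theorem IsPresentation.nonempty_iso {E F : FlatBundle Ω} {t} (hE : IsPresentation E t)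
    (hF : IsPresentation F t) : Nonempty (E ≅ F) := by
  obtain ⟨i, r, h, h1, h2⟩ := hE
  obtain ⟨i', r', h', h1', h2'⟩ := hF
  have key : ∀ {E F : FlatBundle Ω}
      (i : GradedBimodule.Hom E.toGradedBimodule (GradedBimodule.free Ω t.1))
      (r : GradedBimodule.Hom (GradedBimodule.free Ω t.1) E.toGradedBimodule)
      (i' : GradedBimodule.Hom F.toGradedBimodule (GradedBimodule.free Ω t.1))
      (r' : GradedBimodule.Hom (GradedBimodule.free Ω t.1) F.toGradedBimodule)
      (_ : ∀ e, r.toLin (i.toLin e) = e) (_ : ∀ e, r'.toLin (i'.toLin e) = e)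
      (_ : ∀ x, i.toLin (E.conn (r.toLin x)) = i'.toLin (F.conn (r'.toLin x))) (e : E.carrier),
      r'.toLin (i.toLin (E.conn e)) = F.conn (r'.toLin (i.toLin e)) := by
    intro E F i r i' r' h h' h2 e
    have h3 := h2 (i.toLin e)
    rw [h] at h3
    rw [h3, h']
  let f : Hom E F :=
    { toLin := r'.toLin ∘ₗ i.toLin
      map_mem := fun he => r'.map_mem (i.map_mem he)
      map_lact := fun α e => (congrArg r'.toLin (i.map_lact α e)).trans (r'.map_lact α _)
      map_ract := fun e α => (congrArg r'.toLin (i.map_ract e α)).trans (r'.map_ract _ α)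
      map_conn := key i r i' r' h h' fun x => (h2 x).symm.trans (h2' x) }
  let g : Hom F E :=
    { toLin := r.toLin ∘ₗ i'.toLin
      map_mem := fun he => r.map_mem (i'.map_mem he)
      map_lact := fun α e => (congrArg r.toLin (i'.map_lact α e)).trans (r.map_lact α _)
      map_ract := fun e α => (congrArg r.toLin (i'.map_ract e α)).trans (r.map_ract _ α)
      map_conn := key i' r' i r h' h fun x => (h2' x).symm.trans (h2 x) }
  exact ⟨{ hom := f
           inv := g
           hom_inv_id := Hom.ext (LinearMap.ext fun e => by
             change r.toLin (i'.toLin (r'.toLin (i.toLin e))) = e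
             refine (congrArg r.toLin ((h1' _).symm.trans (h1 _))).trans ((h _).trans (h e)))
           inv_hom_id := Hom.ext (LinearMap.ext fun e => by
             change r'.toLin (i.toLin (r.toLin (i'.toLin e))) = e
             refine (congrArg r'.toLin ((h1 _).symm.trans (h1' _))).trans ((h' _).trans (h' e))) }⟩

/-- Isomorphism classes of flat bundles inject into the set of presentations. -/
instance : EssentiallySmall.{u} (FlatBundle Ω) :=
  (essentiallySmall_iff _).2 ⟨small_of_injective
    (f := fun X => (exists_isPresentation ((fromSkeleton (FlatBundle Ω)).obj X)).choose)
    fun X Y h => by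
      have hX := (exists_isPresentation ((fromSkeleton (FlatBundle Ω)).obj X)).choose_spec
      have hY := (exists_isPresentation ((fromSkeleton (FlatBundle Ω)).obj Y)).choose_spec
      exact skeleton_skeletal _
        ((hX.nonempty_iso (hY.congr h.symm)).map (fromSkeleton _).preimageIso),
    inferInstance⟩

end FlatBundle

end NCG

namespace NCG

/-! ### Exterior algebras -/

section Exterior

variable (V : Type u) [AddCommGroup V] [Module ℂ V]

theorem exists_of_mem_exterior_zero {a : CDGA.exterior V} (ha : a ∈ (CDGA.exterior V).gr 0) :
    a = algebraMap ℂ (CDGA.exterior V) (exteriorCounit V a) := by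
  have h : a ∈ (1 : Submodule ℂ (ExteriorAlgebra ℂ V)) := by
    have h' := ha
    change a ∈ ⋀[ℂ]^0 V at h'
    rwa [ExteriorAlgebra.exteriorPower, pow_zero] at h'
  obtain ⟨c, rfl⟩ := Submodule.mem_one.1 h
  exact congrArg (algebraMap ℂ (ExteriorAlgebra ℂ V))
    (ExteriorAlgebra.algebraMap_leftInverse (R := ℂ) V c).symm

theorem exists_of_mem_exterior_one {γ : CDGA.exterior V} (hγ : γ ∈ (CDGA.exterior V).gr 1) :
    ∃ x : V, ExteriorAlgebra.ι ℂ x = γ := by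
  have h := Submodule.pow_one (LinearMap.range (ExteriorAlgebra.ι ℂ : V →ₗ[ℂ] _))
  exact h.le hγ

theorem exteriorPoint_injective : Function.Injective (exteriorPoint V) := by
  intro a b h
  refine Subtype.ext ?_
  rw [exists_of_mem_exterior_zero V a.2, exists_of_mem_exterior_zero V b.2]
  exact congrArg _ h

/-- Property Q is trivial for `⋀ V`, as all nonzero scalars are invertible. -/
theorem propertyQ_exterior : PropertyQ (CDGA.exterior V) (exteriorPoint V) := by
  intro a s b ω _ _ _ _
  by_cases h : exteriorPoint V a = 0
  · exact Or.inl (exteriorPoint_injective V (h.trans (map_zero _).symm))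
  · refine Or.inr ?_
    have h1 : a = algebraMap ℂ _ (exteriorPoint V a) :=
      Subtype.ext (exists_of_mem_exterior_zero V a.2)
    rw [h1]
    exact (IsUnit.mk0 _ h).map (algebraMap ℂ _)

variable {V} {n : ℕ}

/-- A basis of `V` and the contractions with the dual basis. -/
noncomputable def CDGA.Cartan.exterior (b : Module.Basis (Fin n) ℂ V) :
    (CDGA.exterior V).Cartan n where
  v := fun j => ExteriorAlgebra.ι ℂ (b j)
  v_mem := fun j => (Submodule.pow_one
    (LinearMap.range (ExteriorAlgebra.ι ℂ : V →ₗ[ℂ] _))).ge ⟨b j, rfl⟩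
  d_v := fun _ => rfl
  c := fun j => CliffordAlgebra.contractLeft (b.coord j)
  c_mem := by
    intro j γ hγ
    obtain ⟨x, rfl⟩ := exists_of_mem_exterior_one V hγ
    have h := CliffordAlgebra.contractLeft_ι (0 : QuadraticForm ℂ V) (b.coord j) x
    have h2 : algebraMap ℂ (CDGA.exterior V) (b.coord j x) ∈ (CDGA.exterior V).gr 0 :=
      SetLike.algebraMap_mem_graded _ _
    exact h ▸ h2
  c_zero := by
    intro j a ha
    rw [exists_of_mem_exterior_zero V ha]
    exact CliffordAlgebra.contractLeft_algebraMap (0 : QuadraticForm ℂ V) (b.coord j) _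
  c_mul_zero := by
    intro j a ha β
    rw [exists_of_mem_exterior_zero V ha]
    exact CliffordAlgebra.contractLeft_algebraMap_mul (Q := (0 : QuadraticForm ℂ V)) (b.coord j) _ β
  c_mul_one := by
    intro j γ hγ β
    obtain ⟨x, rfl⟩ := exists_of_mem_exterior_one V hγ
    have h := CliffordAlgebra.contractLeft_ι (0 : QuadraticForm ℂ V) (b.coord j) x
    refine (CliffordAlgebra.contractLeft_ι_mul (Q := (0 : QuadraticForm ℂ V)) (d := b.coord j) x
      β).trans ?_
    refine congrArg (· - _) ?_
    exact (Algebra.smul_def _ _).trans (congrArg (· * β) h.symm)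
  c_v := by
    intro i j
    refine (CliffordAlgebra.contractLeft_ι (0 : QuadraticForm ℂ V) (b.coord j) (b i)).trans ?_
    rw [Module.Basis.coord_apply, Module.Basis.repr_self, Finsupp.single_apply]
    by_cases h : i = j
    · rw [if_pos h, if_pos h]; exact map_one _
    · rw [if_neg h, if_neg h]; exact map_zero _
  c_d := by
    intro j β
    exact (congrArg (· + (0 : ExteriorAlgebra ℂ V)) (map_zero _)).trans (add_zero _)

/-- `⋀¹ V` is spanned by the basis, with the contractions as coordinates. -/
theorem exterior_eq_sum (b : Module.Basis (Fin n) ℂ V) {γ : CDGA.exterior V}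
    (hγ : γ ∈ (CDGA.exterior V).gr 1) :
    γ = ∑ j, (CDGA.Cartan.exterior b).v j * (CDGA.Cartan.exterior b).c j γ := by
  obtain ⟨x, rfl⟩ := exists_of_mem_exterior_one V hγ
  have h : ∀ j, (CDGA.Cartan.exterior b).v j * (CDGA.Cartan.exterior b).c j
      (ExteriorAlgebra.ι ℂ x) = ExteriorAlgebra.ι ℂ (b.coord j x • b j) := by
    intro j
    refine (congrArg (ExteriorAlgebra.ι ℂ (b j) * ·)
      (CliffordAlgebra.contractLeft_ι (0 : QuadraticForm ℂ V) (b.coord j) x)).trans ?_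
    rw [map_smul, Algebra.smul_def]
    exact (Algebra.commutes _ _).symm
  rw [Finset.sum_congr rfl fun j _ => h j]
  refine Eq.trans ?_ (map_sum (ExteriorAlgebra.ι ℂ) _ _)
  exact congrArg _ (b.sum_repr x).symm

end Exterior

/-! ### Tensor products with an exterior algebra -/

namespace CDGA

section Tensor

variable {Ω Ω' : CDGA.{u}} {n : ℕ}

/-- The contraction `c (α ⊗ β) = (-1) ^ |α| α ⊗ c β`. -/
noncomputable def tC (c : Ω' →ₗ[ℂ] Ω') : TensorCarrier Ω Ω' →ₗ[ℂ] TensorCarrier Ω Ω' :=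
  (GradedTensorProduct.of ℂ Ω.gr Ω'.gr).toLinearMap ∘ₗ
    TensorProduct.map (gradedSign Ω.internal) c ∘ₗ
    (GradedTensorProduct.of ℂ Ω.gr Ω'.gr).symm.toLinearMap

theorem tC_tm (c : Ω' →ₗ[ℂ] Ω') {k : ℕ} {α : Ω} (hα : α ∈ Ω.gr k) (β : Ω') :
    tC c (tm α β) = (-1 : ℂ) ^ k • tm α (c β) := by
  rw [← LinearMap.map_smul₂, ← gradedSign_apply Ω.internal hα]
  rfl

theorem neg_one_pow_mul_self (k : ℕ) : (-1 : ℂ) ^ k * (-1 : ℂ) ^ k = 1 := by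
  rw [← mul_pow]; simp

theorem tC_mem (K : Ω'.Cartan n) (j : Fin n) {γ : TensorCarrier Ω Ω'} (hγ : γ ∈ tGr Ω Ω' 1) :
    tC (K.c j) γ ∈ tGr Ω Ω' 0 := by
  refine tGr_induction (P := fun γ => tC (K.c j) γ ∈ tGr Ω Ω' 0) ?_
    (by rw [map_zero]; exact zero_mem _)
    (fun a b ha hb => by rw [map_add]; exact add_mem ha hb)
    (fun c a ha => by rw [map_smul]; exact Submodule.smul_mem _ _ ha) hγ
  intro k l hkl α hα β hβ
  rw [tC_tm _ hα]
  refine Submodule.smul_mem _ _ ?_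
  obtain ⟨rfl, rfl⟩ | ⟨rfl, rfl⟩ : (k = 0 ∧ l = 1) ∨ (k = 1 ∧ l = 0) := by omega
  · have h := tm_mem hα (K.c_mem j hβ)
    rwa [add_zero] at h
  · rw [K.c_zero j hβ, map_zero]; exact zero_mem _

theorem tC_zero (K : Ω'.Cartan n) (j : Fin n) {a : TensorCarrier Ω Ω'} (ha : a ∈ tGr Ω Ω' 0) :
    tC (K.c j) a = 0 := by
  refine tGr_induction (P := fun γ => tC (K.c j) γ = 0) ?_ (by rw [map_zero])
    (fun a b ha hb => by rw [map_add, ha, hb, add_zero])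
    (fun c a ha => by rw [map_smul, ha, smul_zero]) ha
  intro k l hkl α hα β hβ
  obtain ⟨rfl, rfl⟩ : k = 0 ∧ l = 0 := by omega
  rw [tC_tm _ hα, K.c_zero j hβ, map_zero, smul_zero]

theorem tC_mul_zero (K : Ω'.Cartan n) (j : Fin n) {a : TensorCarrier Ω Ω'}
    (ha : a ∈ tGr Ω Ω' 0) (y : TensorCarrier Ω Ω') :
    tC (K.c j) (a * y) = a * tC (K.c j) y := by
  refine tGr_induction (P := fun a : TensorCarrier Ω Ω' =>
    tC (K.c j) (a * y) = a * tC (K.c j) y) ?_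
    (by rw [zero_mul, map_zero, zero_mul])
    (fun a b ha hb => by rw [add_mul, map_add, ha, hb, add_mul])
    (fun c a ha => by rw [smul_mul_assoc, map_smul, ha, smul_mul_assoc]) ha
  intro k l hkl α hα β hβ
  obtain ⟨rfl, rfl⟩ : k = 0 ∧ l = 0 := by omega
  refine t_induction (P := fun y : TensorCarrier Ω Ω' =>
    tC (K.c j) (tm α β * y) = tm α β * tC (K.c j) y) ?_
    (by rw [mul_zero, map_zero, mul_zero])
    (fun a b ha hb => by rw [mul_add, map_add, ha, hb, map_add, mul_add])
    (fun c a ha => by rw [mul_smul_comm, map_smul, ha, map_smul, mul_smul_comm]) y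
  intro k' l' α' hα' β' hβ'
  rw [tm_mul_tm _ _ hβ hα', map_smul, tC_tm _ (Ω.mul_mem hα hα'), tC_tm _ hα', mul_smul_comm,
    tm_mul_tm _ _ hβ hα', K.c_mul_zero j hβ]
  simp

theorem tC_mul_one (K : Ω'.Cartan n) (j : Fin n) {a : TensorCarrier Ω Ω'}
    (ha : a ∈ tGr Ω Ω' 1) (y : TensorCarrier Ω Ω') :
    tC (K.c j) (a * y) = tC (K.c j) a * y - a * tC (K.c j) y := by
  refine tGr_induction (P := fun a : TensorCarrier Ω Ω' =>
    tC (K.c j) (a * y) = tC (K.c j) a * y - a * tC (K.c j) y) ?_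
    (by rw [zero_mul, map_zero, zero_mul, zero_mul, sub_zero])
    (fun a b ha hb => by rw [add_mul, map_add, ha, hb, map_add, add_mul, add_mul]; abel)
    (fun c a ha => by
      rw [smul_mul_assoc, map_smul, ha, map_smul, smul_mul_assoc, smul_mul_assoc, smul_sub]) ha
  intro k l hkl α hα β hβ
  refine t_induction (P := fun y : TensorCarrier Ω Ω' =>
    tC (K.c j) (tm α β * y) = tC (K.c j) (tm α β) * y - tm α β * tC (K.c j) y) ?_
    (by rw [mul_zero, map_zero, mul_zero, mul_zero, sub_zero])
    (fun a b ha hb => by rw [mul_add, map_add, ha, hb, map_add, mul_add, mul_add]; abel)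
    (fun c a ha => by
      rw [mul_smul_comm, map_smul, ha, map_smul, mul_smul_comm, mul_smul_comm, smul_sub]) y
  intro k' l' α' hα' β' hβ'
  rw [tm_mul_tm _ _ hβ hα', map_smul, tC_tm _ (Ω.mul_mem hα hα'), tC_tm _ hα', tC_tm _ hα,
    mul_smul_comm, tm_mul_tm _ _ hβ hα', smul_mul_assoc]
  obtain ⟨rfl, rfl⟩ | ⟨rfl, rfl⟩ : (k = 0 ∧ l = 1) ∨ (k = 1 ∧ l = 0) := by omega
  · rw [K.c_mul_one j hβ, tm_mul_tm _ _ (K.c_mem j hβ) hα', map_sub, smul_smul, smul_smul,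
      zero_add, one_mul, neg_one_pow_mul_self]
    simp [smul_smul, neg_one_pow_mul_self]
  · rw [K.c_mul_zero j hβ, K.c_zero j hβ]
    simp [pow_add]

theorem tC_tD (K : Ω'.Cartan n) (j : Fin n) (y : TensorCarrier Ω Ω') :
    tC (K.c j) (tD Ω Ω' y) + tD Ω Ω' (tC (K.c j) y) = 0 := by
  refine t_induction (P := fun y : TensorCarrier Ω Ω' =>
    tC (K.c j) (tD Ω Ω' y) + tD Ω Ω' (tC (K.c j) y) = 0) ?_
    (by simp only [map_zero, add_zero])
    (fun a b ha hb => by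
      rw [map_add, map_add, map_add, map_add, add_add_add_comm, ha, hb, add_zero])
    (fun c a ha => by rw [map_smul, map_smul, map_smul, map_smul, ← smul_add, ha, smul_zero]) y
  intro k l α hα β hβ
  have h := K.c_d j β
  rw [tD_tm hα, map_add, tC_tm _ (Ω.d_mem hα), map_smul, tC_tm _ hα, tC_tm _ hα, map_smul,
    tD_tm hα, smul_add, smul_smul, smul_smul, neg_one_pow_mul_self, one_smul, one_smul, pow_succ,
    mul_neg_one, neg_smul, eq_neg_of_add_eq_zero_left h, map_neg]
  abel

variable (Ω) in
/-- Contractions on `Ω'` extend to `Ω ⊗ Ω'`. -/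
noncomputable def Cartan.tensor (K : Ω'.Cartan n) : (Ω.tensor Ω').Cartan n where
  v := fun j => tm 1 (K.v j)
  v_mem := fun j => by
    have h := tm_mem Ω.one_mem (K.v_mem j)
    rwa [zero_add] at h
  d_v := fun j => by
    refine (tD_tm Ω.one_mem (K.v j)).trans ?_
    rw [Ω.d_one, K.d_v, map_zero, map_zero, LinearMap.zero_apply, smul_zero, add_zero]
    rfl
  c := fun j => tC (K.c j)
  c_mem := fun j _ hγ => tC_mem K j hγ
  c_zero := fun j _ ha => tC_zero K j ha
  c_mul_zero := fun j _ ha => tC_mul_zero K j ha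
  c_mul_one := fun j _ ha => tC_mul_one K j ha
  c_v := by
    intro i j
    refine (tC_tm _ Ω.one_mem _).trans ?_
    rw [K.c_v, pow_zero, one_smul]
    by_cases h : i = j
    · rw [if_pos h, if_pos h]; rfl
    · rw [if_neg h, if_neg h, map_zero]; rfl
  c_d := tC_tD K

end Tensor

end CDGA

section Split

variable {V : Type u} [AddCommGroup V] [Module ℂ V] (Ω : CDGA.{u}) {n : ℕ}

theorem CDGA.tm_one_mul (α β : Ω) : CDGA.tm (Ω := Ω) (Ω' := CDGA.exterior V) (α * β) 1 =
    CDGA.tm α 1 * CDGA.tm β 1 := by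
  refine graded_induction Ω.iSup_gr (P := fun β => CDGA.tm (Ω := Ω) (Ω' := CDGA.exterior V)
    (α * β) 1 = CDGA.tm α 1 * CDGA.tm β 1) (fun k β hβ => ?_) (fun β β' h h' => ?_) β
  · rw [CDGA.tm_mul_tm _ _ (CDGA.exterior V).one_mem hβ, zero_mul, pow_zero, one_smul, one_mul]
  · rw [mul_add, map_add, map_add, LinearMap.add_apply, LinearMap.add_apply, mul_add, h, h']

theorem CDGA.tm_one_d (α : Ω) : CDGA.tm (Ω := Ω) (Ω' := CDGA.exterior V) (Ω.d α) 1 =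
    CDGA.tD Ω (CDGA.exterior V) (CDGA.tm α 1) := by
  refine graded_induction Ω.iSup_gr (P := fun α => CDGA.tm (Ω := Ω) (Ω' := CDGA.exterior V)
    (Ω.d α) 1 = CDGA.tD Ω (CDGA.exterior V) (CDGA.tm α 1)) (fun k α hα => ?_)
    (fun α α' h h' => ?_) α
  · rw [CDGA.tD_tm hα, (CDGA.exterior V).d_one, map_zero, smul_zero, add_zero]
  · rw [map_add, map_add, map_add, LinearMap.add_apply, LinearMap.add_apply, map_add, h, h']

theorem tm_augmentation_tm (α : Ω) {β : CDGA.exterior V} (hβ : β ∈ (CDGA.exterior V).gr 0) :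
    CDGA.tm (augmentation V Ω (CDGA.tm α β)) 1 = CDGA.tm α β := by
  rw [augmentation_tm, ← Algebra.commutes, ← Algebra.smul_def, map_smul, LinearMap.smul_apply,
    ← map_smul, Algebra.smul_def, mul_one, ← exists_of_mem_exterior_zero V hβ]

/-- The inclusion `α ↦ α ⊗ 1`. -/
noncomputable def CDGA.tensorIncl : CDGA.Hom Ω (Ω.tensor (CDGA.exterior V)) where
  toAlg := AlgHom.ofLinearMap (B := (Ω.tensor (CDGA.exterior V)).carrier)
    ((CDGA.tm (Ω := Ω) (Ω' := CDGA.exterior V)).flip 1) rfl (CDGA.tm_one_mul Ω)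
  map_mem := fun {k α} hα => by
    have h := CDGA.tm_mem hα (CDGA.exterior V).one_mem
    rwa [add_zero] at h
  map_d := CDGA.tm_one_d Ω

theorem augmentation_tD (x : CDGA.TensorCarrier Ω (CDGA.exterior V)) :
    augmentation V Ω (CDGA.tD Ω (CDGA.exterior V) x) = Ω.d (augmentation V Ω x) := by
  refine CDGA.t_induction (P := fun x => augmentation V Ω (CDGA.tD Ω (CDGA.exterior V) x) =
    Ω.d (augmentation V Ω x)) ?_ (by simp only [map_zero])
    (fun x y hx hy => by rw [map_add, map_add, map_add, map_add, hx, hy])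
    (fun c x hx => by rw [map_smul, map_smul, map_smul, map_smul, hx]) x
  intro k l α hα β hβ
  have h0 : (CDGA.exterior V).d β = 0 := rfl
  rw [CDGA.tD_tm hα, h0, map_zero, smul_zero, add_zero, augmentation_tm, augmentation_tm,
    ← Algebra.commutes, ← Algebra.commutes, ← Algebra.smul_def, ← Algebra.smul_def, map_smul]

/-- The augmentation as a morphism of dgas. -/
noncomputable def CDGA.tensorRet : CDGA.Hom (Ω.tensor (CDGA.exterior V)) Ω where
  toAlg := augmentation V Ω
  map_mem := augmentation_mem V Ω
  map_d := augmentation_tD Ω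

theorem augmentation_tm_one (α : Ω) : augmentation V Ω (CDGA.tm α 1) = α := by
  rw [augmentation_tm, map_one, map_one, mul_one]

theorem tm_augmentation {a : CDGA.TensorCarrier Ω (CDGA.exterior V)}
    (ha : a ∈ CDGA.tGr Ω (CDGA.exterior V) 0) : CDGA.tm (augmentation V Ω a) 1 = a := by
  refine CDGA.tGr_induction (P := fun a : CDGA.TensorCarrier Ω (CDGA.exterior V) =>
    CDGA.tm (augmentation V Ω a) 1 = a) ?_ (by rw [map_zero, map_zero, LinearMap.zero_apply])
    (fun x y hx hy => by rw [map_add, map_add, LinearMap.add_apply, hx, hy])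
    (fun c x hx => by rw [map_smul, map_smul, LinearMap.smul_apply, hx]) ha
  intro k l hkl α hα β hβ
  obtain ⟨rfl, rfl⟩ : k = 0 ∧ l = 0 := by omega
  exact tm_augmentation_tm Ω α hβ

/-- An element of degree `1` of `Ω ⊗ ⋀ V` is the sum of an element of `Ω¹ ⊗ 1` and an element of
`Ω⁰ ⊗ V`. -/
theorem tensor_eq_sum (b : Module.Basis (Fin n) ℂ V) {γ : CDGA.TensorCarrier Ω (CDGA.exterior V)}
    (hγ : γ ∈ CDGA.tGr Ω (CDGA.exterior V) 1) : γ = CDGA.tm (augmentation V Ω γ) 1 +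
      ∑ j, CDGA.tm 1 ((CDGA.Cartan.exterior b).v j) * CDGA.tC ((CDGA.Cartan.exterior b).c j) γ := by
  refine CDGA.tGr_induction (P := fun γ : CDGA.TensorCarrier Ω (CDGA.exterior V) =>
    γ = CDGA.tm (augmentation V Ω γ) 1 +
      ∑ j, CDGA.tm 1 ((CDGA.Cartan.exterior b).v j) * CDGA.tC ((CDGA.Cartan.exterior b).c j) γ)
    ?_ (by simp only [map_zero, LinearMap.zero_apply, mul_zero, Finset.sum_const_zero, add_zero])
    (fun x y hx hy => by
      conv_lhs => rw [hx, hy]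
      simp only [map_add, LinearMap.add_apply, mul_add, Finset.sum_add_distrib]
      abel)
    (fun c x hx => by
      conv_lhs => rw [hx]
      simp only [map_smul, LinearMap.smul_apply, mul_smul_comm, smul_add, Finset.smul_sum]) hγ
  intro k l hkl α hα β hβ
  obtain ⟨rfl, rfl⟩ | ⟨rfl, rfl⟩ : (k = 0 ∧ l = 1) ∨ (k = 1 ∧ l = 0) := by omega
  · have h : ∀ j, CDGA.tm 1 ((CDGA.Cartan.exterior b).v j) *
        CDGA.tC ((CDGA.Cartan.exterior b).c j) (CDGA.tm α β) =
        CDGA.tm α ((CDGA.Cartan.exterior b).v j * (CDGA.Cartan.exterior b).c j β) := by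
      intro j
      rw [CDGA.tC_tm _ hα, pow_zero, one_smul,
        CDGA.tm_mul_tm _ _ ((CDGA.Cartan.exterior b).v_mem j) hα, mul_zero, pow_zero, one_smul,
        one_mul]
    rw [augmentation_tm, exteriorCounit_eq_zero V one_ne_zero hβ, map_zero, mul_zero, map_zero,
      LinearMap.zero_apply, zero_add, Finset.sum_congr rfl fun j _ => h j, ← map_sum,
      ← exterior_eq_sum b hβ]
  · rw [Finset.sum_eq_zero, add_zero]
    · exact (tm_augmentation_tm Ω α hβ).symm
    · intro j _
      rw [CDGA.tC_tm _ hα, (CDGA.Cartan.exterior b).c_zero j hβ, map_zero, smul_zero, mul_zero]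

/-- The dga `Ω ⊗ ⋀ V` is a split extension of `Ω` by a basis of `V`. -/
noncomputable def CDGA.Split.tensor (b : Module.Basis (Fin n) ℂ V) :
    CDGA.Split Ω (Ω.tensor (CDGA.exterior V)) n where
  K := (CDGA.Cartan.exterior b).tensor Ω
  incl := CDGA.tensorIncl Ω
  ret := CDGA.tensorRet Ω
  ret_incl := augmentation_tm_one Ω
  incl_ret := tm_augmentation Ω
  ret_v := fun j => by
    refine (augmentation_tm V Ω 1 ((CDGA.Cartan.exterior b).v j)).trans ?_
    rw [exteriorCounit_eq_zero V one_ne_zero ((CDGA.Cartan.exterior b).v_mem j), map_zero, mul_zero]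
  c_incl := fun j {α} hα => by
    refine (CDGA.tC_tm ((CDGA.Cartan.exterior b).c j) hα 1).trans ?_
    rw [(CDGA.Cartan.exterior b).c_zero j (CDGA.exterior V).one_mem, map_zero, smul_zero]
    rfl
  eq_sum := tensor_eq_sum Ω b

/-- The augmentation `Ω ⊗ ⋀ V → Ω` is a morphism of dgas that is an isomorphism in degree `0`; so
an equation in `Ω ⊗ ⋀ V` as in property Q gives one in `Ω`. -/
theorem propertyQ_tensor {A : Type v} [CommCStarAlgebra A] [PartialOrder A] [StarOrderedRing A]
    {ι : Ω.gr 0 →ₐ[ℂ] A} (hQ : PropertyQ Ω ι) :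
    PropertyQ (Ω.tensor (CDGA.exterior V)) (ι.comp (augmentation₀ V Ω)) := by
  intro a s b ω h0 hb hω hd
  have h := hQ (augmentation₀ V Ω a) s (fun i => augmentation₀ V Ω (b i))
    (fun i => augmentation V Ω (ω i)) h0 hb (fun i => augmentation_mem V Ω (hω i)) (by
      refine (augmentation_tD Ω a.1).symm.trans ((congrArg (augmentation V Ω) hd).trans ?_)
      refine (map_sum (augmentation V Ω) _ _).trans (Finset.sum_congr rfl fun i _ => ?_)
      exact map_mul (augmentation V Ω) _ _)
  have hinv : ∀ x : (Ω.tensor (CDGA.exterior V)).gr 0,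
      CDGA.tm (augmentation₀ V Ω x : Ω) 1 = x.1 :=
    fun x => tm_augmentation Ω x.2
  rcases h with h | ⟨w, hw⟩
  · refine Or.inl (Subtype.ext ((hinv a).symm.trans ?_))
    rw [h]
    exact LinearMap.map_zero₂ _ _
  · have h1 : (augmentation₀ V Ω a : Ω) * ((w⁻¹ : (Ω.gr 0)ˣ).val : Ω) = 1 :=
      congrArg Subtype.val (by rw [← hw, Units.mul_inv] : augmentation₀ V Ω a * (w⁻¹).val = 1)
    have h2 : ((w⁻¹ : (Ω.gr 0)ˣ).val : Ω) * (augmentation₀ V Ω a : Ω) = 1 :=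
      congrArg Subtype.val (by rw [← hw, Units.inv_mul] : (w⁻¹).val * augmentation₀ V Ω a = 1)
    refine Or.inr ⟨⟨a, (CDGA.tensorIncl Ω).map₀ (w⁻¹ : (Ω.gr 0)ˣ).val, Subtype.ext ?_,
      Subtype.ext ?_⟩, rfl⟩
    · refine (congrArg (fun z : CDGA.TensorCarrier Ω (CDGA.exterior V) =>
        z * CDGA.tm ((w⁻¹ : (Ω.gr 0)ˣ).val : Ω) 1) (hinv a).symm).trans ?_
      exact (CDGA.tm_one_mul Ω _ _).symm.trans (by rw [h1]; rfl)
    · refine (congrArg (fun z : CDGA.TensorCarrier Ω (CDGA.exterior V) =>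
        CDGA.tm ((w⁻¹ : (Ω.gr 0)ˣ).val : Ω) 1 * z) (hinv a).symm).trans ?_
      exact (CDGA.tm_one_mul Ω _ _).symm.trans (by rw [h2]; rfl)

end Split

end NCG

namespace NCG

namespace FlatBundle

open GradedBimodule

variable {B : CDGA.{u}} {n : ℕ} (K : B.Cartan n) (p : B.gr 0 →ₐ[ℂ] ℂ)

/-! ### The action of `ℝⁿ` on the fibres -/

theorem fibreRes_nat {E F : FlatBundle B} (φ : FlatBundle.Hom E F) (j : Fin n) :
    Hom.fibreMap p φ ∘ₗ fibreRes K p E j = fibreRes K p F j ∘ₗ Hom.fibreMap p φ :=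
  fibre_ext p fun e => congrArg (fibreMk p F) (Subtype.ext (residue_nat K (F := F) φ j e.1))

theorem fibreRes_unit (j : Fin n) : fibreRes K p (FlatBundle.unit B) j = 0 :=
  fibre_ext p fun e => (congrArg (fibreMk p (FlatBundle.unit B))
    (Subtype.ext (residue_unit K j e.2))).trans (map_zero _)

theorem fibreRes_tensor (E F : FlatBundle B) (j : Fin n) :
    fibreTensor p E F ∘ₗ (TensorProduct.map (fibreRes K p E j) LinearMap.id +
      TensorProduct.map LinearMap.id (fibreRes K p F j)) =
      fibreRes K p (tensor E F) j ∘ₗ fibreTensor p E F := by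
  refine TensorProduct.ext' fun x y => ?_
  obtain ⟨e, rfl⟩ := fibreMk_surjective p E x
  obtain ⟨f, rfl⟩ := fibreMk_surjective p F y
  refine Eq.trans (b := fibreTensor p E F (fibreRes K p E j (fibreMk p E e) ⊗ₜ fibreMk p F f) +
    fibreTensor p E F (fibreMk p E e ⊗ₜ fibreRes K p F j (fibreMk p F f)))
    (map_add (fibreTensor p E F) (fibreRes K p E j (fibreMk p E e) ⊗ₜ fibreMk p F f)
      (fibreMk p E e ⊗ₜ fibreRes K p F j (fibreMk p F f))) (Eq.symm ?_)
  let x : (tensor E F).gr 0 := ⟨GradedBimodule.tm _ _ (residue K E j e) (f : F.carrier),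
    GradedBimodule.tm_mem (k := 0) (l := 0) (residue_mem_zero K E j e.2) f.2⟩
  let y : (tensor E F).gr 0 := ⟨GradedBimodule.tm _ _ (e : E.carrier) (residue K F j f),
    GradedBimodule.tm_mem (k := 0) (l := 0) e.2 (residue_mem_zero K F j f.2)⟩
  exact (congrArg (fibreMk p (tensor E F)) (Subtype.ext (a2 := x + y)
    (residue_tensor K E F j e.2 f.2))).trans (map_add (fibreMk p (tensor E F)) x y)

theorem fibreRes_linBundle {W : Type u} [AddCommGroup W] [Module ℂ W] [FiniteDimensional ℂ W]
    (N : Fin n → Module.End ℂ W) (hc : ∀ i j, Commute (N i) (N j)) (j : Fin n) :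
    (linFibre K N hc p).toLinearMap ∘ₗ N j =
      fibreRes K p (linBundle K N hc) j ∘ₗ (linFibre K N hc p).toLinearMap :=
  LinearMap.ext fun w => congrArg (fibreMk p (linBundle K N hc))
    (Subtype.ext (residue_constSec K N hc j w).symm)

/-- The action of `ℝⁿ` on a fibre: the exponential of the residues. -/
noncomputable def fibreRep (E : FlatBundle B) :
    Multiplicative (Fin n → ℝ) →* Module.End ℂ (Fibre p E) :=
  expRep (fibreRes K p E) (fibreRes_comm K p E)

theorem fibreRep_continuous (E : FlatBundle B) : ContinuousRep (fibreRep K p E) :=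
  expRep_continuous _ _

theorem fibreRep_nat {E F : FlatBundle B} (φ : FlatBundle.Hom E F) (t) :
    Hom.fibreMap p φ ∘ₗ fibreRep K p E t = fibreRep K p F t ∘ₗ Hom.fibreMap p φ :=
  expRep_intertwine (fibreRes_nat K p φ) t

theorem expRep_of_eq_zero {W : Type u} [AddCommGroup W] [Module ℂ W] [FiniteDimensional ℂ W]
    {N : Fin n → Module.End ℂ W} {hc : ∀ i j, Commute (N i) (N j)} (h : ∀ j, N j = 0) :
    expRep N hc = 1 := by
  obtain rfl : N = 0 := funext h
  exact expRep_zero _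

theorem fibreRep_unit : fibreRep K p (FlatBundle.unit B) = 1 :=
  expRep_of_eq_zero (fibreRes_unit K p)

theorem fibreRep_tensor (E F : FlatBundle B) (t) :
    fibreTensor p E F ∘ₗ tensorRep (fibreRep K p E) (fibreRep K p F) t =
      fibreRep K p (tensor E F) t ∘ₗ fibreTensor p E F := by
  have hc : ∀ i j, Commute (TensorProduct.map (fibreRes K p E i) LinearMap.id +
      TensorProduct.map LinearMap.id (fibreRes K p F i) :
        Module.End ℂ (Fibre p E ⊗[ℂ] Fibre p F))
      (TensorProduct.map (fibreRes K p E j) LinearMap.id +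
        TensorProduct.map LinearMap.id (fibreRes K p F j)) := by
    intro i j
    refine TensorProduct.ext' fun x y => ?_
    have h1 := LinearMap.congr_fun (fibreRes_comm K p E i j) x
    have h2 := LinearMap.congr_fun (fibreRes_comm K p F i j) y
    rw [Module.End.mul_apply, Module.End.mul_apply] at h1 h2
    simp only [Module.End.mul_apply, LinearMap.add_apply, TensorProduct.map_tmul,
      LinearMap.id_apply, map_add, h1, h2]
    abel
  have h := expRep_tensor (fibreRes_comm K p E) (fibreRes_comm K p F) hc
  refine (congrArg (fibreTensor p E F ∘ₗ ·) (DFunLike.congr_fun h t).symm).trans ?_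
  exact expRep_intertwine (fibreRes_tensor K p E F) t

theorem fibreRep_linBundle {W : Type u} [AddCommGroup W] [Module ℂ W] [FiniteDimensional ℂ W]
    (N : Fin n → Module.End ℂ W) (hc : ∀ i j, Commute (N i) (N j)) (t) :
    (linFibre K N hc p).toLinearMap ∘ₗ expRep N hc t =
      fibreRep K p (linBundle K N hc) t ∘ₗ (linFibre K N hc p).toLinearMap :=
  expRep_intertwine (fibreRes_linBundle K p N hc) t

/-- The identification of the fibre of the unit object with `ℂ`. -/
noncomputable def unitFibre : Fibre p (FlatBundle.unit B) →ₗ[ℂ] ULift.{u} ℂ :=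
  ULift.moduleEquiv.symm.toLinearMap ∘ₗ
    fibreLift p (X := FlatBundle.unit B) p.toLinearMap (fun a e => map_mul p a e)

theorem unitFibre_injective : Function.Injective (unitFibre p) := by
  rw [injective_iff_map_eq_zero]
  intro x hx
  obtain ⟨e, rfl⟩ := fibreMk_surjective p (FlatBundle.unit B) x
  have h1 : p e = 0 := congrArg ULift.down hx
  have h2 := fibreMk_act p (FlatBundle.unit B) e (⟨(1 : B), B.one_mem⟩ : B.gr 0)
  have h3 : act₀ (FlatBundle.unit B) e (⟨(1 : B), B.one_mem⟩ : B.gr 0) = e :=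
    Subtype.ext (mul_one (show B from e.1))
  rw [h3] at h2
  exact h2.trans (by rw [h1, zero_smul])

section Points

variable {R : Type u} [CommRing R] [Algebra ℂ R]

theorem aut_fibreRep (θ : (fibreData p).autPoints R) (E : FlatBundle B) (t) :
    (θ.1 E).val ∘ₗ (fibreRep K p E t).baseChange R =
      (fibreRep K p E t).baseChange R ∘ₗ (θ.1 E).val :=
  expRep_comm (T := (show GLPoints R (Fibre p E) from θ.1 E).val)
    (fun j => FibreFunctorData.aut_nat θ (parallelHom (res K E j).2)) t

end Points

/-! ### The fundamental group when `B¹` is generated by the `v_j` -/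

/-- The fibre of a flat connection as a representation of `ℝⁿ`. -/
noncomputable def hullObj (E : FlatBundle B) : ContRep.{u} (Multiplicative (Fin n → ℝ)) where
  carrier := Fibre p E
  σ := fibreRep K p E
  σ_cont := fibreRep_continuous K p E

/-- The functor from flat connections to representations of `ℝⁿ` as a comparison of fibre
functors. -/
noncomputable def hullComparison : FibreFunctorData.Comparison (fibreData p)
    (ContRep.fibreData.{u} (Multiplicative (Fin n → ℝ))) where
  obj := hullObj K p
  iso E := LinearEquiv.refl ℂ (Fibre p E)
  nat := fun {E F} φ => ⟨(⟨Hom.fibreMap p φ,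
    fun t x => LinearMap.congr_fun (fibreRep_nat K p φ t) x⟩ :
      ContRep.Hom (hullObj K p E) (hullObj K p F)), rfl⟩
  unit := ⟨(⟨unitFibre p, fun t x => congrArg (unitFibre p)
      (LinearMap.congr_fun (DFunLike.congr_fun (fibreRep_unit K p) t) x)⟩ :
      ContRep.Hom (hullObj K p (FlatBundle.unit B)) (ContRep.fibreData _).unit),
    unitFibre_injective p⟩
  tensor := fun E F => ⟨hullObj K p (tensor E F), 𝟙 _,
    (⟨fibreTensor p E F, fun t x => LinearMap.congr_fun (fibreRep_tensor K p E F t) x⟩ :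
      ContRep.Hom ((ContRep.fibreData _).tensor (hullObj K p E) (hullObj K p F))
        (hullObj K p (tensor E F))), Function.injective_id,
    TensorProduct.ext' fun _ _ => rfl⟩

variable {R : Type u} [CommRing R] [Algebra ℂ R]

theorem finiteDimensional_parallel {E : FlatBundle B}
    (h : Function.Injective (parallelFibre p E)) : FiniteDimensional ℂ E.parallel :=
  FiniteDimensional.of_injective (parallelFibre p E).toLinearMap h

theorem hullObj_gen (E : FlatBundle B) : (hullObj K p E).gen = fibreRes K p E :=
  (hullObj K p E).gen_eq (hc := fibreRes_comm K p E) rfl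

theorem conj_linFibre_congr (θ : (fibreData p).autPoints R) {W : Type u} [AddCommGroup W]
    [Module ℂ W] [FiniteDimensional ℂ W] {N N' : Fin n → Module.End ℂ W}
    {hc : ∀ i j, Commute (N i) (N j)} (hc' : ∀ i j, Commute (N' i) (N' j)) (h : N = N') :
    GLPoints.conj R (linFibre K N hc p) (θ.1 (linBundle K N hc)) =
      GLPoints.conj R (linFibre K N' hc' p) (θ.1 (linBundle K N' hc')) := by
  subst h
  rfl

/-- The fibre of the connection of a representation is the representation. -/
theorem conj_hullObj (η : (ContRep.fibreData.{u} (Multiplicative (Fin n → ℝ))).autPoints R)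
    (X : ContRep.{u} (Multiplicative (Fin n → ℝ))) :
    η.1 X = GLPoints.conj R (linFibre K X.gen X.gen_comm p)
      (η.1 (hullObj K p (linBundle K X.gen X.gen_comm))) :=
  GLPoints.eq_conj (linFibre K X.gen X.gen_comm p) _ _
    (FibreFunctorData.aut_nat η (⟨(linFibre K X.gen X.gen_comm p).toLinearMap, fun t x => by
      rw [X.eq_gen]
      exact LinearMap.congr_fun (fibreRep_linBundle K p X.gen X.gen_comm t) x⟩ :
      ContRep.Hom X (hullObj K p (linBundle K X.gen X.gen_comm)))).symm

/-- If `B¹` is generated by the `v_j`, then the fundamental group is the algebraic hull of `ℝⁿ`: the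
restriction along `hullComparison` is inverse to that along `linComparison`. In one direction,
`aut_eq_conj_mul_conj` applies, where `∇ - ∑ v_j N_j` is trivial. -/
theorem nonempty_iso_algebraicHull (hK : ∀ γ ∈ B.gr 1, γ = ∑ j, K.v j * K.c j γ)
    (hp : ∀ E : FlatBundle B, Function.Injective (parallelFibre p E)) :
    Nonempty (fundamentalGroup B p ≅ algebraicHull.{u} (Multiplicative (Fin n → ℝ))) := by
  refine (hullComparison K p).nonempty_iso fun R _ _ => ?_
  refine Function.bijective_iff_has_inverse.2 ⟨(linComparison K p).restrict R, fun η => ?_,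
    fun θ => ?_⟩
  · refine Subtype.ext (funext fun X => ?_)
    refine Eq.trans ?_ (conj_hullObj K p η X).symm
    exact congrArg (GLPoints.conj R (linFibre K X.gen X.gen_comm p)) (GLPoints.conj_refl _)
  · refine Subtype.ext (funext fun E => ?_)
    have := finiteDimensional_parallel p (hp E)
    have h := aut_eq_conj_mul_conj K p E θ
    have h1 : θ.1 (untwist K E) = 1 :=
      aut_eq_one_of_flat θ fun e he => untwist_conn_eq_zero K E hK he
    refine Eq.trans ?_ (h.trans ((congrArg (fun a : GLPoints R (Fibre p (untwist K E)) =>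
      GLPoints.conj R (linFibre K (fibreRes K p E) (fibreRes_comm K p E) p)
        (θ.1 (linBundle K (fibreRes K p E) (fibreRes_comm K p E))) *
      GLPoints.conj R (untwistFibre K p E) a) h1).trans
        ((congrArg (_ * ·) (map_one _)).trans (mul_one _)))).symm
    refine (GLPoints.conj_refl _).trans ?_
    exact conj_linFibre_congr K p θ (W := Fibre p E) _ (hullObj_gen K p E)

end FlatBundle

end NCG

namespace NCG

namespace ProdRep

variable {G : CommAlgCat.{u} ℂ ⥤ GrpCat.{u + 1}} {H : Type} [Group H] [TopologicalSpace H]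

/-! ### Tensor automorphisms that come from the two factors -/

/-- The restriction of a representation of `G × H` to `H`. -/
noncomputable def contPart (X : ProdRep G H) : ContRep.{u} H where
  carrier := X.carrier
  σ := X.σ
  σ_cont := X.σ_cont

variable (G H) in
/-- The restriction to `H` as a comparison of fibre functors. -/
noncomputable def contComparison :
    FibreFunctorData.Comparison (fibreData G H) (ContRep.fibreData.{u} H) where
  obj := contPart
  iso X := LinearEquiv.refl ℂ X.carrier
  nat := fun {X Y} f => ⟨(⟨Hom.toLin f, Hom.map_σ f⟩ : ContRep.Hom X.contPart Y.contPart), rfl⟩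
  unit := ⟨𝟙 _, Function.injective_id⟩
  tensor := fun X Y => ⟨(tensor X Y).contPart, 𝟙 _, 𝟙 _, Function.injective_id,
    TensorProduct.ext' fun _ _ => rfl⟩

/-- A point of `G` acts on all representations of `G × H`. -/
noncomputable def ofPoint {R : CommAlgCat.{u} ℂ} (g : G.obj R) : (fibreData G H).autPoints R :=
  ⟨fun X => X.ρ R g, fun _ _ f => (Hom.map_ρ f R g).symm, rfl, fun X Y => by
    have h : ∀ {M : Type u} [AddCommGroup M] [Module ℂ M] (φ : Module.End R (R ⊗[ℂ] M)),
        φ ∘ₗ (LinearMap.id : M →ₗ[ℂ] M).baseChange R =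
          (LinearMap.id : M →ₗ[ℂ] M).baseChange R ∘ₗ φ := by
      intro M _ _ φ
      rw [LinearMap.baseChange_id, LinearMap.comp_id, LinearMap.id_comp]
    exact h (M := X.carrier ⊗[ℂ] Y.carrier) (boxTensor (X.ρ R g).val (Y.ρ R g).val)⟩

end ProdRep

namespace FlatBundle

open GradedBimodule

variable {Ω B : CDGA.{u}} {n : ℕ} (s : CDGA.Split Ω B n) {p : B.gr 0 →ₐ[ℂ] ℂ}
  {q : Ω.gr 0 →ₐ[ℂ] ℂ} (hr : ∀ a, q (s.ret.map₀ a) = p a)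

/-! ### The fundamental group of a split extension -/

/-- The fibre of a flat connection as a representation of `π¹(Ω, q) × ℝⁿ`: the first factor acts
through base change along `ret`, the second through the exponential of the residues. -/
noncomputable def splitObj (E : FlatBundle B) :
    ProdRep (fundamentalGroup Ω q) (Multiplicative (Fin n → ℝ)) where
  carrier := Fibre p E
  finite := fibre_finiteDimensional p E
  ρ := fun R =>
    { toFun := fun g : (fibreData q).autPoints R => (s.resRet hr R g).1 E
      map_one' := congrArg (fun a : (fibreData p).autPoints R => a.1 E) (map_one (s.resRet hr R))
      map_mul' := fun g h =>
        congrArg (fun a : (fibreData p).autPoints R => a.1 E) (map_mul (s.resRet hr R) g h) }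
  ρ_nat := fun {_ S} f g => congrArg (fun a : (fibreData p).autPoints S => a.1 E)
    ((baseChangeComparison s.ret s.ret_bijective hr).restrict_autMap f.hom g)
  σ := fibreRep s.K p E
  σ_cont := fibreRep_continuous s.K p E
  comm := fun R g t => aut_fibreRep s.K p (s.resRet hr R g) E t

/-- The functor from flat connections over `B` to representations of `π¹(Ω, q) × ℝⁿ` as a
comparison of fibre functors. -/
noncomputable def splitComparison : FibreFunctorData.Comparison (fibreData p)
    (ProdRep.fibreData (fundamentalGroup Ω q) (Multiplicative (Fin n → ℝ))) where
  obj := splitObj s hr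
  iso E := LinearEquiv.refl ℂ (Fibre p E)
  nat := fun {E F} φ => ⟨(⟨Hom.fibreMap p φ,
    fun R g => (FibreFunctorData.aut_nat (s.resRet hr R g) φ).symm,
    fun t x => LinearMap.congr_fun (fibreRep_nat s.K p φ t) x⟩ :
      ProdRep.Hom (splitObj s hr E) (splitObj s hr F)), rfl⟩
  unit := ⟨(⟨unitFibre p, fun R g => by
      have h : (s.resRet hr R g).1 (FlatBundle.unit B) = 1 :=
        FibreFunctorData.aut_unit (s.resRet hr R g)
      exact congrArg (fun a : GLPoints R (Fibre p (FlatBundle.unit B)) =>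
        (unitFibre p).baseChange R ∘ₗ a.val) h,
    fun t x => congrArg (unitFibre p)
      (LinearMap.congr_fun (DFunLike.congr_fun (fibreRep_unit s.K p) t) x)⟩ :
      ProdRep.Hom (splitObj s hr (FlatBundle.unit B)) (ProdRep.unit _ _)),
    unitFibre_injective p⟩
  tensor := fun E F => ⟨splitObj s hr (tensor E F), 𝟙 _,
    (⟨fibreTensor p E F,
      fun R g => (FibreFunctorData.aut_tensor (s.resRet hr R g) E F).symm,
      fun t x => LinearMap.congr_fun (fibreRep_tensor s.K p E F t) x⟩ :
      ProdRep.Hom (ProdRep.tensor (splitObj s hr E) (splitObj s hr F))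
        (splitObj s hr (tensor E F))), Function.injective_id,
    TensorProduct.ext' fun _ _ => rfl⟩

variable {R : Type u} [CommRing R] [Algebra ℂ R]

/-- A tensor automorphism whose restriction to flat connections is trivial is trivial on
representations of `ℝⁿ`: these come from the connections `d + ∑ v_j N_j`. -/
theorem aut_ofCont (η : (ProdRep.fibreData (fundamentalGroup Ω q)
    (Multiplicative (Fin n → ℝ))).autPoints R) (h : (splitComparison s hr).restrict R η = 1)
    (X : ContRep.{u} (Multiplicative (Fin n → ℝ))) :
    η.1 (ProdRep.ofCont _ X.σ X.σ_cont) = 1 := by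
  have h2 : ∀ (S : CommAlgCat.{u} ℂ) (g : (fundamentalGroup Ω q).obj S),
      (s.resRet hr S g).1 (linBundle s.K X.gen X.gen_comm) = 1 := fun S g =>
    resRet_linBundle s hr X.gen X.gen_comm g
  have h4 : ∀ t, (linFibre s.K X.gen X.gen_comm p).toLinearMap ∘ₗ X.σ t =
      fibreRep s.K p (linBundle s.K X.gen X.gen_comm) t ∘ₗ
        (linFibre s.K X.gen X.gen_comm p).toLinearMap := fun t => by
    refine Eq.trans ?_ (fibreRep_linBundle s.K p X.gen X.gen_comm t)
    exact congrArg _ (DFunLike.congr_fun X.eq_gen t)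
  have h1 : η.1 (ProdRep.ofCont _ X.σ X.σ_cont) =
      GLPoints.conj R (linFibre s.K X.gen X.gen_comm p)
        (η.1 (splitObj s hr (linBundle s.K X.gen X.gen_comm))) :=
    GLPoints.eq_conj (linFibre s.K X.gen X.gen_comm p) _ _
      (FibreFunctorData.aut_nat η (⟨(linFibre s.K X.gen X.gen_comm p).toLinearMap, fun S g =>
        congrArg (fun a : GLPoints S (Fibre p (linBundle s.K X.gen X.gen_comm)) =>
          a.val ∘ₗ (linFibre s.K X.gen X.gen_comm p).toLinearMap.baseChange S) (h2 S g).symm,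
      fun t x => LinearMap.congr_fun (h4 t) x⟩ :
      ProdRep.Hom (ProdRep.ofCont _ X.σ X.σ_cont)
        (splitObj s hr (linBundle s.K X.gen X.gen_comm)))).symm
  have h3 : η.1 (splitObj s hr (linBundle s.K X.gen X.gen_comm)) = 1 :=
    (GLPoints.conj_refl _).symm.trans
      (congrArg (fun a : (fibreData p).autPoints R =>
        a.1 (linBundle s.K X.gen X.gen_comm)) h)
  exact h1.trans ((congrArg (GLPoints.conj R (linFibre s.K X.gen X.gen_comm p)) h3).trans
    (map_one _))

instance (Y : FlatBundle Ω) : FiniteDimensional ℂ ((fibreData q).ω.obj Y) :=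
  fibre_finiteDimensional q Y

/-- A tensor automorphism whose restriction to flat connections is trivial is trivial on the
tautological representations of `π¹(Ω, q)`: these come from base changes along `incl`. -/
theorem aut_taut (η : (ProdRep.fibreData (fundamentalGroup Ω q)
    (Multiplicative (Fin n → ℝ))).autPoints R) (h : (splitComparison s hr).restrict R η = 1)
    (hi : ∀ a, p (s.incl.map₀ a) = q a) (Y : FlatBundle Ω) :
    η.1 (ProdRep.taut (Multiplicative (Fin n → ℝ)) (fibreData q) Y) = 1 := by
  let E := baseChange s.incl Y
  let e := baseChangeFibre s.incl s.incl_bijective hi Y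
  have h1 : η.1 (ProdRep.taut (Multiplicative (Fin n → ℝ)) (fibreData q) Y) =
      GLPoints.conj R e (η.1 (splitObj s hr E)) :=
    GLPoints.eq_conj e _ _ (FibreFunctorData.aut_nat η (⟨e.toLinearMap, fun S g => by
        have h2 : GLPoints.conj S e ((s.resRet hr S g).1 E) = g.1 Y :=
          congrArg (fun a : (fibreData q).autPoints S => a.1 Y) (resIncl_resRet s hi hr g)
        have h3 := GLPoints.baseChange_conj e ((s.resRet hr S g).1 E)
        exact (congrArg (fun a : GLPoints S (Fibre q Y) =>
          e.toLinearMap.baseChange S ∘ₗ a.val) h2).symm.trans h3,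
      fun t x => (LinearMap.congr_fun (DFunLike.congr_fun (expRep_of_eq_zero
        (hc := fibreRes_comm s.K p E) (fibreRes_baseChange s Y)) t) (e x)).symm⟩ :
      ProdRep.Hom (ProdRep.taut (Multiplicative (Fin n → ℝ)) (fibreData q) Y)
        (splitObj s hr E))).symm
  have h2 : η.1 (splitObj s hr E) = 1 :=
    (GLPoints.conj_refl _).symm.trans
      (congrArg (fun a : (fibreData p).autPoints R => a.1 E) h)
  exact h1.trans ((congrArg (GLPoints.conj R e) h2).trans (map_one _))

/-- Injectivity: tensor automorphisms of the representations of a product are determined by the two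
factors, and those of the representations of `π¹(Ω, q)` by the tautological representations. -/
theorem splitComparison_injective (hi : ∀ a, p (s.incl.map₀ a) = q a) :
    Function.Injective ((splitComparison s hr).restrict R) := by
  rw [injective_iff_map_eq_one]
  intro η h
  refine Subtype.ext (funext fun X => ?_)
  refine (ProdRep.aut_eq_mul η X).trans ?_
  have h1 : η.1 (ProdRep.ofCont _ X.σ X.σ_cont) = 1 := aut_ofCont s hr η h X.contPart
  have h2 : η.1 X.algPart = 1 :=
    ProdRep.aut_eq_one_of_taut (D := fibreData q) η (aut_taut s hr η h hi) rfl
  rw [h1, h2]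
  exact mul_one _

end FlatBundle

end NCG

namespace NCG

namespace FlatBundle

open GradedBimodule

variable {Ω B : CDGA.{u}} {n : ℕ} {p : B.gr 0 →ₐ[ℂ] ℂ}
  {q : Ω.gr 0 →ₐ[ℂ] ℂ}

/-- A tensor automorphism of the fibre functor over `B` comes from its restrictions to the
connections `d + ∑ v_j N_j`, which are representations of `ℝⁿ`, and to the connections over `Ω`,
which form a point of `π¹(Ω, q)`. -/
theorem splitComparison_surjective (s : CDGA.Split Ω B n)
    (hr : ∀ a, q (s.ret.map₀ a) = p a) (hi : ∀ a, p (s.incl.map₀ a) = q a)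
    (hp : ∀ E : FlatBundle B, Function.Injective (parallelFibre p E)) (R : Type u) [CommRing R]
    [Algebra ℂ R] : Function.Surjective ((splitComparison s hr).restrict R) := by
  intro θ
  refine ⟨(ProdRep.contComparison _ _).restrict R ((linComparison s.K p).restrict R θ) *
    ProdRep.ofPoint (R := CommAlgCat.of ℂ R) (s.resIncl hi R θ), ?_⟩
  refine Subtype.ext (funext fun E => ?_)
  have := finiteDimensional_parallel p (hp E)
  refine (GLPoints.conj_refl _).trans ?_
  refine Eq.trans ?_ (aut_eq_conj_mul_conj s.K p E θ).symm
  refine congrArg₂ (fun a b : GLPoints R (Fibre p E) => a * b) ?_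
    (conj_untwist s E hi hr θ).symm
  refine (GLPoints.conj_refl _).trans ?_
  exact conj_linFibre_congr s.K p θ (W := Fibre p E) _ (hullObj_gen s.K p E)

/-- The fundamental group of a split extension by `n` elements of degree one. -/
theorem nonempty_iso_of_split (s : CDGA.Split Ω B n)
    (hr : ∀ a, q (s.ret.map₀ a) = p a) (hi : ∀ a, p (s.incl.map₀ a) = q a)
    (hp : ∀ E : FlatBundle B, Function.Injective (parallelFibre p E)) :
    Nonempty (fundamentalGroup B p ≅
      algebraicHullProd (fundamentalGroup Ω q) (Multiplicative (Fin n → ℝ))) :=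
  (splitComparison s hr).nonempty_iso fun R _ _ =>
    ⟨splitComparison_injective s hr hi, splitComparison_surjective s hr hi hp R⟩

end FlatBundle

/-! ### The fundamental groups of exterior algebras and of tensor products with them -/

section Exterior

variable {V : Type u} [AddCommGroup V] [Module ℂ V] {n : ℕ}

theorem nonempty_iso_exterior (b : Module.Basis (Fin n) ℂ V) :
    Nonempty (fundamentalGroup (CDGA.exterior V) (exteriorPoint V) ≅
      algebraicHull.{u} (Multiplicative (Fin n → ℝ))) :=
  FlatBundle.nonempty_iso_algebraicHull (CDGA.Cartan.exterior b) _
    (fun _ hγ => exterior_eq_sum b hγ)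
    (FlatBundle.parallelFibre_injective_of_point (exteriorPoint_injective V))

theorem nonempty_iso_tensor (b : Module.Basis (Fin n) ℂ V) {Ω : CDGA.{u}} {A : Type v}
    [CommCStarAlgebra A] [PartialOrder A] [StarOrderedRing A] (S : StarStructure Ω A)
    (hQ : PropertyQ Ω S.ι) (p : WeakDual.characterSpace ℂ A) :
    Nonempty (fundamentalGroup (Ω.tensor (CDGA.exterior V))
        ((S.point p).comp (augmentation₀ V Ω)) ≅
      algebraicHullProd (fundamentalGroup Ω (S.point p)) (Multiplicative (Fin n → ℝ))) := by
  have hr : ∀ a, S.point p ((CDGA.Split.tensor Ω b).ret.map₀ a) =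
      (S.point p).comp (augmentation₀ V Ω) a := fun _ => rfl
  have hi : ∀ a, (S.point p).comp (augmentation₀ V Ω) ((CDGA.Split.tensor Ω b).incl.map₀ a) =
      S.point p a := fun a =>
    congrArg (S.point p) (Subtype.ext (augmentation_tm_one Ω a.1))
  exact FlatBundle.nonempty_iso_of_split _ hr hi fun E =>
    FlatBundle.parallelFibre_injective_of_baseChange _ (CDGA.Split.tensor Ω b).ret_bijective hr E
      (FlatBundle.parallelFibre_injective_of_propertyQ S hQ p _)

end Exterior

end NCG

theorem mainTheorem11 (V : Type u) [AddCommGroup V] [Module ℂ V] [FiniteDimensional ℂ V]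
    (n : ℕ) (hn : Module.finrank ℂ V = n) :
    (NCG.PropertyQ (NCG.CDGA.exterior V) (NCG.exteriorPoint V) ∧
      Nonempty (NCG.fundamentalGroup (NCG.CDGA.exterior V) (NCG.exteriorPoint V) ≅
        NCG.algebraicHull.{u} (Multiplicative (Fin n → ℝ)))) ∧
    ∀ (Ω : NCG.CDGA.{u}) (A : Type v) [CommCStarAlgebra A] [PartialOrder A] [StarOrderedRing A]
      (S : NCG.StarStructure Ω A), NCG.PropertyQ Ω S.ι →
      ∀ p : WeakDual.characterSpace ℂ A,
        NCG.PropertyQ (Ω.tensor (NCG.CDGA.exterior V)) (S.ι.comp (NCG.augmentation₀ V Ω)) ∧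
        Nonempty (NCG.fundamentalGroup (Ω.tensor (NCG.CDGA.exterior V))
            ((S.point p).comp (NCG.augmentation₀ V Ω)) ≅
          NCG.algebraicHullProd (NCG.fundamentalGroup Ω (S.point p))
            (Multiplicative (Fin n → ℝ))) := by
  have b : Module.Basis (Fin n) ℂ V := Module.finBasisOfFinrankEq ℂ V hn
  exact ⟨⟨NCG.propertyQ_exterior V, NCG.nonempty_iso_exterior b⟩, fun Ω A _ _ _ S hQ p =>
    ⟨NCG.propertyQ_tensor Ω hQ, NCG.nonempty_iso_tensor b S hQ p⟩⟩
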